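/- For a permutation group $G \le \mathrm{Sym}(\Omega)$ on a finite set $\Omega$, a base is a subset of $\Omega$ with trivial pointwise stabiliser in $G$, the base size $b(G)$ is the least size of a base, and the Saxl hypergraph of $G$ has vertex set $\Omega$ and the bases of size $b(G)$ as its edges. The degree of a vertex is the number of edges containing it; a hypergraph in which all vertices have degree $d$ is said to have valency $d$. Let $G \le \mathrm{Sym}(\Omega)$ be a finite primitive permutation group which is almost simple with socle $T$ (that is, $T$ is non-abelian simple and $T \le G \le \mathrm{Aut}(T)$), and let $H$ be a point stabiliser in $G$. Suppose that one of the following holds, where $q$ is a prime power: 1. $T = {}^2G_2(q)$ is a Ree group, $q = 3^{2n+1} \ge 27$, and $H \cap T = [q^3]{:}C_{q-1}$ is a Borel subgroup of $T$ (a point stabiliser in the doubly transitive action of $T$ on $q^3+1$ points); 2. $T = \mathrm{PSL}_2(q)$, $q$ odd, and $H \cap T$ is of type $P_1$, i.e. the stabiliser of a point of the projective line over $\mathbb{F}_q$; 3. $T = \mathrm{PSL}_2(q)$, $q$ even, $G \ne T$, and $H \cap T \cong D_{2(q-1)}$ is of type $\mathrm{GL}_1(q) \wr S_2$, i.e. the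 setwise stabiliser of a pair of distinct points of the projective line; 4. $T = \mathrm{PSL}_2(q)$, $q$ even, and $H \cap T \cong D_{2(q+1)}$ is of type $\mathrm{GL}_1(q^2)$, i.e. the normaliser in $\mathrm{SL}_2(q) = \mathrm{PSL}_2(q)$ of a subalgebra of $M_2(\mathbb{F}_q)$ that is a field with $q^2$ elements; 5. $T = \mathrm{PSL}_3(3)$, $|G:T| = 2$ (so $G = \mathrm{PSL}_3(3).2$), and $H \cap T \cong C_{13}{:}C_3$ is of type $\mathrm{GL}_1(3^3)$, i.e. the normaliser in $\mathrm{SL}_3(3) = \mathrm{PSL}_3(3)$ of a subalgebra of $M_3(\mathbb{F}_3)$ that is a field with $27$ elements. Then the Saxl hypergraph of $G$ is regular, and its valency is odd if and only if one of the following holds: * $G$ is as in 3 with $q = 2^e$, where $e$ is odd and square-free, and $G = \mathrm{P\Gamma L}_2(2^e)$ (acting on the pairs of distinct points of the projective line); * $G$ is as in 2 with $q \equiv 3 \pmod 4$, and $G = \mathrm{PSL}_2(q)$ or $G = \mathrm{PGL}_2(q)$ (acting on the projective line). -/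

import Mathlib

open scoped LinearAlgebra.Projectivization Pointwise OnePoint

noncomputable section

namespace SaxlHypergraph

section Bases

variable {Ω : Type*}

/-- `B` is a base for the permutation group `G`: its pointwise stabiliser is trivial. -/
def IsBase (G : Subgroup (Equiv.Perm Ω)) (B : Set Ω) : Prop :=
  fixingSubgroup G B = ⊥

/-- The base size `b(G)`: the least size of a base. (For finite `Ω` the whole of `Ω` is a base, so
the minimum is over a non-empty set.) -/
def baseSize (G : Subgroup (Equiv.Perm Ω)) : ℕ :=
  sInf {k : ℕ | ∃ B : Set Ω, B.Finite ∧ IsBase G B ∧ B.ncard = k}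

/-- The Saxl hypergraph of `G`: vertex set `Ω`, and the bases of size `b(G)` as edges. -/
def saxlHypergraph (G : Subgroup (Equiv.Perm Ω)) : Hypergraph Ω where
  vertexSet := Set.univ
  edgeSet := {B | B.Finite ∧ IsBase G B ∧ B.ncard = baseSize G}
  subset_vertexSet_of_mem_edgeSet' := fun _ _ => Set.subset_univ _

/-- The degree of a vertex of a hypergraph: the number of edges that contain it. -/
def degree (Γ : Hypergraph Ω) (v : Ω) : ℕ :=
  {e : Set Ω | e ∈ Γ.edgeSet ∧ v ∈ e}.ncard

/-- The hypergraph is regular of valency `d`. -/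
def HasValency (Γ : Hypergraph Ω) (d : ℕ) : Prop :=
  ∀ v ∈ Γ.vertexSet, degree Γ v = d

end Bases

section AlmostSimple

/-- `G` is almost simple with socle `T`: the subgroup `T` is normal, non-abelian and simple, and `G`
acts faithfully on it by conjugation, that is, `T ≤ G ≤ Aut(T)`. -/
structure IsAlmostSimpleWithSocle {G : Type*} [Group G] (T : Subgroup G) : Prop where
  normal : T.Normal
  simple : IsSimpleGroup T
  nonabelian : ∃ x ∈ T, ∃ y ∈ T, x * y ≠ y * x
  centralizer_eq_bot : Subgroup.centralizer (T : Set G) = ⊥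

/-- The permutation group `G` is almost simple with socle `T`, and for a point stabiliser `H` some
isomorphism `T ≃* S` takes `H ∩ T` to the subgroup `P` of `S`. -/
def HasSocleAndStabilizer {Ω : Type*} (G : Subgroup (Equiv.Perm Ω)) (T : Subgroup G)
    {S : Type*} [Group S] (P : Subgroup S) : Prop :=
  IsAlmostSimpleWithSocle T ∧ ∃ (ω : Ω) (φ : T ≃* S),
    ((MulAction.stabilizer G ω).subgroupOf T).map φ.toMonoidHom = P

end AlmostSimple

section Linear

/-- `PSL_n(F)`. -/
abbrev PSL (n : ℕ) (F : Type*) [Field F] : Type _ :=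
  Matrix.ProjectiveSpecialLinearGroup (Fin n) F

/-- `PGL_n(F)`. -/
abbrev PGL (n : ℕ) (F : Type*) [Field F] : Type _ :=
  Matrix.ProjGenLinGroup (Fin n) F

/-- `PΓL_n(F)`, as the group of the permutations of the projective space that are induced by
bijective semilinear maps of `F ^ n`. -/
def PGammaL (n : ℕ) (F : Type*) [Field F] : Subgroup (Equiv.Perm (ℙ F (Fin n → F))) where
  carrier := {π | ∃ (σ : F ≃+* F) (f : (Fin n → F) ≃+ (Fin n → F)),
    (∀ (c : F) (v : Fin n → F), f (c • v) = σ c • f v) ∧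
    ∀ (v : Fin n → F) (hv : v ≠ 0),
      π (Projectivization.mk F v hv) =
        Projectivization.mk F (f v) ((map_ne_zero_iff f f.injective).2 hv)}
  one_mem' := ⟨RingEquiv.refl F, AddEquiv.refl _, fun _ _ => rfl, fun _ _ => rfl⟩
  mul_mem' := by
    rintro π ρ ⟨σ, f, hf, hπ⟩ ⟨τ, g, hg, hρ⟩
    refine ⟨τ.trans σ, g.trans f, fun c v => ?_, fun v hv => ?_⟩
    · simp [hf, hg]
    · rw [Equiv.Perm.mul_apply, hρ v hv, hπ]
      rfl
  inv_mem' := by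
    rintro π ⟨σ, f, hf, hπ⟩
    refine ⟨σ.symm, f.symm, fun c v => ?_, fun v hv => ?_⟩
    · apply f.injective
      simp [hf]
    · rw [Equiv.Perm.inv_eq_iff_eq, hπ]
      simp

/-- The subgroups of `PSL_n(F)` of type `P_1`: the stabilisers of a point of the projective
space. -/
def IsTypeP1 {n : ℕ} {F : Type*} [Field F] (P : Subgroup (PSL n F)) : Prop :=
  ∃ p : ℙ F (Fin n → F), P = MulAction.stabilizer (PSL n F) p

/-- The subgroups of `PSL_2(F)` of type `GL_1(q) wr S_2`: the setwise stabilisers of a pair of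
distinct points of the projective line. They are dihedral of order `2 (q - 1)` if `q = |F|` is
even. -/
def IsTypeGL1Wr {F : Type*} [Field F] (P : Subgroup (PSL 2 F)) : Prop :=
  ∃ p p' : ℙ F (Fin 2 → F), p ≠ p' ∧
    P = MulAction.stabilizer (PSL 2 F) ({p, p'} : Set (ℙ F (Fin 2 → F)))

/-- The matrices in `SL_n(F)` that normalise the subalgebra `A` of the matrix algebra. -/
def slNormalizer {n : ℕ} {F : Type*} [Field F] (A : Subalgebra F (Matrix (Fin n) (Fin n) F)) :
    Subgroup (Matrix.SpecialLinearGroup (Fin n) F) where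
  carrier := {g : Matrix.SpecialLinearGroup (Fin n) F | ∀ x : Matrix (Fin n) (Fin n) F,
    x ∈ A ↔ (g : Matrix (Fin n) (Fin n) F) * x * (g⁻¹ : Matrix.SpecialLinearGroup (Fin n) F) ∈ A}
  one_mem' := by simp
  mul_mem' := by
    intro g h hg hh x
    have h1 := (hh x).trans (hg _)
    rw [mul_inv_rev, Matrix.SpecialLinearGroup.coe_mul, Matrix.SpecialLinearGroup.coe_mul]
    simpa only [Matrix.mul_assoc] using h1
  inv_mem' := by
    intro g hg x
    have h1 : (g : Matrix (Fin n) (Fin n) F) * (g⁻¹ : Matrix.SpecialLinearGroup (Fin n) F) = 1 := by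
      rw [← Matrix.SpecialLinearGroup.coe_mul, mul_inv_cancel, Matrix.SpecialLinearGroup.coe_one]
    have key : ∀ a b : Matrix (Fin n) (Fin n) F, a * b = 1 → a * (b * x * a) * b = x := by
      intro a b h
      rw [show a * (b * x * a) * b = (a * b) * x * (a * b) by simp only [Matrix.mul_assoc], h,
        Matrix.one_mul, Matrix.mul_one]
    have h2 := hg ((g⁻¹ : Matrix.SpecialLinearGroup (Fin n) F) * x * g)
    rw [key _ _ h1] at h2
    rw [inv_inv]
    exact h2.symm

/-- The subgroups of `PSL_n(F)` of type `GL_1(q ^ n)`, `q = |F|`: the normalisers of a subfield of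
degree `n` over `F` of the matrix algebra (an embedded copy of `GF(q ^ n)`), modulo scalars. They
are dihedral of order `2 (q + 1)` if `n = 2` and `q` is even, and of shape `13:3` if `n = 3` and
`q = 3`. -/
def IsTypeGL1Ext {n : ℕ} {F : Type*} [Field F] (P : Subgroup (PSL n F)) : Prop :=
  ∃ A : Subalgebra F (Matrix (Fin n) (Fin n) F), IsField A ∧ Module.finrank F A = n ∧
    P = (slNormalizer A).map
      (QuotientGroup.mk' (Subgroup.center (Matrix.SpecialLinearGroup (Fin n) F)))

end Linear

section Ree

variable {F : Type*} [Field F]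

/-- The map `(x, y, z) ↦ (x + a, y + b + a^θ x, z + c - a y + b x - a^(θ+1) x)`, `∞ ↦ ∞`, where
`u^θ = u ^ t`. -/
def reeTranslation (t : ℕ) (a b c : F) (p : OnePoint (F × F × F)) : OnePoint (F × F × F) :=
  p.elim ∞ fun (x, y, z) =>
    ((x + a, y + b + a ^ t * x, z + c - a * y + b * x - a ^ (t + 1) * x) : F × F × F)

/-- The map `(x, y, z) ↦ (κ x, κ^(θ+1) y, κ^(θ+2) z)`, `∞ ↦ ∞`, where `u^θ = u ^ t`. -/
def reeTorus (t : ℕ) (κ : F) (p : OnePoint (F × F × F)) : OnePoint (F × F × F) :=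
  p.elim ∞ fun (x, y, z) => ((κ * x, κ ^ (t + 1) * y, κ ^ (t + 2) * z) : F × F × F)

open Classical in
/-- The involution that exchanges `∞` and `(0, 0, 0)` and takes any other `(x, y, z)` to
`(-v/w, -u/w, -z/w)`, where `u^θ = u ^ t`. -/
def reeInversion (t : ℕ) (p : OnePoint (F × F × F)) : OnePoint (F × F × F) :=
  p.elim (((0, 0, 0) : F × F × F) : OnePoint (F × F × F)) fun (x, y, z) =>
    let u := x ^ 2 * y - x * z + y ^ t - x ^ (t + 3)
    let v := x ^ t * y ^ t - z ^ t + x * y ^ 2 + y * z - x ^ (2 * t + 3)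
    let w := -(x * z ^ t) + x ^ (t + 1) * y ^ t - x ^ (t + 3) * y - x ^ 2 * y ^ 2 + y ^ (t + 1)
      + z ^ 2 - x ^ (2 * t + 4)
    if (x, y, z) = ((0, 0, 0) : F × F × F) then ∞ else ((-v / w, -u / w, -z / w) : F × F × F)

/-- For a field `F` with `q = 3 ^ (2 n + 1)` elements, the Ree group `Ree(q) = ²G₂(q)` in its doubly
transitive action on the `q ^ 3 + 1` points of `F ^ 3 ∪ {∞}`, generated by the maps above with
`t = 3 ^ (n + 1)`, so that `θ ^ 2` is the Frobenius map `u ↦ u ^ 3`. All of these maps are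
permutations. -/
def reeGroup (F : Type*) [Field F] (n : ℕ) : Subgroup (Equiv.Perm (OnePoint (F × F × F))) :=
  Subgroup.closure {π |
    (∃ a b c : F, ⇑π = reeTranslation (3 ^ (n + 1)) a b c) ∨
    (∃ κ : F, κ ≠ 0 ∧ ⇑π = reeTorus (3 ^ (n + 1)) κ) ∨
    ⇑π = reeInversion (3 ^ (n + 1))}

end Ree

section Table

variable {Ω : Type*} (G : Subgroup (Equiv.Perm Ω))

/-- First family: `T = Ree(q)`, `q = 3 ^ (2 n + 1) ≥ 27`, and `H ∩ T` is the Borel subgroup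
`[q^3]:C_(q-1)`, the stabiliser of a point in the doubly transitive action. -/
def IsReeCase : Prop :=
  ∃ (n : ℕ) (F : Type) (_ : Field F) (T : Subgroup G), 1 ≤ n ∧ Nat.card F = 3 ^ (2 * n + 1) ∧
    HasSocleAndStabilizer G T
      (MulAction.stabilizer (reeGroup F n) (∞ : OnePoint (F × F × F)))

/-- Second family: `T = PSL_2(F)`, `q = |F|` odd, and `H ∩ T` is of type `P_1`. -/
def IsParabolicCase (F : Type) [Field F] (T : Subgroup G) : Prop :=
  Odd (Nat.card F) ∧ ∃ P : Subgroup (PSL 2 F), IsTypeP1 P ∧ HasSocleAndStabilizer G T P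

/-- Third family: `T = PSL_2(F)`, `q = |F|` even, `G ≠ T`, and `H ∩ T` is of type
`GL_1(q) wr S_2`. -/
def IsSplitCase (F : Type) [Field F] (T : Subgroup G) : Prop :=
  Even (Nat.card F) ∧ T ≠ ⊤ ∧
    ∃ P : Subgroup (PSL 2 F), IsTypeGL1Wr P ∧ HasSocleAndStabilizer G T P

/-- Fourth family: `T = PSL_2(F)`, `q = |F|` even, and `H ∩ T` is of type `GL_1(q^2)`. -/
def IsNonsplitCase (F : Type) [Field F] (T : Subgroup G) : Prop :=
  Even (Nat.card F) ∧ ∃ P : Subgroup (PSL 2 F), IsTypeGL1Ext P ∧ HasSocleAndStabilizer G T P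

/-- The group `G = PSL_3(3).2`, where `H ∩ T` is of type `GL_1(3^3)`. -/
def IsPSL33Case : Prop :=
  ∃ (T : Subgroup G) (P : Subgroup (PSL 3 (ZMod 3))), T.index = 2 ∧ IsTypeGL1Ext P ∧
    HasSocleAndStabilizer G T P

/-- `G` belongs to one of the five families. -/
def InTable : Prop :=
  IsReeCase G ∨
  (∃ (F : Type) (_ : Field F) (_ : Finite F) (T : Subgroup G), IsParabolicCase G F T) ∨
  (∃ (F : Type) (_ : Field F) (_ : Finite F) (T : Subgroup G), IsSplitCase G F T) ∨
  (∃ (F : Type) (_ : Field F) (_ : Finite F) (T : Subgroup G), IsNonsplitCase G F T) ∨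
  IsPSL33Case G

end Table

end SaxlHypergraph

end

/-! A primitive group is transitive, so all degrees agree and only the parity of the number of
minimal bases through one point v matters. An involution s that fixes v and normalises G permutes
these bases, and modulo two only the invariant ones count (`degree_mod_two`). If bases have size
three and none containing v lies inside Fix(s), the invariant ones are the sets {v, x, sx}, each
obtained from two points x; hence the degree is odd exactly when the number of such x is 2 modulo 4
(`odd_degree_iff`). What remains is a concrete model of each action, its base size, and a count
modulo 4.

For T = PSL_2(q), an automorphism of T carries elements with a single fixed point on the projective
line to elements of the same kind, so it is induced by a semilinear permutation and G acts
semilinearly on the line (`exists_semilinear_hom`).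

If q is even, the points of Ω are quadratic forms cX^2 + XY + nY^2. The orbits of SL_2(q) are the
classes of the Arf invariant cn modulo the elements z^2 + z: the split class gives the pairs of
points, the nonsplit class the quadratic subfields. G becomes SL_2(q) extended by a group Γ of field
automorphisms (`exists_isFormModel`), and bases have size three (`IsFormModel.baseSize_eq`). If |Γ|
is even, a point stabiliser contains a group of order four, which cannot preserve a base of size
three through the point (`even_degree_of_four_dvd`). If |Γ| is odd, a transvection s reduces the
question to counting forms with c ≠ 1 and trivial stabiliser in Γ. Those with c ≠ 0 are a multiple
of four in number (`four_dvd_ncard_regular`). Forms with c = 0 are split, and they contribute the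
number of n in F that no non-trivial element of Γ fixes. This is a multiple of four if Γ is not the
whole Galois group, since the fixed field then has at least four elements and acts freely by
translation. For the whole Galois group Möbius inversion gives the sum of μ(e/d) 2^d over d dividing
e, which is 2μ(e) modulo 4, so that squarefree e are singled out (`ncard_regular_mod_four`).

If q is odd and Ω is the projective line, PGL_2(q) normalises G and is 3-transitive. If G contains
no non-trivial field automorphism, all triples are bases, and s : x ↦ -x moves q - 1 points: the
degree is odd exactly when q is 3 modulo 4, and then G is PSL_2(q) or PGL_2(q). Otherwise bases have
size four, and an s-invariant base through ∞ would be contained in some {∞, 0, a, -a}; after a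
dilation this is {∞, 0, 1, -1}, which field automorphisms fix pointwise.

For PSL_3(3).2 the stabiliser of v in T is 13:3, and there is an involution t outside T that fixes
v, inverts the elements of order 13 and centralises an element c of order 3. For x moved by t, {v,
x, tx} is a base exactly when c moves x. The numbers of all points, of points fixed by t, and of
points fixed by c but not by t are all multiples of four, so the count is too
(`even_degree_of_singer`).

For the Ree groups, the seven-dimensional representation shows that the stabiliser of ∞ and the
origin in the Ree group is the torus, and hence that its stabiliser in G consists of torus elements
times field automorphisms. These commute with sign changes of the coordinates up to the required
extent to make the set of third base points sign-invariant; with one exchange of coordinate axes its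
size is a multiple of four (`IsReeModel.four_dvd_ncard_basePoints`). Counting ordered pairs of
further base points doubles the degree, which is therefore even. -/

namespace SaxlHypergraph

/-! ### Counting modulo two and by fibres. -/

section Parity

/-- An involution of a finite set has as many fixed points as the set has elements, modulo two. -/
theorem card_mod_two_of_involutive {α : Type*} [Finite α] {f : α → α}
    (hf : Function.Involutive f) : Nat.card α % 2 = Nat.card {x // f x = x} % 2 := by
  classical
  have := Fintype.ofFinite α
  have h := Equiv.Perm.card_fixedPoints_modEq (α := α) (f := (f : Function.End α)) (p := 2) (n := 1)
    (funext hf)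
  rw [Nat.card_eq_fintype_card]
  refine h.trans ?_
  rw [← Nat.card_eq_fintype_card]
  rfl

theorem ncard_mod_two_of_involutive {α : Type*} [Finite α] {f : α → α}
    (hf : Function.Involutive f) {S : Set α} (hS : ∀ x ∈ S, f x ∈ S) :
    S.ncard % 2 = {x ∈ S | f x = x}.ncard % 2 := by
  have h := card_mod_two_of_involutive (α := S) (f := fun x => ⟨f x, hS x x.2⟩)
    (fun x => Subtype.ext (hf x))
  rw [Nat.card_coe_set_eq] at h
  rw [h, ← Nat.card_coe_set_eq {x ∈ S | f x = x}]
  congr 1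
  refine Nat.card_congr ⟨fun x => ⟨x.1.1, x.1.2, congrArg Subtype.val x.2⟩,
    fun x => ⟨⟨x.1, x.2.1⟩, Subtype.ext x.2.2⟩, fun _ => rfl, fun _ => rfl⟩

/-- If all fibres of a map have `k` elements, the domain has `k` times as many elements as the
image. -/
theorem ncard_eq_mul_of_fiber {α β : Type*} [Finite α] {S : Set α} {R : Set β} {f : α → β} {k : ℕ}
    (hR : R.Finite) (hf : ∀ x ∈ S, f x ∈ R) (hk : ∀ y ∈ R, {x ∈ S | f x = y}.ncard = k) :
    S.ncard = k * R.ncard := by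
  classical
  have := Fintype.ofFinite α
  rw [Set.ncard_eq_toFinset_card S (Set.toFinite S), Set.ncard_eq_toFinset_card R hR,
    Finset.card_eq_sum_card_fiberwise (f := f) (t := hR.toFinset) (by simpa [Set.MapsTo] using hf),
    Finset.sum_const_nat (m := k), mul_comm]
  intro y hy
  rw [← hk y (by simpa using hy), Set.ncard_eq_toFinset_card _ (Set.toFinite _)]
  congr 1
  ext x
  simp

/-- A group that acts freely on a set has an order that divides the number of its elements. -/
theorem card_dvd_ncard_of_free {K α : Type*} [Group K] [Finite α] [MulAction K α] {S : Set α}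
    (hS : ∀ (k : K), ∀ x ∈ S, k • x ∈ S) (hfree : ∀ (k : K), ∀ x ∈ S, k • x = x → k = 1) :
    Nat.card K ∣ S.ncard := by
  classical
  by_cases hK : Finite K
  swap
  · rcases S.eq_empty_or_nonempty with rfl | ⟨x, hx⟩
    · simp
    · refine absurd (Finite.of_injective (fun k : K => k • x) fun a b h => ?_) hK
      have : b⁻¹ * a = 1 := hfree _ x hx (by rw [mul_smul]; simpa [inv_smul_eq_iff] using h)
      exact (inv_mul_eq_one.1 this).symm
  rw [ncard_eq_mul_of_fiber (S := S) (R := (fun x => MulAction.orbit K x) '' S)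
    (f := fun x => MulAction.orbit K x) (k := Nat.card K) (Set.toFinite _)
    (fun x hx => Set.mem_image_of_mem _ hx)]
  · exact dvd_mul_right _ _
  · rintro _ ⟨x, hx, rfl⟩
    rw [← Nat.card_coe_set_eq]
    refine (Nat.card_congr (Equiv.ofBijective (fun k : K => ⟨k • x, hS k x hx, by simp⟩)
      ⟨?_, ?_⟩)).symm
    · intro a b h
      have : b⁻¹ * a = 1 := hfree _ x hx (by
        rw [mul_smul]; simpa [inv_smul_eq_iff] using congrArg Subtype.val h)
      exact (inv_mul_eq_one.1 this).symm
    · rintro ⟨y, hy, hxy⟩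
      have : y ∈ MulAction.orbit K x :=
        (show MulAction.orbit K y = MulAction.orbit K x from hxy) ▸ MulAction.mem_orbit_self y
      obtain ⟨k, hk⟩ := this
      exact ⟨k, Subtype.ext hk⟩

end Parity

/-! ### Bases, degrees, and involutions acting on the edges. -/

section Bases

variable {Ω : Type*} {G : Subgroup (Equiv.Perm Ω)}

theorem isBase_iff {B : Set Ω} : IsBase G B ↔ ∀ g ∈ G, (∀ x ∈ B, g x = x) → g = 1 := by
  rw [IsBase, eq_bot_iff]
  refine ⟨fun h g hg hx => ?_, fun h g hg => ?_⟩
  · have : (⟨g, hg⟩ : G) ∈ fixingSubgroup G B := (mem_fixingSubgroup_iff G).2 hx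
    simpa using h this
  · exact Subgroup.mem_bot.2 (Subtype.ext (h g g.2 ((mem_fixingSubgroup_iff G).1 hg)))

theorem IsBase.mono {B C : Set Ω} (hB : IsBase G B) (h : B ⊆ C) : IsBase G C :=
  isBase_iff.2 fun g hg hx => isBase_iff.1 hB g hg fun x hxB => hx x (h hxB)

theorem isBase_image_of_normalizes {s : Equiv.Perm Ω} (hs : ∀ g ∈ G, s⁻¹ * g * s ∈ G)
    {B : Set Ω} (hB : IsBase G B) : IsBase G (s '' B) := by
  refine isBase_iff.2 fun g hg hx => ?_
  have h := isBase_iff.1 hB _ (hs g hg) fun x hxB => by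
    have := hx (s x) ⟨x, hxB, rfl⟩
    simp [this]
  calc g = s * (s⁻¹ * g * s) * s⁻¹ := by group
    _ = 1 := by rw [h]; simp

theorem mem_edgeSet {e : Set Ω} :
    e ∈ (saxlHypergraph G).edgeSet ↔ e.Finite ∧ IsBase G e ∧ e.ncard = baseSize G := Iff.rfl

theorem image_mem_edgeSet {s : Equiv.Perm Ω} (hs : ∀ g ∈ G, s⁻¹ * g * s ∈ G) {e : Set Ω}
    (he : e ∈ (saxlHypergraph G).edgeSet) : s '' e ∈ (saxlHypergraph G).edgeSet :=
  ⟨he.1.image _, isBase_image_of_normalizes hs he.2.1, by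
    rw [Set.ncard_image_of_injective _ s.injective, he.2.2]⟩

theorem normalizes_of_mem {s : Equiv.Perm Ω} (hs : s ∈ G) : ∀ g ∈ G, s⁻¹ * g * s ∈ G :=
  fun _ hg => G.mul_mem (G.mul_mem (G.inv_mem hs) hg) hs

theorem degree_smul {s : Equiv.Perm Ω} (hs : s ∈ G) (v : Ω) :
    degree (saxlHypergraph G) (s v) = degree (saxlHypergraph G) v := by
  unfold degree
  rw [← Set.ncard_image_of_injective {e | e ∈ (saxlHypergraph G).edgeSet ∧ v ∈ e}
    (Set.image_injective.2 s.injective)]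
  congr 1
  ext e
  constructor
  · rintro ⟨he, hv⟩
    refine ⟨(s⁻¹ : Equiv.Perm Ω) '' e, ⟨image_mem_edgeSet (normalizes_of_mem (G.inv_mem hs)) he,
      s v, hv, by simp⟩, ?_⟩
    rw [← Set.image_comp]
    simp
  · rintro ⟨e, ⟨he, hv⟩, rfl⟩
    exact ⟨image_mem_edgeSet (normalizes_of_mem hs) he, v, hv, rfl⟩

theorem hasValency_degree [MulAction.IsPretransitive G Ω] (v : Ω) :
    HasValency (saxlHypergraph G) (degree (saxlHypergraph G) v) := by
  intro w _
  obtain ⟨g, rfl⟩ := MulAction.exists_smul_eq G v w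
  exact degree_smul g.2 v

theorem ncard_triple_le (x y z : Ω) : ({x, y, z} : Set Ω).ncard ≤ 3 := by
  refine (Set.ncard_insert_le _ _).trans ?_
  have := Set.ncard_insert_le y ({z} : Set Ω)
  rw [Set.ncard_singleton] at this
  omega

theorem exists_eq_triple {e : Set Ω} {v : Ω} (he : e.ncard = 3) (hv : v ∈ e) :
    ∃ x y, x ≠ v ∧ y ≠ v ∧ x ≠ y ∧ e = {v, x, y} := by
  have h : (e \ {v}).ncard = 2 := by
    rw [Set.ncard_sdiff_singleton_of_mem hv, he]
  obtain ⟨x, y, hxy, h2⟩ := Set.ncard_eq_two.1 h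
  have hx : x ∈ e \ {v} := h2 ▸ (by simp)
  have hy : y ∈ e \ {v} := h2 ▸ (by simp)
  refine ⟨x, y, hx.2, hy.2, hxy, ?_⟩
  rw [← h2, Set.insert_sdiff_singleton, Set.insert_eq_of_mem hv]

variable [Finite Ω]

theorem baseSize_le {B : Set Ω} (hB : IsBase G B) : baseSize G ≤ B.ncard :=
  Nat.sInf_le ⟨B, Set.toFinite B, hB, rfl⟩

theorem le_baseSize {k : ℕ} (h : ∀ B : Set Ω, IsBase G B → k ≤ B.ncard) : k ≤ baseSize G := by
  have hne : {k : ℕ | ∃ B : Set Ω, B.Finite ∧ IsBase G B ∧ B.ncard = k}.Nonempty :=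
    ⟨_, Set.univ, Set.toFinite _, isBase_iff.2 fun g _ hx => Equiv.ext fun x => hx x trivial, rfl⟩
  obtain ⟨B, _, hB, hk⟩ := Nat.sInf_mem hne
  exact (h B hB).trans_eq hk

theorem three_le_baseSize [Nonempty Ω] (h : ∀ x y : Ω, ¬ IsBase G {x, y}) : 3 ≤ baseSize G := by
  refine le_baseSize fun B hB => ?_
  by_contra! hlt
  obtain ⟨x⟩ := ‹Nonempty Ω›
  have : B.ncard = 0 ∨ B.ncard = 1 ∨ B.ncard = 2 := by omega
  rcases this with h0 | h1 | h2
  · exact h x x (hB.mono (by rw [(Set.ncard_eq_zero (Set.toFinite B)).1 h0]; simp))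
  · obtain ⟨a, rfl⟩ := Set.ncard_eq_one.1 h1
    exact h a a (hB.mono (by simp))
  · obtain ⟨a, b, -, rfl⟩ := Set.ncard_eq_two.1 h2
    exact h a b hB

theorem baseSize_eq_three [Nonempty Ω] (h : ∀ x y : Ω, ¬ IsBase G {x, y}) {x y z : Ω}
    (hB : IsBase G {x, y, z}) : baseSize G = 3 :=
  le_antisymm ((baseSize_le hB).trans (ncard_triple_le x y z)) (three_le_baseSize h)

/-- An involution in the normaliser acts on the edges through its fixed point, and non-invariant
edges cancel in pairs. Membership of s in G is not demanded: on the projective line the reflection x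
↦ -x may lie outside G. -/
theorem degree_mod_two {s : Equiv.Perm Ω} (hs : ∀ g ∈ G, s⁻¹ * g * s ∈ G) (hs2 : s * s = 1)
    {v : Ω} (hv : s v = v) :
    degree (saxlHypergraph G) v % 2 =
      {e | (e ∈ (saxlHypergraph G).edgeSet ∧ v ∈ e) ∧ s '' e = e}.ncard % 2 := by
  refine ncard_mod_two_of_involutive (f := fun e : Set Ω => s '' e) (fun e => ?_)
    (S := {e | e ∈ (saxlHypergraph G).edgeSet ∧ v ∈ e}) ?_
  · have : ⇑s ∘ ⇑s = id := by
      funext x; exact congrArg (fun f : Equiv.Perm Ω => f x) hs2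
    simp only [← Set.image_comp, this, Set.image_id]
  · rintro e ⟨he, hve⟩
    exact ⟨image_mem_edgeSet hs he, v, hve, hv⟩

theorem even_degree_of_no_fixed_edge {s : Equiv.Perm Ω} (hs : ∀ g ∈ G, s⁻¹ * g * s ∈ G)
    (hs2 : s * s = 1) {v : Ω} (hv : s v = v)
    (h : ∀ e, e ∈ (saxlHypergraph G).edgeSet → v ∈ e → s '' e ≠ e) :
    Even (degree (saxlHypergraph G) v) := by
  rw [Nat.even_iff, degree_mod_two hs hs2 hv]
  convert Nat.zero_mod 2
  rw [Set.ncard_eq_zero (Set.toFinite _), Set.eq_empty_iff_forall_notMem]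
  rintro e ⟨⟨he, hve⟩, hse⟩
  exact h e he hve hse

/-- The parity of the valency when bases have size three: only the bases `{v, x, s x}` count,
where `s` is an involution that fixes `v`. -/
theorem odd_degree_iff {s : Equiv.Perm Ω} (hs : ∀ g ∈ G, s⁻¹ * g * s ∈ G) (hs2 : s * s = 1)
    {v : Ω} (hv : s v = v) (hb : baseSize G = 3)
    (hfix : ∀ x y, s x = x → s y = y → x ≠ y → x ≠ v → y ≠ v → ¬ IsBase G {v, x, y}) :
    Odd (degree (saxlHypergraph G) v) ↔ {x | s x ≠ x ∧ IsBase G {v, x, s x}}.ncard % 4 = 2 := by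
  have hss : ∀ x, s (s x) = x := fun x => congrArg (fun f : Equiv.Perm Ω => f x) hs2
  rw [Nat.odd_iff, degree_mod_two hs hs2 hv]
  have hne : ∀ x, s x ≠ x → x ≠ v ∧ s x ≠ v := fun x hx =>
    ⟨fun h => hx (h ▸ hv), fun h => hx (by rw [s.injective (h.trans hv.symm), hv])⟩
  -- The map x ↦ {v, x, s x} onto the invariant edges is two to one, which turns a parity into a
  -- residue modulo 4.
  have key : {x | s x ≠ x ∧ IsBase G {v, x, s x}}.ncard =
      2 * {e | (e ∈ (saxlHypergraph G).edgeSet ∧ v ∈ e) ∧ s '' e = e}.ncard := by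
    refine ncard_eq_mul_of_fiber (f := fun x => ({v, x, s x} : Set Ω)) (Set.toFinite _) ?_ ?_
    · rintro x ⟨hx, hB⟩
      obtain ⟨h1, h2⟩ := hne x hx
      refine ⟨⟨⟨Set.toFinite _, hB, ?_⟩, by simp⟩, ?_⟩
      · rw [hb, Set.ncard_eq_three]
        exact ⟨v, x, s x, h1.symm, h2.symm, hx.symm, rfl⟩
      · rw [Set.image_insert_eq, Set.image_pair, hv, hss, Set.pair_comm (s x) x]
    · rintro e ⟨⟨⟨-, hB, hc⟩, hve⟩, hse⟩
      obtain ⟨x, y, hxv, hyv, hxy, rfl⟩ := exists_eq_triple (hc.trans hb) hve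
      have hsx : s x = x ∨ s x = y := by
        have : s x ∈ ({v, x, y} : Set Ω) := hse ▸ ⟨x, by simp, rfl⟩
        rcases this with h | h | h
        · exact absurd (s.injective (h.trans hv.symm)) hxv
        · exact Or.inl h
        · exact Or.inr h
      have hsy : s y = x ∨ s y = y := by
        have : s y ∈ ({v, x, y} : Set Ω) := hse ▸ ⟨y, by simp, rfl⟩
        rcases this with h | h | h
        · exact absurd (s.injective (h.trans hv.symm)) hyv
        · exact Or.inl h
        · exact Or.inr h
      have hsxy : s x = y := by
        rcases hsx with h | h
        · rcases hsy with h' | h'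
          · exact absurd (s.injective (h.trans h'.symm)) hxy
          · exact absurd hB (hfix x y h h' hxy hxv hyv)
        · exact h
      have hsyx : s y = x := by rw [← hsxy, hss]
      rw [Set.ncard_eq_two]
      refine ⟨x, y, hxy, ?_⟩
      ext z
      simp only [Set.mem_ofPred_eq, Set.mem_insert_iff, Set.mem_singleton_iff]
      constructor
      · rintro ⟨⟨hz, -⟩, hze⟩
        have : z ∈ ({v, x, y} : Set Ω) := hze ▸ (by simp)
        rcases this with h | h | h
        · exact absurd h (hne z hz).1
        · exact Or.inl h
        · exact Or.inr h
      · rintro (rfl | rfl)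
        · rw [hsxy]; exact ⟨⟨hxy.symm, hB⟩, rfl⟩
        · rw [hsyx]
          exact ⟨⟨hxy, by rwa [Set.pair_comm]⟩, by rw [Set.pair_comm]⟩
  rw [key]
  omega

/-- If bases have size three and a point stabiliser has order divisible by four, then the valency
is even. -/
theorem even_degree_of_four_dvd {v : Ω} (hb : baseSize G = 3)
    (h4 : 4 ∣ Nat.card (MulAction.stabilizer G v)) : Even (degree (saxlHypergraph G) v) := by
  have : Fact (Nat.Prime 2) := ⟨Nat.prime_two⟩
  obtain ⟨S, hS⟩ := Sylow.exists_subgroup_card_pow_prime (G := MulAction.stabilizer G v) 2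
    (n := 2) h4
  let E : Set (Set Ω) := {e | e ∈ (saxlHypergraph G).edgeSet ∧ v ∈ e}
  let act : MulAction S E :=
    { smul := fun k e => ⟨(k.1.1.1 : Equiv.Perm Ω) '' e.1,
        image_mem_edgeSet (normalizes_of_mem k.1.1.2) e.2.1, v, e.2.2, k.1.2⟩
      one_smul := fun e => Subtype.ext (Set.image_id e.1)
      mul_smul := fun k l e => Subtype.ext (Set.image_comp k.1.1.1 l.1.1.1 e.1) }
  have hmod := (IsPGroup.of_card (p := 2) (n := 2) hS).card_modEq_card_fixedPoints E
  rw [Nat.even_iff]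
  change E.ncard % 2 = 0
  rw [← Nat.card_coe_set_eq]
  refine Eq.trans hmod ?_
  convert Nat.zero_mod 2
  rw [Finite.card_eq_zero_iff]
  refine ⟨fun ef => ?_⟩
  obtain ⟨⟨e, ⟨_, hB, hc⟩, hve⟩, hfix'⟩ := ef
  have hfix : ∀ k : S, (k.1.1.1 : Equiv.Perm Ω) '' e = e := fun k => congrArg Subtype.val (hfix' k)
  clear hfix'
  obtain ⟨x, y, hxv, hyv, hxy, rfl⟩ := exists_eq_triple (hc.trans hb) hve
  have hmem : ∀ k : S, (k.1.1.1 x = x ∧ k.1.1.1 y = y) ∨ (k.1.1.1 x = y ∧ k.1.1.1 y = x) := by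
    intro k
    have himg : (k.1.1.1 : Equiv.Perm Ω) '' {v, x, y} = {v, x, y} := hfix k
    have hkv : k.1.1.1 v = v := k.1.2
    have h1 : k.1.1.1 x ∈ ({v, x, y} : Set Ω) := himg ▸ ⟨x, by simp, rfl⟩
    have h2 : k.1.1.1 y ∈ ({v, x, y} : Set Ω) := himg ▸ ⟨y, by simp, rfl⟩
    have i1 : k.1.1.1 x ≠ v := fun h => hxv (k.1.1.1.injective (h.trans hkv.symm))
    have i2 : k.1.1.1 y ≠ v := fun h => hyv (k.1.1.1.injective (h.trans hkv.symm))
    have i3 : k.1.1.1 x ≠ k.1.1.1 y := fun h => hxy (k.1.1.1.injective h)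
    simp only [Set.mem_insert_iff, Set.mem_singleton_iff] at h1 h2
    rcases h1 with h1 | h1 | h1 <;> rcases h2 with h2 | h2 | h2 <;>
      first
      | exact absurd h1 i1
      | exact absurd h2 i2
      | exact absurd (h1.trans h2.symm) i3
      | exact Or.inl ⟨h1, h2⟩
      | exact Or.inr ⟨h1, h2⟩
  have htriv : ∀ k : S, k.1.1.1 x = x → k = 1 := by
    intro k hk
    have hky : k.1.1.1 y = y := by
      rcases hmem k with h | h
      · exact h.2
      · exact absurd (hk.symm.trans h.1) hxy
    have := isBase_iff.1 hB k.1.1.1 k.1.1.2 (by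
      rintro z (rfl | rfl | rfl)
      · exact k.1.2
      · exact hk
      · exact hky)
    exact Subtype.ext (Subtype.ext (Subtype.ext this))
  -- If the group S of order four preserves the base {v, x, y}, then k ↦ k x embeds S into {x, y},
  -- because an element of S that fixes x also fixes v and y.
  have hinj : Function.Injective (fun k : S => (⟨k.1.1.1 x, by
      rcases hmem k with h | h
      · rw [h.1]; simp
      · rw [h.1]; simp⟩ : ({x, y} : Set Ω))) := by
    intro k l hkl
    have h1 : k.1.1.1 x = l.1.1.1 x := congrArg Subtype.val hkl
    have := htriv (l⁻¹ * k) (by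
      change (l.1.1.1⁻¹ * k.1.1.1 : Equiv.Perm Ω) x = x
      rw [Equiv.Perm.mul_apply, h1]
      simp)
    exact (inv_mul_eq_one.1 this).symm
  have hle := Nat.card_le_card_of_injective _ hinj
  rw [hS, Nat.card_coe_set_eq, Set.ncard_pair hxy] at hle
  omega

end Bases

end SaxlHypergraph

namespace SaxlHypergraph

/-! ### Transitivity of the socle and orders of point stabilisers. -/

section AlmostSimple

variable {Ω : Type*} {G : Subgroup (Equiv.Perm Ω)} {T : Subgroup G}

/-- Primitive groups are quasiprimitive, so a normal subgroup is transitive unless it acts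
trivially; the latter is impossible for a non-abelian group of permutations. -/
theorem IsAlmostSimpleWithSocle.isPretransitive (h : IsAlmostSimpleWithSocle T)
    (hprim : MulAction.IsPreprimitive G Ω) : MulAction.IsPretransitive T Ω := by
  have := h.normal
  refine MulAction.IsQuasiPreprimitive.isPretransitive_of_normal (G := G) (X := Ω) fun hfix => ?_
  obtain ⟨x, hx, y, hy, hxy⟩ := h.nonabelian
  have : ∀ z ∈ T, z = 1 := by
    intro z hz
    refine Subtype.ext (Equiv.ext fun ω => ?_)
    have : ω ∈ MulAction.fixedPoints T Ω := hfix ▸ Set.mem_univ ω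
    exact this ⟨z, hz⟩
  exact hxy (by rw [this x hx, this y hy])

theorem card_stabilizer_eq [Finite Ω] (htr : MulAction.IsPretransitive T Ω) (ω : Ω) :
    Nat.card (MulAction.stabilizer G ω) =
      T.index * Nat.card ((MulAction.stabilizer G ω).subgroupOf T) := by
  have htr' : MulAction.IsPretransitive G Ω := ⟨fun x y => by
    obtain ⟨t, ht⟩ := MulAction.exists_smul_eq T x y
    exact ⟨t.1, ht⟩⟩
  have h1 := Subgroup.index_mul_card (MulAction.stabilizer G ω)
  have h2 := Subgroup.index_mul_card (MulAction.stabilizer T ω)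
  have h3 := Subgroup.index_mul_card T
  rw [MulAction.index_stabilizer_of_transitive] at h1 h2
  have h4 : (MulAction.stabilizer G ω).subgroupOf T = MulAction.stabilizer T ω := rfl
  rw [h4]
  have hpos : 0 < Nat.card Ω := Nat.card_pos_iff.2 ⟨⟨ω⟩, inferInstance⟩
  refine Nat.eq_of_mul_eq_mul_left hpos ?_
  rw [h1, ← h3, ← h2]
  ring

end AlmostSimple

/-! ### The projective line as the field together with a point at infinity. -/

section ProjectiveLine

open Matrix Projectivization

variable {F : Type*} [Field F]

/-- The point at infinity of the projective line. -/
def ptInf : ℙ F (Fin 2 → F) := mk F ![1, 0] (by simp)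

/-- The affine points of the projective line. -/
def pt (a : F) : ℙ F (Fin 2 → F) := mk F ![a, 1] (by simp)

theorem pt_injective : Function.Injective (pt : F → ℙ F (Fin 2 → F)) := by
  intro a b h
  obtain ⟨c, hc⟩ := (mk_eq_mk_iff' F _ _ _ _).1 h
  have h0 := congrFun hc 0
  have h1 := congrFun hc 1
  simp only [Pi.smul_apply, smul_eq_mul, cons_val_zero, cons_val_one] at h0 h1
  rw [mul_one] at h1
  rw [← h0, h1, one_mul]

theorem pt_ne_ptInf (a : F) : pt a ≠ ptInf := by
  intro h
  obtain ⟨c, hc⟩ := (mk_eq_mk_iff' F _ _ _ _).1 h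
  have h1 := congrFun hc 1
  simp at h1

theorem eq_ptInf_or_pt (x : ℙ F (Fin 2 → F)) : x = ptInf ∨ ∃ a, x = pt a := by
  induction x using Projectivization.ind with | _ v hv =>
  by_cases h : v 1 = 0
  · left
    refine (mk_eq_mk_iff' F _ _ _ _).2 ⟨v 0, ?_⟩
    ext i
    fin_cases i <;> simp [h]
  · right
    refine ⟨v 0 / v 1, (mk_eq_mk_iff' F _ _ _ _).2 ⟨v 1, ?_⟩⟩
    ext i
    fin_cases i
    · simp; field_simp
    · simp

theorem sl_smul_zero (M : SpecialLinearGroup (Fin 2) F) (v : Fin 2 → F) :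
    (M • v) 0 = M 0 0 * v 0 + M 0 1 * v 1 := by
  change (M.1 *ᵥ v) 0 = _
  simp [mulVec, dotProduct, Fin.sum_univ_two]

theorem sl_smul_one (M : SpecialLinearGroup (Fin 2) F) (v : Fin 2 → F) :
    (M • v) 1 = M 1 0 * v 0 + M 1 1 * v 1 := by
  change (M.1 *ᵥ v) 1 = _
  simp [mulVec, dotProduct, Fin.sum_univ_two]

theorem smul_ptInf_eq (M : SpecialLinearGroup (Fin 2) F) :
    M • (ptInf : ℙ F (Fin 2 → F)) = ptInf ↔ M 1 0 = 0 := by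
  rw [ptInf, smul_mk, mk_eq_mk_iff']
  constructor
  · rintro ⟨c, hc⟩
    have := congrFun hc 1
    simpa [sl_smul_zero, sl_smul_one] using this.symm
  · intro h
    refine ⟨M 0 0, ?_⟩
    ext i
    fin_cases i <;> simp [sl_smul_zero, sl_smul_one, h]

theorem smul_pt_zero_eq (M : SpecialLinearGroup (Fin 2) F) :
    M • (pt 0 : ℙ F (Fin 2 → F)) = pt 0 ↔ M 0 1 = 0 := by
  rw [pt, smul_mk, mk_eq_mk_iff']
  constructor
  · rintro ⟨c, hc⟩
    have := congrFun hc 0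
    simpa [sl_smul_zero, sl_smul_one] using this.symm
  · intro h
    refine ⟨M 1 1, ?_⟩
    ext i
    fin_cases i <;> simp [sl_smul_zero, sl_smul_one, h]

theorem smul_pt_of_lower_eq_zero {M : SpecialLinearGroup (Fin 2) F} (h : M 1 0 = 0) (x : F) :
    M • pt x = pt (M 0 0 * M 0 0 * x + M 0 0 * M 0 1) := by
  have hd : M 0 0 * M 1 1 = 1 := by
    have := M.det_coe
    rw [det_fin_two, h] at this
    simpa using this
  rw [pt, pt, smul_mk, mk_eq_mk_iff']
  refine ⟨M 1 1, ?_⟩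
  ext i
  fin_cases i
  · simp [sl_smul_zero, sl_smul_one]
    linear_combination (M 0 0 * x + M 0 1) * hd
  · simp [sl_smul_zero, sl_smul_one, h]

/-- The upper unitriangular matrices. -/
def upper (a : F) : SpecialLinearGroup (Fin 2) F := ⟨!![1, a; 0, 1], by simp⟩

/-- The diagonal matrices. -/
def diag (s : Fˣ) : SpecialLinearGroup (Fin 2) F := ⟨!![(s : F), 0; 0, (s⁻¹ : Fˣ)], by simp⟩

theorem upper_smul_pt (a x : F) : upper a • pt x = pt (x + a) := by
  rw [smul_pt_of_lower_eq_zero (by simp [upper])]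
  simp [upper]

theorem upper_smul_ptInf (a : F) : upper a • (ptInf : ℙ F (Fin 2 → F)) = ptInf := by
  rw [smul_ptInf_eq]; simp [upper]

theorem diag_smul_pt (s : Fˣ) (x : F) : diag s • pt x = pt (s * s * x) := by
  rw [smul_pt_of_lower_eq_zero (by simp [diag])]
  simp [diag]

theorem diag_smul_ptInf (s : Fˣ) : diag s • (ptInf : ℙ F (Fin 2 → F)) = ptInf := by
  rw [smul_ptInf_eq]; simp [diag]

theorem upper_add (a b : F) : upper (a + b) = upper a * upper b := by
  refine Subtype.ext ?_
  change (upper (a + b)).1 = (upper a).1 * (upper b).1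
  simp [upper, add_comm]

theorem exists_sl_smul_eq {x y : ℙ F (Fin 2 → F)} (h : x ≠ y) :
    ∃ N : SpecialLinearGroup (Fin 2) F, N • x = ptInf ∧ N • y = pt 0 :=
  (MulAction.is_two_pretransitive_iff (G := SpecialLinearGroup (Fin 2) F)).1 inferInstance h
    (pt_ne_ptInf 0).symm

theorem psl_exists_affine {t : PSL 2 F} (h : t • (ptInf : ℙ F (Fin 2 → F)) = ptInf) :
    ∃ l c : F, l ≠ 0 ∧ ∀ x, t • pt x = pt (l * x + c) := by
  induction t using QuotientGroup.induction_on with | H M =>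
  rw [Matrix.ProjectiveSpecialLinearGroup.smul_proj_mk, smul_ptInf_eq] at h
  refine ⟨M 0 0 * M 0 0, M 0 0 * M 0 1, ?_, fun x => ?_⟩
  swap
  · rw [Matrix.ProjectiveSpecialLinearGroup.smul_proj_mk, smul_pt_of_lower_eq_zero h]
  · have hd : M 0 0 * M 1 1 = 1 := by
      have := M.det_coe
      rw [det_fin_two, h] at this
      simpa using this
    exact mul_ne_zero (left_ne_zero_of_mul_eq_one hd) (left_ne_zero_of_mul_eq_one hd)

/-- The permutation of the projective line induced by a field automorphism. -/
def galPerm (σ : F ≃+* F) : Equiv.Perm (ℙ F (Fin 2 → F)) where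
  toFun := Projectivization.map (σ := (σ : F →+* F))
    { toFun := fun v i => σ (v i)
      map_add' := fun v w => by ext; simp
      map_smul' := fun c v => by ext; simp } fun v w h => funext fun i => σ.injective (congrFun h i)
  invFun := Projectivization.map (σ := (σ.symm : F →+* F))
    { toFun := fun v i => σ.symm (v i)
      map_add' := fun v w => by ext; simp
      map_smul' := fun c v => by ext; simp }
      fun v w h => funext fun i => σ.symm.injective (congrFun h i)
  left_inv x := by
    induction x using Projectivization.ind with | _ v hv =>
    change mk F (fun i => σ.symm (σ (v i))) _ = mk F v hv
    congr 1
    ext i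
    simp
  right_inv x := by
    induction x using Projectivization.ind with | _ v hv =>
    change mk F (fun i => σ (σ.symm (v i))) _ = mk F v hv
    congr 1
    ext i
    simp

theorem galPerm_mk (σ : F ≃+* F) (v : Fin 2 → F) (hv : v ≠ 0) :
    galPerm σ (mk F v hv) = mk F (fun i => σ (v i)) (fun h => hv (funext fun i => by
      simpa using congrFun h i)) := rfl

theorem galPerm_pt (σ : F ≃+* F) (x : F) : galPerm σ (pt x) = pt (σ x) := by
  rw [pt, galPerm_mk, pt]
  congr 1
  ext i
  fin_cases i <;> simp

theorem galPerm_ptInf (σ : F ≃+* F) : galPerm σ ptInf = ptInf := by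
  rw [ptInf, galPerm_mk]
  congr 1
  ext i
  fin_cases i <;> simp

end ProjectiveLine

end SaxlHypergraph

namespace SaxlHypergraph

/-! ### Automorphisms of `PSL 2 F` are induced by semilinear maps. -/

section PSLAut

open Matrix Projectivization

variable {F : Type*} [Field F]

/-- Multiplicativity on squares suffices for an additive map: in characteristic two every element is
a square, otherwise y = ((y + 1)/2)^2 - ((y - 1)/2)^2. -/
theorem add_mul_of_square_mul [Finite F] {f : F → F} (hadd : ∀ x y, f (x + y) = f x + f y)
    (hsq : ∀ s x, f (s * s * x) * f 1 = f (s * s) * f x) (y x : F) :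
    f (y * x) * f 1 = f y * f x := by
  have hsub : ∀ x y, f (x - y) = f x - f y := fun x y => by
    have := hadd (x - y) y
    rw [sub_add_cancel] at this
    rw [this, add_sub_cancel_right]
  by_cases h2 : ringChar F = 2
  · have := Fintype.ofFinite F
    obtain ⟨s, rfl⟩ := FiniteField.isSquare_of_char_two h2 y
    exact hsq s x
  · have h2' : (2 : F) ≠ 0 := Ring.two_ne_zero h2
    have hy : y = (y + 1) / 2 * ((y + 1) / 2) - (y - 1) / 2 * ((y - 1) / 2) := by
      field_simp
      ring
    rw [hy, sub_mul, hsub, sub_mul, hsq, hsq, hsub, sub_mul]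

/-- A permutation of an affine line over a finite field which normalises the translations and the
multiplications by squares is semilinear. -/
theorem exists_ringEquiv_of_square_mul [Finite F] {f : F → F} (hinj : Function.Injective f)
    (hadd : ∀ x y, f (x + y) = f x + f y)
    (hsq : ∀ s x, f (s * s * x) * f 1 = f (s * s) * f x) :
    f 1 ≠ 0 ∧ ∃ σ : F ≃+* F, ∀ x, f x = f 1 * σ x := by
  have h0 : f 0 = 0 := by simpa using hadd 0 0
  have h1 : f 1 ≠ 0 := fun h => one_ne_zero (hinj (h.trans h0.symm))
  refine ⟨h1, RingEquiv.ofBijective (⟨⟨⟨fun x => f x / f 1, div_self h1⟩, fun y x => ?_⟩, ?_,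
    fun x y => ?_⟩ : F →+* F) (Finite.injective_iff_bijective.1 (RingHom.injective
      (R := F) _)),
    fun x => (mul_div_cancel₀ _ h1).symm⟩
  · have := add_mul_of_square_mul hadd hsq y x
    change f (y * x) / f 1 = f y / f 1 * (f x / f 1)
    field_simp
    exact this
  · change f 0 / f 1 = 0
    rw [h0, zero_div]
  · change f (x + y) / f 1 = f x / f 1 + f y / f 1
    rw [hadd, add_div]

theorem smul_eq_one_of_fixes {t : PSL 2 F} (h : t • (ptInf : ℙ F (Fin 2 → F)) = ptInf)
    (hl : ∀ x : F, t • pt x = pt x) : t = 1 := by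
  refine FaithfulSMul.eq_of_smul_eq_smul (α := ℙ F (Fin 2 → F)) fun x => ?_
  rw [one_smul]
  rcases eq_ptInf_or_pt x with rfl | ⟨a, rfl⟩
  · exact h
  · exact hl a

/-- The image of an upper unitriangular matrix in `PSL_2(F)`. -/
def upperPSL (a : F) : PSL 2 F := (upper a : SpecialLinearGroup (Fin 2) F)

/-- The image of a diagonal matrix in `PSL_2(F)`. -/
def diagPSL (s : Fˣ) : PSL 2 F := (diag s : SpecialLinearGroup (Fin 2) F)

theorem upperPSL_smul_pt (a x : F) : upperPSL a • pt x = pt (x + a) := upper_smul_pt a x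

theorem upperPSL_smul_ptInf (a : F) : upperPSL a • (ptInf : ℙ F (Fin 2 → F)) = ptInf :=
  upper_smul_ptInf a

theorem diagPSL_smul_pt (s : Fˣ) (x : F) : diagPSL s • pt x = pt (s * s * x) := diag_smul_pt s x

theorem diagPSL_smul_ptInf (s : Fˣ) : diagPSL s • (ptInf : ℙ F (Fin 2 → F)) = ptInf :=
  diag_smul_ptInf s

theorem upperPSL_smul_eq_iff {a : F} (ha : a ≠ 0) (z : ℙ F (Fin 2 → F)) :
    upperPSL a • z = z ↔ z = ptInf := by
  constructor
  · intro h
    rcases eq_ptInf_or_pt z with rfl | ⟨x, rfl⟩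
    · rfl
    · rw [upperPSL_smul_pt] at h
      exact absurd (add_eq_left.1 (pt_injective h)) ha
  · rintro rfl
    exact upperPSL_smul_ptInf a

theorem exists_psl_smul_eq {x y : ℙ F (Fin 2 → F)} (h : x ≠ y) :
    ∃ N : PSL 2 F, N • x = ptInf ∧ N • y = pt 0 := by
  obtain ⟨N, h1, h2⟩ := exists_sl_smul_eq h
  exact ⟨(N : PSL 2 F), h1, h2⟩

theorem exists_psl_smul_eq_ptInf (x : ℙ F (Fin 2 → F)) : ∃ N : PSL 2 F, N • x = ptInf := by
  by_cases h : x = pt 0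
  · obtain ⟨N, h1, -⟩ := exists_psl_smul_eq (x := x) (y := ptInf) (h ▸ pt_ne_ptInf 0)
    exact ⟨N, h1⟩
  · obtain ⟨N, h1, -⟩ := exists_psl_smul_eq h
    exact ⟨N, h1⟩

/-- An element of `PSL_2(F)` of order the characteristic with two fixed points is trivial. -/
theorem eq_one_of_pow_char {p : ℕ} [Fact p.Prime] [CharP F p] {t : PSL 2 F} (ht : t ^ p = 1)
    {y z : ℙ F (Fin 2 → F)} (hyz : y ≠ z) (hy : t • y = y) (hz : t • z = z) : t = 1 := by
  obtain ⟨N, h1, h2⟩ := exists_psl_smul_eq hyz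
  set r := N * t * N⁻¹ with hr
  have hrp : r ^ p = 1 := by rw [hr, conj_pow, ht]; simp
  have hy' : r • (ptInf : ℙ F (Fin 2 → F)) = ptInf := by
    rw [← h1, hr, mul_smul, inv_smul_smul, mul_smul, hy]
  have hz' : r • (pt 0 : ℙ F (Fin 2 → F)) = pt 0 := by
    rw [← h2, hr, mul_smul, inv_smul_smul, mul_smul, hz]
  obtain ⟨l, c, hl, h⟩ := psl_exists_affine hy'
  have hc : c = 0 := by
    have := h 0
    rw [hz'] at this
    simpa using (pt_injective this).symm
  subst hc
  have hk : ∀ k : ℕ, ∀ x : F, r ^ k • pt x = pt (l ^ k * x) := by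
    intro k
    induction k with
    | zero => intro x; simp
    | succ k ih => intro x; rw [pow_succ', mul_smul, ih, h, pow_succ', add_zero, mul_assoc]
  have hlp : l ^ p = 1 := by
    have := hk p 1
    rw [hrp, one_smul] at this
    simpa using (pt_injective this).symm
  have hl1 : l = 1 := by
    have : (l - 1) ^ p = 0 := by rw [sub_pow_char, hlp]; simp
    exact sub_eq_zero.1 (pow_eq_zero_iff (Fact.out : p.Prime).ne_zero |>.1 this)
  have : r = 1 := smul_eq_one_of_fixes hy' fun x => by rw [h, hl1]; simp
  rw [hr] at this
  simpa using this

/-- An affine map x ↦ l x + c with l ≠ 1 has the finite fixed point c / (1 - l), so an element whose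
only fixed point is ∞ is a translation. -/
theorem eq_upperPSL_of_fixes_iff {t : PSL 2 F}
    (ht : ∀ z : ℙ F (Fin 2 → F), t • z = z ↔ z = ptInf) : ∃ a, a ≠ 0 ∧ t = upperPSL a := by
  obtain ⟨l, c, -, h⟩ := psl_exists_affine ((ht _).2 rfl)
  have hl : l = 1 := by
    by_contra hne
    have h1 : 1 - l ≠ 0 := sub_ne_zero.2 (Ne.symm hne)
    refine pt_ne_ptInf (c / (1 - l)) ((ht _).1 ?_)
    rw [h]
    congr 1
    field_simp
    ring
  subst hl
  refine ⟨c, ?_, ?_⟩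
  · rintro rfl
    exact pt_ne_ptInf 0 ((ht _).1 (by rw [h]; simp))
  · refine FaithfulSMul.eq_of_smul_eq_smul (α := ℙ F (Fin 2 → F)) fun x => ?_
    rcases eq_ptInf_or_pt x with rfl | ⟨a, rfl⟩
    · rw [upperPSL_smul_ptInf]; exact (ht _).2 rfl
    · rw [h, upperPSL_smul_pt, one_mul]

/-- The translations form a p-group, which acts through α on the p^n + 1 points of the line and
hence fixes some point y. A second fixed point of a single image would make that image trivial by
`eq_one_of_pow_char`. -/
theorem exists_fixed_image_ptInf [Finite F] (α : PSL 2 F ≃* PSL 2 F) :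
    ∃ y : ℙ F (Fin 2 → F), ∀ a : F, a ≠ 0 → ∀ z : ℙ F (Fin 2 → F),
      α (upperPSL a) • z = z ↔ z = y := by
  obtain ⟨p, hp⟩ := CharP.exists F
  have hpp : Fact p.Prime := ⟨CharP.char_is_prime F p⟩
  have := Fintype.ofFinite F
  obtain ⟨n, -, hcard⟩ := FiniteField.card F p
  have hadd : ∀ a b : F, upperPSL (a + b) = upperPSL a * upperPSL b := fun a b => by
    rw [upperPSL, upper_add]; rfl
  have h0 : upperPSL (0 : F) = 1 := by simpa using hadd 0 0
  let θ : Multiplicative F →* PSL 2 F := α.toMonoidHom.comp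
    { toFun := fun a => upperPSL a.toAdd
      map_one' := h0
      map_mul' := fun a b => hadd _ _ }
  let act : MulAction (Multiplicative F) (ℙ F (Fin 2 → F)) := MulAction.compHom _ θ
  have hP : IsPGroup p (Multiplicative F) := IsPGroup.of_card (n := n) (by
    exact (Nat.card_eq_fintype_card (α := F)).trans hcard)
  have hmod := hP.card_modEq_card_fixedPoints (ℙ F (Fin 2 → F))
  rw [Projectivization.card_of_finrank_two F _ (by simp), Nat.card_eq_fintype_card, hcard] at hmod
  have hne : Nat.card (MulAction.fixedPoints (Multiplicative F) (ℙ F (Fin 2 → F))) ≠ 0 := by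
    intro h
    rw [h] at hmod
    have h1 := (Nat.modEq_zero_iff_dvd.1 hmod)
    have h2 : p ∣ p ^ (n : ℕ) := dvd_pow_self p n.ne_zero
    exact hpp.out.one_lt.ne' (Nat.dvd_one.1 ((Nat.dvd_add_right h2).1 h1))
  obtain ⟨⟨⟨y, hy⟩⟩, -⟩ := Nat.card_ne_zero.1 hne
  refine ⟨y, fun a ha z => ⟨fun hz => ?_, ?_⟩⟩
  · by_contra hzy
    have hpow : (α (upperPSL a)) ^ p = 1 := by
      have : θ (Multiplicative.ofAdd a) ^ p = 1 := by
        rw [← map_pow, ← ofAdd_nsmul, nsmul_eq_mul, CharP.cast_eq_zero, zero_mul]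
        exact map_one θ
      exact this
    have h1 := eq_one_of_pow_char hpow hzy hz (hy (Multiplicative.ofAdd a))
    have h2 : upperPSL a = 1 := α.injective (h1.trans (map_one α).symm)
    have h3 := upperPSL_smul_pt a 0
    rw [h2, one_smul, zero_add] at h3
    exact ha (pt_injective h3).symm
  · rintro rfl
    exact hy (Multiplicative.ofAdd a)

/-- Every automorphism of `PSL_2(F)` takes the elements with a single fixed point `x` to elements
with a single fixed point that depends on `x` only. -/
theorem exists_fixed_image [Finite F] (α : PSL 2 F ≃* PSL 2 F) (x : ℙ F (Fin 2 → F)) :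
    ∃ y : ℙ F (Fin 2 → F), ∀ t : PSL 2 F, (∀ z : ℙ F (Fin 2 → F), t • z = z ↔ z = x) →
      ∀ z : ℙ F (Fin 2 → F), α t • z = z ↔ z = y := by
  obtain ⟨N, hN⟩ := exists_psl_smul_eq_ptInf x
  obtain ⟨y, hy⟩ := exists_fixed_image_ptInf α
  refine ⟨(α N)⁻¹ • y, fun t ht z => ?_⟩
  obtain ⟨a, ha, hta⟩ := eq_upperPSL_of_fixes_iff (t := N * t * N⁻¹) (fun z => by
    rw [mul_smul, mul_smul, smul_eq_iff_eq_inv_smul, ht, inv_smul_eq_iff, hN])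
  have ht' : t = N⁻¹ * upperPSL a * N := by rw [← hta]; group
  rw [ht', map_mul, map_mul, map_inv, mul_smul, mul_smul, inv_smul_eq_iff, hy a ha,
    eq_inv_smul_iff]

/-- This encodes a point by a group element that fixes nothing else, so that maps between points can
be read off from automorphisms. -/
theorem exists_fixes_iff (x : ℙ F (Fin 2 → F)) :
    ∃ t : PSL 2 F, ∀ z : ℙ F (Fin 2 → F), t • z = z ↔ z = x := by
  obtain ⟨N, hN⟩ := exists_psl_smul_eq_ptInf x
  refine ⟨N⁻¹ * upperPSL 1 * N, fun z => ?_⟩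
  rw [mul_smul, mul_smul, inv_smul_eq_iff, upperPSL_smul_eq_iff one_ne_zero, ← hN,
    smul_left_cancel_iff]

/-- Every automorphism of `PSL_2(F)` is induced by a permutation of the projective line. -/
theorem exists_perm_of_mulEquiv [Finite F] (α : PSL 2 F ≃* PSL 2 F) :
    ∃ π : Equiv.Perm (ℙ F (Fin 2 → F)), ∀ (t : PSL 2 F) x, π (t • x) = α t • π x := by
  choose π hπ using exists_fixed_image α
  choose ρ hρ using exists_fixed_image α.symm
  -- The maps attached to α and to its inverse are mutually inverse, as both are determined by the
  -- fixed points of corresponding elements.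
  have h1 : ∀ x, ρ (π x) = x := fun x => by
    obtain ⟨t, ht⟩ := exists_fixes_iff x
    have := (hρ (π x) (α t) (hπ x t ht) x)
    rw [α.symm_apply_apply, ht] at this
    exact (this.1 rfl).symm
  have h2 : ∀ x, π (ρ x) = x := fun x => by
    obtain ⟨t, ht⟩ := exists_fixes_iff x
    have := (hπ (ρ x) (α.symm t) (hρ x t ht) x)
    rw [α.apply_symm_apply, ht] at this
    exact (this.1 rfl).symm
  refine ⟨⟨π, ρ, h1, h2⟩, fun t x => ?_⟩
  obtain ⟨r, hr⟩ := exists_fixes_iff x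
  have h3 := hπ (t • x) (t * r * t⁻¹) (fun z => by
    rw [mul_smul, mul_smul, smul_eq_iff_eq_inv_smul, hr, inv_smul_eq_iff]) (α t • π x)
  rw [map_mul, map_mul, map_inv, mul_smul, mul_smul, inv_smul_smul, smul_left_cancel_iff] at h3
  exact (h3.1 ((hπ x r hr _).2 rfl)).symm

/-- The image of x is the only fixed point of the image of an element t whose only fixed point is x,
so the intertwining permutation is unique. This makes g ↦ `P g` multiplicative in
`exists_semilinear_hom`. -/
theorem perm_eq_of_intertwines {α : PSL 2 F → PSL 2 F}
    {π ρ : Equiv.Perm (ℙ F (Fin 2 → F))} (hπ : ∀ (t : PSL 2 F) x, π (t • x) = α t • π x)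
    (hρ : ∀ (t : PSL 2 F) x, ρ (t • x) = α t • ρ x) : π = ρ := by
  refine Equiv.ext fun x => ?_
  obtain ⟨t, ht⟩ := exists_fixes_iff x
  obtain ⟨w, hw⟩ := ρ.surjective (π x)
  have h : w = x := (ht _).1 (ρ.injective (by rw [hρ, hw, ← hπ, (ht x).2 rfl]))
  rw [← hw, h]

/-- The permutations that are induced by a linear map of the plane followed, before it, by a field
automorphism. -/
def semilinearPerm (M : GL (Fin 2) F) (σ : F ≃+* F) : Equiv.Perm (ℙ F (Fin 2 → F)) :=
  MulAction.toPerm M * galPerm σ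

/-- Translations are the elements whose only fixed point is ∞, so π carries them to translations:
this is additivity. Diagonal elements go to affine maps that fix 0, which gives multiplicativity on
squares; `exists_ringEquiv_of_square_mul` does the rest. -/
theorem exists_semilinearPerm_of_fixes [Finite F] {α : PSL 2 F → PSL 2 F}
    {π : Equiv.Perm (ℙ F (Fin 2 → F))} (hπ : ∀ (t : PSL 2 F) x, π (t • x) = α t • π x)
    (hinf : π ptInf = ptInf) (hzero : π (pt 0) = pt 0) :
    ∃ (c : F) (σ : F ≃+* F), c ≠ 0 ∧ ∀ x, π (pt x) = pt (c * σ x) := by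
  have hex : ∀ x : F, ∃ y, π (pt x) = pt y := fun x => by
    rcases eq_ptInf_or_pt (π (pt x)) with h | h
    · exact absurd (π.injective (h.trans hinf.symm)) (pt_ne_ptInf x)
    · exact h
  choose f hf using hex
  have hf0 : f 0 = 0 := pt_injective ((hf 0).symm.trans hzero)
  have hinj : Function.Injective f := fun x y h => by
    refine pt_injective (π.injective ?_)
    rw [hf, hf, h]
  have hadd : ∀ x y, f (x + y) = f x + f y := by
    intro x y
    by_cases hy : y = 0
    · simp [hy, hf0]
    obtain ⟨a, -, ha⟩ := eq_upperPSL_of_fixes_iff (t := α (upperPSL y)) (fun z => by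
      obtain ⟨w, rfl⟩ := π.surjective z
      rw [← hπ, π.injective.eq_iff, upperPSL_smul_eq_iff hy, ← π.injective.eq_iff, hinf])
    have h : ∀ x, f (x + y) = f x + a := fun x => by
      have := hπ (upperPSL y) (pt x)
      rw [upperPSL_smul_pt, ha, hf, hf, upperPSL_smul_pt] at this
      exact pt_injective this
    have h0 := h 0
    rw [hf0, zero_add, zero_add] at h0
    rw [h, h0]
  have hsq : ∀ s x, f (s * s * x) * f 1 = f (s * s) * f x := by
    intro s x
    by_cases hs : s = 0
    · simp [hs, hf0]
    obtain ⟨l, c, -, h⟩ := psl_exists_affine (t := α (diagPSL (Units.mk0 s hs))) (by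
      conv_lhs => rw [← hinf]
      rw [← hπ, diagPSL_smul_ptInf, hinf])
    have h' : ∀ x, f (s * s * x) = l * f x + c := fun x => by
      have := hπ (diagPSL (Units.mk0 s hs)) (pt x)
      rw [diagPSL_smul_pt, hf, hf, h] at this
      exact pt_injective this
    have hc : c = 0 := by simpa [hf0] using (h' 0).symm
    have h1 := h' 1
    rw [mul_one] at h1
    rw [h1, h', hc]
    ring
  obtain ⟨h1, σ, hσ⟩ := exists_ringEquiv_of_square_mul hinj hadd hsq
  exact ⟨f 1, σ, h1, fun x => by rw [hf, hσ]⟩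

/-- The matrix `diag(c, 1)`. -/
def dilation (c : Fˣ) : GL (Fin 2) F :=
  GeneralLinearGroup.mkOfDetNeZero !![(c : F), 0; 0, 1] (by simp)

theorem dilation_smul_vec (c : Fˣ) (x y : F) : dilation c • ![x, y] = ![c * x, y] := by
  change !![(c : F), 0; 0, 1] *ᵥ ![x, y] = _
  ext i
  fin_cases i <;> simp [mulVec, dotProduct, Fin.sum_univ_two]

theorem dilation_smul_pt (c : Fˣ) (x : F) : dilation c • pt x = pt (c * x) := by
  rw [pt, pt, smul_mk]
  congr 1
  exact dilation_smul_vec c x 1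

theorem dilation_smul_ptInf (c : Fˣ) :
    dilation c • (ptInf : ℙ F (Fin 2 → F)) = ptInf := by
  rw [ptInf, smul_mk, mk_eq_mk_iff']
  refine ⟨c, ?_⟩
  rw [dilation_smul_vec]
  simp

/-- The permutations of the projective line that normalise `PSL_2(F)` are semilinear. -/
theorem exists_eq_semilinearPerm [Finite F] {α : PSL 2 F → PSL 2 F}
    {π : Equiv.Perm (ℙ F (Fin 2 → F))} (hπ : ∀ (t : PSL 2 F) x, π (t • x) = α t • π x) :
    ∃ (M : GL (Fin 2) F) (σ : F ≃+* F), π = semilinearPerm M σ := by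
  obtain ⟨N, h1, h2⟩ := exists_sl_smul_eq (x := π ptInf) (y := π (pt 0))
    (π.injective.ne (pt_ne_ptInf 0).symm)
  let ρ : Equiv.Perm (ℙ F (Fin 2 → F)) := MulAction.toPerm N * π
  have hρ : ∀ x, ρ x = N • π x := fun _ => rfl
  obtain ⟨c, σ, hc, h⟩ := exists_semilinearPerm_of_fixes (π := ρ)
    (α := fun t => (N : PSL 2 F) * α t * (N : PSL 2 F)⁻¹) (fun t x => by
      rw [hρ, hρ, hπ, ← Matrix.ProjectiveSpecialLinearGroup.smul_proj_mk,
        ← Matrix.ProjectiveSpecialLinearGroup.smul_proj_mk, mul_smul, mul_smul, inv_smul_smul]) h1 h2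
  refine ⟨(N⁻¹ : SpecialLinearGroup (Fin 2) F) * dilation (Units.mk0 c hc), σ,
    Equiv.ext fun x => ?_⟩
  have key : ρ x = dilation (Units.mk0 c hc) • galPerm σ x := by
    rcases eq_ptInf_or_pt x with rfl | ⟨a, rfl⟩
    · rw [galPerm_ptInf, dilation_smul_ptInf]; exact h1
    · rw [galPerm_pt, dilation_smul_pt, h]; rfl
  change _ = ((N⁻¹ : SpecialLinearGroup (Fin 2) F) * _ : GL (Fin 2) F) • galPerm σ x
  rw [mul_smul, ← key, hρ]
  exact (inv_smul_smul N (π x)).symm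

end PSLAut

end SaxlHypergraph

namespace SaxlHypergraph

/-! ### The group PΓL_2 and its field automorphisms. -/

section SemilinearGroup

open Matrix Projectivization

variable {F : Type*} [Field F]

/-- The action of the field automorphisms on the projective line. -/
def galHom : (F ≃+* F) →* Equiv.Perm (ℙ F (Fin 2 → F)) where
  toFun := galPerm
  map_one' := by
    refine Equiv.ext fun x => ?_
    rcases eq_ptInf_or_pt x with rfl | ⟨a, rfl⟩
    · exact galPerm_ptInf _
    · exact galPerm_pt _ _
  map_mul' σ τ := by
    refine Equiv.ext fun x => ?_
    rcases eq_ptInf_or_pt x with rfl | ⟨a, rfl⟩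
    · simp [galPerm_ptInf]
    · simp [galPerm_pt]

theorem galHom_apply (σ : F ≃+* F) : galHom σ = galPerm σ := rfl

theorem galHom_injective : Function.Injective (galHom : (F ≃+* F) →* _) := by
  intro σ τ h
  refine RingEquiv.ext fun x => pt_injective ?_
  rw [← galPerm_pt, ← galPerm_pt, ← galHom_apply, h, galHom_apply]

/-- If l x + c = σ x for all x, then the values at 0 and 1 give c = 0 and l = 1. The factorisation
into a linear part and a field automorphism is therefore unique. -/
theorem eq_one_of_smul_eq_galPerm {t : PSL 2 F} {σ : F ≃+* F}
    (h : ∀ x, t • x = galPerm σ x) : t = 1 ∧ σ = 1 := by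
  have hinf := h ptInf
  rw [galPerm_ptInf] at hinf
  obtain ⟨l, c, -, hlc⟩ := psl_exists_affine hinf
  have h0 : ∀ x, l * x + c = σ x := fun x => pt_injective (by rw [← hlc, h, galPerm_pt])
  have hc : c = 0 := by simpa using h0 0
  have hl : l = 1 := by simpa [hc] using h0 1
  have hσ : ∀ x, σ x = x := fun x => by rw [← h0, hc, hl]; ring
  exact ⟨smul_eq_one_of_fixes hinf fun x => by rw [hlc, h0, hσ], RingEquiv.ext hσ⟩

theorem galPerm_sl_smul (σ : F ≃+* F) (M : SpecialLinearGroup (Fin 2) F)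
    (x : ℙ F (Fin 2 → F)) :
    galPerm σ (M • x) = SpecialLinearGroup.map (σ : F →+* F) M • galPerm σ x := by
  induction x using Projectivization.ind with | _ v hv =>
  rw [smul_mk, galPerm_mk, galPerm_mk, smul_mk]
  congr 1
  ext i
  fin_cases i <;> simp [sl_smul_zero, sl_smul_one]

theorem semilinearPerm_mem (M : GL (Fin 2) F) (σ : F ≃+* F) :
    semilinearPerm M σ ∈ PGammaL 2 F := by
  refine ⟨σ, AddEquiv.mk' ((Equiv.piCongrRight fun _ => σ.toEquiv).trans (MulAction.toPerm M))
    fun v w => ?_, fun c v => ?_, fun v hv => rfl⟩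
  · change M.1 *ᵥ (fun i => σ ((v + w) i)) = M.1 *ᵥ (fun i => σ (v i)) + M.1 *ᵥ (fun i => σ (w i))
    rw [← mulVec_add]
    congr 1
    ext i
    simp
  · change M.1 *ᵥ (fun i => σ ((c • v) i)) = σ c • M.1 *ᵥ (fun i => σ (v i))
    rw [← mulVec_smul]
    congr 1
    ext i
    simp

/-- The matrix has the images of the standard basis vectors as its columns. -/
theorem exists_eq_semilinearPerm_of_mem {π : Equiv.Perm (ℙ F (Fin 2 → F))}
    (h : π ∈ PGammaL 2 F) : ∃ (M : GL (Fin 2) F) (σ : F ≃+* F), π = semilinearPerm M σ := by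
  obtain ⟨σ, f, hf, hπ⟩ := h
  let A : Matrix (Fin 2) (Fin 2) F := Matrix.of fun i j => f (Pi.single j 1) i
  have hA : ∀ v, A *ᵥ (fun i => σ (v i)) = f v := by
    intro v
    have hv : v = v 0 • Pi.single 0 1 + v 1 • Pi.single 1 1 := by
      ext i
      fin_cases i <;> simp
    conv_rhs => rw [hv]
    rw [map_add, hf, hf]
    ext i
    simp [A, mulVec, dotProduct, Fin.sum_univ_two, mul_comm]
  have hu : IsUnit A := by
    rw [← mulVec_injective_iff_isUnit]
    intro v w hvw
    have h1 := hA (fun i => σ.symm (v i))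
    have h2 := hA (fun i => σ.symm (w i))
    simp only [RingEquiv.apply_symm_apply] at h1 h2
    have h3 := f.injective (h1.symm.trans (hvw.trans h2))
    exact funext fun i => σ.symm.injective (congrFun h3 i)
  refine ⟨hu.unit, σ, Equiv.ext fun x => ?_⟩
  induction x using Projectivization.ind with | _ v hv =>
  rw [hπ v hv]
  change _ = hu.unit • galPerm σ (mk F v hv)
  rw [galPerm_mk, smul_mk]
  congr 1
  exact (hA v).symm

/-- In characteristic two the determinant is a square s^2, and division by s does not change the
action on the line. -/
theorem exists_sl_smul_eq_gl_smul [Finite F] [CharP F 2] (M : GL (Fin 2) F) :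
    ∃ N : SpecialLinearGroup (Fin 2) F, ∀ x : ℙ F (Fin 2 → F), M • x = N • x := by
  have := Fintype.ofFinite F
  obtain ⟨s, hs⟩ := FiniteField.isSquare_of_char_two (ringChar.eq F 2) M.1.det
  have hdet : M.1.det ≠ 0 := by
    have := M.isUnit
    rw [Matrix.isUnit_iff_isUnit_det] at this
    exact this.ne_zero
  have hs0 : s ≠ 0 := by
    rintro rfl
    exact hdet (by rw [hs, mul_zero])
  have h1 : (s⁻¹ • M.1).det = 1 := by
    rw [det_smul, hs, Fintype.card_fin]; field_simp
  refine ⟨⟨s⁻¹ • M.1, h1⟩, fun x => ?_⟩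
  induction x using Projectivization.ind with | _ v hv =>
  refine (mk_eq_mk_iff' F _ _ _ _).2 ⟨s, ?_⟩
  change s • ((s⁻¹ • M.1) *ᵥ v) = M.1 *ᵥ v
  rw [smul_mulVec, smul_smul, mul_inv_cancel₀ hs0, one_smul]

end SemilinearGroup

/-! ### The action on the projective line of a group with socle `PSL 2 F`. -/

section Embedding

open Matrix Projectivization

variable {Ω : Type*} {G : Subgroup (Equiv.Perm Ω)} {T : Subgroup G} {F : Type*} [Field F]

/-- An almost simple group with socle `PSL_2(F)` acts faithfully on the projective line by
semilinear maps. -/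
theorem exists_semilinear_hom [Finite F] (hT : IsAlmostSimpleWithSocle T) (φ : T ≃* PSL 2 F) :
    ∃ Ψ : G →* Equiv.Perm (ℙ F (Fin 2 → F)), Function.Injective Ψ ∧
      (∀ (t : T) x, Ψ t x = φ t • x) ∧
      ∀ g : G, ∃ (M : GL (Fin 2) F) (σ : F ≃+* F), Ψ g = semilinearPerm M σ := by
  have := hT.normal
  let α : G → (PSL 2 F ≃* PSL 2 F) := fun g => (φ.symm.trans (MulAut.conjNormal g)).trans φ
  have hα : ∀ g h t, α (g * h) t = α g (α h t) := fun g h t => by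
    simp [α, map_mul]
  choose P hP using fun g => exists_perm_of_mulEquiv (α g)
  let Ψ : G →* Equiv.Perm (ℙ F (Fin 2 → F)) := MonoidHom.mk' P fun g h => by
    refine perm_eq_of_intertwines (α := α (g * h)) (hP _) fun t x => ?_
    rw [Equiv.Perm.mul_apply, Equiv.Perm.mul_apply, hP, hP, hα]
  refine ⟨Ψ, ?_, fun t x => ?_, fun g => exists_eq_semilinearPerm (hP g)⟩
  · rw [injective_iff_map_eq_one]
    intro g hg
    -- The kernel acts trivially on T by conjugation, and T has trivial centraliser.
    have hc : g ∈ Subgroup.centralizer (T : Set G) := by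
      rw [Subgroup.mem_centralizer_iff]
      intro t ht
      have h1 : φ ⟨t, ht⟩ = α g (φ ⟨t, ht⟩) := by
        refine FaithfulSMul.eq_of_smul_eq_smul (α := ℙ F (Fin 2 → F)) fun x => ?_
        have h2 := hP g (φ ⟨t, ht⟩) x
        have h3 : P g = 1 := hg
        simpa [h3] using h2
      have h2 : (⟨t, ht⟩ : T) = MulAut.conjNormal g ⟨t, ht⟩ := φ.injective (by simpa [α] using h1)
      have h3 : t = g * t * g⁻¹ := by simpa using congrArg Subtype.val h2
      nth_rewrite 1 [h3]
      group
    rw [hT.centralizer_eq_bot] at hc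
    exact hc
  · have : P t = MulAction.toPerm (φ t) := by
      refine perm_eq_of_intertwines (α := α t) (hP _) fun r x => ?_
      obtain ⟨s, rfl⟩ := φ.surjective r
      have : α t (φ s) = φ t * φ s * (φ t)⁻¹ := by
        rw [← map_inv, ← map_mul, ← map_mul]
        refine congrArg φ (Subtype.ext ?_)
        simp
      rw [MulAction.toPerm_apply, MulAction.toPerm_apply, this, mul_smul, mul_smul, inv_smul_smul]
    have h := Equiv.congr_fun this x
    exact h

end Embedding

end SaxlHypergraph

/-! ### Quadratic forms in characteristic two. -/

namespace SaxlHypergraph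

open Matrix Projectivization

/-- The binary quadratic form `c X ^ 2 + X Y + n Y ^ 2`. In characteristic two these are the forms
that polarise to the determinant. -/
@[ext]
structure PolarForm (F : Type*) where
  /-- The coefficient of `X ^ 2`. -/
  c : F
  /-- The coefficient of `Y ^ 2`. -/
  n : F

/-- The matrix with rows `(p, q)` and `(r, t)`. -/
def mkSL {F : Type*} [Field F] (p q r t : F) (h : p * t - q * r = 1) :
    SpecialLinearGroup (Fin 2) F := ⟨!![p, q; r, t], by rw [det_fin_two_of, h]⟩

section mkSL

variable {F : Type*} [Field F] {p q r t : F} (h : p * t - q * r = 1)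

@[simp] theorem mkSL_zero_zero : mkSL p q r t h 0 0 = p := rfl
@[simp] theorem mkSL_zero_one : mkSL p q r t h 0 1 = q := rfl
@[simp] theorem mkSL_one_zero : mkSL p q r t h 1 0 = r := rfl
@[simp] theorem mkSL_one_one : mkSL p q r t h 1 1 = t := rfl

theorem sl_mul_apply (M N : SpecialLinearGroup (Fin 2) F) (i j : Fin 2) :
    (M * N) i j = M i 0 * N 0 j + M i 1 * N 1 j := by
  change (M.1 * N.1) i j = _
  rw [mul_apply, Fin.sum_univ_two]

end mkSL

namespace PolarForm

variable {F : Type*} [Field F]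

/-- The image of a form under a field automorphism. -/
def map (σ : F ≃+* F) (Q : PolarForm F) : PolarForm F := ⟨σ Q.c, σ Q.n⟩

theorem map_injective (σ : F ≃+* F) : Function.Injective (map σ) := fun Q R h =>
  PolarForm.ext (σ.injective (congrArg PolarForm.c h)) (σ.injective (congrArg PolarForm.n h))

/-- The value of a form at a vector. -/
def eval (Q : PolarForm F) (x y : F) : F := Q.c * x * x + x * y + Q.n * y * y

variable [CharP F 2]

theorem det_eq (M : SpecialLinearGroup (Fin 2) F) : M 0 0 * M 1 1 + M 0 1 * M 1 0 = 1 := by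
  have h := M.det_coe
  rw [det_fin_two] at h
  linear_combination h + M 0 1 * M 1 0 * CharTwo.two_eq_zero (R := F)

/-- The substitution of the inverse of a matrix of determinant one. -/
def act (M : SpecialLinearGroup (Fin 2) F) (Q : PolarForm F) : PolarForm F :=
  ⟨Q.c * M 1 1 ^ 2 + M 1 1 * M 1 0 + Q.n * M 1 0 ^ 2,
    Q.c * M 0 1 ^ 2 + M 0 1 * M 0 0 + Q.n * M 0 0 ^ 2⟩

/-- The special linear group acts on forms by the substitution of the inverse matrix. -/
instance : MulAction (SpecialLinearGroup (Fin 2) F) (PolarForm F) where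
  smul := act
  one_smul Q := by
    change act 1 Q = Q
    ext <;> simp [act]
  mul_smul M N Q := by
    have h2 : (2 : F) = 0 := CharTwo.two_eq_zero
    have hN := det_eq N
    change act (M * N) Q = act M (act N Q)
    ext
    · simp only [act, sl_mul_apply]
      linear_combination M 1 1 * M 1 0 * hN + (Q.c * M 1 0 * N 0 1 * M 1 1 * N 1 1 +
        Q.n * M 1 0 * N 0 0 * M 1 1 * N 1 0) * h2
    · simp only [act, sl_mul_apply]
      linear_combination M 0 1 * M 0 0 * hN + (Q.c * M 0 0 * N 0 1 * M 0 1 * N 1 1 +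
        Q.n * M 0 0 * N 0 0 * M 0 1 * N 1 0) * h2

theorem smul_c (M : SpecialLinearGroup (Fin 2) F) (Q : PolarForm F) :
    (M • Q).c = Q.c * M 1 1 ^ 2 + M 1 1 * M 1 0 + Q.n * M 1 0 ^ 2 := rfl

theorem smul_n (M : SpecialLinearGroup (Fin 2) F) (Q : PolarForm F) :
    (M • Q).n = Q.c * M 0 1 ^ 2 + M 0 1 * M 0 0 + Q.n * M 0 0 ^ 2 := rfl

theorem map_smul (σ : F ≃+* F) (M : SpecialLinearGroup (Fin 2) F) (Q : PolarForm F) :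
    map σ (M • Q) = SpecialLinearGroup.map (σ : F →+* F) M • map σ Q := by
  ext <;> simp [map, smul_c, smul_n]

/-- A form is determined by its stabiliser. -/
theorem eq_of_stabilizer_eq {Q R : PolarForm F}
    (h : ∀ M : SpecialLinearGroup (Fin 2) F, M • Q = Q ↔ M • R = R) : Q = R := by
  have h2 : (2 : F) = 0 := CharTwo.two_eq_zero
  have key : ∀ Q R : PolarForm F, (∀ M : SpecialLinearGroup (Fin 2) F, M • Q = Q → M • R = R) →
      ∀ x y, Q.eval x y ≠ 0 → (x ≠ 0 ∨ y ≠ 0) → R.eval x y = Q.eval x y := by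
    intro Q R h x y hQ hxy
    set l := (Q.eval x y)⁻¹ with hl
    have hlQ : l * (Q.c * x * x + x * y + Q.n * y * y) = 1 := inv_mul_cancel₀ hQ
    have hl0 : l ≠ 0 := inv_ne_zero hQ
    have hdet : (1 + l * x * y) * (1 + l * x * y) - l * x * x * (l * y * y) = 1 := by
      linear_combination l * x * y * h2
    have hM := h (mkSL _ _ _ _ hdet) (by
      ext
      · simp only [smul_c, mkSL_zero_zero, mkSL_zero_one, mkSL_one_zero, mkSL_one_one]
        linear_combination l * y * y * hlQ + (Q.c * l * x * y + l * y * y) * h2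
      · simp only [smul_n, mkSL_zero_zero, mkSL_zero_one, mkSL_one_zero, mkSL_one_one]
        linear_combination l * x * x * hlQ + (Q.n * l * x * y + l * x * x) * h2)
    have hc := congrArg PolarForm.c hM
    have hn := congrArg PolarForm.n hM
    simp only [smul_c, smul_n, mkSL_zero_zero, mkSL_zero_one, mkSL_one_zero,
      mkSL_one_one] at hc hn
    have hc' : y * y * l * (l * R.eval x y - 1) = 0 := by
      rw [eval]
      linear_combination hc - (R.c * l * x * y + l * y * y) * h2
    have hn' : x * x * l * (l * R.eval x y - 1) = 0 := by
      rw [eval]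
      linear_combination hn - (R.n * l * x * y + l * x * x) * h2
    have : l * R.eval x y - 1 = 0 := by
      rcases hxy with hx | hy
      · exact (mul_eq_zero.1 hn').resolve_left (by simp [hx, hl0])
      · exact (mul_eq_zero.1 hc').resolve_left (by simp [hy, hl0])
    rw [sub_eq_zero, hl, inv_mul_eq_one₀ hQ] at this
    exact this.symm
  -- By symmetry the two forms agree wherever one of them is non-zero, hence everywhere.
  have key2 : ∀ x y, (x ≠ 0 ∨ y ≠ 0) → Q.eval x y = R.eval x y := by
    intro x y hxy
    by_cases hQ : Q.eval x y = 0
    · by_contra hne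
      exact hne (key R Q (fun M => (h M).2) x y (fun hR => hne (hQ.trans hR.symm)) hxy)
    · exact (key Q R (fun M => (h M).1) x y hQ hxy).symm
  have h10 := key2 1 0 (by simp)
  have h01 := key2 0 1 (by simp)
  simp only [eval] at h10 h01
  ext
  · linear_combination h10
  · linear_combination h01

/-- The Arf invariant. -/
theorem arf_smul (M : SpecialLinearGroup (Fin 2) F) (Q : PolarForm F) :
    ∃ z, (M • Q).c * (M • Q).n + Q.c * Q.n = z * z + z := by
  have h2 : (2 : F) = 0 := CharTwo.two_eq_zero
  have hd := det_eq M
  refine ⟨Q.c * M 1 1 * M 0 1 + Q.n * M 1 0 * M 0 0 + M 0 1 * M 1 0, ?_⟩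
  rw [smul_c, smul_n]
  generalize M 0 0 = p at *
  generalize M 0 1 = q at *
  generalize M 1 0 = r at *
  generalize M 1 1 = t at *
  generalize Q.c = c at *
  generalize Q.n = n at *
  linear_combination (c * t * q + n * r * p + q * r + c * n * (p * t + q * r + 1)) * hd +
    (c * n - c * n * t * p * q * r - q ^ 2 * r ^ 2 -
      (c * n * t * q * r * p + c * t * q ^ 2 * r + n * r ^ 2 * p * q)) * h2

/-- If c = s^2 ≠ 0, scaling by s makes the first coefficient 1, and a shear built from the
Artin-Schreier root w then adjusts the second to δ. -/
theorem exists_smul_eq_of_arf [Finite F] {Q : PolarForm F} {δ w : F}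
    (h : Q.c * Q.n + δ = w * w + w) :
    ∃ M : SpecialLinearGroup (Fin 2) F, M • Q = ⟨1, δ⟩ := by
  have h2 : (2 : F) = 0 := CharTwo.two_eq_zero
  have := Fintype.ofFinite F
  have key : ∀ Q : PolarForm F, Q.c ≠ 0 → Q.c * Q.n + δ = w * w + w →
      ∃ M : SpecialLinearGroup (Fin 2) F, M • Q = ⟨1, δ⟩ := by
    intro Q hc h
    obtain ⟨s, hs⟩ := FiniteField.isSquare_of_char_two (ringChar.eq F 2) Q.c
    have hs0 : s ≠ 0 := by
      rintro rfl
      exact hc (by rw [hs, mul_zero])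
    have hdet : s * s⁻¹ - w * s⁻¹ * 0 = 1 := by
      rw [mul_inv_cancel₀ hs0]; ring
    refine ⟨mkSL _ _ _ _ hdet, ?_⟩
    ext
    · simp only [smul_c, mkSL_zero_zero, mkSL_zero_one, mkSL_one_zero, mkSL_one_one, hs]
      field_simp
      ring
    · simp only [smul_n, mkSL_zero_zero, mkSL_zero_one, mkSL_one_zero, mkSL_one_one]
      have : δ = Q.c * w ^ 2 * s⁻¹ ^ 2 + w + Q.n * s ^ 2 := by
        rw [hs] at h ⊢
        field_simp
        linear_combination h - s * s * Q.n * h2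
      rw [this]
      field_simp
  -- A form with c = 0 is moved to one with c ≠ 0 by a matrix that preserves the product cn, so the
  -- same w still serves: a shear for XY, otherwise the exchange of the variables.
  by_cases hc : Q.c = 0
  · by_cases hn : Q.n = 0
    · have hdet : (1 : F) * 1 - 0 * 1 = 1 := by ring
      obtain ⟨M, hM⟩ := key (mkSL _ _ _ _ hdet • Q)
        (by simp [smul_c, hc, hn]) (by
          simp only [smul_c, smul_n, mkSL_zero_zero, mkSL_zero_one, mkSL_one_zero,
            mkSL_one_one]
          rw [← h, hc, hn]; ring)
      exact ⟨M * _, by rw [mul_smul, hM]⟩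
    · have hdet : (0 : F) * 0 - 1 * 1 = 1 := by linear_combination -h2
      obtain ⟨M, hM⟩ := key (mkSL _ _ _ _ hdet • Q)
        (by simp [smul_c, hc, hn]) (by
          simp only [smul_c, smul_n, mkSL_zero_zero, mkSL_zero_one, mkSL_one_zero,
            mkSL_one_one]
          rw [← h, hc]; ring)
      exact ⟨M * _, by rw [mul_smul, hM]⟩
  · exact key Q hc h

end PolarForm

end SaxlHypergraph

namespace SaxlHypergraph

/-! ### The points of Ω as quadratic forms. -/

section FormModel

open Matrix Projectivization PolarForm

variable {Ω : Type*} {G : Subgroup (Equiv.Perm Ω)} {T : Subgroup G} {F : Type*} [Field F]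

/-- A model of the permutation group `G`: the points are forms, and the group consists of the maps
`Q ↦ M • Q ^ σ`, where `M` has determinant one and `σ` lies in a group of field automorphisms. -/
structure IsFormModel [CharP F 2] (G : Subgroup (Equiv.Perm Ω)) (e : Ω → PolarForm F)
    (Γ : Subgroup (F ≃+* F)) : Prop where
  injective : Function.Injective e
  exists_of_mem : ∀ g ∈ G, ∃ (M : SpecialLinearGroup (Fin 2) F) (σ : F ≃+* F), σ ∈ Γ ∧
    ∀ ω, e (g ω) = M • map σ (e ω)
  exists_mem : ∀ (M : SpecialLinearGroup (Fin 2) F), ∀ σ ∈ Γ, ∃ g ∈ G,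
    ∀ ω, e (g ω) = M • map σ (e ω)

theorem exists_sl_galPerm [Finite F] [CharP F 2] (M : GL (Fin 2) F) (σ : F ≃+* F) :
    ∃ N : SpecialLinearGroup (Fin 2) F, ∀ x, semilinearPerm M σ x = N • galPerm σ x := by
  obtain ⟨N, hN⟩ := exists_sl_smul_eq_gl_smul M
  exact ⟨N, fun x => hN _⟩

theorem psl_mk_eq_iff {M N : SpecialLinearGroup (Fin 2) F} :
    ((M : PSL 2 F) = (N : PSL 2 F)) ↔ ∀ x : ℙ F (Fin 2 → F), M • x = N • x := by
  refine ⟨fun h x => ?_, fun h => ?_⟩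
  · rw [← Matrix.ProjectiveSpecialLinearGroup.smul_proj_mk, h,
      Matrix.ProjectiveSpecialLinearGroup.smul_proj_mk]
  · exact FaithfulSMul.eq_of_smul_eq_smul (α := ℙ F (Fin 2 → F)) h

/-- Each point corresponds to the form with the same stabiliser in SL_2. Since a form is determined
by its stabiliser, this correspondence is canonical and thus compatible with all of G, not only with
T. In characteristic two every semilinear permutation is an element of SL_2 after a field
automorphism, so G is T extended by the group Γ of field automorphisms that it contains. -/
theorem exists_isFormModel [Finite Ω] [Finite F] [CharP F 2] (hT : IsAlmostSimpleWithSocle T)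
    (htr : MulAction.IsPretransitive T Ω) (φ : T ≃* PSL 2 F) (ω₀ : Ω) (Q₀ : PolarForm F)
    (hQ₀ : ∀ M : SpecialLinearGroup (Fin 2) F, φ.symm (M : PSL 2 F) • ω₀ = ω₀ ↔ M • Q₀ = Q₀) :
    ∃ (e : Ω → PolarForm F) (Γ : Subgroup (F ≃+* F)), IsFormModel G e Γ ∧
      (∀ Q, (∃ ω, e ω = Q) ↔ ∃ M : SpecialLinearGroup (Fin 2) F, M • Q₀ = Q) ∧
      Nat.card Γ = T.index ∧ (Nonempty (G ≃* PGammaL 2 F) ↔ Γ = ⊤) := by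
  obtain ⟨Ψ, hinj, hΨT, hΨ⟩ := exists_semilinear_hom hT φ
  have hΨM : ∀ (M : SpecialLinearGroup (Fin 2) F) x,
      Ψ (φ.symm (M : PSL 2 F) : T) x = M • x := fun M x => by
    rw [hΨT, φ.apply_symm_apply]; rfl
  have hΨ' : ∀ g, ∃ (N : SpecialLinearGroup (Fin 2) F) (σ : F ≃+* F),
      ∀ x, Ψ g x = N • galPerm σ x := fun g => by
    obtain ⟨M, σ, h⟩ := hΨ g
    obtain ⟨N, hN⟩ := exists_sl_galPerm M σ
    exact ⟨N, σ, fun x => by rw [h, hN]⟩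
  -- The relation of having the same stabiliser in SL_2.
  let R : Ω → PolarForm F → Prop := fun ω Q =>
    ∀ M : SpecialLinearGroup (Fin 2) F, φ.symm (M : PSL 2 F) • ω = ω ↔ M • Q = Q
  have hRg : ∀ (g : G) (N : SpecialLinearGroup (Fin 2) F) (σ : F ≃+* F),
      (∀ x, Ψ g x = N • galPerm σ x) → ∀ ω Q, R ω Q → R (g • ω) (N • map σ Q) := by
    intro g N σ hg ω Q hR M
    have hg' : ∀ x, galPerm σ (Ψ g⁻¹ x) = N⁻¹ • x := fun x => by
      rw [eq_inv_smul_iff, ← hg, ← Equiv.Perm.mul_apply, ← map_mul, mul_inv_cancel, map_one,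
        Equiv.Perm.one_apply]
    have hτ : ∀ x, SpecialLinearGroup.map (σ : F →+* F)
        (SpecialLinearGroup.map (σ.symm : F →+* F) x) = (x : SpecialLinearGroup (Fin 2) F) :=
      fun x => by ext i j; simp
    -- M' represents the conjugate of M under g, so that stabilisers on both sides are conjugated
    -- compatibly.
    set M' := SpecialLinearGroup.map (σ.symm : F →+* F) (N⁻¹ * M * N) with hM'
    have h1 : ((φ.symm (M' : PSL 2 F) : T) : G) = g⁻¹ * (φ.symm (M : PSL 2 F) : T) * g := by
      refine hinj (Equiv.ext fun x => (galPerm σ).injective ?_)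
      rw [hΨM, galPerm_sl_smul, hM', hτ, map_mul, map_mul, Equiv.Perm.mul_apply,
        Equiv.Perm.mul_apply, hg', hΨM, hg, mul_smul, mul_smul]
    have h2 : φ.symm (M : PSL 2 F) • g • ω = g • ω ↔ φ.symm (M' : PSL 2 F) • ω = ω := by
      change ((φ.symm (M : PSL 2 F) : T) : G) • g • ω = g • ω ↔
        ((φ.symm (M' : PSL 2 F) : T) : G) • ω = ω
      rw [h1, mul_smul, mul_smul, inv_smul_eq_iff]
    rw [h2, hR M', ← (map_injective σ).eq_iff, PolarForm.map_smul, hM', hτ, mul_smul, mul_smul,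
      inv_smul_eq_iff]
  have hRt : ∀ (N : SpecialLinearGroup (Fin 2) F) ω Q, R ω Q →
      R (φ.symm (N : PSL 2 F) • ω) (N • Q) := by
    intro N ω Q hR
    have := hRg (φ.symm (N : PSL 2 F) : T) N 1 (fun x => by
      rw [hΨM, ← galHom_apply, map_one, Equiv.Perm.one_apply]) ω Q hR
    exact this
  have htr' : ∀ ω, ∃ N : SpecialLinearGroup (Fin 2) F, ω = φ.symm (N : PSL 2 F) • ω₀ := fun ω => by
    obtain ⟨t, rfl⟩ := MulAction.exists_smul_eq T ω₀ ω
    obtain ⟨N, hN⟩ := QuotientGroup.mk_surjective (φ t)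
    exact ⟨N, by rw [hN, φ.symm_apply_apply]⟩
  have hex : ∀ ω, ∃ Q, R ω Q := fun ω => by
    obtain ⟨N, rfl⟩ := htr' ω
    exact ⟨N • Q₀, hRt N ω₀ Q₀ hQ₀⟩
  choose e he using hex
  have huniq : ∀ {ω Q}, R ω Q → e ω = Q := fun {ω Q} h =>
    eq_of_stabilizer_eq fun M => (he ω M).symm.trans (h M)
  have heg : ∀ (g : G) (N : SpecialLinearGroup (Fin 2) F) (σ : F ≃+* F),
      (∀ x, Ψ g x = N • galPerm σ x) → ∀ ω, e (g • ω) = N • map σ (e ω) :=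
    fun g N σ hg ω => huniq (hRg g N σ hg ω _ (he ω))
  have het : ∀ (N : SpecialLinearGroup (Fin 2) F) ω, e (φ.symm (N : PSL 2 F) • ω) = N • e ω :=
    fun N ω => huniq (hRt N ω _ (he ω))
  have he0 : e ω₀ = Q₀ := huniq hQ₀
  let Γ : Subgroup (F ≃+* F) := Ψ.range.comap galHom
  have hΓ : ∀ (g : G) (N : SpecialLinearGroup (Fin 2) F) (σ : F ≃+* F),
      (∀ x, Ψ g x = N • galPerm σ x) → σ ∈ Γ := fun g N σ hg =>
    ⟨((φ.symm (N : PSL 2 F) : T) : G)⁻¹ * g, Equiv.ext fun x => by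
      rw [map_mul, Equiv.Perm.mul_apply, hg, galHom_apply, map_inv, Equiv.Perm.inv_eq_iff_eq,
        hΨM]⟩
  have hmem : ∀ (M : SpecialLinearGroup (Fin 2) F), ∀ σ ∈ Γ, ∃ g : G,
      ∀ x, Ψ g x = M • galPerm σ x := by
    rintro M σ ⟨g, hg⟩
    exact ⟨(φ.symm (M : PSL 2 F) : T) * g, fun x => by
      rw [map_mul, Equiv.Perm.mul_apply, hΨM, hg]; rfl⟩
  -- Each element of G is uniquely an element of PSL_2 times one of Γ; uniqueness is
  -- `eq_one_of_smul_eq_galPerm`.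
  have hcard : Nat.card G = Nat.card (PSL 2 F) * Nat.card Γ := by
    rw [← Nat.card_prod]
    choose f hf using fun (x : PSL 2 F × Γ) =>
      (show ∃ g : G, ∀ y, Ψ g y = x.1 • galPerm x.2.1 y by
        obtain ⟨M, hM⟩ := QuotientGroup.mk_surjective x.1
        obtain ⟨g, hg⟩ := hmem M x.2.1 x.2.2
        exact ⟨g, fun y => by rw [hg, ← hM]; rfl⟩)
    refine (Nat.card_congr (Equiv.ofBijective f ⟨fun x y hxy => ?_, fun g => ?_⟩)).symm
    · have h1 : ∀ z, (y.1⁻¹ * x.1) • z = galPerm (y.2.1 * x.2.1⁻¹) z := fun z => by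
        have h2 := hf x (galPerm x.2.1⁻¹ z)
        have h3 : galPerm x.2.1 (galPerm x.2.1⁻¹ z) = z := by
          simp only [← galHom_apply, ← Equiv.Perm.mul_apply, ← map_mul, mul_inv_cancel, map_one,
            Equiv.Perm.one_apply]
        rw [hxy, hf, h3] at h2
        rw [mul_smul, inv_smul_eq_iff, ← h2]
        simp only [← galHom_apply, map_mul, Equiv.Perm.mul_apply]
      obtain ⟨h2, h3⟩ := eq_one_of_smul_eq_galPerm h1
      exact Prod.ext (inv_mul_eq_one.1 h2).symm (Subtype.ext (mul_inv_eq_one.1 h3).symm)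
    · obtain ⟨N, σ, h⟩ := hΨ' g
      refine ⟨((N : PSL 2 F), ⟨σ, hΓ g N σ h⟩), hinj (Equiv.ext fun x => ?_)⟩
      rw [hf, h]; rfl
  refine ⟨e, Γ, ⟨fun ω ω' h => ?_, fun g hg => ?_, fun M σ hσ => ?_⟩, fun Q => ⟨?_, ?_⟩, ?_, ?_, ?_⟩
  · obtain ⟨t, rfl⟩ := MulAction.exists_smul_eq T ω ω'
    obtain ⟨N, hN⟩ := QuotientGroup.mk_surjective (φ t)
    have ht : t = φ.symm (N : PSL 2 F) := by rw [hN, φ.symm_apply_apply]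
    rw [ht] at h ⊢
    rw [het] at h
    exact ((he ω N).2 h.symm).symm
  · obtain ⟨N, σ, h⟩ := hΨ' ⟨g, hg⟩
    exact ⟨N, σ, hΓ _ N σ h, heg ⟨g, hg⟩ N σ h⟩
  · obtain ⟨g, hg⟩ := hmem M σ hσ
    exact ⟨g.1, g.2, heg g M σ hg⟩
  · rintro ⟨ω, rfl⟩
    obtain ⟨N, rfl⟩ := htr' ω
    exact ⟨N, by rw [het, he0]⟩
  · rintro ⟨M, rfl⟩
    exact ⟨_, (het M ω₀).trans (by rw [he0])⟩
  · have h1 := T.index_mul_card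
    rw [hcard, Nat.card_congr φ.toEquiv, mul_comm (Nat.card (PSL 2 F))] at h1
    exact (Nat.eq_of_mul_eq_mul_right Nat.card_pos h1).symm
  · rintro ⟨θ⟩
    have hle : Ψ.range ≤ PGammaL 2 F := by
      rintro _ ⟨g, rfl⟩
      obtain ⟨M, σ, h⟩ := hΨ g
      rw [h]
      exact semilinearPerm_mem M σ
    -- An abstract isomorphism is used only through the orders: the image lies in PΓL_2 and has the
    -- same order.
    have heq : Ψ.range = PGammaL 2 F := by
      refine Subgroup.eq_of_le_of_card_ge hle (le_of_eq ?_)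
      rw [← Nat.card_congr θ.toEquiv]
      exact Nat.card_congr (MonoidHom.ofInjective hinj).toEquiv
    refine eq_top_iff.2 fun σ _ => ?_
    change galHom σ ∈ Ψ.range
    rw [heq]
    have : galHom σ = semilinearPerm 1 σ := Equiv.ext fun x => (one_smul (GL (Fin 2) F) _).symm
    rw [this]
    exact semilinearPerm_mem 1 σ
  · intro htop
    have heq : Ψ.range = PGammaL 2 F := by
      refine le_antisymm ?_ fun π hπ => ?_
      · rintro _ ⟨g, rfl⟩
        obtain ⟨M, σ, h⟩ := hΨ g
        rw [h]
        exact semilinearPerm_mem M σ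
      · obtain ⟨M, σ, rfl⟩ := exists_eq_semilinearPerm_of_mem hπ
        obtain ⟨N, hN⟩ := exists_sl_galPerm M σ
        obtain ⟨g, hg⟩ := hmem N σ (htop ▸ Subgroup.mem_top σ)
        exact ⟨g, Equiv.ext fun x => by rw [hg, hN]⟩
    exact ⟨(MonoidHom.ofInjective hinj).trans (MulEquiv.subgroupCongr heq)⟩

end FormModel

end SaxlHypergraph

namespace SaxlHypergraph

open Matrix PolarForm

/-! ### Stabilisers of pairs and triples of forms. -/

section FormModelBases

variable {F : Type*} [Field F] [CharP F 2]

/-- The forms of a given Arf invariant. -/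
def IsArf (δ : F) (Q : PolarForm F) : Prop := ∃ z, Q.c * Q.n + δ = z * z + z

theorem add_self_eq (x : F) : x + x = 0 := CharTwo.add_self_eq_zero x

theorem eq_of_add_eq_zero' {x y : F} (h : x + y = 0) : x = y := CharTwo.add_eq_zero.1 h

theorem mul_self_add_eq_iff {x y : F} : x * x + x = y * y + y ↔ x = y ∨ x = y + 1 := by
  have h2 : (2 : F) = 0 := CharTwo.two_eq_zero
  constructor
  · intro h
    have h3 : (x + y) * (x + (y + 1)) = 0 := by
      linear_combination h + (x * y + y + y * y) * h2
    rcases mul_eq_zero.1 h3 with h | h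
    · exact Or.inl (eq_of_add_eq_zero' h)
    · exact Or.inr (eq_of_add_eq_zero' h)
  · rintro (rfl | rfl)
    · rfl
    · linear_combination (y + 1) * h2

/-- The third form is the image of the second under the transvection (1, 1; 0, 1), which fixes the
first. The lemma thus describes what fixes all points of the triples {v, x, sx} that are counted
later. -/
theorem fixes_three {σ : F ≃+* F} {M : SpecialLinearGroup (Fin 2) F} {δ c n : F} (hc : c ≠ 1)
    (h1 : M • map σ ⟨1, δ⟩ = ⟨1, δ⟩) (h2 : M • map σ ⟨c, n⟩ = ⟨c, n⟩)
    (h3 : M • map σ ⟨c, n + c + 1⟩ = ⟨c, n + c + 1⟩) :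
    ∃ k, M = mkSL 1 k 0 1 (by ring) ∧ σ c = c ∧ k * k + k = σ δ + δ ∧ σ n + k + c * k * k = n := by
  have h20 : (2 : F) = 0 := CharTwo.two_eq_zero
  have a1 := congrArg PolarForm.c h1
  have a2 := congrArg PolarForm.c h2
  have a3 := congrArg PolarForm.c h3
  have b1 := congrArg PolarForm.n h1
  have b2 := congrArg PolarForm.n h2
  simp only [smul_c, smul_n, PolarForm.map, map_add, map_one] at a1 a2 a3 b1 b2
  have hd := PolarForm.det_eq M
  have hσc : σ c + 1 ≠ 0 := fun h => hc (σ.injective (by rw [map_one]; exact eq_of_add_eq_zero' h))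
  -- Only the coefficient n differs between the second and the third form, and its contribution to
  -- the first coefficient of the image is a multiple of the square of this entry.
  have hr : M 1 0 = 0 := by
    have : (σ c + 1) * M 1 0 ^ 2 = 0 := by linear_combination a3 - a2
    simpa [hσc] using this
  have ht : M 1 1 = 1 := by
    have : (M 1 1 + 1) ^ 2 = 0 := by
      rw [hr] at a1
      linear_combination a1 + (M 1 1 + 1) * h20
    exact eq_of_add_eq_zero' (by simpa using this)
  have hp : M 0 0 = 1 := by
    rw [hr, ht] at hd
    linear_combination hd
  rw [hr, ht] at a2
  have hcc : σ c = c := by linear_combination a2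
  rw [hp] at b1 b2
  refine ⟨M 0 1, ?_, hcc, ?_, ?_⟩
  · ext i j
    fin_cases i <;> fin_cases j
    · exact hp
    · rfl
    · exact hr
    · exact ht
  · linear_combination b1 - σ δ * h20
  · rw [hcc] at b2
    linear_combination b2

/-- A generator of the cyclic group of units is moved by every non-trivial field automorphism; it
differs from 1 as soon as there are more than two elements. -/
theorem exists_generator [Finite F] (hF : 2 < Nat.card F) :
    ∃ c : F, c ≠ 0 ∧ c ≠ 1 ∧ ∀ σ : F ≃+* F, σ c = c → σ = 1 := by
  have := Fintype.ofFinite F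
  obtain ⟨g, hg⟩ := IsCyclic.exists_generator (α := Fˣ)
  have hall : ∀ σ : F ≃+* F, σ g = g → σ = 1 := by
    intro σ hσ
    refine RingEquiv.ext fun x => ?_
    by_cases hx : x = 0
    · simp [hx]
    obtain ⟨k, hk⟩ := hg (Units.mk0 x hx)
    have : x = (g : F) ^ k := by
      have := congrArg Units.val hk
      simpa using this.symm
    change σ x = x
    rw [this, map_zpow₀, hσ]
  refine ⟨g, g.ne_zero, fun h1 => ?_, hall⟩
  have hg1 : g = 1 := Units.ext h1
  have : ∀ x : F, x = 0 ∨ x = 1 := fun x => by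
    by_cases hx : x = 0
    · exact Or.inl hx
    · obtain ⟨k, hk⟩ := hg (Units.mk0 x hx)
      right
      simpa [hg1] using (congrArg Units.val hk).symm
  have hle : (Set.univ : Set F).ncard ≤ 2 := by
    refine (Set.ncard_le_ncard (t := {0, 1}) (fun x _ => by simpa using this x)).trans ?_
    exact (Set.ncard_insert_le _ _).trans (by simp)
  rw [Set.ncard_univ] at hle
  omega

theorem exists_sq [Finite F] (x : F) : ∃ s, x = s * s := by
  have := Fintype.ofFinite F
  exact FiniteField.isSquare_of_char_two (ringChar.eq F 2) x

/-- Two distinct forms agree on a non-zero vector. -/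
theorem exists_eval_eq [Finite F] {Q R : PolarForm F} (h : Q ≠ R) :
    ∃ x y, (x ≠ 0 ∨ y ≠ 0) ∧ Q.eval x y = R.eval x y := by
  have h2 : (2 : F) = 0 := CharTwo.two_eq_zero
  -- The sum of the two forms has no mixed term and is the square of the linear form sX + rY, which
  -- vanishes at (r, s).
  obtain ⟨s, hs⟩ := exists_sq (Q.c + R.c)
  obtain ⟨r, hr⟩ := exists_sq (Q.n + R.n)
  refine ⟨r, s, ?_, ?_⟩
  · by_contra! h0
    refine h (PolarForm.ext (eq_of_add_eq_zero' ?_) (eq_of_add_eq_zero' ?_))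
    · rw [hs, h0.2, mul_zero]
    · rw [hr, h0.1, mul_zero]
  · simp only [eval]
    linear_combination r * r * hs + s * s * hr - (R.c * r * r + R.n * s * s - r * r * s * s) * h2

/-- Two forms that agree at a vector where they do not vanish are both fixed by a transvection. -/
theorem exists_transvection {Q R : PolarForm F} {x y : F} (hxy : x ≠ 0 ∨ y ≠ 0)
    (hQ : Q.eval x y ≠ 0) (h : Q.eval x y = R.eval x y) :
    ∃ M : SpecialLinearGroup (Fin 2) F, M • Q = Q ∧ M • R = R ∧ M ≠ 1 := by
  have h2 : (2 : F) = 0 := CharTwo.two_eq_zero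
  set l := (Q.eval x y)⁻¹ with hl
  have hlQ : l * (Q.c * x * x + x * y + Q.n * y * y) = 1 := inv_mul_cancel₀ hQ
  have hlR : l * (R.c * x * x + x * y + R.n * y * y) = 1 := by
    rw [h] at hl hQ
    rw [hl]
    exact inv_mul_cancel₀ hQ
  have hl0 : l ≠ 0 := inv_ne_zero hQ
  have hdet : (1 + l * x * y) * (1 + l * x * y) - l * x * x * (l * y * y) = 1 := by
    linear_combination l * x * y * h2
  refine ⟨mkSL _ _ _ _ hdet, ?_, ?_, fun hM => ?_⟩
  · ext
    · simp only [smul_c, mkSL_one_zero, mkSL_one_one]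
      linear_combination l * y * y * hlQ + (Q.c * l * x * y + l * y * y) * h2
    · simp only [smul_n, mkSL_zero_zero, mkSL_zero_one]
      linear_combination l * x * x * hlQ + (Q.n * l * x * y + l * x * x) * h2
  · ext
    · simp only [smul_c, mkSL_one_zero, mkSL_one_one]
      linear_combination l * y * y * hlR + (R.c * l * x * y + l * y * y) * h2
    · simp only [smul_n, mkSL_zero_zero, mkSL_zero_one]
      linear_combination l * x * x * hlR + (R.n * l * x * y + l * x * x) * h2
  · have h01 := congrArg (fun M : SpecialLinearGroup (Fin 2) F => M 0 1) hM
    have h10 := congrArg (fun M : SpecialLinearGroup (Fin 2) F => M 1 0) hM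
    simp [hl0] at h01 h10
    rcases hxy with hx | hy
    · exact hx h01
    · exact hy h10

/-- Two forms with a common zero are equivalent to `X Y` and `X Y + Y ^ 2`. -/
theorem exists_smul_eq_pair [Finite F] {Q R : PolarForm F} {x y : F} (hxy : x ≠ 0 ∨ y ≠ 0)
    (hQ : Q.eval x y = 0) (hR : R.eval x y = 0) (hne : Q ≠ R) :
    ∃ M : SpecialLinearGroup (Fin 2) F, M • Q = ⟨0, 0⟩ ∧ M • R = ⟨0, 1⟩ := by
  have h2 : (2 : F) = 0 := CharTwo.two_eq_zero
  obtain ⟨N, hN⟩ : ∃ N : SpecialLinearGroup (Fin 2) F, N 1 1 = x ∧ N 1 0 = y := by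
    by_cases hx : x = 0
    · have hy : y ≠ 0 := hxy.resolve_left (by simp [hx])
      exact ⟨mkSL 0 (-y⁻¹) y x (by field_simp; ring), rfl, rfl⟩
    · exact ⟨mkSL x⁻¹ 0 y x (by field_simp; ring), rfl, rfl⟩
  have hc : ∀ Q : PolarForm F, (N • Q).c = Q.eval x y := fun Q => by
    rw [smul_c, hN.1, hN.2, eval]; ring
  have hnn : (N • Q).n ≠ (N • R).n := fun h => hne (smul_left_cancel N (PolarForm.ext
    (by rw [hc, hc, hQ, hR]) h))
  obtain ⟨s, hs⟩ := exists_sq ((N • Q).n + (N • R).n)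
  have hs0 : s ≠ 0 := by
    rintro rfl
    exact hnn (eq_of_add_eq_zero' (by rw [hs, mul_zero]))
  refine ⟨mkSL s⁻¹ ((N • Q).n * s⁻¹) 0 s (by field_simp; ring) * N, ?_, ?_⟩
  · rw [mul_smul]
    ext
    · simp [smul_c _ (N • Q), hc, hQ]
    · simp only [smul_n _ (N • Q), mkSL_zero_zero, mkSL_zero_one, hc, hQ]
      linear_combination ((N • Q).n * s⁻¹ ^ 2) * h2
  · rw [mul_smul]
    ext
    · simp [smul_c _ (N • R), hc, hR]
    · simp only [smul_n _ (N • R), mkSL_zero_zero, mkSL_zero_one, hc, hR]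
      field_simp
      linear_combination hs

end FormModelBases

/-! ### Bases of forms have size three. -/

section FormModelBaseSize

variable {Ω : Type*} [Finite Ω] {G : Subgroup (Equiv.Perm Ω)} {F : Type*} [Field F] [Finite F]
  [CharP F 2] {e : Ω → PolarForm F} {Γ : Subgroup (F ≃+* F)} {δ : F}

theorem isArf_one (δ : F) : IsArf δ ⟨1, δ⟩ := ⟨0, by simp [add_self_eq]⟩

theorem isArf_div {c : F} (hc : c ≠ 0) (δ : F) : IsArf δ ⟨c, δ / c⟩ :=
  ⟨0, by simp [mul_div_cancel₀ _ hc, add_self_eq]⟩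

theorem isArf_div_add {c : F} (hc : c ≠ 0) (δ : F) : IsArf δ ⟨c, δ / c + c + 1⟩ :=
  ⟨c, by
    have h2 : (2 : F) = 0 := CharTwo.two_eq_zero
    field_simp
    linear_combination δ * h2⟩

/-- Three forms already detect triviality: those of `fixes_three`, with first coefficient of the
second a generator of the field. -/
theorem IsFormModel.eq_one_of_forall (hF : 2 < Nat.card F) {M : SpecialLinearGroup (Fin 2) F}
    {σ : F ≃+* F} (h : ∀ Q, IsArf δ Q → M • map σ Q = Q) : M = 1 ∧ σ = 1 := by
  obtain ⟨c, hc0, hc1, hc⟩ := exists_generator hF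
  obtain ⟨k, rfl, hσc, hk1, hk2⟩ := fixes_three hc1 (h _ (isArf_one δ)) (h _ (isArf_div hc0 δ))
    (h _ (isArf_div_add hc0 δ))
  have hσ := hc σ hσc
  subst hσ
  refine ⟨?_, rfl⟩
  have h1 : k * k + k = 0 * 0 + 0 := by rw [hk1]; simp [add_self_eq]
  have h3 : k + c * k * k = 0 := by
    change δ / c + k + c * k * k = δ / c at hk2
    linear_combination hk2
  rcases mul_self_add_eq_iff.1 h1 with rfl | rfl
  · ext i j
    fin_cases i <;> fin_cases j <;> rfl
  · exact absurd (eq_of_add_eq_zero' (x := c) (y := 1) (by linear_combination h3)) hc1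

/-- Two distinct forms agree at some non-zero vector. If the common value is non-zero, the
transvection along that vector fixes both. If it is zero, the forms are split and equivalent to XY
and XY + Y^2, which every field automorphism fixes; this is why the split class needs Γ to be
non-trivial. -/
theorem IsFormModel.baseSize_eq (hm : IsFormModel G e Γ) (he : ∀ Q, (∃ ω, e ω = Q) ↔ IsArf δ Q)
    (hF : 2 < Nat.card F) (hΓ : (¬ ∃ z, δ = z * z + z) ∨ Γ ≠ ⊥) : baseSize G = 3 := by
  have hne1 : ∀ {M : SpecialLinearGroup (Fin 2) F} {σ : F ≃+* F} {g : Equiv.Perm Ω}, (∀ ω, e (g ω) = M • map σ (e ω)) → g = 1 →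
      M = 1 ∧ σ = 1 := by
    rintro M σ g hg rfl
    refine IsFormModel.eq_one_of_forall (δ := δ) hF fun Q hQ => ?_
    obtain ⟨ω, rfl⟩ := (he Q).2 hQ
    exact (hg ω).symm
  obtain ⟨v, hv⟩ := (he _).2 (isArf_one δ)
  have hΩ : Nonempty Ω := ⟨v⟩
  obtain ⟨c, hc0, hc1, hc⟩ := exists_generator hF
  obtain ⟨a, ha⟩ := (he _).2 (isArf_div hc0 δ)
  obtain ⟨b, hb⟩ := (he _).2 (isArf_div_add hc0 δ)
  have key : ∀ x y : Ω, x ≠ y → ¬ IsBase G {x, y} := by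
    intro x y hxy hB
    have hne : e x ≠ e y := fun h => hxy (hm.injective h)
    obtain ⟨p, q, hpq, heq⟩ := exists_eval_eq hne
    by_cases h0 : (e x).eval p q = 0
    · have hz : ∃ z, δ = z * z + z := by
        obtain ⟨M, hM, -⟩ := exists_smul_eq_pair hpq h0 (heq ▸ h0) hne
        obtain ⟨z, hz⟩ := arf_smul M (e x)
        obtain ⟨w, hw⟩ := (he (e x)).1 ⟨x, rfl⟩
        rw [hM] at hz
        refine ⟨z + w, ?_⟩
        have h2 : (2 : F) = 0 := CharTwo.two_eq_zero
        simp only [mul_zero, zero_add] at hz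
        linear_combination hw + hz - ((e x).c * (e x).n + z * w) * h2
      obtain ⟨⟨σ, hσΓ⟩, hσ⟩ := Γ.ne_bot_iff_exists_ne_one.1 (hΓ.resolve_left (not_not.2 hz))
      obtain ⟨M, hMx, hMy⟩ := exists_smul_eq_pair hpq h0 (heq ▸ h0) hne
      obtain ⟨g, hg, hge⟩ := hm.exists_mem 1 σ hσΓ
      obtain ⟨h, hh, hhe⟩ := hm.exists_mem M 1 (one_mem _)
      have hhe' : ∀ ω, e (h ω) = M • e ω := hhe
      have h1 : g (h x) = h x := hm.injective (by
        rw [hge, hhe', hMx, one_smul]; ext <;> simp [PolarForm.map])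
      have h2 : g (h y) = h y := hm.injective (by
        rw [hge, hhe', hMy, one_smul]; ext <;> simp [PolarForm.map])
      have h3 := isBase_iff.1 hB (h⁻¹ * g * h) (normalizes_of_mem hh g hg) (by
        rintro z (rfl | rfl)
        · simp [h1]
        · simp [h2])
      have h4 : g = 1 := by
        have : g = h * (h⁻¹ * g * h) * h⁻¹ := by group
        rw [this, h3]; simp
      exact hσ (Subtype.ext (hne1 hge h4).2)
    · obtain ⟨M, hMx, hMy, hM⟩ := exists_transvection hpq h0 heq
      obtain ⟨g, hg, hge⟩ := hm.exists_mem M 1 (one_mem _)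
      have hge' : ∀ ω, e (g ω) = M • e ω := hge
      have h1 := isBase_iff.1 hB g hg (by
        rintro z (rfl | rfl)
        · exact hm.injective (by rw [hge', hMx])
        · exact hm.injective (by rw [hge', hMy]))
      exact hM (hne1 hge h1).1
  refine baseSize_eq_three (x := v) (y := a) (z := b) (fun x y => ?_) ?_
  · by_cases hxy : x = y
    · subst hxy
      by_cases hx : x = v
      · have : x ≠ a := by
          rintro rfl
          rw [hx, hv] at ha
          exact hc1 (congrArg PolarForm.c ha).symm
        exact fun hB => key x a this (hB.mono (by simp))
      · exact fun hB => key x v hx (hB.mono (by simp))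
    · exact key x y hxy
  · refine isBase_iff.2 fun g hg hx => ?_
    obtain ⟨M, σ, hσ, hge⟩ := hm.exists_of_mem g hg
    have f1 := hge v
    have f2 := hge a
    have f3 := hge b
    rw [hx v (by simp), hv] at f1
    rw [hx a (by simp), ha] at f2
    rw [hx b (by simp), hb] at f3
    obtain ⟨k, rfl, hσc, hk1, hk2⟩ := fixes_three hc1 f1.symm f2.symm f3.symm
    have hσ1 := hc σ hσc
    subst hσ1
    have h1 : k * k + k = 0 * 0 + 0 := by rw [hk1]; simp [add_self_eq]
    have h3 : k + c * k * k = 0 := by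
      change δ / c + k + c * k * k = δ / c at hk2
      linear_combination hk2
    -- The other root k = 1 of k^2 + k = 0 would force c = 1.
    have hk : k = 0 := by
      rcases mul_self_add_eq_iff.1 h1 with h | h
      · exact h
      · rw [h] at h3
        exact absurd (eq_of_add_eq_zero' (x := c) (y := 1) (by linear_combination h3)) hc1
    subst hk
    refine Equiv.ext fun ω => hm.injective ?_
    rw [hge]
    ext <;> simp [smul_c, smul_n, PolarForm.map]

end FormModelBaseSize

end SaxlHypergraph

/-! ### Counting forms modulo four. -/

namespace SaxlHypergraph

open Matrix PolarForm

/-- The map τ pairs the two elements of each fibre. Repeated use extracts one factor two for each of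
several such pairings. -/
theorem ncard_eq_two_mul_image {α β : Type*} [Finite α] [Finite β] {S : Set α} {f : α → β}
    {τ : α → α} (hτ : ∀ x ∈ S, τ x ∈ S) (hne : ∀ x ∈ S, x ≠ τ x)
    (hf : ∀ x ∈ S, ∀ y ∈ S, f y = f x ↔ y = x ∨ y = τ x) : S.ncard = 2 * (f '' S).ncard := by
  refine ncard_eq_mul_of_fiber (Set.toFinite _) (fun x hx => ⟨x, hx, rfl⟩) ?_
  rintro _ ⟨x, hx, rfl⟩
  have : {y ∈ S | f y = f x} = {x, τ x} := by
    ext y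
    simp only [Set.mem_insert_iff, Set.mem_singleton_iff]
    constructor
    · rintro ⟨hy, h⟩
      exact (hf x hx y hy).1 h
    · intro h
      have hy : y ∈ S := by
        rcases h with rfl | rfl
        · exact hx
        · exact hτ x hx
      exact ⟨hy, (hf x hx y hy).2 h⟩
  rw [this, Set.ncard_pair (hne x hx)]

theorem eq_one_of_mul_self_of_odd {K : Type*} [Group K] {Γ : Subgroup K} (hodd : Odd (Nat.card Γ))
    {σ : K} (hσ : σ ∈ Γ) (h : σ * σ = 1) : σ = 1 := by
  have h1 : (⟨σ, hσ⟩ : Γ) ^ 2 = 1 := Subtype.ext (by rw [pow_two]; exact h)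
  have h2 : (⟨σ, hσ⟩ : Γ) ^ Nat.card Γ = 1 := pow_card_eq_one'
  have h3 : orderOf (⟨σ, hσ⟩ : Γ) ∣ 1 := by
    have := Nat.dvd_gcd (orderOf_dvd_of_pow_eq_one h1) (orderOf_dvd_of_pow_eq_one h2)
    rwa [show Nat.gcd 2 (Nat.card Γ) = 1 from Nat.coprime_two_left.2 hodd] at this
  have := orderOf_eq_one_iff.1 (Nat.dvd_one.1 h3)
  exact congrArg Subtype.val this

section Parity

variable {F : Type*} [Field F] [Finite F] [CharP F 2] {Γ : Subgroup (F ≃+* F)} {δ : F}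

/-- The forms with neither `c = 0` nor `c = 1`, and with trivial stabiliser in `Γ`, are counted
with multiplicity two by pairs `(c, w)`. -/
theorem four_dvd_ncard_regular (hodd : Odd (Nat.card Γ)) (hδ : ∀ σ ∈ Γ, σ δ = δ) :
    4 ∣ {Q : PolarForm F | (IsArf δ Q ∧ Q.c ≠ 1 ∧ ∀ σ ∈ Γ, PolarForm.map σ Q = Q → σ = 1) ∧
      Q.c ≠ 0}.ncard := by
  have h2 : (2 : F) = 0 := CharTwo.two_eq_zero
  have : Finite (PolarForm F) := Finite.of_injective (fun Q => (Q.c, Q.n)) fun Q R h =>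
    PolarForm.ext (congrArg Prod.fst h) (congrArg Prod.snd h)
  -- The second entry w is a root of w^2 + w = cn + δ, so a form corresponds to the two pairs (c, w)
  -- and (c, w + 1).
  set W : Set (F × F) := {x | x.1 ≠ 0 ∧ x.1 ≠ 1 ∧ ∀ σ ∈ Γ, σ x.1 = x.1 → σ x.2 = x.2 → σ = 1}
  have hW1 : ∀ x ∈ W, (x.1, x.2 + 1) ∈ W := fun x hx =>
    ⟨hx.1, hx.2.1, fun σ hσ h1 h2 => hx.2.2 σ hσ h1 (by simpa using h2)⟩
  have hWc : ∀ x ∈ W, (x.1, x.2 + x.1) ∈ W := fun x hx =>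
    ⟨hx.1, hx.2.1, fun σ hσ h1 h2 => hx.2.2 σ hσ h1 (by simpa [show σ x.1 = x.1 from h1] using h2)⟩
  have hWd : ∀ x ∈ W, (x.1 + 1, x.2) ∈ W := fun x hx =>
    ⟨fun h => hx.2.1 (eq_of_add_eq_zero' h), fun h => hx.1 (by simpa using h),
      fun σ hσ h1 h2 => hx.2.2 σ hσ (by simpa using h1) h2⟩
  -- the map to forms
  have e1 : W.ncard = 2 * ((fun x : F × F =>
      (⟨x.1, (x.2 * x.2 + x.2 + δ) / x.1⟩ : PolarForm F)) '' W).ncard := by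
    refine ncard_eq_two_mul_image hW1 (fun x _ h => by simpa using congrArg Prod.snd h) ?_
    rintro ⟨c, w⟩ hx ⟨c', w'⟩ hy
    have hc : c ≠ 0 := hx.1
    simp only [PolarForm.mk.injEq, Prod.mk.injEq]
    constructor
    · rintro ⟨rfl, h⟩
      rw [div_left_inj' hc, add_left_inj, mul_self_add_eq_iff] at h
      simpa using h
    · intro h
      have h1 : c' = c := by tauto
      refine ⟨h1, ?_⟩
      rw [h1, div_left_inj' hc, add_left_inj, mul_self_add_eq_iff]
      tauto
  have e2 : (fun x : F × F => (⟨x.1, (x.2 * x.2 + x.2 + δ) / x.1⟩ : PolarForm F)) '' W =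
      {Q : PolarForm F | (IsArf δ Q ∧ Q.c ≠ 1 ∧ ∀ σ ∈ Γ, PolarForm.map σ Q = Q → σ = 1) ∧
        Q.c ≠ 0} := by
    ext Q
    constructor
    · rintro ⟨⟨c, w⟩, ⟨hc0, hc1, hr⟩, rfl⟩
      refine ⟨⟨⟨w, ?_⟩, hc1, fun σ hσ h => ?_⟩, hc0⟩
      · change c * ((w * w + w + δ) / c) + δ = w * w + w
        rw [mul_div_cancel₀ _ hc0]
        linear_combination δ * h2
      · have h1 : σ c = c := congrArg PolarForm.c h
        have h3 : σ ((w * w + w + δ) / c) = (w * w + w + δ) / c := congrArg PolarForm.n h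
        rw [map_div₀, h1, div_left_inj' hc0] at h3
        simp only [map_add, map_mul, hδ σ hσ, add_left_inj] at h3
        -- An automorphism that fixes the form may still take w to w + 1; its square then fixes c
        -- and w, so it is an involution or trivial, and odd order leaves only the latter.
        rcases mul_self_add_eq_iff.1 h3 with h4 | h4
        · exact hr σ hσ h1 h4
        · have h5 : σ * σ = 1 := hr _ (mul_mem hσ hσ) (by simp [h1]) (by
            rw [RingAut.mul_apply, h4, map_add, h4, map_one]
            linear_combination h2)
          exact eq_one_of_mul_self_of_odd hodd hσ h5
    · rintro ⟨⟨⟨w, hw⟩, hc1, hr⟩, hc0⟩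
      refine ⟨(Q.c, w), ⟨hc0, hc1, fun σ hσ h1 h3 => hr σ hσ ?_⟩, ?_⟩
      · have hn : Q.n = (w * w + w + δ) / Q.c := by
          rw [eq_div_iff hc0]
          linear_combination hw - δ * h2
        have h1' : σ Q.c = Q.c := h1
        have h3' : σ w = w := h3
        ext
        · exact h1
        · change σ Q.n = Q.n
          rw [hn]
          simp [h1', h3', hδ σ hσ]
      · ext
        · rfl
        · change (w * w + w + δ) / Q.c = Q.n
          rw [div_eq_iff hc0]
          linear_combination -hw + δ * h2
  -- The set W is also divided successively by w ↦ w + 1, w ↦ w + c and c ↦ c + 1, through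
  -- invariants of these maps. Hence 8 divides |W|, while |W| is twice the number of forms.
  have e3 : W.ncard = 2 * ((fun x : F × F => (x.1, x.2 * x.2 + x.2)) '' W).ncard := by
    refine ncard_eq_two_mul_image hW1 (fun x _ h => by simpa using congrArg Prod.snd h) ?_
    rintro ⟨c, w⟩ hx ⟨c', w'⟩ hy
    simp only [Prod.mk.injEq, mul_self_add_eq_iff]
    tauto
  set W1 := (fun x : F × F => (x.1, x.2 * x.2 + x.2)) '' W
  have e4 : W1.ncard = 2 * ((fun x : F × F => (x.1, x.2 * (x.2 + (x.1 * x.1 + x.1)))) '' W1).ncard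
      := by
    refine ncard_eq_two_mul_image (τ := fun x => (x.1, x.2 + (x.1 * x.1 + x.1))) ?_ ?_ ?_
    · rintro _ ⟨⟨c, w⟩, hx, rfl⟩
      refine ⟨_, hWc _ hx, Prod.ext rfl ?_⟩
      linear_combination w * c * h2
    · rintro _ ⟨⟨c, w⟩, hx, rfl⟩ h
      have h3 : c * (c + 1) = 0 := by
        have := congrArg Prod.snd h
        simp only at this
        linear_combination -this
      rcases mul_eq_zero.1 h3 with h | h
      · exact hx.1 h
      · exact hx.2.1 (eq_of_add_eq_zero' h)
    · rintro ⟨c, w⟩ hx ⟨c', w'⟩ hy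
      simp only [Prod.mk.injEq]
      constructor
      · rintro ⟨rfl, h⟩
        have h3 : (w' + w) * (w' + (w + (c' * c' + c'))) = 0 := by
          linear_combination h + (w * w' + w * (w + (c' * c' + c'))) * h2
        rcases mul_eq_zero.1 h3 with h | h
        · exact Or.inl ⟨rfl, eq_of_add_eq_zero' h⟩
        · exact Or.inr ⟨rfl, eq_of_add_eq_zero' h⟩
      · rintro (⟨rfl, rfl⟩ | ⟨rfl, rfl⟩)
        · exact ⟨rfl, rfl⟩
        · refine ⟨rfl, ?_⟩
          linear_combination (w + (c' * c' + c')) * (c' * c' + c') * h2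
  set W2 := (fun x : F × F => (x.1, x.2 * (x.2 + (x.1 * x.1 + x.1)))) '' W1
  have e5 : W2.ncard = 2 * ((fun x : F × F => (x.1 * x.1 + x.1, x.2)) '' W2).ncard := by
    refine ncard_eq_two_mul_image (τ := fun x => (x.1 + 1, x.2)) ?_
      (fun x _ h => by simpa using congrArg Prod.fst h) ?_
    · rintro _ ⟨_, ⟨⟨c, w⟩, hx, rfl⟩, rfl⟩
      refine ⟨_, ⟨_, hWd _ hx, rfl⟩, Prod.ext rfl ?_⟩
      linear_combination (w * w + w) * (c + 1) * h2
    · rintro ⟨c, w⟩ hx ⟨c', w'⟩ hy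
      simp only [Prod.mk.injEq, mul_self_add_eq_iff]
      tauto
  rw [e2] at e1
  omega

variable {Ω : Type*} [Finite Ω] {G : Subgroup (Equiv.Perm Ω)} {e : Ω → PolarForm F}

/-- The involution is the transvection (1, 1; 0, 1): it fixes v and exactly the forms with c = 1.
Since |Γ| is odd and Γ fixes δ, the set {v, x, sx} is a base precisely when no non-trivial element
of Γ fixes the form of x. -/
theorem IsFormModel.odd_degree_iff (hm : IsFormModel G e Γ)
    (he : ∀ Q, (∃ ω, e ω = Q) ↔ IsArf δ Q) (hF : 2 < Nat.card F) (hb : baseSize G = 3)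
    (hodd : Odd (Nat.card Γ)) (hδ : ∀ σ ∈ Γ, σ δ = δ) {v : Ω} (hv : e v = ⟨1, δ⟩) :
    Odd (degree (saxlHypergraph G) v) ↔
      {Q : PolarForm F | IsArf δ Q ∧ Q.c ≠ 1 ∧
        ∀ σ ∈ Γ, PolarForm.map σ Q = Q → σ = 1}.ncard % 4 = 2 := by
  have h2 : (2 : F) = 0 := CharTwo.two_eq_zero
  have hne1 : ∀ {M : SpecialLinearGroup (Fin 2) F} {σ : F ≃+* F} {g : Equiv.Perm Ω},
      (∀ ω, e (g ω) = M • PolarForm.map σ (e ω)) → g = 1 → M = 1 ∧ σ = 1 := by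
    rintro M σ g hg rfl
    refine IsFormModel.eq_one_of_forall (δ := δ) hF fun Q hQ => ?_
    obtain ⟨ω, rfl⟩ := (he Q).2 hQ
    exact (hg ω).symm
  obtain ⟨s, hs, hse⟩ := hm.exists_mem (mkSL 1 1 0 1 (by ring)) 1 (one_mem _)
  have hse' : ∀ ω, e (s ω) = ⟨(e ω).c, (e ω).n + (e ω).c + 1⟩ := fun ω => by
    rw [hse]
    ext
    · simp [smul_c, PolarForm.map]
    · simp only [smul_n, PolarForm.map, mkSL_zero_zero, mkSL_zero_one, RingAut.one_apply]
      ring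
  have hsfix : ∀ x, s x = x ↔ (e x).c = 1 := fun x => by
    rw [← hm.injective.eq_iff, hse']
    constructor
    · intro h
      have := congrArg PolarForm.n h
      simp only at this
      exact eq_of_add_eq_zero' (by linear_combination this)
    · intro h
      ext
      · rfl
      · change (e x).n + (e x).c + 1 = (e x).n
        rw [h]
        linear_combination h2
  have hs2 : s * s = 1 := Equiv.ext fun x => hm.injective (by
    rw [Equiv.Perm.mul_apply, hse', hse']
    ext
    · rfl
    · change (e x).n + (e x).c + 1 + (e x).c + 1 = (e x).n
      linear_combination ((e x).c + 1) * h2)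
  have hsv : s v = v := (hsfix v).2 (by rw [hv])
  rw [SaxlHypergraph.odd_degree_iff (normalizes_of_mem hs) hs2 hsv hb ?_]
  · have : {Q : PolarForm F | IsArf δ Q ∧ Q.c ≠ 1 ∧ ∀ σ ∈ Γ, PolarForm.map σ Q = Q → σ = 1} =
        e '' {x | s x ≠ x ∧ IsBase G {v, x, s x}} := by
      have key : ∀ x, (e x).c ≠ 1 →
          (IsBase G {v, x, s x} ↔ ∀ σ ∈ Γ, PolarForm.map σ (e x) = e x → σ = 1) := by
        intro x hx
        rw [isBase_iff]
        constructor
        · intro h σ hσ hσx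
          obtain ⟨g, hg, hge⟩ := hm.exists_mem 1 σ hσ
          have hg1 := h g hg (by
            rintro z (rfl | rfl | rfl)
            · exact hm.injective (by
                rw [hge, one_smul, hv]
                ext <;> simp [PolarForm.map, hδ σ hσ])
            · exact hm.injective (by rw [hge, one_smul, hσx])
            · refine hm.injective ?_
              have h1 : σ (e x).c = (e x).c := congrArg PolarForm.c hσx
              have h3 : σ (e x).n = (e x).n := congrArg PolarForm.n hσx
              rw [hge, one_smul, hse']
              ext <;> simp [PolarForm.map, h1, h3])
          exact (hne1 hge hg1).2
        · intro h g hg hgx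
          obtain ⟨M, σ, hσ, hge⟩ := hm.exists_of_mem g hg
          have f1 := hge v
          have f2 := hge x
          have f3 := hge (s x)
          rw [hgx v (by simp), hv] at f1
          rw [hgx x (by simp)] at f2
          rw [hgx (s x) (by simp), hse'] at f3
          obtain ⟨k, rfl, hσc, hk1, hk2⟩ := fixes_three hx f1.symm f2.symm f3.symm
          rw [hδ σ hσ, add_self_eq] at hk1
          have h1 : k * k + k = 0 * 0 + 0 := by rw [hk1]; ring
          rcases mul_self_add_eq_iff.1 h1 with rfl | rfl
          · have := h σ hσ (PolarForm.ext hσc (by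
              change σ (e x).n = (e x).n
              linear_combination hk2))
            subst this
            refine Equiv.ext fun ω => hm.injective ?_
            rw [hge]
            ext <;> simp [smul_c, smul_n, PolarForm.map]
          -- For k = 1 the automorphism adds c + 1 to n, so its square fixes the form and is
          -- trivial. Odd order makes σ itself trivial, and then c = 1.
          · exfalso
            have hn : σ (e x).n = (e x).n + (e x).c + 1 := by
              linear_combination hk2 - (1 + (e x).c) * h2
            have h5 : σ * σ = 1 := h _ (mul_mem hσ hσ) (PolarForm.ext
              (by change σ (σ (e x).c) = (e x).c; rw [hσc, hσc]) (by
                change σ (σ (e x).n) = (e x).n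
                rw [hn, map_add, map_add, hn, hσc, map_one]
                linear_combination ((e x).c + 1) * h2))
            rw [eq_one_of_mul_self_of_odd hodd hσ h5] at hn
            change (e x).n = _ at hn
            exact hx (eq_of_add_eq_zero' (by linear_combination -hn))
      ext Q
      constructor
      · rintro ⟨hA, hc, hr⟩
        obtain ⟨x, rfl⟩ := (he Q).2 hA
        exact ⟨x, ⟨fun h => hc ((hsfix x).1 h), (key x hc).2 hr⟩, rfl⟩
      · rintro ⟨x, ⟨hx, hB⟩, rfl⟩
        have hc : (e x).c ≠ 1 := fun h => hx ((hsfix x).2 h)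
        exact ⟨(he _).1 ⟨x, rfl⟩, hc, (key x hc).1 hB⟩
    rw [this, Set.ncard_image_of_injective _ hm.injective]
  · intro x y hx hy _ _ _ hB
    have h1 := isBase_iff.1 hB s hs (by
      rintro z (rfl | rfl | rfl)
      · exact hsv
      · exact hx
      · exact hy)
    have h3 := congrArg (fun M : SpecialLinearGroup (Fin 2) F => M 0 1) (hne1 hse h1).1
    simp at h3

/-- Nonsplit forms. -/
theorem IsFormModel.even_degree (hm : IsFormModel G e Γ)
    (he : ∀ Q, (∃ ω, e ω = Q) ↔ IsArf δ Q) (hF : 2 < Nat.card F) (hb : baseSize G = 3)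
    (hodd : Odd (Nat.card Γ)) (hδ : ∀ σ ∈ Γ, σ δ = δ) {v : Ω} (hv : e v = ⟨1, δ⟩)
    (hδ' : ¬ ∃ z, δ = z * z + z) : Even (degree (saxlHypergraph G) v) := by
  rw [← Nat.not_odd_iff_even, hm.odd_degree_iff he hF hb hodd hδ hv]
  have h4 := four_dvd_ncard_regular hodd hδ
  have : {Q : PolarForm F | IsArf δ Q ∧ Q.c ≠ 1 ∧ ∀ σ ∈ Γ, PolarForm.map σ Q = Q → σ = 1} =
      {Q : PolarForm F | (IsArf δ Q ∧ Q.c ≠ 1 ∧ ∀ σ ∈ Γ, PolarForm.map σ Q = Q → σ = 1) ∧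
        Q.c ≠ 0} := by
    ext Q
    refine ⟨fun h => ⟨h, fun h0 => ?_⟩, fun h => h.1⟩
    obtain ⟨z, hz⟩ := h.1
    rw [h0, zero_mul, zero_add] at hz
    exact hδ' ⟨z, hz⟩
  rw [this]
  omega

/-- Split forms. -/
theorem IsFormModel.odd_degree_iff_of_split (hm : IsFormModel G e Γ)
    (he : ∀ Q, (∃ ω, e ω = Q) ↔ IsArf 0 Q) (hF : 2 < Nat.card F) (hb : baseSize G = 3)
    (hodd : Odd (Nat.card Γ)) {v : Ω} (hv : e v = ⟨1, 0⟩) :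
    Odd (degree (saxlHypergraph G) v) ↔ {n : F | ∀ σ ∈ Γ, σ n = n → σ = 1}.ncard % 4 = 2 := by
  have hδ : ∀ σ ∈ Γ, σ (0 : F) = 0 := fun σ _ => map_zero σ
  have : Finite (PolarForm F) := Finite.of_injective (fun Q => (Q.c, Q.n)) fun Q R h =>
    PolarForm.ext (congrArg Prod.fst h) (congrArg Prod.snd h)
  rw [hm.odd_degree_iff he hF hb hodd hδ hv]
  have h4 := four_dvd_ncard_regular hodd hδ
  set S := {Q : PolarForm F | IsArf 0 Q ∧ Q.c ≠ 1 ∧ ∀ σ ∈ Γ, PolarForm.map σ Q = Q → σ = 1}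
  -- With c = 0 the Arf condition is vacuous in the split class, so n is an arbitrary field element
  -- that Γ moves regularly.
  have h1 : S = {Q | Q ∈ S ∧ Q.c ≠ 0} ∪
      (fun n => (⟨0, n⟩ : PolarForm F)) '' {n : F | ∀ σ ∈ Γ, σ n = n → σ = 1} := by
    ext Q
    constructor
    · intro h
      by_cases h0 : Q.c = 0
      · refine Or.inr ⟨Q.n, fun σ hσ h3 => h.2.2 σ hσ (PolarForm.ext ?_ h3), PolarForm.ext h0.symm rfl⟩
        change σ Q.c = Q.c
        rw [h0, map_zero]
      · exact Or.inl ⟨h, h0⟩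
    · rintro (h | ⟨n, hn, rfl⟩)
      · exact h.1
      · exact ⟨⟨0, by simp⟩, by simp, fun σ hσ h => hn σ hσ (congrArg PolarForm.n h)⟩
  have h3 : Disjoint {Q | Q ∈ S ∧ Q.c ≠ 0}
      ((fun n => (⟨0, n⟩ : PolarForm F)) '' {n : F | ∀ σ ∈ Γ, σ n = n → σ = 1}) := by
    rw [Set.disjoint_left]
    rintro _ h ⟨n, _, rfl⟩
    exact h.2 rfl
  have h5 := Set.ncard_union_eq h3
  rw [← h1, Set.ncard_image_of_injective _ fun a b h => congrArg PolarForm.n h] at h5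
  have h6 : 4 ∣ {Q | Q ∈ S ∧ Q.c ≠ 0}.ncard := h4
  omega

end Parity

end SaxlHypergraph

namespace SaxlHypergraph

/-! ### Field elements in regular orbits of field automorphisms. -/

section FieldAutomorphisms

variable {F : Type*} [Field F] [Finite F]

/-- Artin's theorem for finite fields. -/
theorem card_eq_ncard_fixed_pow (Γ : Subgroup (F ≃+* F)) :
    Nat.card F = {x : F | ∀ σ ∈ Γ, σ x = x}.ncard ^ Nat.card Γ := by
  have : Finite (F ≃+* F) := Finite.of_injective (fun σ : F ≃+* F => (σ : F → F))
    DFunLike.coe_injective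
  let Γ' : Subgroup (RingAut F) := Γ
  have : Finite Γ' := inferInstanceAs (Finite Γ)
  have := Fintype.ofFinite Γ'
  have h := FixedPoints.finrank_eq_card Γ' F
  rw [Module.natCard_eq_pow_finrank (K := FixedPoints.subfield Γ' F) (V := F), h,
    ← Nat.card_eq_fintype_card, ← Nat.card_coe_set_eq]
  congr 1
  refine Nat.card_congr (Equiv.subtypeEquivRight fun x => ?_)
  exact ⟨fun hx σ hσ => hx ⟨σ, hσ⟩, fun hx σ => hx σ.1 σ.2⟩

variable [CharP F 2]

theorem ncard_le_two_of_mul_self {S : Set F} (h0 : (0 : F) ∈ S) (h1 : (1 : F) ∈ S)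
    (hS : ∀ x ∈ S, x * x = x) : S.ncard = 2 := by
  have : S = {0, 1} := by
    ext x
    simp only [Set.mem_insert_iff, Set.mem_singleton_iff]
    refine ⟨fun h => ?_, ?_⟩
    · have : x * (x - 1) = 0 := by linear_combination hS x h
      rcases mul_eq_zero.1 this with h | h
      · exact Or.inl h
      · exact Or.inr (sub_eq_zero.1 h)
    · rintro (rfl | rfl) <;> assumption
  rw [this, Set.ncard_pair zero_ne_one]

/-- Elements fixed by Frobenius satisfy x^2 = x, so the fixed field in Artin's theorem has two
elements. -/
theorem card_eq_two_pow_of_frobenius_mem {Γ : Subgroup (F ≃+* F)} (h : frobeniusEquiv F 2 ∈ Γ) :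
    Nat.card F = 2 ^ Nat.card Γ := by
  rw [card_eq_ncard_fixed_pow Γ, ncard_le_two_of_mul_self]
  · exact fun σ _ => map_zero σ
  · exact fun σ _ => map_one σ
  · intro x hx
    have := hx _ h
    rwa [coe_frobeniusEquiv, frobenius_def, pow_two] at this

theorem card_eq_two_pow : Nat.card F = 2 ^ Nat.card (F ≃+* F) := by
  rw [card_eq_two_pow_of_frobenius_mem (Subgroup.mem_top (frobeniusEquiv F 2)), Subgroup.card_top]

theorem zpowers_frobenius : Subgroup.zpowers (frobeniusEquiv F 2) = ⊤ := by
  have : Finite (F ≃+* F) := Finite.of_injective (fun σ : F ≃+* F => (σ : F → F))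
    DFunLike.coe_injective
  refine Subgroup.eq_top_of_card_eq _ ?_
  have h := card_eq_two_pow_of_frobenius_mem (Subgroup.mem_zpowers (frobeniusEquiv F 2))
  rw [card_eq_two_pow] at h
  exact (Nat.pow_right_injective le_rfl h).symm

/-- For j dividing e the j-th power of Frobenius has order e/j, and Artin's theorem says that the
number of its fixed points, raised to the power e/j, is 2^e. -/
theorem ncard_fixed_frobenius_pow {j : ℕ} (hj : j ∣ Nat.card (F ≃+* F)) :
    {x : F | (frobeniusEquiv F 2 ^ j) x = x}.ncard = 2 ^ j := by
  have : Finite (F ≃+* F) := Finite.of_injective (fun σ : F ≃+* F => (σ : F → F))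
    DFunLike.coe_injective
  have h := card_eq_ncard_fixed_pow (Subgroup.zpowers (frobeniusEquiv F 2 ^ j))
  have ho : orderOf (frobeniusEquiv F 2) = Nat.card (F ≃+* F) := by
    rw [← Nat.card_zpowers, zpowers_frobenius, Subgroup.card_top]
  have hpos : 0 < Nat.card (F ≃+* F) := Nat.card_pos
  have hj0 : j ≠ 0 := fun h => by simp [h] at hj; omega
  rw [Nat.card_zpowers, orderOf_pow_of_dvd hj0 (ho ▸ hj), ho, card_eq_two_pow] at h
  have h3 : {x : F | ∀ σ ∈ Subgroup.zpowers (frobeniusEquiv F 2 ^ j), σ x = x} =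
      {x : F | (frobeniusEquiv F 2 ^ j) x = x} := by
    ext x
    refine ⟨fun hx => hx _ (Subgroup.mem_zpowers _), fun hx σ hσ => ?_⟩
    have : Subgroup.zpowers (frobeniusEquiv F 2 ^ j) ≤ MulAction.stabilizer (F ≃+* F) x :=
      Subgroup.zpowers_le.2 hx
    exact this hσ
  rw [h3] at h
  obtain ⟨k, hk⟩ := hj
  rw [hk, Nat.mul_div_cancel_left _ (Nat.pos_of_ne_zero hj0), pow_mul] at h
  have hk0 : k ≠ 0 := by
    rintro rfl
    omega
  exact (Nat.pow_left_injective hk0 h).symm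

/-- The points fixed by the j-th power of Frobenius are those whose Frobenius period divides j;
there are 2^j of them, and Möbius inversion isolates the period e. -/
theorem ncard_regular_cast : ({n : F | ∀ σ : F ≃+* F, σ n = n → σ = 1}.ncard : ℤ) =
    ∑ x ∈ (Nat.card (F ≃+* F)).divisorsAntidiagonal, ArithmeticFunction.moebius x.1 * 2 ^ x.2 := by
  classical
  have : Finite (F ≃+* F) := Finite.of_injective (fun σ : F ≃+* F => (σ : F → F))
    DFunLike.coe_injective
  have hpos : 0 < Nat.card (F ≃+* F) := Nat.card_pos
  set E := Nat.card (F ≃+* F) with hE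
  set f := frobeniusEquiv F 2 with hf
  have ho : orderOf f = E := by
    rw [← Nat.card_zpowers, zpowers_frobenius, Subgroup.card_top]
  have hper : ∀ (j : ℕ) (x : F), (f ^ j) x = x ↔ Function.minimalPeriod f x ∣ j := fun j x => by
    rw [← Function.isPeriodicPt_iff_minimalPeriod_dvd, Function.IsPeriodicPt,
      Function.IsFixedPt]
    have : ∀ j : ℕ, ((f ^ j : F ≃+* F) : F → F) = f^[j] := fun j => by
      induction j with
      | zero => rfl
      | succ j ih =>
        rw [Function.iterate_succ, pow_succ, ← ih]; rfl
    rw [this]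
  let g : ℕ → ℤ := fun j => ({x : F | Function.minimalPeriod f x = j}.ncard : ℤ)
  have hsum : ∀ j > 0, j ∈ {j | j ∣ E} → ∑ i ∈ j.divisors, g i = 2 ^ j := by
    intro j hj0 hj
    have h1 := ncard_fixed_frobenius_pow hj
    have := Fintype.ofFinite F
    have h3 : {x : F | (f ^ j) x = x}.ncard = ∑ i ∈ j.divisors,
        {x : F | Function.minimalPeriod f x = i}.ncard := by
      rw [Set.ncard_eq_toFinset_card', Finset.card_eq_sum_card_fiberwise
        (f := Function.minimalPeriod f) (t := j.divisors)]
      · refine Finset.sum_congr rfl fun i hi => ?_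
        rw [Set.ncard_eq_toFinset_card']
        congr 1
        ext x
        simp only [Set.mem_toFinset, Set.mem_ofPred_eq, Finset.mem_filter, hper]
        constructor
        · exact fun h => h.2
        · exact fun h => ⟨h ▸ Nat.dvd_of_mem_divisors hi, h⟩
      · intro x hx
        simp only [Set.coe_toFinset, Set.mem_ofPred_eq, hper] at hx
        simpa using ⟨hx, hj0.ne'⟩
    rw [h1] at h3
    simp only [g]
    exact_mod_cast h3.symm
  have hmob := (ArithmeticFunction.sum_eq_iff_sum_mul_moebius_eq_on (f := g)
    (g := fun j => (2 : ℤ) ^ j) {j | j ∣ E}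
    (fun m n hmn hn => hmn.trans hn)).1 hsum E hpos (dvd_refl E)
  -- Frobenius generates all automorphisms, so a trivial stabiliser means full period.
  have hreg : {n : F | ∀ σ : F ≃+* F, σ n = n → σ = 1} =
      {x : F | Function.minimalPeriod f x = E} := by
    ext x
    constructor
    · intro h
      refine Nat.dvd_antisymm ((hper E x).1 ?_) ?_
      · rw [← ho, pow_orderOf_eq_one]; rfl
      · rw [← ho]
        exact orderOf_dvd_of_pow_eq_one (h _ ((hper _ x).2 dvd_rfl))
    · intro h σ hσ
      have hmem : σ ∈ Subgroup.zpowers f := by rw [zpowers_frobenius]; trivial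
      obtain ⟨k, rfl⟩ := mem_powers_iff_mem_zpowers.2 hmem
      change (f ^ k) x = x at hσ
      rw [hper, h, ← ho] at hσ
      exact orderOf_dvd_iff_pow_eq_one.1 hσ
  rw [hreg]
  simpa using hmob.symm

/-- In the Möbius sum every power 2^d with d ≥ 2 vanishes modulo 4, which leaves 2μ(e). -/
theorem ncard_regular_mod_four_of_top :
    {n : F | ∀ σ : F ≃+* F, σ n = n → σ = 1}.ncard % 4 = 2 ↔ Squarefree (Nat.card (F ≃+* F)) := by
  have : Finite (F ≃+* F) := Finite.of_injective (fun σ : F ≃+* F => (σ : F → F))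
    DFunLike.coe_injective
  have hpos : 0 < Nat.card (F ≃+* F) := Nat.card_pos
  have h := ncard_regular_cast (F := F)
  set E := Nat.card (F ≃+* F)
  have h4 : (4 : ℤ) ∣ ∑ x ∈ E.divisorsAntidiagonal.erase (E, 1),
      ArithmeticFunction.moebius x.1 * 2 ^ x.2 := by
    refine Finset.dvd_sum fun x hx => Dvd.dvd.mul_left ?_ _
    rw [Finset.mem_erase, Nat.mem_divisorsAntidiagonal] at hx
    have : 2 ≤ x.2 := by
      have h0 : x.2 ≠ 0 := fun h => by rw [h] at hx; omega
      have h1 : x.2 ≠ 1 := fun h => hx.1 (Prod.ext (by rw [← hx.2.1, h, mul_one]) h)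
      omega
    exact (show (4 : ℤ) = 2 ^ 2 by norm_num) ▸ pow_dvd_pow 2 this
  rw [← Finset.add_sum_erase _ _ (show (E, 1) ∈ E.divisorsAntidiagonal by simp; omega)] at h
  simp only [pow_one] at h
  rw [← ArithmeticFunction.moebius_ne_zero_iff_squarefree]
  rcases ArithmeticFunction.moebius_eq_or E with h1 | h1 | h1 <;> rw [h1] at h ⊢ <;> omega

/-- For a proper subgroup Γ the fixed field has order at least 4. Adding its elements does not
change stabilisers in Γ, so its additive group acts freely on the set that is counted. -/
theorem ncard_regular_mod_four {Γ : Subgroup (F ≃+* F)} (hodd : Odd (Nat.card Γ)) :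
    {n : F | ∀ σ ∈ Γ, σ n = n → σ = 1}.ncard % 4 = 2 ↔
      Γ = ⊤ ∧ ∃ e, Odd e ∧ Squarefree e ∧ Nat.card F = 2 ^ e := by
  have : Finite (F ≃+* F) := Finite.of_injective (fun σ : F ≃+* F => (σ : F → F))
    DFunLike.coe_injective
  by_cases hΓ : Γ = ⊤
  · subst hΓ
    rw [Subgroup.card_top] at hodd
    have := ncard_regular_mod_four_of_top (F := F)
    simp only [Subgroup.mem_top, true_imp_iff, true_and, this]
    constructor
    · exact fun h => ⟨_, hodd, h, card_eq_two_pow⟩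
    · rintro ⟨e, -, he, h⟩
      rw [card_eq_two_pow] at h
      rwa [Nat.pow_right_injective le_rfl h]
  · simp only [hΓ, false_and, iff_false]
    set K : AddSubgroup F :=
      { carrier := {x : F | ∀ σ ∈ Γ, σ x = x}
        zero_mem' := fun σ _ => map_zero σ
        add_mem' := fun {a b} ha hb σ hσ => by rw [map_add, ha σ hσ, hb σ hσ]
        neg_mem' := fun {a} ha σ hσ => by rw [map_neg, ha σ hσ] }
    have h1 : Nat.card (Multiplicative K) ∣ {n : F | ∀ σ ∈ Γ, σ n = n → σ = 1}.ncard := by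
      let _ : MulAction (Multiplicative K) F :=
        { smul := fun k x => (k.toAdd : F) + x
          one_smul := fun x => zero_add x
          mul_smul := fun a b x => add_assoc (a.toAdd : F) b.toAdd x }
      refine card_dvd_ncard_of_free (fun k n hn σ hσ h => hn σ hσ ?_) fun k n _ h => ?_
      · change σ ((k.toAdd : F) + n) = k.toAdd + n at h
        rw [map_add, k.toAdd.2 σ hσ] at h
        exact add_left_cancel h
      · change (k.toAdd : F) + n = n at h
        exact Subtype.ext (add_eq_right.1 h)
    have h3 : 4 ∣ Nat.card (Multiplicative K) := by
      have h4 : Nat.card (Multiplicative K) = {x : F | ∀ σ ∈ Γ, σ x = x}.ncard := rfl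
      rw [h4]
      have h5 := card_eq_ncard_fixed_pow Γ
      rw [card_eq_two_pow] at h5
      set N := {x : F | ∀ σ ∈ Γ, σ x = x}.ncard
      have hc : Nat.card Γ ≠ 0 := Nat.card_pos.ne'
      obtain ⟨i, -, hi⟩ := (Nat.dvd_prime_pow Nat.prime_two).1 (h5 ▸ dvd_pow_self N hc)
      rw [hi, ← pow_mul] at h5
      have h6 := Nat.pow_right_injective le_rfl h5
      have hi0 : i ≠ 0 := by
        rintro rfl
        rw [zero_mul] at h6
        exact Nat.card_pos.ne' h6
      -- A fixed field of order 2 would make |Γ| equal to the number of all automorphisms.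
      have hi1 : i ≠ 1 := by
        rintro rfl
        rw [one_mul] at h6
        exact hΓ (Subgroup.eq_top_of_card_eq _ h6.symm)
      rw [hi]
      exact (show 4 = 2 ^ 2 by norm_num) ▸ pow_dvd_pow 2 (by omega)
    have := h3.trans h1
    omega

end FieldAutomorphisms

end SaxlHypergraph

namespace SaxlHypergraph

open Matrix PolarForm

/-! ### Simplicity excludes the fields with two and three elements. -/

section SmallFields

theorem eq_one_of_simple {T A : Type*} [Group T] [IsSimpleGroup T] [CommGroup A]
    (hT : ∃ x y : T, x * y ≠ y * x) (f : T →* A) (t : T) : f t = 1 := by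
  rcases Subgroup.Normal.eq_bot_or_eq_top (H := f.ker) inferInstance with h | h
  · obtain ⟨x, y, hxy⟩ := hT
    refine absurd ((MonoidHom.ker_eq_bot_iff f).1 h ?_) hxy
    rw [map_mul, map_mul, mul_comm]
  · exact f.mem_ker.1 (h ▸ Subgroup.mem_top t)

/-- A non-abelian simple group has no non-trivial abelian quotient, so its image would lie in A_4,
then in the commutator subgroup of A_4, which is the abelian Klein four-group. -/
theorem not_injective_of_simple {T : Type*} [Group T] [IsSimpleGroup T]
    (hT : ∃ x y : T, x * y ≠ y * x) (f : T →* Equiv.Perm (Fin 4)) : ¬ Function.Injective f := by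
  intro hf
  have h4 : Nat.card (Fin 4) = 4 := by simp
  let f1 : T →* alternatingGroup (Fin 4) := f.codRestrict _ fun t =>
    Equiv.Perm.mem_alternatingGroup.2 (eq_one_of_simple hT (Equiv.Perm.sign.comp f) t)
  have h1 : ∀ t, f1 t ∈ alternatingGroup.kleinFour (Fin 4) := fun t => by
    rw [alternatingGroup.kleinFour_eq_commutator h4]
    exact (QuotientGroup.eq_one_iff _).1 (eq_one_of_simple hT (Abelianization.of.comp f1) t)
  obtain ⟨x, y, hxy⟩ := hT
  have := alternatingGroup.kleinFour_isKleinFour h4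
  have h2 := mul_comm_of_exponent_two
    (IsKleinFour.exponent_two (G := alternatingGroup.kleinFour (Fin 4))) ⟨f1 x, h1 x⟩ ⟨f1 y, h1 y⟩
  exact hxy (hf (by
    rw [map_mul, map_mul]
    exact congrArg (fun g => ((g : alternatingGroup (Fin 4)) : Equiv.Perm (Fin 4)))
      (congrArg Subtype.val h2)))

/-- For at most three field elements the projective line has at most four points, so T would embed
in S_4. -/
theorem IsAlmostSimpleWithSocle.three_lt_card {G : Type*} [Group G] {T : Subgroup G} {F : Type*}
    [Field F] [Finite F] (hT : IsAlmostSimpleWithSocle T) (φ : T ≃* PSL 2 F) : 3 < Nat.card F := by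
  by_contra! h
  have := hT.simple
  have hne : ∃ x y : T, x * y ≠ y * x := by
    obtain ⟨x, hx, y, hy, hxy⟩ := hT.nonabelian
    exact ⟨⟨x, hx⟩, ⟨y, hy⟩, fun h => hxy (congrArg Subtype.val h)⟩
  have hcard : Nat.card (ℙ F (Fin 2 → F)) = Nat.card F + 1 := by
    rw [Projectivization.card_of_finrank F (Fin 2 → F) (n := 2) (by simp)]
    simp [Finset.sum_range_succ, add_comm]
  have : Finite (ℙ F (Fin 2 → F)) := Nat.finite_of_card_ne_zero (by omega)
  have := Fintype.ofFinite (ℙ F (Fin 2 → F))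
  obtain ⟨ι⟩ := Function.Embedding.nonempty_of_card_le (α := ℙ F (Fin 2 → F)) (β := Fin 4) (by
    rw [← Nat.card_eq_fintype_card, hcard, Fintype.card_fin]; omega)
  refine not_injective_of_simple hne (((Equiv.Perm.viaEmbeddingHom ι).comp
    (MulAction.toPermHom (PSL 2 F) (ℙ F (Fin 2 → F)))).comp φ.toMonoidHom) ?_
  rw [MonoidHom.coe_comp, MonoidHom.coe_comp]
  exact ((Equiv.Perm.viaEmbeddingHom_injective ι).comp MulAction.toPerm_injective).comp φ.injective

end SmallFields

/-! ### The elements z^2 + z form a subgroup of index two. -/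

section ArtinSchreier

variable {F : Type*} [Field F] [Finite F] [CharP F 2]

/-- The elements `z ^ 2 + z`. -/
def artinSchreier (F : Type*) [Field F] [CharP F 2] : F →+ F where
  toFun z := z * z + z
  map_zero' := by simp
  map_add' x y := by linear_combination x * y * CharTwo.two_eq_zero (R := F)

theorem artinSchreier_range_index : (artinSchreier F).range.index = 2 := by
  have h := AddSubgroup.card_mul_index (artinSchreier F).range
  have h1 := AddSubgroup.card_mul_index (artinSchreier F).ker
  rw [AddSubgroup.index_ker] at h1
  have h2 : Nat.card (artinSchreier F).ker = 2 := by
    have : ((artinSchreier F).ker : Set F) = {0, 1} := by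
      ext x
      have h3 := mul_self_add_eq_iff (x := x) (y := 0)
      simp only [mul_zero, add_zero, zero_add] at h3
      exact h3
    rw [← SetLike.coe_sort_coe, this, Nat.card_coe_set_eq, Set.ncard_pair zero_ne_one]
  rw [h2, ← h, mul_comm] at h1
  have hpos : 0 < Nat.card (artinSchreier F).range := Nat.card_pos
  exact (Nat.eq_of_mul_eq_mul_left hpos h1).symm

theorem exists_add_eq_of_not_mem {a b : F} (ha : ¬ ∃ z, a = z * z + z)
    (hb : ¬ ∃ z, b = z * z + z) : ∃ z, a + b = z * z + z := by
  have key : ∀ a : F, a ∈ (artinSchreier F).range ↔ ∃ z, a = z * z + z := fun a =>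
    ⟨fun ⟨z, hz⟩ => ⟨z, hz.symm⟩, fun ⟨z, hz⟩ => ⟨z, hz.symm⟩⟩
  rw [← key, AddSubgroup.add_mem_iff_of_index_two artinSchreier_range_index]
  rw [← key] at ha hb
  simp [ha, hb]

/-- On the fixed field z ↦ z^2 + z is not injective, hence not surjective. A value δ missed there is
also missed in F: a root z outside the fixed field is sent to z + 1 by some σ in Γ, but an odd
number of steps must return z to itself. This supplies a nonsplit form with coefficients fixed by Γ.
-/
theorem exists_fixed_not_artinSchreier {Γ : Subgroup (F ≃+* F)} (hodd : Odd (Nat.card Γ)) :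
    ∃ δ : F, (∀ σ ∈ Γ, σ δ = δ) ∧ ¬ ∃ z, δ = z * z + z := by
  have h2 : (2 : F) = 0 := CharTwo.two_eq_zero
  let K := {x : F // ∀ σ ∈ Γ, σ x = x}
  let f : K → K := fun x => ⟨x.1 * x.1 + x.1, fun σ hσ => by simp [x.2 σ hσ]⟩
  have hf : ¬ Function.Surjective f := by
    rw [← Finite.injective_iff_surjective]
    intro h
    have h3 := @h ⟨0, fun σ _ => map_zero σ⟩ ⟨1, fun σ _ => map_one σ⟩
      (Subtype.ext (by simp [f, add_self_eq]))
    simpa using congrArg Subtype.val h3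
  rw [Function.Surjective] at hf
  push Not at hf
  obtain ⟨⟨δ, hδ⟩, h⟩ := hf
  refine ⟨δ, hδ, ?_⟩
  rintro ⟨z, hz⟩
  refine h ⟨z, fun σ hσ => ?_⟩ (Subtype.ext hz.symm)
  have h3 := hδ σ hσ
  rw [hz, map_add, map_mul] at h3
  rcases mul_self_add_eq_iff.1 h3 with h4 | h4
  · exact h4
  · exfalso
    have h5 : ∀ k : ℕ, (σ ^ k) z = z + k := fun k => by
      induction k with
      | zero => simp
      | succ k ih =>
        rw [pow_succ', RingAut.mul_apply, ih, map_add, map_natCast, h4]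
        push_cast
        ring
    have h6 : (⟨σ, hσ⟩ : Γ) ^ Nat.card Γ = 1 := pow_card_eq_one'
    have h7 := h5 (Nat.card Γ)
    rw [show σ ^ Nat.card Γ = 1 from congrArg Subtype.val h6] at h7
    obtain ⟨k, hk⟩ := hodd
    rw [hk] at h7
    push_cast at h7
    rw [h2, zero_mul, zero_add] at h7
    exact absurd h7.symm (by simp)

end ArtinSchreier

/-! ### Parity of the degree for forms. -/

section DegreeParity

variable {Ω : Type*} [Finite Ω] {G : Subgroup (Equiv.Perm Ω)} {T : Subgroup G} {F : Type*}
  [Field F] [Finite F] [CharP F 2]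

/-- The Arf class is invariant, and every form of a class is equivalent to the normal form with
coefficients 1 and δ; so the orbits are the classes. -/
theorem exists_smul_eq_iff_isArf {Q₀ : PolarForm F} {δ : F} (h : IsArf δ Q₀) (Q : PolarForm F) :
    (∃ M : SpecialLinearGroup (Fin 2) F, M • Q₀ = Q) ↔ IsArf δ Q := by
  have h2 : (2 : F) = 0 := CharTwo.two_eq_zero
  constructor
  · rintro ⟨M, rfl⟩
    obtain ⟨z, hz⟩ := arf_smul M Q₀
    obtain ⟨w, hw⟩ := h
    exact ⟨z + w, by linear_combination hz + hw - (Q₀.c * Q₀.n + z * w) * h2⟩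
  · rintro ⟨w, hw⟩
    obtain ⟨z, hz⟩ := h
    obtain ⟨M, hM⟩ := exists_smul_eq_of_arf hz
    obtain ⟨N, hN⟩ := exists_smul_eq_of_arf hw
    exact ⟨N⁻¹ * M, by rw [mul_smul, hM, ← hN, inv_smul_smul]⟩

/-- Every form is equivalent to one with c = 1, and such a form is fixed by the involution (1, 1; 0,
1). -/
theorem two_dvd_card_stabilizer (φ : T ≃* PSL 2 F) {ω₀ : Ω} {Q₀ : PolarForm F}
    (hQ₀ : ∀ M : SpecialLinearGroup (Fin 2) F, φ.symm (M : PSL 2 F) • ω₀ = ω₀ ↔ M • Q₀ = Q₀) :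
    2 ∣ Nat.card ((MulAction.stabilizer G ω₀).subgroupOf T) := by
  have h2 : (2 : F) = 0 := CharTwo.two_eq_zero
  obtain ⟨N, hN⟩ := exists_smul_eq_of_arf (Q := Q₀) (δ := Q₀.c * Q₀.n) (w := 0)
    (by rw [add_self_eq]; ring)
  set J : SpecialLinearGroup (Fin 2) F := mkSL 1 1 0 1 (by ring) with hJ
  have hJQ : J • (⟨1, Q₀.c * Q₀.n⟩ : PolarForm F) = ⟨1, Q₀.c * Q₀.n⟩ := by
    ext
    · simp [hJ, smul_c]
    · simp only [hJ, smul_n, mkSL_zero_zero, mkSL_zero_one]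
      linear_combination h2
  have hJ2 : J * J = 1 := by
    ext i j
    rw [sl_mul_apply]
    fin_cases i <;> fin_cases j <;> simp [hJ, add_self_eq]
  have hM : (N⁻¹ * J * N) • Q₀ = Q₀ := by
    rw [mul_smul, mul_smul, hN, hJQ, ← hN, inv_smul_smul]
  have hM2 : (N⁻¹ * J * N) * (N⁻¹ * J * N) = 1 := by
    rw [show (N⁻¹ * J * N) * (N⁻¹ * J * N) = N⁻¹ * (J * J) * N by group, hJ2]; group
  set t := φ.symm ((N⁻¹ * J * N : SpecialLinearGroup (Fin 2) F) : PSL 2 F) with ht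
  have htmem : t ∈ (MulAction.stabilizer G ω₀).subgroupOf T := (hQ₀ _).2 hM
  have ht2 : t * t = 1 := by
    rw [ht, ← map_mul, ← QuotientGroup.mk_mul, hM2, QuotientGroup.mk_one, map_one]
  have ht1 : t ≠ 1 := by
    intro h
    rw [ht, map_eq_one_iff _ φ.symm.injective] at h
    have h3 := psl_mk_eq_iff.1 (h.trans (QuotientGroup.mk_one _).symm) (N⁻¹ • pt 0)
    rw [mul_smul, mul_smul, smul_inv_smul, one_smul] at h3
    have h4 := (smul_left_cancel_iff _).1 h3
    rw [smul_pt_zero_eq] at h4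
    simp [hJ] at h4
  have ho : orderOf (⟨t, htmem⟩ : (MulAction.stabilizer G ω₀).subgroupOf T) = 2 :=
    orderOf_eq_prime (Subtype.ext (by rw [pow_two]; exact ht2))
      fun h => ht1 (congrArg Subtype.val h)
  exact ho ▸ orderOf_dvd_natCard _

theorem degree_eq_degree (htr : MulAction.IsPretransitive T Ω) (v w : Ω) :
    degree (saxlHypergraph G) v = degree (saxlHypergraph G) w := by
  obtain ⟨t, rfl⟩ := MulAction.exists_smul_eq T v w
  exact (degree_smul t.1.2 v).symm

/-- For |Γ| odd the nonsplit class has a representative with Γ-fixed δ, as it is a single orbit, and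
no form in it has c = 0. For |Γ| even, |Γ| and the stabiliser in T contribute two factors 2 to the
order of the point stabiliser. -/
theorem even_degree_of_nonsplit (hT : IsAlmostSimpleWithSocle T)
    (htr : MulAction.IsPretransitive T Ω) (φ : T ≃* PSL 2 F) {ω₀ : Ω} {Q₀ : PolarForm F}
    (hQ₀ : ∀ M : SpecialLinearGroup (Fin 2) F, φ.symm (M : PSL 2 F) • ω₀ = ω₀ ↔ M • Q₀ = Q₀)
    (hns : ¬ ∃ z, Q₀.c * Q₀.n = z * z + z) (v : Ω) : Even (degree (saxlHypergraph G) v) := by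
  have hF := hT.three_lt_card φ
  obtain ⟨e, Γ, hm, horb, hcard, -⟩ := exists_isFormModel hT htr φ ω₀ Q₀ hQ₀
  by_cases hodd : Odd (Nat.card Γ)
  · obtain ⟨δ, hδ, hδ'⟩ := exists_fixed_not_artinSchreier hodd
    have he : ∀ Q, (∃ ω, e ω = Q) ↔ IsArf δ Q := fun Q => by
      rw [horb, exists_smul_eq_iff_isArf (exists_add_eq_of_not_mem hns hδ')]
    obtain ⟨w, hw⟩ := (he _).2 (isArf_one δ)
    rw [degree_eq_degree htr v w]
    exact hm.even_degree he (by omega) (hm.baseSize_eq he (by omega) (Or.inl hδ')) hodd hδ hw hδ'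
  · have he : ∀ Q, (∃ ω, e ω = Q) ↔ IsArf (Q₀.c * Q₀.n) Q := fun Q => by
      rw [horb, exists_smul_eq_iff_isArf ⟨0, by rw [add_self_eq]; ring⟩]
    rw [degree_eq_degree htr v ω₀]
    refine even_degree_of_four_dvd (hm.baseSize_eq he (by omega) (Or.inl hns)) ?_
    rw [card_stabilizer_eq htr, ← hcard]
    exact mul_dvd_mul (even_iff_two_dvd.1 (Nat.not_odd_iff_even.1 hodd))
      (two_dvd_card_stabilizer φ hQ₀)

/-- Here δ = 0 is fixed by all field automorphisms, and G ≠ T makes Γ non-trivial, as the base size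
requires. -/
theorem odd_degree_iff_of_split (hT : IsAlmostSimpleWithSocle T)
    (htr : MulAction.IsPretransitive T Ω) (hne : T ≠ ⊤) (φ : T ≃* PSL 2 F) {ω₀ : Ω} {Q₀ : PolarForm F}
    (hQ₀ : ∀ M : SpecialLinearGroup (Fin 2) F, φ.symm (M : PSL 2 F) • ω₀ = ω₀ ↔ M • Q₀ = Q₀)
    (hs : IsArf 0 Q₀) (v : Ω) : Odd (degree (saxlHypergraph G) v) ↔
      ∃ e, Odd e ∧ Squarefree e ∧ Nat.card F = 2 ^ e ∧ Nonempty (G ≃* PGammaL 2 F) := by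
  have hF := hT.three_lt_card φ
  obtain ⟨e, Γ, hm, horb, hcard, htop⟩ := exists_isFormModel hT htr φ ω₀ Q₀ hQ₀
  have he : ∀ Q, (∃ ω, e ω = Q) ↔ IsArf 0 Q := fun Q => by
    rw [horb, exists_smul_eq_iff_isArf hs]
  have hΓ : Γ ≠ ⊥ := by
    rintro rfl
    rw [Subgroup.card_bot] at hcard
    exact hne (Subgroup.index_eq_one.1 hcard.symm)
  have hb := hm.baseSize_eq he (by omega) (Or.inr hΓ)
  rw [htop]
  by_cases hodd : Odd (Nat.card Γ)
  · obtain ⟨w, hw⟩ := (he _).2 (isArf_one 0)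
    rw [degree_eq_degree htr v w, hm.odd_degree_iff_of_split he (by omega) hb hodd hw,
      ncard_regular_mod_four hodd]
    exact ⟨fun ⟨h, k, h1, h2, h3⟩ => ⟨k, h1, h2, h3, h⟩,
      fun ⟨k, h1, h2, h3, h⟩ => ⟨h, k, h1, h2, h3⟩⟩
  · refine iff_of_false (Nat.not_odd_iff_even.2 ?_) ?_
    · rw [degree_eq_degree htr v ω₀]
      refine even_degree_of_four_dvd hb ?_
      rw [card_stabilizer_eq htr, ← hcard]
      exact mul_dvd_mul (even_iff_two_dvd.1 (Nat.not_odd_iff_even.1 hodd))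
        (two_dvd_card_stabilizer φ hQ₀)
    -- With Γ the full group, |Γ| is the exponent e, so that e cannot be odd here.
    · rintro ⟨k, hk, -, hk2, rfl⟩
      rw [card_eq_two_pow] at hk2
      rw [Subgroup.card_top, Nat.pow_right_injective le_rfl hk2] at hodd
      exact hodd hk

end DegreeParity

end SaxlHypergraph

namespace SaxlHypergraph

open Matrix PolarForm Projectivization

theorem charP_two_of_even {F : Type*} [Field F] [Finite F] (h : Even (Nat.card F)) : CharP F 2 := by
  have := Fintype.ofFinite F
  rw [Nat.card_eq_fintype_card, Nat.even_iff, ← FiniteField.even_card_iff_char_two] at h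
  exact ringChar.of_eq h

theorem symm_smul_eq_iff {Ω : Type*} {G : Subgroup (Equiv.Perm Ω)} {T : Subgroup G} {S : Type*}
    [Group S] {P : Subgroup S} {ω : Ω} (φ : T ≃* S)
    (h : ((MulAction.stabilizer G ω).subgroupOf T).map φ.toMonoidHom = P) (x : S) :
    φ.symm x • ω = ω ↔ x ∈ P := by
  rw [← h]
  constructor
  · exact fun hx => ⟨φ.symm x, hx, φ.apply_symm_apply x⟩
  · rintro ⟨t, ht, rfl⟩
    have : φ.symm (φ.toMonoidHom t) = t := φ.symm_apply_apply t
    rw [this]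
    exact ht

/-! ### Pairs of points of the line as split forms. -/

section Types

variable {F : Type*} [Field F] [CharP F 2]

theorem smul_ptInf_eq_pt_zero_iff (M : SpecialLinearGroup (Fin 2) F) :
    M • (ptInf : ℙ F (Fin 2 → F)) = pt 0 ↔ M 0 0 = 0 := by
  rw [ptInf, smul_mk, pt, mk_eq_mk_iff']
  constructor
  · rintro ⟨c, hc⟩
    have := congrFun hc 0
    rw [sl_smul_zero] at this
    simpa using this.symm
  · intro h
    refine ⟨M 1 0, ?_⟩
    ext i
    fin_cases i
    · change _ = (M • ![1, 0]) 0
      rw [sl_smul_zero]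
      simp [h]
    · change _ = (M • ![1, 0]) 1
      rw [sl_smul_one]
      simp

theorem smul_pt_zero_eq_ptInf_iff (M : SpecialLinearGroup (Fin 2) F) :
    M • (pt 0 : ℙ F (Fin 2 → F)) = ptInf ↔ M 1 1 = 0 := by
  rw [ptInf, pt, smul_mk, mk_eq_mk_iff']
  constructor
  · rintro ⟨c, hc⟩
    have := congrFun hc 1
    rw [sl_smul_one] at this
    simpa using this.symm
  · intro h
    refine ⟨M 0 1, ?_⟩
    ext i
    fin_cases i
    · change _ = (M • ![0, 1]) 0
      rw [sl_smul_zero]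
      simp
    · change _ = (M • ![0, 1]) 1
      rw [sl_smul_one]
      simp [h]

/-- The zeros of the form XY are the two points ∞ and 0. In entries, both conditions say that the
matrix is diagonal or antidiagonal. -/
theorem mem_stabilizer_pair_iff (M : SpecialLinearGroup (Fin 2) F) :
    (M : PSL 2 F) ∈ MulAction.stabilizer (PSL 2 F) ({ptInf, pt 0} : Set (ℙ F (Fin 2 → F))) ↔
      M • (⟨0, 0⟩ : PolarForm F) = ⟨0, 0⟩ := by
  have hd := det_eq M
  have h0 : M • (⟨0, 0⟩ : PolarForm F) = ⟨0, 0⟩ ↔ M 1 1 * M 1 0 = 0 ∧ M 0 1 * M 0 0 = 0 := by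
    rw [PolarForm.ext_iff, smul_c, smul_n]
    simp
  rw [MulAction.mem_stabilizer_iff, h0, ← Set.image_smul, Set.image_pair]
  change {M • (ptInf : ℙ F (Fin 2 → F)), M • pt 0} = ({ptInf, pt 0} : Set _) ↔ _
  rw [Set.pair_eq_pair_iff, smul_ptInf_eq, smul_pt_zero_eq, smul_ptInf_eq_pt_zero_iff,
    smul_pt_zero_eq_ptInf_iff, mul_eq_zero, mul_eq_zero]
  have h1 : ¬ (M 1 1 = 0 ∧ M 0 1 = 0) := fun ⟨h, h'⟩ => by simp [h, h'] at hd
  have h2 : ¬ (M 1 0 = 0 ∧ M 0 0 = 0) := fun ⟨h, h'⟩ => by simp [h, h'] at hd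
  tauto

theorem IsTypeGL1Wr.exists_form {P : Subgroup (PSL 2 F)} (hP : IsTypeGL1Wr P) :
    ∃ Q₀ : PolarForm F, IsArf 0 Q₀ ∧
      ∀ M : SpecialLinearGroup (Fin 2) F, (M : PSL 2 F) ∈ P ↔ M • Q₀ = Q₀ := by
  obtain ⟨p, p', hpp, rfl⟩ := hP
  obtain ⟨N, h1, h2⟩ := exists_sl_smul_eq hpp
  refine ⟨N⁻¹ • ⟨0, 0⟩, ?_, fun M => ?_⟩
  · obtain ⟨z, hz⟩ := arf_smul N⁻¹ (⟨0, 0⟩ : PolarForm F)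
    exact ⟨z, by simpa using hz⟩
  · rw [← smul_left_cancel_iff N, smul_smul, smul_inv_smul, ← mul_smul, ← mem_stabilizer_pair_iff,
      MulAction.mem_stabilizer_iff, MulAction.mem_stabilizer_iff]
    have h3 : ({ptInf, pt 0} : Set (ℙ F (Fin 2 → F))) = (N : PSL 2 F) • {p, p'} := by
      rw [← Set.image_smul, Set.image_pair, ← h1, ← h2]; rfl
    rw [h3, QuotientGroup.mk_mul, QuotientGroup.mk_mul, QuotientGroup.mk_inv, smul_smul,
      inv_mul_cancel_right, mul_smul, smul_left_cancel_iff]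

end Types

/-! ### Normalisers of subalgebras modulo scalars. -/

section Fields

variable {n : ℕ} {F : Type*} [Field F]

theorem sl_mul_inv_coe (M : SpecialLinearGroup (Fin n) F) :
    (M : Matrix (Fin n) (Fin n) F) * (M⁻¹ : SpecialLinearGroup (Fin n) F) = 1 := by
  rw [← Matrix.SpecialLinearGroup.coe_mul, mul_inv_cancel, Matrix.SpecialLinearGroup.coe_one]

theorem sl_inv_mul_coe (M : SpecialLinearGroup (Fin n) F) :
    ((M⁻¹ : SpecialLinearGroup (Fin n) F) : Matrix (Fin n) (Fin n) F) * M = 1 := by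
  rw [← Matrix.SpecialLinearGroup.coe_mul, inv_mul_cancel, Matrix.SpecialLinearGroup.coe_one]

/-- Scalar matrices centralise everything, so the normaliser contains the kernel of the projection.
-/
theorem mk_mem_map_slNormalizer_iff (A : Subalgebra F (Matrix (Fin n) (Fin n) F))
    (M : SpecialLinearGroup (Fin n) F) :
    (M : PSL n F) ∈ (slNormalizer A).map
      (QuotientGroup.mk' (Subgroup.center (SpecialLinearGroup (Fin n) F))) ↔
      M ∈ slNormalizer A := by
  constructor
  · rintro ⟨N, hN, h⟩
    have h1 : N⁻¹ * M ∈ Subgroup.center (SpecialLinearGroup (Fin n) F) := QuotientGroup.eq.1 h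
    have h2 : N⁻¹ * M ∈ slNormalizer A := by
      obtain ⟨r, -, hr⟩ := Matrix.SpecialLinearGroup.mem_center_iff.1 h1
      generalize N⁻¹ * M = Z at hr
      intro x
      have h3 : (Z : Matrix (Fin n) (Fin n) F) * x = x * Z := by
        rw [← hr]
        exact (scalar_commute r (fun _ => mul_comm _ _) x).eq
      rw [h3, Matrix.mul_assoc, sl_mul_inv_coe, Matrix.mul_one]
    have h3 := mul_mem hN h2
    rwa [mul_inv_cancel_left] at h3
  · exact fun h => ⟨M, h, rfl⟩

theorem mem_slNormalizer_of_forall {A : Subalgebra F (Matrix (Fin n) (Fin n) F)}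
    {M : SpecialLinearGroup (Fin n) F}
    (h : ∀ x ∈ A, (M : Matrix (Fin n) (Fin n) F) * x * (M⁻¹ : SpecialLinearGroup (Fin n) F) ∈ A)
    (h' : ∀ x ∈ A, ((M⁻¹ : SpecialLinearGroup (Fin n) F) : Matrix (Fin n) (Fin n) F) * x * M ∈ A) :
    M ∈ slNormalizer A := by
  intro x
  refine ⟨h x, fun hx => ?_⟩
  have h1 := h' _ hx
  rwa [Matrix.mul_assoc, Matrix.mul_assoc, Matrix.mul_assoc, sl_inv_mul_coe, Matrix.mul_one,
    ← Matrix.mul_assoc, sl_inv_mul_coe, Matrix.one_mul] at h1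

theorem eq_zero_or_of_mul_eq_zero {A : Subalgebra F (Matrix (Fin n) (Fin n) F)} (hA : IsField A)
    {x y : Matrix (Fin n) (Fin n) F} (hx : x ∈ A) (hy : y ∈ A) (h : x * y = 0) :
    x = 0 ∨ y = 0 := by
  have := hA.isDomain
  have h1 : (⟨x, hx⟩ : A) * ⟨y, hy⟩ = 0 := Subtype.ext h
  rcases mul_eq_zero.1 h1 with h | h
  · exact Or.inl (congrArg Subtype.val h)
  · exact Or.inr (congrArg Subtype.val h)

end Fields

/-! ### Quadratic subfields as nonsplit forms. -/

section Ext

variable {F : Type*} [Field F] [Finite F] [CharP F 2]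

/-- The subfield is spanned by 1 and a matrix X with trace τ ≠ 0. Under conjugation the off-diagonal
entries of X divided by τ transform like the coefficients of a form. A conjugate of X inside the
subfield has the same trace and therefore differs from X by a scalar, so the normaliser of the
subfield is the stabiliser of that form. -/
theorem IsTypeGL1Ext.exists_form {P : Subgroup (PSL 2 F)} (hP : IsTypeGL1Ext P) :
    ∃ Q₀ : PolarForm F, (¬ ∃ z, Q₀.c * Q₀.n = z * z + z) ∧
      ∀ M : SpecialLinearGroup (Fin 2) F, (M : PSL 2 F) ∈ P ↔ M • Q₀ = Q₀ := by
  have h2 : (2 : F) = 0 := CharTwo.two_eq_zero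
  obtain ⟨A, hA, hrank, rfl⟩ := hP
  have hsc : ∀ α : F, α • (1 : Matrix (Fin 2) (Fin 2) F) ∈ A := fun α => A.smul_mem A.one_mem α
  -- a generator
  obtain ⟨X, hXA, hX⟩ : ∃ X ∈ A, ∀ α : F, X ≠ α • (1 : Matrix (Fin 2) (Fin 2) F) := by
    by_contra! h
    have h1 : Module.finrank F A ≤ 1 := finrank_le_one (⟨1, A.one_mem⟩ : A) (by
      rintro ⟨x, hx⟩
      obtain ⟨α, hα⟩ := h x hx
      exact ⟨α, Subtype.ext hα.symm⟩)
    omega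
  have hspan : ∀ Y ∈ A, ∃ α β : F, Y = α • (1 : Matrix (Fin 2) (Fin 2) F) + β • X := by
    intro Y hY
    let f : Fin 2 → A := ![⟨1, A.one_mem⟩, ⟨X, hXA⟩]
    have hli : LinearIndependent F f := by
      rw [LinearIndependent.pair_iff]
      intro s t hst
      have hst' : s • (1 : Matrix (Fin 2) (Fin 2) F) + t • X = 0 := congrArg Subtype.val hst
      have ht : t = 0 := by
        by_contra ht
        refine hX (-(t⁻¹ * s)) ?_
        have := congrArg (fun Z => t⁻¹ • Z) hst'
        simp only [smul_add, smul_smul, inv_mul_cancel₀ ht, one_smul, smul_zero] at this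
        rw [neg_smul]
        exact eq_neg_of_add_eq_zero_right this
      refine ⟨?_, ht⟩
      rw [ht, zero_smul, add_zero] at hst'
      have := congrFun (congrFun hst' 0) 0
      simpa using this
    have hsp := hli.span_eq_top_of_card_eq_finrank (by simp [hrank])
    have h1 : (⟨Y, hY⟩ : A) ∈ Submodule.span F (Set.range f) := hsp ▸ Submodule.mem_top
    rw [show Set.range f = {⟨1, A.one_mem⟩, ⟨X, hXA⟩} by simp [f, Set.pair_comm],
      Submodule.mem_span_pair] at h1
    obtain ⟨α, β, h⟩ := h1
    exact ⟨α, β, (congrArg Subtype.val h).symm⟩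
  obtain ⟨a, b, c, d, rfl⟩ : ∃ a b c d, X = !![a, b; c, d] := ⟨_, _, _, _, eta_fin_two X⟩
  have hquad : ∀ y z : F, y + z = a + d → y * z = a * d + b * c →
      ∃ w : F, (!![a, b; c, d] : Matrix (Fin 2) (Fin 2) F) = w • (1 : Matrix (Fin 2) (Fin 2) F) := by
    intro y z hs hp
    have h0 : (!![a, b; c, d] - y • (1 : Matrix (Fin 2) (Fin 2) F)) *
        (!![a, b; c, d] - z • (1 : Matrix (Fin 2) (Fin 2) F)) = 0 := by
      ext i j
      fin_cases i <;> fin_cases j <;> simp [mul_apply, Fin.sum_univ_two]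
      · linear_combination hp - a * hs + b * c * h2
      · linear_combination -b * hs
      · linear_combination -c * hs
      · linear_combination hp - d * hs + b * c * h2
    rcases eq_zero_or_of_mul_eq_zero hA (A.sub_mem hXA (hsc y)) (A.sub_mem hXA (hsc z)) h0 with h | h
    · exact ⟨y, sub_eq_zero.1 h⟩
    · exact ⟨z, sub_eq_zero.1 h⟩
  -- With trace zero the characteristic polynomial would be a square in characteristic two, and X
  -- would be scalar because a field has no zero divisors.
  have hτ : a + d ≠ 0 := by
    intro h
    obtain ⟨y, hy⟩ := exists_sq (a * d + b * c)
    obtain ⟨w, hw⟩ := hquad y y (by rw [h, add_self_eq]) hy.symm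
    exact hX w hw
  set τ := a + d with hτdef
  refine ⟨⟨c / τ, b / τ⟩, ?_, fun M => ?_⟩
  -- A solution of z^2 + z = bc/τ^2 would yield the eigenvalue a + τz of X, and the characteristic
  -- polynomial would split.
  · rintro ⟨z, hz⟩
    have hz' : b * c = τ * τ * (z * z + z) := by
      rw [← hz]
      field_simp
    obtain ⟨w, hw⟩ := hquad (a + τ * z) (a + τ * z + τ) (by linear_combination (a + τ * z) * h2)
      (by linear_combination -hz' + a * hτdef + (a * a + a * τ * z) * h2)
    exact hX w hw
  · rw [mk_mem_map_slNormalizer_iff]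
    have hconj : ∀ M : SpecialLinearGroup (Fin 2) F, (M : Matrix (Fin 2) (Fin 2) F) *
        !![a, b; c, d] * (M⁻¹ : SpecialLinearGroup (Fin 2) F) =
        !![(M 0 0 * a + M 0 1 * c) * M 1 1 + (M 0 0 * b + M 0 1 * d) * M 1 0,
          τ * (M • (⟨c / τ, b / τ⟩ : PolarForm F)).n;
          τ * (M • (⟨c / τ, b / τ⟩ : PolarForm F)).c,
          (M 1 0 * a + M 1 1 * c) * M 0 1 + (M 1 0 * b + M 1 1 * d) * M 0 0] := by
      intro M
      rw [smul_c, smul_n, Matrix.SpecialLinearGroup.coe_inv, adjugate_fin_two]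
      ext i j
      fin_cases i <;> fin_cases j <;> simp [mul_apply, Fin.sum_univ_two]
      · linear_combination -(M 0 0 * b + M 0 1 * d) * M 1 0 * h2
      · field_simp
        linear_combination -M 0 1 * M 0 0 * hτdef - (M 0 0 * M 0 1 * a + M 0 1 ^ 2 * c) * h2
      · field_simp
        linear_combination -M 1 1 * M 1 0 * hτdef - (M 1 0 ^ 2 * b + M 1 0 * M 1 1 * d) * h2
      · linear_combination -(M 1 0 * a + M 1 1 * c) * M 0 1 * h2
    have key : ∀ M : SpecialLinearGroup (Fin 2) F,
        (M • (⟨c / τ, b / τ⟩ : PolarForm F) = ⟨c / τ, b / τ⟩ ↔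
          (M : Matrix (Fin 2) (Fin 2) F) * !![a, b; c, d] * (M⁻¹ : SpecialLinearGroup (Fin 2) F) ∈ A)
        := by
      intro M
      have hd := det_eq M
      have htr : (M 0 0 * a + M 0 1 * c) * M 1 1 + (M 0 0 * b + M 0 1 * d) * M 1 0 +
          ((M 1 0 * a + M 1 1 * c) * M 0 1 + (M 1 0 * b + M 1 1 * d) * M 0 0) = τ := by
        linear_combination (a + d) * hd + (M 0 1 * M 1 1 * c + M 0 0 * M 1 0 * b) * h2
      rw [hconj]
      constructor
      · intro h
        rw [h]
        set x := (M 0 0 * a + M 0 1 * c) * M 1 1 + (M 0 0 * b + M 0 1 * d) * M 1 0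
        set y := (M 1 0 * a + M 1 1 * c) * M 0 1 + (M 1 0 * b + M 1 1 * d) * M 0 0
        have : (!![x, τ * (b / τ); τ * (c / τ), y] : Matrix (Fin 2) (Fin 2) F) =
            (x + a) • (1 : Matrix (Fin 2) (Fin 2) F) + !![a, b; c, d] := by
          ext i j
          fin_cases i <;> fin_cases j <;> simp [mul_div_cancel₀ _ hτ]
          · linear_combination -a * h2
          · linear_combination htr + hτdef - x * h2
        change (!![x, τ * (b / τ); τ * (c / τ), y] : Matrix (Fin 2) (Fin 2) F) ∈ A
        rw [this]
        exact A.add_mem (hsc _) hXA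
      · intro h
        obtain ⟨α, β, h⟩ := hspan _ h
        have h00 := congrFun (congrFun h 0) 0
        have h01 := congrFun (congrFun h 0) 1
        have h10 := congrFun (congrFun h 1) 0
        have h11 := congrFun (congrFun h 1) 1
        simp at h00 h01 h10 h11
        -- The conjugate and X have the same trace, and scalars have trace zero in characteristic
        -- two.
        have hβ : β = 1 := by
          have : τ * (β - 1) = 0 := by
            linear_combination htr - h00 - h11 - α * h2 - (β - 1) * hτdef
          rcases mul_eq_zero.1 this with h | h
          · exact absurd h hτ
          · exact sub_eq_zero.1 h
        rw [hβ, one_mul] at h01 h10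
        ext
        · rw [eq_div_iff hτ, mul_comm, h10]
        · rw [eq_div_iff hτ, mul_comm, h01]
    constructor
    · intro h
      exact (key M).2 ((h _).1 hXA)
    · intro h
      have haux : ∀ N : SpecialLinearGroup (Fin 2) F,
          N • (⟨c / τ, b / τ⟩ : PolarForm F) = ⟨c / τ, b / τ⟩ → ∀ x ∈ A,
          (N : Matrix (Fin 2) (Fin 2) F) * x * (N⁻¹ : SpecialLinearGroup (Fin 2) F) ∈ A := by
        intro N hN x hx
        obtain ⟨α, β, rfl⟩ := hspan x hx
        rw [Matrix.mul_add, Matrix.add_mul, Matrix.mul_smul, Matrix.mul_one, Matrix.smul_mul,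
          sl_mul_inv_coe, Matrix.mul_smul, Matrix.smul_mul]
        exact A.add_mem (hsc α) (A.smul_mem ((key N).1 hN) β)
      refine mem_slNormalizer_of_forall (haux M h) fun x hx => ?_
      have h3 := haux M⁻¹ (inv_smul_eq_iff.2 h.symm) x hx
      rwa [inv_inv] at h3

end Ext

/-! ### The two families in even characteristic. -/

section Cases

variable {Ω : Type*} [Finite Ω] {G : Subgroup (Equiv.Perm Ω)} {T : Subgroup G} {F : Type}
  [Field F] [Finite F]

theorem IsSplitCase.odd_degree_iff (hprim : MulAction.IsPreprimitive G Ω) (h : IsSplitCase G F T)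
    (v : Ω) : Odd (degree (saxlHypergraph G) v) ↔
      ∃ e, Odd e ∧ Squarefree e ∧ Nat.card F = 2 ^ e ∧ Nonempty (G ≃* PGammaL 2 F) := by
  obtain ⟨hF, hne, P, hP, hT, ω, φ, hφ⟩ := h
  have := charP_two_of_even hF
  obtain ⟨Q₀, hQ, hQ₀⟩ := hP.exists_form
  exact odd_degree_iff_of_split hT (hT.isPretransitive hprim) hne φ
    (fun M => (symm_smul_eq_iff φ hφ _).trans (hQ₀ M)) hQ v

theorem IsNonsplitCase.even_degree (hprim : MulAction.IsPreprimitive G Ω)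
    (h : IsNonsplitCase G F T) (v : Ω) : Even (degree (saxlHypergraph G) v) := by
  obtain ⟨hF, P, hP, hT, ω, φ, hφ⟩ := h
  have := charP_two_of_even hF
  obtain ⟨Q₀, hQ, hQ₀⟩ := hP.exists_form
  exact even_degree_of_nonsplit hT (hT.isPretransitive hprim) φ
    (fun M => (symm_smul_eq_iff φ hφ _).trans (hQ₀ M)) hQ v

end Cases

end SaxlHypergraph

namespace SaxlHypergraph

/-! ### Transport of bases and degrees along a bijection. -/

section Transport

variable {Ω Ω' : Type*} {G : Subgroup (Equiv.Perm Ω)} {G' : Subgroup (Equiv.Perm Ω')} {e : Ω ≃ Ω'}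

theorem isBase_image_equiv (h : ∀ g, g ∈ G ↔ e.permCongr g ∈ G') (B : Set Ω) :
    IsBase G' (e '' B) ↔ IsBase G B := by
  rw [isBase_iff, isBase_iff]
  constructor
  · intro hB g hg hx
    refine e.permCongr.injective ((hB _ ((h g).1 hg) ?_).trans (by ext; simp))
    rintro _ ⟨x, hxB, rfl⟩
    simp [hx x hxB]
  · intro hB g hg hx
    obtain ⟨g, rfl⟩ := e.permCongr.surjective g
    rw [hB g ((h g).2 hg) fun x hxB => e.injective (by simpa using hx (e x) ⟨x, hxB, rfl⟩)]
    ext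
    simp

theorem baseSize_equiv (h : ∀ g, g ∈ G ↔ e.permCongr g ∈ G') : baseSize G = baseSize G' := by
  rw [baseSize, baseSize]
  congr 1
  ext k
  constructor
  · rintro ⟨B, hB, hB', rfl⟩
    exact ⟨e '' B, hB.image _, (isBase_image_equiv h B).2 hB',
      Set.ncard_image_of_injective _ e.injective⟩
  · rintro ⟨B, hB, hB', rfl⟩
    obtain ⟨B, rfl⟩ : ∃ B', B = e '' B' := ⟨e.symm '' B, by simp⟩
    exact ⟨B, hB.of_finite_image e.injective.injOn, (isBase_image_equiv h B).1 hB',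
      (Set.ncard_image_of_injective _ e.injective).symm⟩

theorem degree_equiv (h : ∀ g, g ∈ G ↔ e.permCongr g ∈ G') (v : Ω) :
    degree (saxlHypergraph G) v = degree (saxlHypergraph G') (e v) := by
  rw [degree, degree, ← Set.ncard_image_of_injective _ e.injective.image_injective]
  congr 1
  ext B
  constructor
  · rintro ⟨B, ⟨⟨hB, hB', hB''⟩, hv⟩, rfl⟩
    exact ⟨⟨hB.image _, (isBase_image_equiv h B).2 hB', by
      rw [Set.ncard_image_of_injective _ e.injective, hB'', baseSize_equiv h]⟩, v, hv, rfl⟩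
  · rintro ⟨⟨hB, hB', hB''⟩, hv⟩
    obtain ⟨B, rfl⟩ : ∃ B', B = e '' B' := ⟨e.symm '' B, by simp⟩
    refine ⟨B, ⟨⟨hB.of_finite_image e.injective.injOn, (isBase_image_equiv h B).1 hB', ?_⟩, ?_⟩, rfl⟩
    · rw [← Set.ncard_image_of_injective _ e.injective, hB'', baseSize_equiv h]
    · simpa using hv

end Transport

/-! ### Semilinear groups on the projective line in odd characteristic. -/

section LineModel

open Matrix Projectivization

variable {F : Type*} [Field F]

/-- The dilation of the projective line by `c`. -/
def dilPerm (c : Fˣ) : Equiv.Perm (ℙ F (Fin 2 → F)) := MulAction.toPerm (dilation c)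

/-- The permutation of the projective line induced by an element of `PSL_2(F)`. -/
def pslPerm : PSL 2 F →* Equiv.Perm (ℙ F (Fin 2 → F)) := MulAction.toPermHom _ _

theorem pslPerm_apply (t : PSL 2 F) (x : ℙ F (Fin 2 → F)) : pslPerm t x = t • x := rfl

theorem pslPerm_injective : Function.Injective (pslPerm : PSL 2 F →* _) :=
  MulAction.toPerm_injective

theorem perm_ext_line {π ρ : Equiv.Perm (ℙ F (Fin 2 → F))} (hinf : π ptInf = ρ ptInf)
    (h : ∀ a, π (pt a) = ρ (pt a)) : π = ρ := by
  refine Equiv.ext fun x => ?_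
  rcases eq_ptInf_or_pt x with rfl | ⟨a, rfl⟩
  · exact hinf
  · exact h a

@[simp] theorem dilPerm_pt (c : Fˣ) (x : F) : dilPerm c (pt x) = pt (c * x) := dilation_smul_pt c x

@[simp] theorem dilPerm_ptInf (c : Fˣ) : dilPerm c (ptInf : ℙ F (Fin 2 → F)) = ptInf :=
  dilation_smul_ptInf c

theorem dilPerm_mul (c d : Fˣ) : dilPerm (c * d) = dilPerm c * dilPerm d :=
  perm_ext_line (by simp) fun a => by simp [mul_assoc]

theorem dilPerm_one : dilPerm (1 : Fˣ) = 1 :=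
  perm_ext_line (by simp) fun a => by simp

theorem dilPerm_inv (c : Fˣ) : (dilPerm c)⁻¹ = dilPerm c⁻¹ :=
  inv_eq_of_mul_eq_one_right (by rw [← dilPerm_mul, mul_inv_cancel, dilPerm_one])

theorem dilPerm_mul_self (s : Fˣ) : dilPerm (s * s) = pslPerm (diagPSL s) :=
  perm_ext_line (by rw [dilPerm_ptInf, pslPerm_apply, diagPSL_smul_ptInf])
    fun a => by rw [dilPerm_pt, pslPerm_apply, diagPSL_smul_pt]; simp

theorem galPerm_mul_dilPerm (σ : F ≃+* F) (c : Fˣ) :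
    galPerm σ * dilPerm c = dilPerm (Units.map (σ : F →* F) c) * galPerm σ :=
  perm_ext_line (by simp [galPerm_ptInf]) fun a => by simp [galPerm_pt]

theorem exists_dilPerm_conj (c : Fˣ) (t : PSL 2 F) :
    ∃ t', dilPerm c * pslPerm t * (dilPerm c)⁻¹ = pslPerm t' := by
  obtain ⟨M, rfl⟩ := QuotientGroup.mk_surjective t
  have hd := M.det_coe
  rw [det_fin_two] at hd
  have hcc : (c : F) * (c⁻¹ : Fˣ) = 1 := c.mul_inv
  let N : SpecialLinearGroup (Fin 2) F := mkSL (M 0 0) (c * M 0 1) (M 1 0 * (c⁻¹ : Fˣ)) (M 1 1) (by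
    linear_combination hd - M 0 1 * M 1 0 * hcc)
  refine ⟨(N : PSL 2 F), mul_inv_eq_iff_eq_mul.2 ?_⟩
  have h : dilation c * (M : GL (Fin 2) F) = (N : GL (Fin 2) F) * dilation c := by
    refine Units.ext ?_
    change !![(c : F), 0; 0, 1] * M.1 = N.1 * !![(c : F), 0; 0, 1]
    ext i j
    fin_cases i <;> fin_cases j <;> simp [mul_apply, Fin.sum_univ_two]
    · exact mul_comm _ _
    · rfl
    · change M 1 0 = M 1 0 * (c⁻¹ : Fˣ) * c
      linear_combination -M 1 0 * hcc
    · rfl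
  refine Equiv.ext fun x => ?_
  change dilation c • (M : GL (Fin 2) F) • x = (N : GL (Fin 2) F) • dilation c • x
  rw [← mul_smul, h, mul_smul]

theorem exists_eq_mul_dilPerm (M : GL (Fin 2) F) :
    ∃ (t : PSL 2 F) (c : Fˣ), (MulAction.toPerm M : Equiv.Perm (ℙ F (Fin 2 → F))) =
      pslPerm t * dilPerm c := by
  let c : Fˣ := GeneralLinearGroup.det M
  have hc : (c : F) = M 0 0 * M 1 1 - M 0 1 * M 1 0 := det_fin_two M.1
  let N : SpecialLinearGroup (Fin 2) F :=
    mkSL (M 0 0 * (c : F)⁻¹) (M 0 1) (M 1 0 * (c : F)⁻¹) (M 1 1) (by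
      field_simp; rw [hc])
  have h : M = (N : GL (Fin 2) F) * dilation c := by
    refine Units.ext ?_
    change M.1 = N.1 * !![(c : F), 0; 0, 1]
    ext i j
    fin_cases i <;> fin_cases j <;> simp [mul_apply, Fin.sum_univ_two]
    · change _ = M 0 0 * (c : F)⁻¹ * c
      field_simp
    · rfl
    · change _ = M 1 0 * (c : F)⁻¹ * c
      field_simp
    · rfl
  refine ⟨(N : PSL 2 F), c, Equiv.ext fun x => ?_⟩
  change M • x = (N : GL (Fin 2) F) • dilation c • x
  rw [← mul_smul, ← h]

/-- A field automorphism preserves squares and non-squares, so σ(c) c is a square, and hence so is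
σ(c) / c. -/
theorem exists_isSquare_map [Finite F] (h2 : (2 : F) ≠ 0) (σ : F ≃+* F) (c : Fˣ) :
    ∃ s : Fˣ, Units.map (σ : F →* F) c = s * s * c := by
  classical
  have := Fintype.ofFinite F
  have hc : (c : F) ≠ 0 := c.ne_zero
  have hσc : σ c ≠ 0 := (map_ne_zero σ).2 hc
  have hiff : IsSquare (σ (c : F)) ↔ IsSquare (c : F) := by
    constructor
    · rintro ⟨y, hy⟩
      exact ⟨σ.symm y, σ.injective (by simp [hy])⟩
    · rintro ⟨y, hy⟩
      exact ⟨σ y, by rw [hy, map_mul]⟩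
  have h1 : quadraticChar F (σ c * c) = 1 := by
    rw [map_mul]
    by_cases h : IsSquare (c : F)
    · rw [(quadraticChar_one_iff_isSquare hc).2 h, (quadraticChar_one_iff_isSquare hσc).2 (hiff.2 h),
        one_mul]
    · have hF : ringChar F ≠ 2 := fun h => h2 (by
        have := ringChar.Nat.cast_ringChar (R := F)
        rw [h] at this
        exact_mod_cast this)
      rw [quadraticChar_neg_one_iff_not_isSquare.2 h,
        quadraticChar_neg_one_iff_not_isSquare.2 (hiff.not.2 h)]
      norm_num
  obtain ⟨y, hy⟩ := (quadraticChar_one_iff_isSquare (mul_ne_zero hσc hc)).1 h1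
  have hy0 : y ≠ 0 := by
    rintro rfl
    exact mul_ne_zero hσc hc (by rw [hy, mul_zero])
  refine ⟨Units.mk0 y hy0 * c⁻¹, Units.ext ?_⟩
  change σ c = y * (c : Fˣ)⁻¹.1 * (y * (c : Fˣ)⁻¹.1) * c
  rw [Units.val_inv_eq_inv_val]
  field_simp
  linear_combination hy

/-- A group of semilinear permutations of the projective line that contains `PSL_2(F)`. -/
structure IsLineModel (G : Subgroup (Equiv.Perm (ℙ F (Fin 2 → F)))) : Prop where
  pslPerm_mem : ∀ t : PSL 2 F, pslPerm t ∈ G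
  exists_eq : ∀ g ∈ G, ∃ (M : GL (Fin 2) F) (σ : F ≃+* F), g = semilinearPerm M σ

variable {G : Subgroup (Equiv.Perm (ℙ F (Fin 2 → F)))}

theorem IsLineModel.exists_eq_mul (hG : IsLineModel G) {g} (hg : g ∈ G) :
    ∃ (t : PSL 2 F) (c : Fˣ) (σ : F ≃+* F), g = pslPerm t * dilPerm c * galPerm σ := by
  obtain ⟨M, σ, rfl⟩ := hG.exists_eq g hg
  obtain ⟨t, c, h⟩ := exists_eq_mul_dilPerm M
  exact ⟨t, c, σ, by rw [semilinearPerm, h]⟩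

/-- Conjugation by a dilation changes an element of G only by a factor in PSL_2: dilations commute
with each other, and moving one past a field automorphism costs the dilation by a square. Thus PGL_2
normalises G even where it is not contained in G. -/
theorem IsLineModel.dilPerm_mem_normalizer [Finite F] (hG : IsLineModel G) (h2 : (2 : F) ≠ 0)
    (c : Fˣ) : dilPerm c ∈ Subgroup.normalizer (G : Set (Equiv.Perm (ℙ F (Fin 2 → F)))) := by
  refine Subgroup.mem_normalizer_fintype fun g hg => ?_
  obtain ⟨t, d, σ, rfl⟩ := hG.exists_eq_mul hg
  obtain ⟨t', ht'⟩ := exists_dilPerm_conj c t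
  obtain ⟨s, hs⟩ := exists_isSquare_map h2 σ c⁻¹
  have h1 : dilPerm c * (pslPerm t * dilPerm d * galPerm σ) * (dilPerm c)⁻¹ =
      pslPerm t' * pslPerm (diagPSL s) * (pslPerm t)⁻¹ *
        (pslPerm t * dilPerm d * galPerm σ) := by
    rw [← dilPerm_mul_self, ← ht']
    simp only [mul_assoc, dilPerm_inv, galPerm_mul_dilPerm, hs, inv_mul_cancel_left]
    congr 2
    simp only [← mul_assoc, ← dilPerm_mul]
    congr 2
    ac_rfl
  rw [h1]
  exact mul_mem (mul_mem (mul_mem (hG.pslPerm_mem _) (hG.pslPerm_mem _))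
    (inv_mem (hG.pslPerm_mem _))) hg

/-- The group `PGL_2(F)` is three times transitive. -/
theorem IsLineModel.exists_normalizer [Finite F] (hG : IsLineModel G) (h2 : (2 : F) ≠ 0)
    {x y z : ℙ F (Fin 2 → F)} (hxy : x ≠ y) (hxz : x ≠ z) (hyz : y ≠ z) :
    ∃ s ∈ Subgroup.normalizer (G : Set (Equiv.Perm (ℙ F (Fin 2 → F)))),
      s x = ptInf ∧ s y = pt 0 ∧ s z = pt 1 := by
  obtain ⟨N, h1, h3⟩ := exists_psl_smul_eq hxy
  rcases eq_ptInf_or_pt (N • z) with h | ⟨a, ha⟩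
  · exact absurd (smul_left_cancel N (h1.trans h.symm)) hxz
  have ha0 : a ≠ 0 := by
    rintro rfl
    exact hyz (smul_left_cancel N (h3.trans ha.symm))
  refine ⟨dilPerm (Units.mk0 a ha0)⁻¹ * pslPerm N, mul_mem (hG.dilPerm_mem_normalizer h2 _)
    (Subgroup.le_normalizer (hG.pslPerm_mem N)), ?_, ?_, ?_⟩
  · rw [Equiv.Perm.mul_apply, pslPerm_apply, h1, dilPerm_ptInf]
  · rw [Equiv.Perm.mul_apply, pslPerm_apply, h3, dilPerm_pt, mul_zero]
  · rw [Equiv.Perm.mul_apply, pslPerm_apply, ha, dilPerm_pt]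
    simp [ha0]

theorem isBase_image_iff {Ω : Type*} {G : Subgroup (Equiv.Perm Ω)} {s : Equiv.Perm Ω}
    (hs : s ∈ Subgroup.normalizer (G : Set (Equiv.Perm Ω))) (B : Set Ω) :
    IsBase G (s '' B) ↔ IsBase G B := by
  have key : ∀ s ∈ Subgroup.normalizer (G : Set (Equiv.Perm Ω)), ∀ g ∈ G, s⁻¹ * g * s ∈ G :=
    fun s hs g hg => (Subgroup.mem_normalizer_iff''.1 hs g).1 hg
  refine ⟨fun h => ?_, isBase_image_of_normalizes (key s hs)⟩
  have h1 := isBase_image_of_normalizes (key s⁻¹ (inv_mem hs)) h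
  rwa [← Set.image_comp, show (⇑s⁻¹ ∘ ⇑s) = id from funext fun x => by simp, Set.image_id] at h1

theorem IsLineModel.eq_galPerm (hG : IsLineModel G) {g} (hg : g ∈ G) (h1 : g ptInf = ptInf)
    (h3 : g (pt 0) = pt 0) (h4 : g (pt 1) = pt 1) : ∃ σ, g = galPerm σ := by
  obtain ⟨t, c, σ, rfl⟩ := hG.exists_eq_mul hg
  simp only [Equiv.Perm.mul_apply, galPerm_pt, galPerm_ptInf, dilPerm_pt, dilPerm_ptInf, map_zero,
    mul_zero, map_one, mul_one, pslPerm_apply] at h1 h3 h4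
  obtain ⟨l, d, -, hld⟩ := psl_exists_affine h1
  rw [hld] at h3 h4
  have hd : d = 0 := by simpa using pt_injective h3
  have hl : l * c = 1 := by simpa [hd] using pt_injective h4
  refine ⟨σ, perm_ext_line ?_ fun a => ?_⟩
  · simp [galPerm_ptInf, pslPerm_apply, h1]
  · simp only [Equiv.Perm.mul_apply, galPerm_pt, dilPerm_pt, pslPerm_apply, hld, hd, add_zero,
      ← mul_assoc, hl, one_mul]

/-- The 3-transitive normaliser moves the triple to ∞, 0, 1, whose pointwise stabiliser in G
consists of field automorphisms. So either all triples are bases or none is. -/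
theorem IsLineModel.isBase_triple [Finite F] (hG : IsLineModel G) (h2 : (2 : F) ≠ 0)
    {x y z : ℙ F (Fin 2 → F)} (hxy : x ≠ y) (hxz : x ≠ z) (hyz : y ≠ z) :
    IsBase G {x, y, z} ↔ ∀ σ, galPerm σ ∈ G → σ = 1 := by
  obtain ⟨s, hs, h1, h3, h4⟩ := hG.exists_normalizer h2 hxy hxz hyz
  rw [← isBase_image_iff hs, Set.image_insert_eq, Set.image_pair, h1, h3, h4, isBase_iff]
  constructor
  · intro h σ hσ
    have := h _ hσ (by
      rintro _ (rfl | rfl | rfl)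
      · exact galPerm_ptInf _
      · rw [galPerm_pt, map_zero]
      · rw [galPerm_pt, map_one])
    exact galHom_injective (this.trans (map_one galHom).symm)
  · intro h g hg hx
    obtain ⟨σ, rfl⟩ := hG.eq_galPerm hg (hx _ (by simp)) (hx _ (by simp)) (hx _ (by simp))
    rw [h σ hg, ← galHom_apply, map_one]

end LineModel

end SaxlHypergraph

namespace SaxlHypergraph

/-! ### Base size and parity on the projective line. -/

section LineParity

open Matrix Projectivization

variable {F : Type*} [Field F] [Finite F] {G : Subgroup (Equiv.Perm (ℙ F (Fin 2 → F)))}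

theorem exists_unit_generator : ∃ c : Fˣ, ∀ σ : F ≃+* F, σ c = c → σ = 1 := by
  obtain ⟨g, hg⟩ := IsCyclic.exists_generator (α := Fˣ)
  refine ⟨g, fun σ hσ => RingEquiv.ext fun x => ?_⟩
  by_cases hx : x = 0
  · simp [hx]
  · have h1 : Units.map (σ : F →* F) g = g := Units.ext hσ
    obtain ⟨k, hk⟩ := hg (Units.mk0 x hx)
    have h2 : Units.map (σ : F →* F) (Units.mk0 x hx) = Units.mk0 x hx := by
      rw [← hk]
      simp only [map_zpow, h1]
    exact congrArg Units.val h2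

theorem exists_mul_self_ne_one (hF : 3 < Nat.card F) : ∃ s : Fˣ, s * s ≠ 1 := by
  by_contra! h
  have h1 : (Set.univ : Set F) ⊆ {0, 1, -1} := by
    intro x _
    by_cases hx : x = 0
    · simp [hx]
    · have := congrArg Units.val (h (Units.mk0 x hx))
      simp only [Units.val_mul, Units.val_mk0, Units.val_one] at this
      rcases mul_self_eq_one_iff.1 this with h | h <;> simp [h]
  have h2 := (Set.ncard_le_ncard h1).trans (ncard_triple_le _ _ _)
  rw [Set.ncard_univ] at h2
  omega

/-- Any pair is moved to ∞ and 0, which are fixed by x ↦ s^2 x; more than three field elements allow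
s^2 ≠ 1. -/
theorem IsLineModel.not_isBase_pair (hG : IsLineModel G) (hF : 3 < Nat.card F)
    (x y : ℙ F (Fin 2 → F)) : ¬ IsBase G {x, y} := by
  have key : ∀ x y : ℙ F (Fin 2 → F), x ≠ y → ¬ IsBase G {x, y} := by
    intro x y hxy hB
    obtain ⟨N, h1, h2⟩ := exists_psl_smul_eq hxy
    have hN : pslPerm N ∈ Subgroup.normalizer (G : Set (Equiv.Perm (ℙ F (Fin 2 → F)))) :=
      Subgroup.le_normalizer (hG.pslPerm_mem N)
    rw [← isBase_image_iff hN, Set.image_pair, pslPerm_apply, pslPerm_apply, h1, h2, isBase_iff]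
      at hB
    obtain ⟨s, hs⟩ := exists_mul_self_ne_one hF
    have h3 := hB _ (hG.pslPerm_mem (diagPSL s)) (by
      rintro _ (rfl | rfl)
      · exact diagPSL_smul_ptInf s
      · rw [pslPerm_apply, diagPSL_smul_pt, mul_zero])
    have h4 := congrArg (fun π => π (pt 1)) h3
    simp only [pslPerm_apply, diagPSL_smul_pt, Equiv.Perm.one_apply] at h4
    exact hs (Units.ext (by simpa using pt_injective h4))
  by_cases hxy : x = y
  · subst hxy
    intro hB
    by_cases hx : x = ptInf
    · exact key x (pt 0) (hx ▸ (pt_ne_ptInf 0).symm) (hB.mono (by simp))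
    · exact key x ptInf hx (hB.mono (by simp))
  · exact key x y hxy

instance : Nonempty (ℙ F (Fin 2 → F)) := ⟨ptInf⟩

theorem IsLineModel.baseSize_eq_three (hG : IsLineModel G) (hF : 3 < Nat.card F) (h2 : (2 : F) ≠ 0)
    (hΓ : ∀ σ, galPerm σ ∈ G → σ = 1) : baseSize G = 3 :=
  SaxlHypergraph.baseSize_eq_three (hG.not_isBase_pair hF)
    ((hG.isBase_triple h2 (pt_ne_ptInf 0).symm (pt_ne_ptInf 1).symm
      (pt_injective.ne zero_ne_one)).2 hΓ)

theorem ne_neg_self (h2 : (2 : F) ≠ 0) {a : F} (ha : a ≠ 0) : a ≠ -a := fun h =>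
  (mul_ne_zero h2 ha) (by linear_combination h)

theorem dilPerm_neg_one_mul_self : dilPerm (-1 : Fˣ) * dilPerm (-1) = 1 := by
  rw [← dilPerm_mul, neg_mul_neg, one_mul, dilPerm_one]

theorem odd_card (h2 : (2 : F) ≠ 0) : Odd (Nat.card F) := by
  rw [← Nat.not_even_iff_odd]
  intro h
  have := charP_two_of_even h
  exact h2 CharTwo.two_eq_zero

/-- The reflection x ↦ -x fixes only ∞ and 0, and all triples are bases, so q - 1 points x are
counted. -/
theorem IsLineModel.odd_degree_iff (hG : IsLineModel G) (hF : 3 < Nat.card F) (h2 : (2 : F) ≠ 0)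
    (hΓ : ∀ σ, galPerm σ ∈ G → σ = 1) :
    Odd (degree (saxlHypergraph G) ptInf) ↔ Nat.card F % 4 = 3 := by
  have hs := hG.dilPerm_mem_normalizer h2 (-1)
  have hfix : ∀ x : ℙ F (Fin 2 → F), dilPerm (-1) x = x ↔ x = ptInf ∨ x = pt 0 := fun x => by
    rcases eq_ptInf_or_pt x with rfl | ⟨a, rfl⟩
    · simp
    · by_cases ha : a = 0
      · simp [ha]
      · have := (ne_neg_self h2 ha).symm
        simp [pt_injective.eq_iff, pt_ne_ptInf, this, ha]
  rw [SaxlHypergraph.odd_degree_iff (fun g hg => (Subgroup.mem_normalizer_iff''.1 hs g).1 hg)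
    dilPerm_neg_one_mul_self (dilPerm_ptInf _) (hG.baseSize_eq_three hF h2 hΓ)]
  · have : {x | dilPerm (-1) x ≠ x ∧ IsBase G {ptInf, x, dilPerm (-1) x}} =
        pt '' {a : F | a ≠ 0} := by
      ext x
      constructor
      · rintro ⟨h1, -⟩
        rcases eq_ptInf_or_pt x with rfl | ⟨a, rfl⟩
        · simp at h1
        · refine ⟨a, ?_, rfl⟩
          rintro rfl
          simp at h1
      · rintro ⟨a, ha, rfl⟩
        have h3 : dilPerm (-1) (pt a) ≠ pt a := by
          rw [Ne, hfix]
          simp [pt_injective.eq_iff, pt_ne_ptInf, show a ≠ 0 from ha]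
        refine ⟨h3, (hG.isBase_triple h2 (pt_ne_ptInf a).symm ?_ h3.symm).2 hΓ⟩
        rw [dilPerm_pt]
        exact (pt_ne_ptInf _).symm
    rw [this, Set.ncard_image_of_injective _ pt_injective,
      show {a : F | a ≠ 0} = {0}ᶜ from rfl, Set.ncard_compl, Set.ncard_singleton]
    have := odd_card h2
    rw [Nat.odd_iff] at this
    omega
  · intro x y hx hy hxy hx' hy'
    exact absurd (((hfix x).1 hx).resolve_left hx' |>.trans
      (((hfix y).1 hy).resolve_left hy').symm) hxy

/-- A fourth point that generates the field removes all field automorphisms, while a smaller base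
would extend to a triple that is a base. -/
theorem IsLineModel.baseSize_eq_four (hG : IsLineModel G) (h2 : (2 : F) ≠ 0) (hF : 3 < Nat.card F)
    (hΓ : ¬ ∀ σ, galPerm σ ∈ G → σ = 1) : baseSize G = 4 := by
  refine le_antisymm ?_ (le_baseSize fun B hB => ?_)
  · obtain ⟨c, hc⟩ := exists_unit_generator (F := F)
    have hB : IsBase G {ptInf, pt 0, pt 1, pt (c : F)} := by
      refine isBase_iff.2 fun g hg hx => ?_
      obtain ⟨σ, rfl⟩ := hG.eq_galPerm hg (hx _ (by simp)) (hx _ (by simp)) (hx _ (by simp))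
      have := hx (pt c) (by simp)
      rw [galPerm_pt] at this
      rw [hc σ (pt_injective this), ← galHom_apply, map_one]
    refine (baseSize_le hB).trans ((Set.ncard_insert_le _ _).trans ?_)
    have := ncard_triple_le (pt 0) (pt 1) (pt (c : F))
    omega
  · by_contra! hlt
    have hcard : 3 ≤ Nat.card (ℙ F (Fin 2 → F)) := by
      have := Nat.card_le_card_of_injective (pt : F → ℙ F (Fin 2 → F)) pt_injective
      omega
    obtain ⟨B', hBB', -, hB'⟩ := Set.exists_subsuperset_card_eq (Set.subset_univ B) (n := 3)
      (by omega) (by rwa [Set.ncard_univ])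
    obtain ⟨x, y, z, hxy, hxz, hyz, rfl⟩ := Set.ncard_eq_three.1 hB'
    exact hΓ ((hG.isBase_triple h2 hxy hxz hyz).1 (hB.mono hBB'))

theorem five_le_ncard {α : Type*} [Finite α] {S : Set α} {a b c d e : α} (h : {a, b, c, d, e} ⊆ S)
    (h1 : a ∉ ({b, c, d, e} : Set α)) (h2 : b ∉ ({c, d, e} : Set α)) (h3 : c ∉ ({d, e} : Set α))
    (h4 : d ≠ e) : 5 ≤ S.ncard := by
  refine le_trans (le_of_eq ?_) (Set.ncard_le_ncard h)
  rw [Set.ncard_insert_of_notMem h1, Set.ncard_insert_of_notMem h2, Set.ncard_insert_of_notMem h3,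
    Set.ncard_pair h4]

/-- No base of size four through ∞ is invariant under x ↦ -x: it would be contained in {∞, 0, a,
-a}, equivalent to the set {∞, 0, 1, -1}, which field automorphisms fix pointwise. -/
theorem IsLineModel.even_degree (hG : IsLineModel G) (hF : 3 < Nat.card F) (h2 : (2 : F) ≠ 0)
    (hΓ : ¬ ∀ σ, galPerm σ ∈ G → σ = 1) : Even (degree (saxlHypergraph G) ptInf) := by
  have hb := hG.baseSize_eq_four h2 hF hΓ
  push Not at hΓ
  obtain ⟨σ, hσ, hσ1⟩ := hΓ
  have hs := hG.dilPerm_mem_normalizer h2 (-1)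
  refine even_degree_of_no_fixed_edge (fun g hg => (Subgroup.mem_normalizer_iff''.1 hs g).1 hg)
    dilPerm_neg_one_mul_self (dilPerm_ptInf _) ?_
  rintro e ⟨-, he, hcard⟩ hinf hse
  rw [hb] at hcard
  have hneg : ∀ a : F, pt a ∈ e → pt (-a) ∈ e := fun a ha => by
    rw [← hse]
    exact ⟨pt a, ha, by simp⟩
  obtain ⟨a, ha0, ha⟩ : ∃ a : F, a ≠ 0 ∧ pt a ∈ e := by
    by_contra! h
    have : e ⊆ {ptInf, pt 0} := by
      intro x hx
      rcases eq_ptInf_or_pt x with rfl | ⟨a, rfl⟩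
      · simp
      · by_cases h0 : a = 0
        · simp [h0]
        · exact absurd hx (h a h0)
    have := (Set.ncard_le_ncard this).trans (Set.ncard_insert_le _ _)
    rw [Set.ncard_singleton] at this
    omega
  have hsub : e ⊆ {ptInf, pt 0, pt a, pt (-a)} := by
    intro x hx
    rcases eq_ptInf_or_pt x with rfl | ⟨b, rfl⟩
    · simp
    · by_contra hb
      simp only [Set.mem_insert_iff, Set.mem_singleton_iff, pt_injective.eq_iff, pt_ne_ptInf,
        false_or, not_or] at hb
      -- A second pair b, -b would give five points in an edge of size four.
      have h5 := five_le_ncard (S := e) (a := ptInf) (b := pt a) (c := pt (-a)) (d := pt b)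
        (e := pt (-b)) (by
          rintro _ (rfl | rfl | rfl | rfl | rfl)
          · exact hinf
          · exact ha
          · exact hneg _ ha
          · exact hx
          · exact hneg _ hx)
        (by simp [(pt_ne_ptInf _).symm])
        (by
          have h1 := ne_neg_self h2 ha0
          have h3 : ¬ a = -b := fun h => hb.2.2 (by rw [h, neg_neg])
          simp [pt_injective.eq_iff, h1, h3, Ne.symm hb.2.1])
        (by
          have h3 : ¬ a = b := Ne.symm hb.2.1
          simp [pt_injective.eq_iff, h3, Ne.symm hb.2.2])
        (pt_injective.ne (ne_neg_self h2 hb.1))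
      omega
  have hd := hG.dilPerm_mem_normalizer h2 (Units.mk0 a ha0)⁻¹
  have hB := (isBase_image_iff hd _).2 (he.mono hsub)
  refine hσ1 (galHom_injective ((isBase_iff.1 hB _ hσ ?_).trans (map_one galHom).symm))
  rintro _ ⟨x, (rfl | rfl | rfl | rfl), rfl⟩ <;> simp [galPerm_ptInf, galPerm_pt, ha0]

end LineParity

end SaxlHypergraph

namespace SaxlHypergraph

/-! ### Recognising `PSL 2 F` and `PGL 2 F` among the semilinear groups. -/

section LineGroups

open Matrix Projectivization

variable {F : Type*} [Field F]

/-- The permutation of the projective line induced by an element of `PGL_2(F)`. -/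
def pglPerm : PGL 2 F →* Equiv.Perm (ℙ F (Fin 2 → F)) := MulAction.toPermHom _ _

theorem pglPerm_mk (M : GL (Fin 2) F) : pglPerm (ProjGenLinGroup.mk M) = MulAction.toPerm M :=
  Equiv.ext fun x => by
    induction x using Projectivization.ind with | _ v hv => rfl

theorem gl_smul_zero (M : GL (Fin 2) F) (v : Fin 2 → F) :
    (M • v) 0 = M 0 0 * v 0 + M 0 1 * v 1 := by
  change (M.1 *ᵥ v) 0 = _
  simp [mulVec, dotProduct, Fin.sum_univ_two]

theorem gl_smul_one (M : GL (Fin 2) F) (v : Fin 2 → F) :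
    (M • v) 1 = M 1 0 * v 0 + M 1 1 * v 1 := by
  change (M.1 *ᵥ v) 1 = _
  simp [mulVec, dotProduct, Fin.sum_univ_two]

/-- A matrix that fixes the lines of the two basis vectors and of their sum is scalar. -/
theorem pglPerm_injective : Function.Injective (pglPerm : PGL 2 F →* _) := by
  rw [injective_iff_map_eq_one]
  intro g hg
  obtain ⟨M, rfl⟩ := ProjGenLinGroup.mk_surjective g
  rw [pglPerm_mk] at hg
  have key : ∀ x y : F, ![x, y] ≠ 0 → ∃ a : F, a * x = M 0 0 * x + M 0 1 * y ∧
      a * y = M 1 0 * x + M 1 1 * y := by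
    intro x y hxy
    have h := congrArg (fun π => π (mk F ![x, y] hxy)) hg
    simp only [MulAction.toPerm_apply, Equiv.Perm.one_apply, smul_mk] at h
    rw [mk_eq_mk_iff'] at h
    obtain ⟨a, ha⟩ := h
    refine ⟨a, ?_, ?_⟩
    · have := congrFun ha 0
      rw [gl_smul_zero] at this
      simpa using this
    · have := congrFun ha 1
      rw [gl_smul_one] at this
      simpa using this
  obtain ⟨a, ha, ha'⟩ := key 1 0 (by simp)
  obtain ⟨b, hb, hb'⟩ := key 0 1 (by simp)
  obtain ⟨c, hc, hc'⟩ := key 1 1 (by simp)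
  simp only [mul_one, mul_zero, add_zero, zero_add] at ha ha' hb hb' hc hc'
  have h01 : M 0 1 = 0 := hb.symm
  have h10 : M 1 0 = 0 := ha'.symm
  have h11 : M 1 1 = M 0 0 := by rw [h01, add_zero] at hc; rw [h10, zero_add] at hc'; rw [← hc, ← hc']
  have hM : M.1 = scalar (Fin 2) (M 0 0) := by
    ext i j
    fin_cases i <;> fin_cases j
    · simp
    · simpa using h01
    · simpa using h10
    · simpa using h11
  have hu : IsUnit (M 0 0) := by
    rw [isUnit_iff_ne_zero]
    intro h0
    have h1 := M.isUnit.ne_zero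
    rw [hM, h0] at h1
    simp at h1
  obtain ⟨u, hu⟩ := hu
  have : M = GeneralLinearGroup.scalar (Fin 2) u := Units.ext (by rw [hM, ← hu]; rfl)
  rw [this, ProjGenLinGroup.mk_scalar]

variable [Finite F] {G : Subgroup (Equiv.Perm (ℙ F (Fin 2 → F)))}

theorem exists_mul_self_or_neg (h3 : Nat.card F % 4 = 3) (c : Fˣ) :
    ∃ s : Fˣ, c = s * s ∨ c = s * s * -1 := by
  classical
  have := Fintype.ofFinite F
  have hneg : ¬ IsSquare (-1 : F) := by
    rw [FiniteField.isSquare_neg_one_iff, ← Nat.card_eq_fintype_card]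
    simpa using h3
  have key : ∀ c : Fˣ, IsSquare (c : F) → ∃ s : Fˣ, c = s * s := by
    rintro c ⟨y, hy⟩
    have hy0 : y ≠ 0 := by
      rintro rfl
      exact c.ne_zero (by rw [hy, mul_zero])
    exact ⟨Units.mk0 y hy0, Units.ext hy⟩
  by_cases hc : IsSquare (c : F)
  · obtain ⟨s, hs⟩ := key c hc
    exact ⟨s, Or.inl hs⟩
  · have h1 : quadraticChar F ((-1) * c) = 1 := by
      rw [map_mul, quadraticChar_neg_one_iff_not_isSquare.2 hneg,
        quadraticChar_neg_one_iff_not_isSquare.2 hc]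
      norm_num
    obtain ⟨s, hs⟩ := key (-1 * c) (by
      refine (quadraticChar_one_iff_isSquare ?_).1 h1
      simp)
    exact ⟨s, Or.inr (by rw [← hs]; simp)⟩

theorem exists_eq_mul_dilPerm_sign (h3 : Nat.card F % 4 = 3) (M : GL (Fin 2) F) :
    ∃ t : PSL 2 F, (MulAction.toPerm M : Equiv.Perm (ℙ F (Fin 2 → F))) = pslPerm t ∨
      (MulAction.toPerm M : Equiv.Perm (ℙ F (Fin 2 → F))) = pslPerm t * dilPerm (-1) := by
  obtain ⟨t, c, h⟩ := exists_eq_mul_dilPerm M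
  obtain ⟨s, hs | hs⟩ := exists_mul_self_or_neg h3 c
  · exact ⟨t * diagPSL s, Or.inl (by rw [h, hs, dilPerm_mul_self, map_mul])⟩
  · exact ⟨t * diagPSL s, Or.inr (by rw [h, hs, dilPerm_mul, dilPerm_mul_self, map_mul, mul_assoc])⟩

/-- An automorphism of order two would make q the square of the order of its fixed field, and
squares are not 3 modulo 4. -/
theorem eq_one_of_mul_self_galois (h3 : Nat.card F % 4 = 3) {σ : F ≃+* F} (h : σ * σ = 1) :
    σ = 1 := by
  by_contra hσ
  have h1 := card_eq_ncard_fixed_pow (Subgroup.zpowers σ)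
  rw [Nat.card_zpowers, orderOf_eq_prime (by rw [pow_two]; exact h) hσ] at h1
  generalize ({x : F | ∀ τ ∈ Subgroup.zpowers σ, τ x = x}).ncard = N at h1
  rw [h1, pow_two, Nat.mul_mod] at h3
  have : N % 4 < 4 := Nat.mod_lt _ (by norm_num)
  interval_cases N % 4 <;> omega

theorem pslPerm_mem_range_pglPerm (t : PSL 2 F) : pslPerm t ∈ (pglPerm (F := F)).range := by
  obtain ⟨M, rfl⟩ := QuotientGroup.mk_surjective t
  exact ⟨ProjGenLinGroup.mk (M : GL (Fin 2) F), pglPerm_mk _⟩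

theorem dilPerm_mem_range_pglPerm (c : Fˣ) : dilPerm c ∈ (pglPerm (F := F)).range :=
  ⟨ProjGenLinGroup.mk (dilation c), pglPerm_mk _⟩

/-- Since -1 is a non-square, every dilation is one by ±1 up to PSL_2. An element of G with a
non-trivial field automorphism σ could only involve the dilation by -1 together with σ, but the
square of that product is σ^2, which forces σ = 1. So G is PSL_2, possibly extended by x ↦ -x. -/
theorem IsLineModel.nonempty_mulEquiv (hG : IsLineModel G) (h3 : Nat.card F % 4 = 3)
    (hΓ : ∀ σ, galPerm σ ∈ G → σ = 1) : Nonempty (G ≃* PSL 2 F) ∨ Nonempty (G ≃* PGL 2 F) := by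
  have key : ∀ g ∈ G, ∃ t : PSL 2 F, g = pslPerm t ∨ g = pslPerm t * dilPerm (-1) := by
    intro g hg
    obtain ⟨M, σ, rfl⟩ := hG.exists_eq g hg
    obtain ⟨t, ht⟩ := exists_eq_mul_dilPerm_sign h3 M
    refine ⟨t, ?_⟩
    rw [semilinearPerm] at hg ⊢
    rcases ht with ht | ht <;> rw [ht] at hg ⊢
    · have h1 := hΓ σ ((G.mul_mem_cancel_left (hG.pslPerm_mem t)).1 hg)
      rw [h1, ← galHom_apply, map_one, mul_one]
      exact Or.inl rfl
    · rw [mul_assoc] at hg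
      have h1 := (G.mul_mem_cancel_left (hG.pslPerm_mem t)).1 hg
      have h4 := mul_mem h1 h1
      have h5 : dilPerm (-1) * galPerm σ * (dilPerm (-1) * galPerm σ) = galPerm (σ * σ) := by
        rw [mul_assoc, ← mul_assoc (galPerm σ), galPerm_mul_dilPerm,
          show Units.map (σ : F →* F) (-1) = -1 from Units.ext (by simp), mul_assoc, ← mul_assoc,
          dilPerm_neg_one_mul_self, one_mul, ← galHom_apply, ← map_mul]
        rfl
      rw [h5] at h4
      rw [eq_one_of_mul_self_galois h3 (hΓ _ h4), ← galHom_apply, map_one, mul_one]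
      exact Or.inr rfl
  by_cases hd : dilPerm (-1) ∈ G
  · right
    have : G = (pglPerm (F := F)).range := by
      refine le_antisymm (fun g hg => ?_) ?_
      · obtain ⟨t, rfl | rfl⟩ := key g hg
        · exact pslPerm_mem_range_pglPerm t
        · exact mul_mem (pslPerm_mem_range_pglPerm t) (dilPerm_mem_range_pglPerm _)
      · rintro _ ⟨x, rfl⟩
        obtain ⟨M, rfl⟩ := ProjGenLinGroup.mk_surjective x
        rw [pglPerm_mk]
        obtain ⟨t, ht | ht⟩ := exists_eq_mul_dilPerm_sign h3 M
        · rw [ht]; exact hG.pslPerm_mem t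
        · rw [ht]; exact mul_mem (hG.pslPerm_mem t) hd
    rw [this]
    exact ⟨(MonoidHom.ofInjective pglPerm_injective).symm⟩
  · left
    have : G = (pslPerm (F := F)).range := by
      refine le_antisymm (fun g hg => ?_) ?_
      · obtain ⟨t, rfl | rfl⟩ := key g hg
        · exact ⟨t, rfl⟩
        · exact absurd ((G.mul_mem_cancel_left (hG.pslPerm_mem t)).1 hg) hd
      · rintro _ ⟨t, rfl⟩
        exact hG.pslPerm_mem t
    rw [this]
    exact ⟨(MonoidHom.ofInjective pslPerm_injective).symm⟩

theorem card_pgl_le (h3 : Nat.card F % 4 = 3) : Nat.card (PGL 2 F) ≤ 2 * Nat.card (PSL 2 F) := by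
  have h1 : Nat.card (Bool × PSL 2 F) = 2 * Nat.card (PSL 2 F) := by simp
  rw [← h1]
  have key : ∀ x : PGL 2 F, ∃ t : Bool × PSL 2 F,
      pglPerm x = pslPerm t.2 * if t.1 then 1 else dilPerm (-1) := by
    intro x
    obtain ⟨M, rfl⟩ := ProjGenLinGroup.mk_surjective x
    obtain ⟨t, h | h⟩ := exists_eq_mul_dilPerm_sign h3 M
    · exact ⟨(true, t), by simp [pglPerm_mk, h]⟩
    · exact ⟨(false, t), by simp [pglPerm_mk, h]⟩
  choose f hf using key
  exact Nat.card_le_card_of_injective f fun x y h => pglPerm_injective (by rw [hf, hf, h])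

/-- Non-trivial field automorphisms have order at least three when q is 3 modulo 4. This excludes an
abstract isomorphism of G with PSL_2 or PGL_2 by order alone. -/
theorem IsLineModel.three_mul_card_le (hG : IsLineModel G) (h3 : Nat.card F % 4 = 3)
    (hΓ : ¬ ∀ σ, galPerm σ ∈ G → σ = 1) : 3 * Nat.card (PSL 2 F) ≤ Nat.card G := by
  push Not at hΓ
  obtain ⟨σ, hσ, hσ1⟩ := hΓ
  have : Finite (F ≃+* F) := Finite.of_injective (fun σ : F ≃+* F => (σ : F → F))
    DFunLike.coe_injective
  let Γ : Subgroup (F ≃+* F) := G.comap galHom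
  have hΓ3 : 3 ≤ Nat.card Γ := by
    have h1 : orderOf σ ≤ Nat.card Γ := by
      rw [← Subgroup.orderOf_mk σ (show σ ∈ Γ from hσ)]
      exact Nat.le_of_dvd Nat.card_pos (orderOf_dvd_natCard _)
    have h0 := orderOf_pos σ
    have h4 : orderOf σ ≠ 1 := fun h => hσ1 (orderOf_eq_one_iff.1 h)
    have h5 : orderOf σ ≠ 2 := fun h => hσ1 (eq_one_of_mul_self_galois h3 (by
      rw [← pow_two, ← h, pow_orderOf_eq_one]))
    omega
  have hinj : Function.Injective (fun x : Γ × PSL 2 F =>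
      (⟨pslPerm x.2 * galPerm x.1.1, mul_mem (hG.pslPerm_mem _) x.1.2⟩ : G)) := by
    rintro ⟨⟨σ, hσ⟩, t⟩ ⟨⟨τ, hτ⟩, u⟩ h
    have h1 : pslPerm t * galHom σ = pslPerm u * galHom τ := congrArg Subtype.val h
    have h2 : pslPerm (u⁻¹ * t) = galHom (τ * σ⁻¹) := by
      rw [map_mul, map_mul, map_inv, map_inv, inv_mul_eq_iff_eq_mul, ← mul_assoc, ← h1,
        mul_inv_cancel_right]
    obtain ⟨h4, h5⟩ := eq_one_of_smul_eq_galPerm (t := u⁻¹ * t) (σ := τ * σ⁻¹) fun x => by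
      rw [← pslPerm_apply, h2]; rfl
    rw [inv_mul_eq_one] at h4
    rw [mul_inv_eq_one] at h5
    simp [h4, h5]
  have h6 := Nat.card_le_card_of_injective _ hinj
  rw [Nat.card_prod] at h6
  exact (Nat.mul_le_mul_right _ hΓ3).trans h6

theorem IsLineModel.odd_degree_iff_mulEquiv (hG : IsLineModel G) (hF : 3 < Nat.card F)
    (h2 : (2 : F) ≠ 0) : Odd (degree (saxlHypergraph G) ptInf) ↔
      Nat.card F % 4 = 3 ∧ (Nonempty (G ≃* PSL 2 F) ∨ Nonempty (G ≃* PGL 2 F)) := by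
  by_cases hΓ : ∀ σ, galPerm σ ∈ G → σ = 1
  · rw [hG.odd_degree_iff hF h2 hΓ]
    exact ⟨fun h => ⟨h, hG.nonempty_mulEquiv h hΓ⟩, fun h => h.1⟩
  · refine iff_of_false (Nat.not_odd_iff_even.2 (hG.even_degree hF h2 hΓ)) ?_
    rintro ⟨h3, h⟩
    have h1 := hG.three_mul_card_le h3 hΓ
    have h4 := card_pgl_le h3
    have h5 : 0 < Nat.card (PSL 2 F) := Nat.card_pos
    rcases h with ⟨⟨e⟩⟩ | ⟨⟨e⟩⟩ <;> rw [Nat.card_congr e.toEquiv] at h1 <;> omega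

variable {Ω : Type*} {H : Subgroup (Equiv.Perm Ω)} {T : Subgroup H}

/-- A point of Ω is matched with the point of the line that has the same stabiliser in T. The match
is unique because some element fixes only that point of the line, so it is respected by all of the
group. -/
theorem exists_isLineModel (hT : IsAlmostSimpleWithSocle T)
    (htr : MulAction.IsPretransitive T Ω) (φ : T ≃* PSL 2 F) (ω₀ : Ω) (p : ℙ F (Fin 2 → F))
    (hp : ∀ t : PSL 2 F, φ.symm t • ω₀ = ω₀ ↔ t • p = p) :
    ∃ (e : Ω ≃ ℙ F (Fin 2 → F)) (G : Subgroup (Equiv.Perm (ℙ F (Fin 2 → F)))), IsLineModel G ∧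
      (∀ g, g ∈ H ↔ e.permCongr g ∈ G) ∧ Nonempty (H ≃* G) := by
  obtain ⟨Ψ, hinj, hΨT, hΨ⟩ := exists_semilinear_hom hT φ
  let R : Ω → ℙ F (Fin 2 → F) → Prop := fun ω x => ∀ t : T, t • ω = ω ↔ φ t • x = x
  have huniq : ∀ {ω x y}, R ω x → R ω y → x = y := by
    intro ω x y hx hy
    obtain ⟨t, ht⟩ := exists_fixes_iff y
    have h1 := (hy (φ.symm t)).2 (by rw [φ.apply_symm_apply, ht])
    rw [hx, φ.apply_symm_apply, ht] at h1
    exact h1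
  have hRg : ∀ (g : H) ω x, R ω x → R (g • ω) (Ψ g x) := by
    intro g ω x hR t
    have := hT.normal
    have h1 := hR ⟨g⁻¹ * t * g, by simpa using hT.normal.conj_mem t.1 t.2 g⁻¹⟩
    rw [← hΨT] at h1
    simp only [map_mul, Equiv.Perm.mul_apply, map_inv, Equiv.Perm.inv_eq_iff_eq] at h1
    rw [← hΨT, ← h1]
    change (t : H) • g • ω = g • ω ↔ (g⁻¹ * t * g) • ω = ω
    rw [mul_smul, mul_smul, inv_smul_eq_iff]
  have h0 : R ω₀ p := fun t => by rw [← hp, φ.symm_apply_apply]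
  have hex : ∀ ω, ∃ x, R ω x := fun ω => by
    obtain ⟨t, rfl⟩ := MulAction.exists_smul_eq T ω₀ ω
    exact ⟨_, hRg t.1 ω₀ p h0⟩
  choose f hf using hex
  have hfg : ∀ (g : H) ω, f (g • ω) = Ψ g (f ω) := fun g ω => huniq (hf _) (hRg g ω _ (hf ω))
  have hbij : Function.Bijective f := by
    constructor
    · intro ω ω' h
      obtain ⟨t, rfl⟩ := MulAction.exists_smul_eq T ω ω'
      exact ((hf ω t).2 (by rw [← hΨT, ← hfg]; exact h.symm)).symm
    · intro x
      obtain ⟨N, hN⟩ := MulAction.exists_smul_eq (PSL 2 F) (f ω₀) x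
      exact ⟨((φ.symm N : T) : H) • ω₀, by rw [hfg, hΨT, φ.apply_symm_apply, hN]⟩
  have hperm : ∀ g : H, (Equiv.ofBijective f hbij).permCongr g = Ψ g := fun g => by
    refine Equiv.ext fun x => ?_
    obtain ⟨ω, rfl⟩ := hbij.2 x
    rw [← hfg, Equiv.permCongr_apply, Equiv.ofBijective_symm_apply_apply]
    rfl
  refine ⟨Equiv.ofBijective f hbij, Ψ.range, ⟨fun t => ⟨(φ.symm t : T), Equiv.ext fun x => ?_⟩, ?_⟩,
    fun g => ⟨fun hg => ⟨⟨g, hg⟩, (hperm ⟨g, hg⟩).symm⟩, ?_⟩, ⟨MonoidHom.ofInjective hinj⟩⟩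
  · rw [hΨT, φ.apply_symm_apply, pslPerm_apply]
  · rintro _ ⟨g, rfl⟩
    exact hΨ g
  · rintro ⟨h, hh⟩
    rw [← hperm] at hh
    rw [← (Equiv.permCongr _).injective hh]
    exact h.2

end LineGroups

/-! ### The family on the projective line. -/

section Parabolic

variable {Ω : Type*} [Finite Ω] {G : Subgroup (Equiv.Perm Ω)} {T : Subgroup G} {F : Type}
  [Field F] [Finite F]

theorem IsParabolicCase.odd_degree_iff (hprim : MulAction.IsPreprimitive G Ω)
    (h : IsParabolicCase G F T) (v : Ω) : Odd (degree (saxlHypergraph G) v) ↔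
      Nat.card F % 4 = 3 ∧ (Nonempty (G ≃* PSL 2 F) ∨ Nonempty (G ≃* PGL 2 F)) := by
  obtain ⟨hF, _, ⟨p, rfl⟩, hT, ω, φ, hφ⟩ := h
  have htr := hT.isPretransitive hprim
  have h2 : (2 : F) ≠ 0 := by
    intro h2
    have : CharP F 2 := CharTwo.of_one_ne_zero_of_two_eq_zero one_ne_zero h2
    have := card_eq_two_pow (F := F)
    have h3 : Nat.card F ≠ 1 := (Finite.one_lt_card (α := F)).ne'
    rw [this] at h3 hF
    have h0 : Nat.card (F ≃+* F) ≠ 0 := fun h => h3 (by rw [h, pow_zero])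
    exact Nat.not_even_iff_odd.2 hF ((Nat.even_pow.2 ⟨even_two, h0⟩))
  obtain ⟨e, G', hG', hperm, ⟨i⟩⟩ := exists_isLineModel hT htr φ ω p fun t =>
    (symm_smul_eq_iff φ hφ t)
  rw [degree_eq_degree htr v (e.symm ptInf), degree_equiv hperm, e.apply_symm_apply,
    hG'.odd_degree_iff_mulEquiv (hT.three_lt_card φ) h2]
  have h1 : ∀ {S : Type} [Group S], Nonempty (G' ≃* S) ↔ Nonempty (G ≃* S) :=
    ⟨fun ⟨j⟩ => ⟨i.trans j⟩, fun ⟨j⟩ => ⟨i.symm.trans j⟩⟩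
  rw [h1, h1]

end Parabolic

end SaxlHypergraph

namespace SaxlHypergraph

/-! ### Identities in the Frobenius group 13:3. -/

section Frobenius

variable {K : Type*} [Group K] {a c t : K}

/-- The number m is an inverse of k modulo 13, so raising to the power m undoes raising to the power
k. -/
theorem pow_thirteen_cancel (h : a ^ 13 = 1) {k m i : ℕ} (hk : k * m % 13 = 1)
    (hi : a ^ (k * i) = 1) : a ^ i = 1 := by
  have h1 : a ^ (k * i * m) = 1 := by rw [pow_mul, hi, one_pow]
  have h2 : k * i * m = 13 * (k * m / 13 * i) + i := by
    have := Nat.div_add_mod (k * m) 13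
    rw [hk] at this
    calc k * i * m = (k * m) * i := by ring
      _ = (13 * (k * m / 13) + 1) * i := by rw [this]
      _ = _ := by ring
  rwa [h2, pow_add, pow_mul, h, one_pow, one_mul] at h1

theorem conj_pow_eq (hca : c * a * c⁻¹ = a ^ 3) (i : ℕ) : c * a ^ i = a ^ (3 * i) * c := by
  rw [pow_mul, ← hca, conj_pow, inv_mul_cancel_right]

theorem pow_conj_pow_eq (hca : c * a * c⁻¹ = a ^ 3) (j i : ℕ) :
    c ^ j * a ^ i = a ^ (3 ^ j * i) * c ^ j := by
  induction j with
  | zero => simp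
  | succ j ih =>
    rw [pow_succ', mul_assoc, ih, ← mul_assoc, conj_pow_eq hca, mul_assoc, ← mul_assoc 3, pow_succ 3,
      mul_comm 3]

/-- Power maps of a cyclic group commute, so d and its conjugate by an element normalising the
cyclic group act on it alike. -/
theorem conj_conj_eq {d h a : K} {k l : ℕ} (hd : d * a * d⁻¹ = a ^ k) (hh : h⁻¹ * a * h = a ^ l) :
    (h * d * h⁻¹) * a * (h * d * h⁻¹)⁻¹ = a ^ k := by
  have h1 : (h * d * h⁻¹) * a * (h * d * h⁻¹)⁻¹ = h * (d * (h⁻¹ * a * h) * d⁻¹) * h⁻¹ := by group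
  have h2 : h * (h⁻¹ * a * h) * h⁻¹ = a := by group
  rw [h1, hh, ← conj_pow, hd, ← pow_mul, mul_comm k, pow_mul, ← hh, ← conj_pow, h2]

end Frobenius

/-- The two commuting involutions generate a Klein four-group that acts freely on S. -/
theorem four_dvd_ncard_of_involutive {α : Type*} [Finite α] {S : Set α} {σ τ : Equiv.Perm α}
    (hσ : σ * σ = 1) (hτ : τ * τ = 1) (hστ : σ * τ = τ * σ) (hσS : ∀ x ∈ S, σ x ∈ S)
    (hτS : ∀ x ∈ S, τ x ∈ S) (h1 : ∀ x ∈ S, σ x ≠ x) (h2 : ∀ x ∈ S, τ x ≠ x)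
    (h3 : ∀ x ∈ S, σ (τ x) ≠ x) : 4 ∣ S.ncard := by
  have eσ : ∀ x, σ (σ x) = x := fun x => congrArg (fun f : Equiv.Perm α => f x) hσ
  have eτ : ∀ x, τ (τ x) = x := fun x => congrArg (fun f : Equiv.Perm α => f x) hτ
  have eστ : ∀ x, σ (τ x) = τ (σ x) := fun x => congrArg (fun f : Equiv.Perm α => f x) hστ
  have e1 : S.ncard = 2 * ((fun x => ({x, σ x} : Set α)) '' S).ncard := by
    refine ncard_eq_two_mul_image hσS (fun x hx => (h1 x hx).symm) fun x hx y hy => ?_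
    rw [Set.pair_eq_pair_iff]
    constructor
    · rintro (h | h)
      · exact Or.inl h.1
      · exact Or.inr h.1
    · rintro (rfl | rfl)
      · exact Or.inl ⟨rfl, rfl⟩
      · exact Or.inr ⟨rfl, eσ x⟩
  have e2 : ((fun x => ({x, σ x} : Set α)) '' S).ncard =
      2 * ((fun B : Set α => B ∪ τ '' B) '' ((fun x => ({x, σ x} : Set α)) '' S)).ncard := by
    refine ncard_eq_two_mul_image (τ := fun B => τ '' B) ?_ ?_ ?_
    · rintro _ ⟨x, hx, rfl⟩
      exact ⟨τ x, hτS x hx, by simp [Set.image_pair, eστ]⟩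
    · rintro _ ⟨x, hx, rfl⟩ h
      have : x ∈ (τ '' {x, σ x} : Set α) := h ▸ (by simp)
      rw [Set.image_pair] at this
      rcases this with h | h
      · exact h2 x hx h.symm
      · exact h3 x hx ((eστ x).trans h.symm)
    · rintro _ ⟨x, hx, rfl⟩ _ ⟨y, hy, rfl⟩
      simp only [Set.image_pair]
      constructor
      · intro h
        have : y ∈ ({x, σ x} ∪ {τ x, τ (σ x)} : Set α) := h ▸ (by simp)
        rcases this with (h | h) | (h | h) <;> rw [h]
        · exact Or.inl rfl
        · exact Or.inl (by rw [eσ, Set.pair_comm])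
        · exact Or.inr (by rw [eστ])
        · exact Or.inr (by rw [eστ, eσ, Set.pair_comm])
      · rintro (h | h) <;> rw [Set.pair_eq_pair_iff] at h
        · rcases h with ⟨rfl, -⟩ | ⟨rfl, h⟩
          · rfl
          · rw [eσ, Set.pair_comm, Set.pair_comm (τ (σ x))]
        · rcases h with ⟨rfl, -⟩ | ⟨rfl, h⟩
          · rw [eστ, eτ, eτ, Set.union_comm]
          · rw [eστ, eσ, eτ, eτ, Set.union_comm, Set.pair_comm, Set.pair_comm (τ (σ x))]
  omega

/-! ### Parity from an outer involution of a Frobenius point stabiliser. -/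

section Singer

variable {Ω : Type*} [Finite Ω] {G : Subgroup (Equiv.Perm Ω)} {T : Subgroup G} {v : Ω} {a c t : G}

-- If g fixes v, x and tx, then g and tgt both fix x. Since t inverts a and centralises c, comparing
-- these two elements leaves a power of a fixing x, so g involves only c and t. Hence {v, x, tx}
-- with tx ≠ x is a base exactly when c moves x, and the points counted are those outside Fix(t) and
-- outside the points fixed by c but not by t.
set_option maxHeartbeats 1000000 in
theorem even_degree_of_singer (hTi : T.index = 2)
    (hstab : ∀ g ∈ T, g • v = v → ∃ i j : ℕ, g = a ^ i * c ^ j)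
    (hav : a • v = v) (hcv : c • v = v) (htv : t • v = v)
    (ha : a ^ 13 = 1) (ha1 : a ≠ 1) (hc : c ^ 3 = 1) (hc1 : c ≠ 1) (hca : c * a * c⁻¹ = a ^ 3)
    (htT : t ∉ T) (ht2 : t * t = 1) (htc : t * c = c * t) (hta : t * a * t⁻¹ = a⁻¹)
    (hfree : ∀ (i : ℕ) (x : Ω), x ≠ v → a ^ i • x = x → a ^ i = 1)
    (h4 : 4 ∣ Nat.card Ω) (h4t : 4 ∣ {x : Ω | t • x = x}.ncard)
    (h4c : 4 ∣ {x : Ω | c • x = x ∧ t • x ≠ x}.ncard) : Even (degree (saxlHypergraph G) v) := by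
  have ht1 : t ≠ 1 := fun h => htT (h ▸ one_mem T)
  have htt : ∀ x : Ω, t • t • x = x := fun x => by rw [smul_smul, ht2, one_smul]
  have htai : ∀ i : ℕ, t * a ^ i = (a ^ i)⁻¹ * t := fun i => by
    rw [← inv_pow, ← hta, conj_pow, inv_mul_cancel_right]
  have htcj : ∀ j : ℕ, t * c ^ j = c ^ j * t := fun j =>
    ((show Commute t c from htc).pow_right j).eq
  have hcj : ∀ (j : ℕ) (x : Ω), c • x ≠ x → c ^ j • x = x → c ^ j = 1 := by
    intro j x hx h
    have h1 : c ^ j = c ^ (j % 3) := pow_eq_pow_mod j hc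
    rw [h1] at h ⊢
    have h2 : j % 3 < 3 := Nat.mod_lt _ (by norm_num)
    interval_cases j % 3
    · simp
    · rw [pow_one] at h; exact absurd h hx
    · refine absurd ?_ hx
      have h3 : c = c ^ 2 * c ^ 2 := by
        rw [← pow_add, show 2 + 2 = 3 + 1 from rfl, pow_succ, hc, one_mul]
      rw [h3, mul_smul, h, h]
  -- the base triples fixed by `t`
  have hbase : ∀ x : Ω, t • x ≠ x →
      (IsBase G {v, x, (t : Equiv.Perm Ω) x} ↔ c • x ≠ x) := by
    intro x htx
    have hxv : x ≠ v := fun h => htx (h ▸ htv)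
    rw [isBase_iff]
    constructor
    · intro h hcx
      refine hc1 (Subtype.ext (h c c.2 ?_))
      rintro y (rfl | rfl | rfl)
      · exact hcv
      · exact hcx
      · change c • t • x = t • x
        rw [smul_smul, ← htc, mul_smul, hcx]
    · intro hcx g' hg' hgx
      set g : G := ⟨g', hg'⟩ with hgdef
      have g1 : g • v = v := hgx v (by simp)
      have g2 : g • x = x := hgx x (by simp)
      have g3 : g • t • x = t • x := hgx ((t : Equiv.Perm Ω) x) (by simp)
      suffices g = 1 from congrArg Subtype.val this
      have g4 : (t * g * t) • x = x := by rw [mul_smul, mul_smul, g3, htt]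
      by_cases hgT : g ∈ T
      · obtain ⟨i, j, hij⟩ := hstab g hgT g1
        -- The part involving a is inverted by t, so g (tgt)⁻¹ is the square of that part.
        have h1 : a ^ (2 * i) • x = x := by
          have : a ^ (2 * i) = g * (t * g * t)⁻¹ := by
            have h5 : t * g * t = (a ^ i)⁻¹ * c ^ j := by
              rw [hij, ← mul_assoc, htai, mul_assoc, mul_assoc, ← htcj, ← mul_assoc t, ht2, one_mul]
            rw [h5, hij, mul_inv_rev, inv_inv, mul_assoc, mul_inv_cancel_left, ← pow_add, two_mul]
          rw [this, mul_smul, inv_smul_eq_iff.2 g4.symm, g2]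
        have h2 := pow_thirteen_cancel ha (k := 2) (m := 7) rfl (hfree _ x hxv h1)
        rw [h2, one_mul] at hij
        rw [hij] at g2 ⊢
        exact hcj j x hcx g2
      · have hgt : g * t ∈ T := (Subgroup.mul_mem_iff_of_index_two hTi).2 (by simp [hgT, htT])
        obtain ⟨i, j, hij⟩ := hstab (g * t) hgt (by rw [mul_smul, htv, g1])
        have hg : g = a ^ i * c ^ j * t := by rw [← hij, mul_assoc, ht2, mul_one]
        have h1 : a ^ (2 * i) • x = x := by
          have : a ^ (2 * i) = g * (t * g * t)⁻¹ := by
            have h5 : t * g * t = (a ^ i)⁻¹ * c ^ j * t := by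
              rw [hg, mul_assoc t, mul_assoc (a ^ i * c ^ j), ht2, mul_one, ← mul_assoc, htai,
                mul_assoc, htcj, mul_assoc]
            rw [h5, hg, mul_inv_rev, mul_inv_rev, inv_inv, two_mul, pow_add]
            group
          rw [this, mul_smul, inv_smul_eq_iff.2 g4.symm, g2]
        have h2 := pow_thirteen_cancel ha (k := 2) (m := 7) rfl (hfree _ x hxv h1)
        rw [h2, one_mul] at hg
        -- In this case g is a power of c times t. Its square is a power of c fixing x, hence
        -- trivial, so g = t; but t moves x.
        have h6 : c ^ (j + j) • x = x := by
          have : c ^ (j + j) = g * g := by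
            rw [hg, mul_assoc, ← mul_assoc t, htcj, mul_assoc (c ^ j) t t, ht2, mul_one, pow_add]
          rw [this, mul_smul, g2, g2]
        have h7 := hcj _ x hcx h6
        have h8 : c ^ j = 1 := by
          have : c ^ j = c ^ (j + j) * c ^ (j + j) * (c ^ 3)⁻¹ ^ j := by
            rw [inv_pow, eq_mul_inv_iff_mul_eq, ← pow_mul, ← pow_add, ← pow_add]
            congr 1
            ring
          rw [this, h7, hc]
          simp
        rw [hg, h8, one_mul] at g2
        exact absurd g2 htx
  have htne : ∀ B : Set Ω, (∀ x ∈ B, t • x = x) → ¬ IsBase G B := fun B hB h =>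
    ht1 (Subtype.ext (isBase_iff.1 h t t.2 hB))
  have ht2' : (t : Equiv.Perm Ω) * t = 1 := congrArg Subtype.val ht2
  -- a base of size three
  obtain ⟨x, hx⟩ : ∃ x : Ω, t • x ≠ x ∧ c • x ≠ x := by
    by_contra! hall
    have h1 : Nat.card Ω ≠ 1 := by omega
    have hpos : 0 < Nat.card Ω := Nat.card_pos_iff.2 ⟨⟨v⟩, inferInstance⟩
    have : Nontrivial Ω := Finite.one_lt_card_iff_nontrivial.1 (by omega)
    obtain ⟨x, hx⟩ := exists_ne v
    -- An element d that fixed two of the points x, ax, a^2x would give a non-trivial commutator in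
    -- ⟨a⟩ with a fixed point other than v. If each of the three points were fixed by t or by c, one
    -- of these elements would fix two of them.
    have key : ∀ (d : G), (∀ i : ℕ, i = 1 ∨ i = 2 → ∃ k : ℕ, 
        (a ^ i)⁻¹ * d⁻¹ * a ^ i * d = a ^ k ∧ a ^ k ≠ 1) → ∀ i j : ℕ, i < j → j < 3 →
        d • a ^ i • x = a ^ i • x → d • a ^ j • x ≠ a ^ j • x := by
      intro d hd i j hij hj h1 h2
      have hy : a ^ i • x ≠ v := fun h => hx (by
        have := congrArg (fun y => (a ^ i)⁻¹ • y) h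
        simp only [inv_smul_smul] at this
        rw [this, inv_smul_eq_iff]
        clear * - hav
        induction i with
        | zero => simp
        | succ i ih => rw [pow_succ, mul_smul, hav, ← ih])
      obtain ⟨k, hk, hk1⟩ := hd (j - i) (by omega)
      refine hk1 (hfree k (a ^ i • x) hy ?_)
      have h3 : a ^ (j - i) • a ^ i • x = a ^ j • x := by
        rw [smul_smul, ← pow_add, Nat.sub_add_cancel hij.le]
      rw [← hk, mul_smul, mul_smul, mul_smul, h1, h3, inv_smul_eq_iff.2 h2.symm, ← h3,
        inv_smul_smul]
    -- Modulo 13, 12 stands for -1, and 9 = 3^2 is the exponent by which the inverse of c, which is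
    -- c^2, acts.
    have hkc := key c fun i hi => ⟨(12 * i) + 9 * i, by
      have h5 : c⁻¹ * a ^ i * c = a ^ (9 * i) := by
        have h6 := pow_conj_pow_eq hca 2 i
        have h7 : c ^ 2 = c⁻¹ := eq_inv_of_mul_eq_one_left (by rw [← pow_succ, hc])
        rw [h7] at h6
        rw [h6]
        norm_num
      rw [mul_assoc, mul_assoc, ← mul_assoc (c⁻¹), h5, pow_add]
      congr 1
      rw [inv_eq_iff_mul_eq_one, ← pow_add, show i + 12 * i = 13 * i by ring, pow_mul, ha, one_pow], by
      intro h
      rw [show 12 * i + 9 * i = 21 * i by ring] at h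
      have h6 := pow_thirteen_cancel ha (k := 21) (m := 5) rfl h
      rcases hi with rfl | rfl
      · exact ha1 (by simpa using h6)
      · exact ha1 (by simpa using pow_thirteen_cancel (i := 1) ha (k := 2) (m := 7) rfl h6)⟩
    -- Modulo 13, 11 stands for -2, as t inverts a.
    have hkt := key t fun i hi => ⟨11 * i, by
      have h5 : t⁻¹ = t := inv_eq_of_mul_eq_one_left ht2
      rw [h5, mul_assoc _ t, htai, mul_assoc, mul_assoc, ht2, mul_one, ← mul_inv_rev, ← pow_add,
        inv_eq_iff_mul_eq_one, ← pow_add, show i + i + 11 * i = 13 * i by ring, pow_mul, ha,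
        one_pow], by
      intro h
      have h6 := pow_thirteen_cancel ha (k := 11) (m := 6) rfl h
      rcases hi with rfl | rfl
      · exact ha1 (by simpa using h6)
      · exact ha1 (by simpa using pow_thirteen_cancel (i := 1) ha (k := 2) (m := 7) rfl h6)⟩
    have e0 := hall (a ^ 0 • x)
    have e1 := hall (a ^ 1 • x)
    have e2 := hall (a ^ 2 • x)
    have c01 := hkc 0 1 (by norm_num) (by norm_num)
    have c02 := hkc 0 2 (by norm_num) (by norm_num)
    have c12 := hkc 1 2 (by norm_num) (by norm_num)
    have t01 := hkt 0 1 (by norm_num) (by norm_num)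
    have t02 := hkt 0 2 (by norm_num) (by norm_num)
    have t12 := hkt 1 2 (by norm_num) (by norm_num)
    by_cases f0 : t • a ^ 0 • x = a ^ 0 • x
    · exact c12 (e1 (t01 f0)) (e2 (t02 f0))
    · by_cases f1 : t • a ^ 1 • x = a ^ 1 • x
      · exact c02 (e0 f0) (e2 (t12 f1))
      · exact c01 (e0 f0) (e1 f1)
  have hb3 : baseSize G ≤ 3 :=
    (baseSize_le ((hbase x hx.1).2 hx.2)).trans (ncard_triple_le _ _ _)
  -- A t-invariant edge through v with fewer than three points would be fixed pointwise by t and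
  -- could not be a base.
  rcases hb3.lt_or_eq with hb | hb
  · refine even_degree_of_no_fixed_edge (normalizes_of_mem t.2) ht2' htv ?_
    rintro e ⟨-, he, hcard⟩ hve hte
    refine htne e (fun y hy => ?_) he
    by_contra hty
    have h1 : (t : Equiv.Perm Ω) y ∈ e := hte ▸ ⟨y, hy, rfl⟩
    have hyv : y ≠ v := fun h => hty (h ▸ htv)
    have h2 : t • y ≠ v := fun h => hyv (by rw [← htt y, h, htv])
    have h3 : 3 ≤ e.ncard := by
      have h5 : ({v, y, t • y} : Set Ω).ncard = 3 :=
        Set.ncard_eq_three.2 ⟨v, y, t • y, hyv.symm, h2.symm, fun h => hty h.symm, rfl⟩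
      rw [← h5]
      refine Set.ncard_le_ncard ?_
      rintro z (rfl | rfl | rfl) <;> assumption
    omega
  · rw [← Nat.not_odd_iff_even, odd_degree_iff (normalizes_of_mem t.2) ht2' htv hb fun x y hx hy _ _ _ =>
      htne _ (by rintro z (rfl | rfl | rfl) <;> assumption)]
    have h1 : {x | (t : Equiv.Perm Ω) x ≠ x ∧ IsBase G {v, x, (t : Equiv.Perm Ω) x}} =
        ({x : Ω | t • x = x} ∪ {x : Ω | c • x = x ∧ t • x ≠ x})ᶜ := by
      ext x
      simp only [Set.mem_compl_iff, Set.mem_union, not_or]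
      constructor
      · rintro ⟨h, hB⟩
        exact ⟨h, fun h' => (hbase x h).1 hB h'.1⟩
      · rintro ⟨h, h'⟩
        exact ⟨h, (hbase x h).2 fun hc => h' ⟨hc, h⟩⟩
    rw [h1, Set.ncard_compl, Set.ncard_union_eq (Set.disjoint_left.2 fun x hx hx' => hx'.2 hx)]
    omega

end Singer

end SaxlHypergraph

namespace SaxlHypergraph

/-! ### Semidihedral groups of order 16. -/

section Semidihedral

variable {K : Type*} [Group K]

/-- The subgroup `R` is generated by `x` of order eight and an involution `u` with `u x u = x ^ 3`. -/
structure IsSemidihedral (R : Subgroup K) (x u : K) : Prop where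
  orderOf_eq : orderOf x = 8
  mul_self : u * u = 1
  conj_eq : u * x * u = x ^ 3
  mem_iff : ∀ q, q ∈ R ↔ q ∈ Subgroup.zpowers x ∨ q * u ∈ Subgroup.zpowers x

theorem mul_zpow_of_conj {x u : K} (hu : u * u = 1) (hux : u * x * u = x ^ 3) (i : ℤ) :
    u * x ^ i = x ^ (3 * i) * u := by
  have h1 : u⁻¹ = u := inv_eq_of_mul_eq_one_left hu
  have h2 : u * x * u⁻¹ = x ^ (3 : ℤ) := by rw [h1, hux]; norm_cast
  rw [zpow_mul, ← h2, conj_zpow, inv_mul_cancel_right]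

theorem not_mem_zpowers_of_conj {x u : K} (hx : orderOf x = 8) (hu : u * u = 1)
    (hux : u * x * u = x ^ 3) : u ∉ Subgroup.zpowers x := by
  intro h
  obtain ⟨i, rfl⟩ := Subgroup.mem_zpowers_iff.1 h
  have h1 : x ^ i * x = x * x ^ i := by rw [← zpow_add_one, ← zpow_one_add, add_comm]
  rw [h1, mul_assoc, hu, mul_one] at hux
  have h2 : x ^ 2 = 1 := by
    have : x * x ^ 2 = x * 1 := by rw [← pow_succ', ← hux, mul_one]
    exact mul_left_cancel this
  have h3 := orderOf_dvd_of_pow_eq_one h2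
  rw [hx] at h3
  omega

/-- The semidihedral subgroup generated by `x` and `u`. -/
def semidihedral {x u : K} (hu : u * u = 1) (hux : u * x * u = x ^ 3) : Subgroup K where
  carrier := {q | q ∈ Subgroup.zpowers x ∨ q * u ∈ Subgroup.zpowers x}
  one_mem' := Or.inl (one_mem _)
  mul_mem' := by
    have key : ∀ q : K, q * u ∈ Subgroup.zpowers x → ∃ i : ℤ, q = x ^ i * u := by
      intro q hq
      obtain ⟨i, hi⟩ := Subgroup.mem_zpowers_iff.1 hq
      exact ⟨i, by rw [hi, mul_assoc, hu, mul_one]⟩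
    rintro p q (hp | hp) (hq | hq)
    · exact Or.inl (mul_mem hp hq)
    · exact Or.inr (by rw [mul_assoc]; exact mul_mem hp hq)
    · obtain ⟨i, rfl⟩ := key p hp
      obtain ⟨j, rfl⟩ := Subgroup.mem_zpowers_iff.1 hq
      refine Or.inr ?_
      rw [mul_assoc (x ^ i), mul_zpow_of_conj hu hux, mul_assoc, mul_assoc, hu, mul_one, ← zpow_add]
      exact Subgroup.mem_zpowers_iff.2 ⟨_, rfl⟩
    · obtain ⟨i, rfl⟩ := key p hp
      obtain ⟨j, rfl⟩ := key q hq
      refine Or.inl ?_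
      rw [mul_assoc (x ^ i), ← mul_assoc u, mul_zpow_of_conj hu hux, mul_assoc, hu, mul_one,
        ← zpow_add]
      exact Subgroup.mem_zpowers_iff.2 ⟨_, rfl⟩
  inv_mem' := by
    rintro q (hq | hq)
    · exact Or.inl (inv_mem hq)
    · obtain ⟨i, hi⟩ := Subgroup.mem_zpowers_iff.1 hq
      have h1 : q = x ^ i * u := by rw [hi, mul_assoc, hu, mul_one]
      refine Or.inr ?_
      rw [h1, mul_inv_rev, ← zpow_neg, inv_eq_of_mul_eq_one_left hu, mul_zpow_of_conj hu hux,
        mul_assoc, hu, mul_one]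
      exact Subgroup.mem_zpowers_iff.2 ⟨_, rfl⟩

theorem isSemidihedral_semidihedral {x u : K} (hx : orderOf x = 8) (hu : u * u = 1)
    (hux : u * x * u = x ^ 3) : IsSemidihedral (semidihedral hu hux) x u :=
  ⟨hx, hu, hux, fun _ => Iff.rfl⟩

theorem IsSemidihedral.card_eq [Finite K] {R : Subgroup K} {x u : K} (h : IsSemidihedral R x u) :
    Nat.card R = 16 := by
  have h1 : (R : Set K) = (Subgroup.zpowers x : Set K) ∪ (fun q => q * u) '' Subgroup.zpowers x := by
    ext q
    rw [Set.mem_union, SetLike.mem_coe, h.mem_iff, SetLike.mem_coe]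
    refine or_congr Iff.rfl ⟨fun hq => ⟨q * u, hq, by simp [mul_assoc, h.mul_self]⟩, ?_⟩
    rintro ⟨y, hy, rfl⟩
    simpa [mul_assoc, h.mul_self] using hy
  have h2 : Nat.card R = (R : Set K).ncard := rfl
  have h3 : (Subgroup.zpowers x : Set K).ncard = 8 := by
    rw [← h.orderOf_eq, ← Nat.card_zpowers]; rfl
  rw [h2, h1, Set.ncard_union_eq, Set.ncard_image_of_injective _ (mul_left_injective u), h3]
  rw [Set.disjoint_left]
  rintro _ hq ⟨y, hy, rfl⟩
  refine not_mem_zpowers_of_conj h.orderOf_eq h.mul_self h.conj_eq ?_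
  have := mul_mem (inv_mem hy) hq
  rwa [inv_mul_cancel_left] at this

theorem IsSemidihedral.map {K' : Type*} [Group K'] {R : Subgroup K} {x u : K}
    (h : IsSemidihedral R x u) (f : K →* K') (hf : Function.Injective f) :
    IsSemidihedral (R.map f) (f x) (f u) := by
  refine ⟨by rw [orderOf_injective f hf, h.orderOf_eq], by rw [← map_mul, h.mul_self, map_one],
    by rw [← map_mul, ← map_mul, h.conj_eq, map_pow], fun q => ?_⟩
  rw [← MonoidHom.map_zpowers, Subgroup.mem_map, Subgroup.mem_map, Subgroup.mem_map]
  constructor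
  · rintro ⟨y, hy, rfl⟩
    rcases (h.mem_iff y).1 hy with hy | hy
    · exact Or.inl ⟨y, hy, rfl⟩
    · exact Or.inr ⟨_, hy, map_mul _ _ _⟩
  · rintro (⟨y, hy, rfl⟩ | ⟨y, hy, hq⟩)
    · exact ⟨y, (h.mem_iff y).2 (Or.inl hy), rfl⟩
    · refine ⟨y * u, (h.mem_iff _).2 (Or.inr (by rwa [mul_assoc, h.mul_self, mul_one])), ?_⟩
      rw [map_mul, hq, mul_assoc, ← map_mul, h.mul_self, map_one, mul_one]

/-- Both subgroups are Sylow 2-subgroups, hence conjugate. -/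
theorem IsSemidihedral.exists_of_card_eq [Finite K] {R R' : Subgroup K} {x u : K} {m : ℕ}
    (h : IsSemidihedral R x u) (hK : Nat.card K = 16 * m) (hm : Odd m) (hR : Nat.card R' = 16) :
    ∃ x' u', IsSemidihedral R' x' u' := by
  have hf : (Nat.card K).factorization 2 = 4 := by
    rw [hK, show 16 = 2 ^ 4 from rfl, Nat.factorization_mul (by norm_num) hm.pos.ne',
      Nat.Prime.factorization_pow Nat.prime_two]
    simp [Nat.factorization_eq_zero_of_not_dvd hm.not_two_dvd_nat]
  have : Fact (Nat.Prime 2) := ⟨Nat.prime_two⟩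
  obtain ⟨g, hg⟩ := MulAction.exists_smul_eq K (Sylow.ofCard (p := 2) R (by rw [hf, h.card_eq]; rfl))
    (Sylow.ofCard (p := 2) R' (by rw [hf, hR]; rfl))
  have h1 := h.map (MulAut.conj g).toMonoidHom (MulAut.conj g).injective
  have h2 : R.map (MulAut.conj g).toMonoidHom = R' :=
    congrArg (fun P : Sylow 2 K => (P : Subgroup K)) hg
  exact ⟨_, _, h2 ▸ h1⟩

end Semidihedral

/-! ### Centralisers in a semidihedral group. -/

section Centralizer

variable {K : Type*} [Group K] [Finite K]

/-- The map q ↦ (t q t⁻¹) q⁻¹ on R takes values in ⟨x^2⟩, of order four, and its fibres are cosets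
of the centraliser of t in R. With |R| = 16 the centraliser has at least four elements, and its
order is a power of two. -/
theorem IsSemidihedral.four_dvd_card {R : Subgroup K} {x u t : K} (h : IsSemidihedral R x u)
    (ht : ∀ q ∈ R, t * q * t⁻¹ ∈ R) : 4 ∣ Nat.card (R ⊓ Subgroup.centralizer {t} : Subgroup K) := by
  have hxR : x ∈ R := (h.mem_iff x).2 (Or.inl (Subgroup.mem_zpowers x))
  have huR : u ∈ R := (h.mem_iff u).2 (Or.inr (by rw [h.mul_self]; exact one_mem _))
  have key : ∀ q ∈ R, q ∉ Subgroup.zpowers x → ∃ i : ℤ, q = x ^ i * u ∧ q * q = x ^ (4 * i) := by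
    intro q hq hq'
    obtain ⟨i, hi⟩ := Subgroup.mem_zpowers_iff.1 (((h.mem_iff q).1 hq).resolve_left hq')
    have h1 : q = x ^ i * u := by rw [hi, mul_assoc, h.mul_self, mul_one]
    refine ⟨i, h1, ?_⟩
    rw [h1, mul_assoc (x ^ i), ← mul_assoc u, mul_zpow_of_conj h.mul_self h.conj_eq, mul_assoc,
      h.mul_self, mul_one, ← zpow_add]
    congr 1
    ring
  have hx8 : ∀ i : ℤ, x ^ i = 1 ↔ (8 : ℤ) ∣ i := fun i => by
    rw [← orderOf_dvd_iff_zpow_eq_one, h.orderOf_eq]; rfl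
  have hconj : ∀ i : ℤ, t * x ^ i * t⁻¹ = (t * x * t⁻¹) ^ i := fun i => (conj_zpow).symm
  -- the image of `x`
  have hx : t * x * t⁻¹ ∈ Subgroup.zpowers x := by
    by_contra hc
    obtain ⟨i, hi, hi'⟩ := key _ (ht x hxR) hc
    have h1 : (t * x * t⁻¹) ^ (4 : ℤ) = x ^ (8 * i) := by
      rw [show (4 : ℤ) = 2 * 2 from rfl, zpow_mul, zpow_two (t * x * t⁻¹), hi', ← zpow_mul]
      congr 1
      ring
    rw [(hx8 _).2 (dvd_mul_right _ _), ← hconj, mul_inv_eq_one, mul_eq_left, hx8] at h1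
    omega
  obtain ⟨i, hi⟩ := Subgroup.mem_zpowers_iff.1 hx
  have hi2 : Odd i := by
    rw [← Int.not_even_iff_odd]
    rintro ⟨k, rfl⟩
    have h1 : t * x ^ (4 : ℤ) * t⁻¹ = 1 := by
      rw [hconj, ← hi, ← zpow_mul, hx8]
      omega
    rw [mul_inv_eq_one, mul_eq_left, hx8] at h1
    omega
  -- the image of `u`
  obtain ⟨j, hj, hj'⟩ := key _ (ht u huR) fun hc => by
    obtain ⟨k, hk⟩ := Subgroup.mem_zpowers_iff.1 hc
    have h1 : (t * u * t⁻¹) * (t * x * t⁻¹) = (t * x * t⁻¹) * (t * u * t⁻¹) := by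
      rw [← hi, ← hk, ← zpow_add, ← zpow_add, add_comm]
    have h2 : u * x = x * u := by
      have h2 : t * (u * x) * t⁻¹ = t * (x * u) * t⁻¹ := by
        simpa [mul_assoc] using h1
      exact mul_left_cancel (mul_right_cancel h2)
    have h3 := h.conj_eq
    rw [h2, mul_assoc, h.mul_self, mul_one] at h3
    have h4 : x ^ (2 : ℤ) = 1 := by
      have : x * x ^ 2 = x * 1 := by rw [← pow_succ', ← h3, mul_one]
      exact_mod_cast mul_left_cancel this
    rw [hx8] at h4
    omega
  -- The image x^j u of u is again an involution, and its square is x^(4j).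
  have hj2 : (2 : ℤ) ∣ j := by
    have h1 : (t * u * t⁻¹) * (t * u * t⁻¹) = 1 := by
      rw [conj_mul, h.mul_self, mul_one, mul_inv_cancel]
    rw [hj', hx8] at h1
    omega
  have hf : ∀ q ∈ R, t * q * t⁻¹ * q⁻¹ ∈ Subgroup.zpowers (x ^ (2 : ℤ)) := by
    intro q hq
    obtain ⟨k, hk⟩ := hi2
    by_cases hqx : q ∈ Subgroup.zpowers x
    · obtain ⟨l, rfl⟩ := Subgroup.mem_zpowers_iff.1 hqx
      refine Subgroup.mem_zpowers_iff.2 ⟨k * l, ?_⟩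
      rw [hconj, ← hi, ← zpow_mul, ← zpow_mul, ← zpow_neg, ← zpow_add, hk]
      congr 1
      ring
    · obtain ⟨l, hl, -⟩ := key q hq hqx
      obtain ⟨m, hm⟩ := hj2
      refine Subgroup.mem_zpowers_iff.2 ⟨k * l + m, ?_⟩
      have h1 : t * q * t⁻¹ = x ^ (i * l) * (x ^ j * u) := by
        rw [← hj, zpow_mul, hi, conj_zpow, hl]
        group
      rw [h1, hl, mul_inv_rev, inv_eq_of_mul_eq_one_left h.mul_self, mul_assoc, mul_assoc,
        ← mul_assoc u, h.mul_self, one_mul, ← zpow_neg, ← zpow_add, ← zpow_add, ← zpow_mul, hk, hm]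
      congr 1
      ring
  set H : Subgroup K := R ⊓ Subgroup.centralizer {t}
  have hH16 : Nat.card H ∣ 2 ^ 4 := by
    have := Subgroup.card_dvd_of_le (inf_le_left : H ≤ R)
    rwa [h.card_eq] at this
  obtain ⟨k, hk, hHk⟩ := (Nat.dvd_prime_pow Nat.prime_two).1 hH16
  have h4 : (Subgroup.zpowers (x ^ (2 : ℤ)) : Set K).ncard = 4 := by
    have h1 : (Subgroup.zpowers (x ^ (2 : ℤ)) : Set K).ncard = orderOf (x ^ (2 : ℤ)) := by
      rw [← Nat.card_zpowers]; rfl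
    rw [h1, show x ^ (2 : ℤ) = x ^ 2 from by norm_cast, orderOf_pow, h.orderOf_eq]
    rfl
  by_cases hk2 : 2 ≤ k
  · rw [hHk]
    exact pow_dvd_pow 2 hk2
  exfalso
  have hH2 : Nat.card H ≤ 2 := by
    rw [hHk]
    calc 2 ^ k ≤ 2 ^ 1 := Nat.pow_le_pow_right (by norm_num) (by omega)
      _ = 2 := rfl
  classical
  have hle := Finset.card_le_mul_card_image (f := fun q => t * q * t⁻¹ * q⁻¹)
    (R : Set K).toFinite.toFinset 2 (by
      intro b hb
      obtain ⟨p, hp, rfl⟩ := Finset.mem_image.1 hb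
      rw [Set.Finite.mem_toFinset, SetLike.mem_coe] at hp
      rw [← Set.ncard_coe_finset]
      calc _ ≤ ((fun y => p * y) '' (H : Set K)).ncard := by
            refine Set.ncard_le_ncard ?_
            intro q hq
            simp only [Finset.coe_filter, Set.Finite.mem_toFinset, SetLike.mem_coe,
              Set.mem_setOf_eq] at hq
            refine ⟨p⁻¹ * q, Subgroup.mem_inf.2 ⟨mul_mem (inv_mem hp) hq.1, ?_⟩,
              mul_inv_cancel_left _ _⟩
            rw [Subgroup.mem_centralizer_singleton_iff]
            have h5 : t * q * t⁻¹ = t * p * t⁻¹ * p⁻¹ * q := by rw [← hq.2, inv_mul_cancel_right]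
            have h6 : t * (p⁻¹ * q) = (t * p * t⁻¹)⁻¹ * (t * q * t⁻¹) * t := by group
            rw [h6, h5]
            group
        _ = (H : Set K).ncard := Set.ncard_image_of_injective _ (mul_right_injective p)
        _ ≤ 2 := hH2)
  rw [← Set.ncard_coe_finset, ← Set.ncard_coe_finset, Set.Finite.coe_toFinset] at hle
  have h7 : ((Finset.image (fun q => t * q * t⁻¹ * q⁻¹) (R : Set K).toFinite.toFinset : Finset K) :
      Set K).ncard ≤ 4 := by
    rw [← h4]
    refine Set.ncard_le_ncard ?_
    intro b hb
    obtain ⟨p, hp, rfl⟩ := Finset.mem_image.1 (Finset.mem_coe.1 hb)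
    exact hf p (by simpa using hp)
  have h8 : (R : Set K).ncard = 16 := h.card_eq
  omega

end Centralizer

end SaxlHypergraph

namespace SaxlHypergraph

/-! ### The arithmetic of a Singer normaliser 13:3. -/

section Singer

variable {K : Type*} [Group K]

/-- The subgroup `B` of `T` is a Frobenius group `13:3` generated by `a` and `c`, embedded in `T` in
the way a Singer normaliser is embedded in `SL_3(3)`. -/
structure IsSingerPair (T B : Subgroup K) (a c : K) : Prop where
  le : B ≤ T
  mem_iff : ∀ g, g ∈ B ↔ ∃ i j : ℕ, g = a ^ i * c ^ j
  pow_a : a ^ 13 = 1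
  a_ne_one : a ≠ 1
  pow_c : c ^ 3 = 1
  c_ne_one : c ≠ 1
  conj : c * a * c⁻¹ = a ^ 3
  mem_of_normalizes : ∀ h ∈ T, (∃ k : ℕ, h⁻¹ * a * h = a ^ k) → h ∈ B
  pow_of_commute : ∀ g ∈ T, g * c = c * g → g ^ 3 = 1
  exists_inverting : ∃ s ∈ T, s * s = 1 ∧ s * c * s⁻¹ = c⁻¹
  exists_semidihedral : ∃ (R : Subgroup K) (x u : K), R ≤ T ∧ IsSemidihedral R x u

namespace IsSingerPair

variable {T B : Subgroup K} {a c : K}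

theorem map {K' : Type*} [Group K'] (h : IsSingerPair T B a c) (f : K →* K')
    (hf : Function.Injective f) : IsSingerPair (T.map f) (B.map f) (f a) (f c) where
  le := Subgroup.map_mono h.le
  mem_iff g := by
    rw [Subgroup.mem_map]
    constructor
    · rintro ⟨y, hy, rfl⟩
      obtain ⟨i, j, rfl⟩ := (h.mem_iff y).1 hy
      exact ⟨i, j, by simp⟩
    · rintro ⟨i, j, rfl⟩
      exact ⟨_, (h.mem_iff _).2 ⟨i, j, rfl⟩, by simp⟩
  pow_a := by rw [← map_pow, h.pow_a, map_one]
  a_ne_one := (map_ne_one_iff f hf).2 h.a_ne_one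
  pow_c := by rw [← map_pow, h.pow_c, map_one]
  c_ne_one := (map_ne_one_iff f hf).2 h.c_ne_one
  conj := by rw [← map_inv, ← map_mul, ← map_mul, h.conj, map_pow]
  mem_of_normalizes := by
    rintro _ ⟨y, hy, rfl⟩ ⟨k, hk⟩
    refine Subgroup.mem_map_of_mem f (h.mem_of_normalizes y hy ⟨k, hf ?_⟩)
    simpa using hk
  pow_of_commute := by
    rintro _ ⟨y, hy, rfl⟩ hc
    rw [← map_pow, h.pow_of_commute y hy (hf (by simpa using hc)), map_one]
  exists_inverting := by
    obtain ⟨s, hs, h1, h2⟩ := h.exists_inverting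
    refine ⟨f s, Subgroup.mem_map_of_mem f hs, by rw [← map_mul, h1, map_one], ?_⟩
    rw [← map_inv, ← map_inv, ← map_mul, ← map_mul, h2]
  exists_semidihedral := by
    obtain ⟨R, x, u, hR, h1⟩ := h.exists_semidihedral
    exact ⟨_, _, _, Subgroup.map_mono hR, h1.map f hf⟩

theorem a_mem (h : IsSingerPair T B a c) : a ∈ B := (h.mem_iff a).2 ⟨1, 0, by simp⟩

theorem c_mem (h : IsSingerPair T B a c) : c ∈ B := (h.mem_iff c).2 ⟨0, 1, by simp⟩

theorem orderOf_a (h : IsSingerPair T B a c) : orderOf a = 13 :=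
  have : Fact (Nat.Prime 13) := ⟨by norm_num⟩
  orderOf_eq_prime h.pow_a h.a_ne_one

theorem pow_eq_pow_iff (h : IsSingerPair T B a c) (m n : ℕ) : a ^ m = a ^ n ↔ m ≡ n [MOD 13] := by
  rw [pow_eq_pow_iff_modEq, h.orderOf_a]

theorem pow_three_mem (h : IsSingerPair T B a c) {y : K} (hy : y ∈ B) : ∃ k : ℕ, y ^ 3 = a ^ k := by
  obtain ⟨i, j, rfl⟩ := (h.mem_iff y).1 hy
  refine ⟨i + 3 ^ j * (i + 3 ^ j * i), ?_⟩
  have h1 : c ^ j * c ^ j * c ^ j = 1 := by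
    rw [← pow_add, ← pow_add, show j + j + j = 3 * j by ring, pow_mul, h.pow_c, one_pow]
  have e := pow_conj_pow_eq h.conj j
  calc (a ^ i * c ^ j) ^ 3 = a ^ i * (c ^ j * (a ^ i * (c ^ j * a ^ i))) * c ^ j := by
        rw [pow_succ, pow_two]; simp only [mul_assoc]
    _ = a ^ i * (a ^ (3 ^ j * (i + 3 ^ j * i)) * (c ^ j * c ^ j * c ^ j)) := by
        rw [e, ← mul_assoc (a ^ i) (a ^ _), ← pow_add, ← mul_assoc (c ^ j) (a ^ _), e]
        simp only [mul_assoc]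
    _ = _ := by rw [h1, mul_one, ← pow_add]

/-- The cube of y lies in ⟨a⟩, and y is the inverse of its twelfth power, so y is the inverse of
a^(4k). Since 4 + 48 = 52 is divisible by 13, this inverse is a^(48k). -/
theorem eq_pow_of_pow (h : IsSingerPair T B a c) {y : K} (hy : y ∈ B) (h13 : y ^ 13 = 1) : ∃ k : ℕ, y = a ^ k := by
  obtain ⟨k, hk⟩ := h.pow_three_mem hy
  refine ⟨48 * k, ?_⟩
  have h1 : y * a ^ (4 * k) = 1 := by
    rw [mul_comm 4, pow_mul, ← hk, ← pow_mul, ← pow_succ', h13]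
  have h2 : a ^ (4 * k) * a ^ (48 * k) = 1 := by
    rw [← pow_add, show 4 * k + 48 * k = 13 * (4 * k) by ring, pow_mul, h.pow_a, one_pow]
  rw [← mul_one y, ← h2, ← mul_assoc, h1, one_mul]

/-- Elements of B have order dividing 39, which is coprime to 16. -/
theorem eq_one_of_pow (h : IsSingerPair T B a c) {y : K} (hy : y ∈ B) (h16 : y ^ 16 = 1) : y = 1 := by
  obtain ⟨k, hk⟩ := h.pow_three_mem hy
  have h1 : y ^ 39 = 1 := by
    rw [show 39 = 3 * 13 from rfl, pow_mul, hk, ← pow_mul, mul_comm, pow_mul, h.pow_a, one_pow]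
  have h2 := orderOf_dvd_of_pow_eq_one h1
  have h3 := orderOf_dvd_of_pow_eq_one h16
  rw [← orderOf_eq_one_iff]
  exact Nat.dvd_one.1 ((Nat.dvd_gcd h2 h3).trans (by norm_num))

/-- The residue 3 has multiplicative order 3 modulo 13, so the action on ⟨a⟩ determines a power of
c. -/
theorem c_pow_eq (h : IsSingerPair T B a c) {j : ℕ} (hj : a ^ (3 ^ j) = a ^ 3) : c ^ j = c := by
  have h1 : c ^ j = c ^ (j % 3) := pow_eq_pow_mod j h.pow_c
  have h2 : 3 ^ j ≡ 3 ^ (j % 3) [MOD 13] := by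
    conv_lhs => rw [← Nat.div_add_mod j 3, pow_add, pow_mul]
    have : 3 ^ 3 ≡ 1 [MOD 13] := rfl
    simpa using (this.pow (j / 3)).mul_right (3 ^ (j % 3))
  have h3 := h2.symm.trans ((h.pow_eq_pow_iff _ _).1 hj)
  rw [h1]
  have h4 : j % 3 < 3 := Nat.mod_lt _ (by norm_num)
  interval_cases j % 3
  · exact absurd h3 (by decide)
  · exact pow_one c
  · exact absurd h3 (by decide)

end IsSingerPair

theorem pow_sixteen_eq_one {R : Subgroup K} [Finite K] {x u : K} (h : IsSemidihedral R x u) {q : K}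
    (hq : q ∈ R) : q ^ 16 = 1 := by
  have h1 : orderOf (⟨q, hq⟩ : R) ∣ 16 := h.card_eq ▸ orderOf_dvd_natCard _
  rw [Subgroup.orderOf_mk] at h1
  exact orderOf_dvd_iff_pow_eq_one.1 h1

end Singer

/-! ### Point stabilisers and the outer involution. -/

section SingerAction

variable {Ω : Type*} [Finite Ω] {G : Subgroup (Equiv.Perm Ω)} {T B : Subgroup G} {v : Ω} {a c : G}

/-- Point stabilisers in T are conjugate into B, where no non-trivial element has 2-power order; so
the 2-elements considered here act without fixed points. -/
theorem IsSingerPair.eq_one_of_smul_eq (h : IsSingerPair T B a c)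
    (hB : ∀ g ∈ T, g • v = v → g ∈ B) (htr : MulAction.IsPretransitive T Ω) [T.Normal] {q : G}
    (hq : q ∈ T) (h16 : q ^ 16 = 1) {x : Ω} (hx : q • x = x) : q = 1 := by
  obtain ⟨g, hg⟩ := MulAction.exists_smul_eq T v x
  have hg' : (g : G) • v = x := hg
  have h1 : (g : G)⁻¹ * q * g ∈ B := by
    refine hB _ (mul_mem (mul_mem (inv_mem g.2) hq) g.2) ?_
    rw [mul_smul, hg', mul_smul, hx, ← hg', inv_smul_smul]
  have h2 := h.eq_one_of_pow h1 (by
    have := conj_pow (a := (g : G)⁻¹) (b := q) (i := 16)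
    rw [inv_inv] at this
    rw [this, h16]
    group)
  rwa [mul_assoc, inv_mul_eq_one, eq_comm, mul_eq_right] at h2

/-- An element outside T that fixes v normalises ⟨a⟩ and, after a correction by a power of a,
centralises c. Its square is then a power of c, so its cube is an involution outside T. It acts on a
by a square root of 1 modulo 13, that is by ±1. -/
theorem IsSingerPair.exists_outer_involution (h : IsSingerPair T B a c) (hTi : T.index = 2)
    (hB : ∀ g ∈ T, g ∈ B ↔ g • v = v) (htr : MulAction.IsPretransitive T Ω) [hn : T.Normal] :
    ∃ t : G, t ∉ T ∧ t • v = v ∧ t * t = 1 ∧ t * c = c * t ∧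
      (t * a * t⁻¹ = a ∨ t * a * t⁻¹ = a⁻¹) := by
  obtain ⟨g₀, hg₀⟩ : ∃ g : G, g ∉ T := by
    by_contra! hall
    rw [(Subgroup.eq_top_iff' T).2 hall, Subgroup.index_top] at hTi
    omega
  obtain ⟨k₀, hk₀⟩ := MulAction.exists_smul_eq T (g₀ • v) v
  obtain ⟨g, hgT, hgv⟩ : ∃ g : G, g ∉ T ∧ g • v = v :=
    ⟨k₀ * g₀, fun hc => hg₀ (by
      simpa using mul_mem (inv_mem k₀.2) hc), by rw [mul_smul]; exact hk₀⟩
  have haT := h.le h.a_mem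
  have hcT := h.le h.c_mem
  have hav := (hB a haT).1 h.a_mem
  have hcv := (hB c hcT).1 h.c_mem
  have hconj : ∀ g : G, g • v = v → ∀ b ∈ B, g * b * g⁻¹ ∈ B := by
    intro g hg b hb
    refine (hB _ (hn.conj_mem b (h.le hb) g)).2 ?_
    rw [mul_smul, mul_smul, inv_smul_eq_iff.2 hg.symm, (hB b (h.le hb)).1 hb, hg]
  have hconja : ∀ g : G, g • v = v → ∃ k : ℕ, g * a * g⁻¹ = a ^ k := fun g hg =>
    h.eq_pow_of_pow (hconj g hg a h.a_mem) (by rw [conj_pow, h.pow_a, mul_one, mul_inv_cancel])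
  -- an element that centralises `c`
  obtain ⟨i, j, hij⟩ := (h.mem_iff _).1 (hconj g hgv c h.c_mem)
  have hj : c ^ j = c := by
    obtain ⟨l, hl⟩ := hconja g⁻¹ (inv_smul_eq_iff.2 hgv.symm)
    rw [inv_inv] at hl
    have h1 := conj_conj_eq h.conj hl
    refine h.c_pow_eq ?_
    rw [← h1, hij]
    have h2 := pow_conj_pow_eq h.conj j 1
    rw [mul_one, pow_one] at h2
    rw [mul_assoc (a ^ i), h2, mul_inv_rev, ← mul_assoc, ← mul_assoc (a ^ i), mul_assoc _ (c ^ j),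
      mul_inv_cancel, mul_one, ← pow_add, add_comm, pow_add, mul_inv_cancel_right]
  rw [hj] at hij
  -- Conjugation by a^m changes the exponent i in a^i c to i - 2m, and 7 is the inverse of 2 modulo
  -- 13.
  set g₁ := a ^ (7 * i) * g with hg₁
  have hg₁T : g₁ ∉ T := fun hc => hgT (by
    have := mul_mem (inv_mem (pow_mem haT (7 * i))) hc
    rwa [hg₁, inv_mul_cancel_left] at this)
  have hpowv : ∀ (g : G) (n : ℕ), g • v = v → g ^ n • v = v := fun g n hg => by
    have : g ∈ MulAction.stabilizer G v := hg
    exact pow_mem this n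
  have hg₁v : g₁ • v = v := by rw [hg₁, mul_smul, hgv, hpowv _ _ hav]
  have hg₁c : g₁ * c = c * g₁ := by
    have h1 : g * c = a ^ i * c * g := by rw [← hij, inv_mul_cancel_right]
    rw [hg₁, mul_assoc, h1, ← mul_assoc c, conj_pow_eq h.conj, ← mul_assoc, ← mul_assoc, ← pow_add]
    congr 2
    rw [h.pow_eq_pow_iff, Nat.ModEq]
    omega
  have hg₁B : g₁ * g₁ ∈ B := (hB _ (Subgroup.mul_self_mem_of_index_two hTi g₁)).2 (by
    rw [mul_smul, hg₁v, hg₁v])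
  obtain ⟨k, l, hkl⟩ := (h.mem_iff _).1 hg₁B
  have hk : a ^ k = 1 := by
    have h1 : c * (g₁ * g₁) = (g₁ * g₁) * c := 
      have h2 : Commute g₁ c := hg₁c
      (h2.mul_left h2).eq.symm
    rw [hkl, ← mul_assoc, conj_pow_eq h.conj, mul_assoc, mul_assoc, ← pow_succ, ← pow_succ',
      mul_left_inj, h.pow_eq_pow_iff, Nat.ModEq] at h1
    rw [← pow_zero a, h.pow_eq_pow_iff, Nat.ModEq]
    omega
  rw [hk, one_mul] at hkl
  have h6 : g₁ ^ 3 * g₁ ^ 3 = 1 := by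
    rw [← pow_add, show 3 + 3 = 2 * 3 from rfl, pow_mul, pow_two, hkl, ← pow_mul, mul_comm, pow_mul,
      h.pow_c, one_pow]
  obtain ⟨m, hm⟩ := hconja (g₁ ^ 3) (hpowv _ _ hg₁v)
  refine ⟨g₁ ^ 3, ?_, hpowv _ _ hg₁v, h6, ((show Commute g₁ c from hg₁c).pow_left 3).eq, ?_⟩
  · rw [pow_succ, pow_two, Subgroup.mul_mem_iff_of_index_two hTi]
    simp [hg₁T, Subgroup.mul_self_mem_of_index_two hTi]
  · set t := g₁ ^ 3
    have h1 : a ^ (m * m) = a := by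
      have h2 : t⁻¹ = t := inv_eq_of_mul_eq_one_left h6
      rw [pow_mul, ← hm, conj_pow, ← hm, h2]
      calc t * (t * a * t) * t = (t * t) * a * (t * t) := by simp only [mul_assoc]
        _ = a := by rw [h6, one_mul, mul_one]
    have h2 : m * m ≡ 1 [MOD 13] := (h.pow_eq_pow_iff _ _).1 (by rw [h1, pow_one])
    have h3 : m ≡ 1 [MOD 13] ∨ m ≡ 12 [MOD 13] := by
      have h4 : (m % 13) * (m % 13) % 13 = 1 := by rw [← Nat.mul_mod]; exact h2
      have h5 : ∀ r < 13, r * r % 13 = 1 → r = 1 ∨ r = 12 := by decide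
      exact h5 _ (Nat.mod_lt _ (by norm_num)) h4
    rw [hm]
    refine h3.imp (fun h4 => ?_) fun h4 => ?_
    · rw [(h.pow_eq_pow_iff _ _).2 h4, pow_one]
    · rw [(h.pow_eq_pow_iff _ _).2 h4, eq_inv_iff_mul_eq_one, ← pow_succ, h.pow_a]

end SingerAction

end SaxlHypergraph

namespace SaxlHypergraph

/-- A Sylow 2-subgroup P of the whole group that contains t has order 32. The intersection of P with
T has index two in P and is normalised by t. -/
theorem exists_subgroup_invariant {K : Type*} [Group K] [Finite K] {T : Subgroup K} {m : ℕ} {t : K}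
    (hTi : T.index = 2) (hT : Nat.card T = 16 * m) (hm : Odd m) (htT : t ∉ T) (ht : t * t = 1) :
    ∃ R : Subgroup K, R ≤ T ∧ Nat.card R = 16 ∧ ∀ q ∈ R, t * q * t⁻¹ ∈ R := by
  have : Fact (Nat.Prime 2) := ⟨Nat.prime_two⟩
  have hf : (Nat.card K).factorization 2 = 5 := by
    rw [← Subgroup.card_mul_index T, hT, hTi, show 16 * m * 2 = 2 ^ 5 * m by ring,
      Nat.factorization_mul (by norm_num) hm.pos.ne', Nat.Prime.factorization_pow Nat.prime_two]
    simp [Nat.factorization_eq_zero_of_not_dvd hm.not_two_dvd_nat]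
  have hz : IsPGroup 2 (Subgroup.zpowers t) := by
    refine IsPGroup.of_card (n := 1) ?_
    rw [Nat.card_zpowers]
    rw [pow_one]
    exact orderOf_eq_prime (by rw [pow_two, ht]) fun h => htT (h ▸ one_mem T)
  obtain ⟨P, hP⟩ := hz.exists_le_sylow
  have htP : t ∈ (P : Subgroup K) := hP (Subgroup.mem_zpowers t)
  have hn : T.Normal := Subgroup.normal_of_index_eq_two hTi
  refine ⟨P ⊓ T, inf_le_right, ?_, fun q hq => ?_⟩
  · have h1 : (T.subgroupOf P).index = 2 := by
      have h2 : (T.subgroupOf P).index ∣ T.index := Subgroup.relIndex_dvd_index_of_normal T P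
      rw [hTi, Nat.dvd_prime Nat.prime_two] at h2
      refine h2.resolve_left fun h3 => ?_
      rw [Subgroup.index_eq_one, Subgroup.subgroupOf_eq_top] at h3
      exact htT (h3 htP)
    have h2 := Subgroup.card_mul_index (T.subgroupOf (P : Subgroup K))
    have h3 : Nat.card (P : Subgroup K) = 32 := by rw [P.card_eq_multiplicity, hf]; rfl
    have h4 : Nat.card (T.subgroupOf (P : Subgroup K)) = Nat.card (P ⊓ T : Subgroup K) := by
      rw [← Subgroup.inf_subgroupOf_left]
      exact Nat.card_congr (Subgroup.subgroupOfEquivOfLe (inf_le_left)).toEquiv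
    rw [h1, h3, h4] at h2
    omega
  · rw [Subgroup.mem_inf] at hq ⊢
    exact ⟨mul_mem (mul_mem htP hq.1) (inv_mem htP), hn.conj_mem q hq.2 t⟩

section SingerAction

variable {Ω : Type*} [Finite Ω] {G : Subgroup (Equiv.Perm Ω)} {T B : Subgroup G} {v : Ω} {a c : G}

/-- If t centralised a, it would centralise the whole stabiliser of v, and by maximality the
stabiliser would be the centraliser of t. As |Ω| is even, t fixes another point gv. Then g⁻¹tg = bt
with b in B and b^2 = 1, so b = 1 because B has odd order. Thus g centralises t and fixes v, a
contradiction. -/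
theorem not_centralizes_of_involution (hT : IsAlmostSimpleWithSocle T)
    (hprim : MulAction.IsPreprimitive G Ω) (h : IsSingerPair T B a c) (hTi : T.index = 2)
    (hB : ∀ g ∈ T, g ∈ B ↔ g • v = v) (h2 : 2 ∣ Nat.card Ω) {t : G} (htT : t ∉ T) (htv : t • v = v)
    (ht : t * t = 1) (htc : t * c = c * t) : t * a * t⁻¹ ≠ a := by
  intro hta
  have hn := hT.normal
  have htr := hT.isPretransitive hprim
  have ht1 : t ≠ 1 := fun h => htT (h ▸ one_mem T)
  have hta' : t * a = a * t := by rw [← hta, inv_mul_cancel_right, hta]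
  have hcomm : ∀ b ∈ B, t * b = b * t := by
    intro b hb
    obtain ⟨i, j, rfl⟩ := (h.mem_iff b).1 hb
    exact (((show Commute t a from hta').pow_right i).mul_right
      ((show Commute t c from htc).pow_right j)).eq
  have hGv : ∀ g : G, g • v = v → g ∈ B ∨ ∃ b ∈ B, g = b * t := by
    intro g hg
    by_cases hgT : g ∈ T
    · exact Or.inl ((hB g hgT).2 hg)
    · refine Or.inr ⟨g * t, (hB _ ?_).2 (by rw [mul_smul, htv, hg]), by rw [mul_assoc, ht, mul_one]⟩
      rw [Subgroup.mul_mem_iff_of_index_two hTi]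
      simp [hgT, htT]
  have hnt : Nontrivial Ω := by
    have hpos : 0 < Nat.card Ω := Nat.card_pos_iff.2 ⟨⟨v⟩, inferInstance⟩
    exact Finite.one_lt_card_iff_nontrivial.1 (by omega)
  have hpre : MulAction.IsPretransitive G Ω := hprim.toIsPretransitive
  have hcoatom := (MulAction.isCoatom_stabilizer_iff_preprimitive G v).2 hprim
  have hle : MulAction.stabilizer G v ≤ Subgroup.centralizer {t} := by
    intro g hg
    rw [Subgroup.mem_centralizer_singleton_iff]
    rcases hGv g hg with hg | ⟨b, hb, rfl⟩
    · exact (hcomm g hg).symm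
    · rw [← mul_assoc, hcomm b hb]
  have hC : Subgroup.centralizer {t} = MulAction.stabilizer G v := by
    rcases hle.eq_or_lt with h1 | h1
    · exact h1.symm
    · have h3 := hcoatom.2 _ h1
      refine absurd ?_ ht1
      have h4 : t ∈ Subgroup.centralizer (T : Set G) := by
        rw [Subgroup.mem_centralizer_iff]
        intro g _
        have h5 : g ∈ Subgroup.centralizer {t} := h3 ▸ Subgroup.mem_top g
        exact Subgroup.mem_centralizer_singleton_iff.1 h5
      rwa [hT.centralizer_eq_bot, Subgroup.mem_bot] at h4
  -- another fixed point
  obtain ⟨x, hxv, hx⟩ : ∃ x : Ω, x ≠ v ∧ t • x = x := by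
    by_contra! hall
    have h3 := ncard_mod_two_of_involutive (S := Set.univ) (f := fun x : Ω => t • x)
      (fun x => by
        change t • t • x = x
        rw [smul_smul, ht, one_smul]) (fun _ _ => Set.mem_univ _)
    have h4 : {x : Ω | x ∈ Set.univ ∧ t • x = x} = {v} := by
      ext x
      simp only [Set.mem_univ, true_and, Set.mem_setOf_eq, Set.mem_singleton_iff]
      exact ⟨fun h5 => by_contra fun h6 => hall x h6 h5, fun h5 => h5 ▸ htv⟩
    rw [h4, Set.ncard_singleton, Set.ncard_univ] at h3
    omega
  obtain ⟨g, hg⟩ := MulAction.exists_smul_eq T v x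
  have hg' : (g : G) • v = x := hg
  rcases hGv ((g : G)⁻¹ * t * g) (by
    rw [mul_smul, mul_smul, hg', hx, ← hg', inv_smul_smul]) with h1 | ⟨b, hb, h1⟩
  · refine htT ?_
    have := hn.conj_mem _ (h.le h1) g
    simpa [mul_assoc] using this
  · have h3 : b * b = 1 := by
      have h4 : (b * t) * (b * t) = 1 := by
        rw [← h1]
        calc _ = (g : G)⁻¹ * (t * t) * g := by group
          _ = 1 := by rw [ht]; group
      rwa [mul_assoc, ← mul_assoc t, hcomm b hb, mul_assoc b, ht, mul_one] at h4
    have h5 : b = 1 := h.eq_one_of_pow hb (by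
      rw [show 16 = 2 * 8 from rfl, pow_mul, pow_two, h3, one_pow])
    rw [h5, one_mul] at h1
    have h6 : (g : G) ∈ Subgroup.centralizer {t} := by
      rw [Subgroup.mem_centralizer_singleton_iff]
      rw [mul_assoc, inv_mul_eq_iff_eq_mul] at h1
      exact h1.symm
    rw [hC] at h6
    exact hxv (hg'.symm.trans h6)

/-- The three divisibilities by four needed in `even_degree_of_singer` come from free actions of
2-groups: a Sylow 2-subgroup of T on Ω, the centraliser of t in a t-invariant Sylow subgroup on
Fix(t), and a Klein four-group on the points fixed by c but not by t. -/
theorem IsSingerPair.even_degree (hT : IsAlmostSimpleWithSocle T)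
    (hprim : MulAction.IsPreprimitive G Ω) (h : IsSingerPair T B a c) (hTi : T.index = 2)
    (hB : ∀ g ∈ T, g ∈ B ↔ g • v = v) {m : ℕ} (hcard : Nat.card T = 16 * m) (hm : Odd m) :
    Even (degree (saxlHypergraph G) v) := by
  have hn := hT.normal
  have htr := hT.isPretransitive hprim
  have haT := h.le h.a_mem
  have hcT := h.le h.c_mem
  have hav := (hB a haT).1 h.a_mem
  have hcv := (hB c hcT).1 h.c_mem
  have hfree2 : ∀ q ∈ T, q ^ 16 = 1 → ∀ x : Ω, q • x = x → q = 1 := fun q hq h16 x hx =>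
    h.eq_one_of_smul_eq (fun g hg => (hB g hg).2) htr hq h16 hx
  obtain ⟨R, x₀, u₀, hRT, hR⟩ := h.exists_semidihedral
  have h4 : 4 ∣ Nat.card Ω := by
    have h1 := card_dvd_ncard_of_free (K := R) (S := (Set.univ : Set Ω)) (fun _ _ _ => Set.mem_univ _)
      fun q x _ hx => Subtype.ext (hfree2 q (hRT q.2) (pow_sixteen_eq_one hR q.2) x hx)
    rw [hR.card_eq, Set.ncard_univ] at h1
    exact (by norm_num : 4 ∣ 16).trans h1
  obtain ⟨t, htT, htv, ht2, htc, hta⟩ := h.exists_outer_involution hTi hB htr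
  have hta := hta.resolve_left (not_centralizes_of_involution hT hprim h hTi hB
    ((by norm_num : 2 ∣ 4).trans h4) htT htv ht2 htc)
  have htt : ∀ x : Ω, t • t • x = x := fun x => by rw [smul_smul, ht2, one_smul]
  have hconj : ∀ (g : T) (x : Ω), (g : G) • v = x → ∀ y ∈ T, y • x = x → (g : G)⁻¹ * y * g ∈ B := by
    intro g x hg y hy hx
    refine (hB _ (mul_mem (mul_mem (inv_mem g.2) hy) g.2)).2 ?_
    rw [mul_smul, hg, mul_smul, hx, ← hg, inv_smul_smul]
  have hconja : ∀ (g : T) (x : Ω), (g : G) • v = x → ∀ i : ℕ, a ^ i • x = x →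
      ∃ k : ℕ, (g : G)⁻¹ * a ^ i * g = a ^ k := by
    intro g x hg i hx
    refine h.eq_pow_of_pow (hconj g x hg _ (pow_mem haT i) hx) ?_
    have := conj_pow (a := (g : G)⁻¹) (b := a ^ i) (i := 13)
    rw [inv_inv] at this
    rw [this, ← pow_mul, mul_comm, pow_mul, h.pow_a, one_pow]
    group
  refine even_degree_of_singer hTi (fun g hg hgv => (h.mem_iff g).1 ((hB g hg).2 hgv)) hav hcv htv
    h.pow_a h.a_ne_one h.pow_c h.c_ne_one h.conj htT ht2 htc hta ?_ h4 ?_ ?_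
  -- A power of a that fixes a second point gv would make g normalise ⟨a⟩, and then g lies in B and
  -- fixes v.
  · intro i x hxv hx
    by_contra hi
    obtain ⟨g, hg⟩ := MulAction.exists_smul_eq T v x
    have hi13 : Nat.Coprime i 13 := by
      rw [Nat.coprime_comm, Nat.Prime.coprime_iff_not_dvd (by norm_num)]
      rintro ⟨l, rfl⟩
      exact hi (by rw [pow_mul, h.pow_a, one_pow])
    obtain ⟨l, hl⟩ := Nat.exists_mul_mod_eq_one_of_coprime hi13 (by norm_num)
    have hal : a ^ (i * l) = a := by
      conv_rhs => rw [← pow_one a]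
      exact (h.pow_eq_pow_iff _ _).2 hl.2
    have hax : a ^ 1 • x = x := by
      rw [pow_one, ← hal, pow_mul]
      have : a ^ i ∈ MulAction.stabilizer G x := hx
      exact pow_mem this l
    obtain ⟨k, hk⟩ := hconja g x hg 1 hax
    rw [pow_one] at hk
    have h1 := (hB g g.2).1 (h.mem_of_normalizes g g.2 ⟨k, hk⟩)
    exact hxv (hg.symm.trans h1)
  · obtain ⟨R', hRT', hR', htR'⟩ := exists_subgroup_invariant hTi hcard hm htT ht2
    have h1 : IsSemidihedral (R.subgroupOf T) (⟨x₀, hRT ((hR.mem_iff _).2 (Or.inl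
        (Subgroup.mem_zpowers _)))⟩ : T) ⟨u₀, hRT ((hR.mem_iff _).2 (Or.inr (by
          rw [hR.mul_self]; exact one_mem _)))⟩ := by
      refine ⟨by rw [Subgroup.orderOf_mk, hR.orderOf_eq], Subtype.ext hR.mul_self,
        Subtype.ext hR.conj_eq, fun q => ?_⟩
      rw [Subgroup.mem_subgroupOf, hR.mem_iff, ← Subgroup.mem_map_iff_mem T.subtype_injective,
        ← Subgroup.mem_map_iff_mem T.subtype_injective, MonoidHom.map_zpowers]
      rfl
    obtain ⟨x', u', h2⟩ := h1.exists_of_card_eq hcard hm (R' := R'.subgroupOf T) (by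
      rw [← hR']
      exact Nat.card_congr (Subgroup.subgroupOfEquivOfLe hRT').toEquiv)
    have h3 := h2.map T.subtype T.subtype_injective
    rw [Subgroup.subgroupOf_map_subtype, inf_eq_left.2 hRT'] at h3
    refine (h3.four_dvd_card htR').trans (card_dvd_ncard_of_free ?_ ?_)
    · rintro ⟨q, hq⟩ x hx
      have h5 := Subgroup.mem_centralizer_singleton_iff.1 (Subgroup.mem_inf.1 hq).2
      change t • q • x = q • x
      rw [smul_smul, ← h5, mul_smul]
      exact congrArg _ hx
    · rintro ⟨q, hq⟩ x - hx
      have h5 := (Subgroup.mem_inf.1 hq).1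
      exact Subtype.ext (hfree2 q (hRT' h5) (pow_sixteen_eq_one h3 h5) x hx)
  · obtain ⟨s₀, hs₀T, hs₀, hs₀c⟩ := h.exists_inverting
    have hti : t⁻¹ = t := inv_eq_of_mul_eq_one_left ht2
    have hs₀i : s₀⁻¹ = s₀ := inv_eq_of_mul_eq_one_left hs₀
    have hs₀c' : s₀ * c = c⁻¹ * s₀ := by rw [← hs₀c, inv_mul_cancel_right]
    have hs₀c'' : s₀ * c⁻¹ = c * s₀ := by
      have := congrArg (fun z => s₀ * z * s₀) hs₀c'
      simp only [mul_assoc, hs₀, mul_one] at this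
      rw [← mul_assoc, hs₀, one_mul] at this
      exact this.symm
    have htci : t * c⁻¹ = c⁻¹ * t := ((show Commute t c from htc).inv_right).eq
    have hts : t * s₀ * t ∈ T := by
      have := hn.conj_mem _ hs₀T t
      rwa [hti] at this
    -- an involution that inverts `c` and commutes with `t`
    set s := s₀ * t * s₀ * t * s₀ with hs
    -- Both s₀ and its conjugate by t invert c, so their product centralises c and has order
    -- dividing three.
    have hw : (s₀ * (t * s₀ * t)) ^ 3 = 1 := by
      refine h.pow_of_commute _ (mul_mem hs₀T hts) ?_
      calc s₀ * (t * s₀ * t) * c = s₀ * (t * (s₀ * (t * c))) := by simp only [mul_assoc]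
        _ = s₀ * (t * (c⁻¹ * (s₀ * t))) := by rw [htc, ← mul_assoc s₀ c, hs₀c', mul_assoc]
        _ = c * (s₀ * (t * (s₀ * t))) := by
          rw [← mul_assoc t, htci, mul_assoc, ← mul_assoc s₀, hs₀c'', mul_assoc]
        _ = _ := by simp only [mul_assoc]
    have hsT : s ∈ T := by
      have : s = s₀ * (t * s₀ * t) * s₀ := by simp only [hs, mul_assoc]
      rw [this]
      exact mul_mem (mul_mem hs₀T hts) hs₀T
    have hss : s * s = 1 := by
      have : s * s = s₀ * (t * (s₀ * (t * (s₀ * s₀) * t) * s₀) * t) * s₀ := by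
        simp only [hs, mul_assoc]
      rw [this, hs₀, mul_one, ht2, mul_one, hs₀, mul_one, ht2, mul_one, hs₀]
    have hsc : s * c = c⁻¹ * s := by
      calc s * c = s₀ * (t * (s₀ * (t * (s₀ * c)))) := by simp only [hs, mul_assoc]
        _ = s₀ * (t * (s₀ * (c⁻¹ * (t * s₀)))) := by rw [hs₀c', ← mul_assoc t c⁻¹, htci, mul_assoc]
        _ = s₀ * (c * (t * (s₀ * (t * s₀)))) := by
          rw [← mul_assoc s₀ c⁻¹, hs₀c'', mul_assoc, ← mul_assoc t, htc, mul_assoc]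
        _ = c⁻¹ * (s₀ * (t * (s₀ * (t * s₀)))) := by rw [← mul_assoc, hs₀c', mul_assoc]
        _ = _ := by simp only [hs, mul_assoc]
    -- The product st is the cube of s₀t, so its square is the cube treated in `hw`; an involutory
    -- product of involutions means that they commute.
    have hst : s * t = t * s := by
      have h1 : s * t * (s * t) = 1 := by
        rw [← hw, pow_succ, pow_two]
        simp only [hs, mul_assoc]
      have h2 := eq_inv_of_mul_eq_one_left h1
      rw [mul_inv_rev, hti, inv_eq_of_mul_eq_one_left hss] at h2
      exact h2
    have hs1 : s ≠ 1 := by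
      intro hs1
      rw [hs1, one_mul, mul_one] at hsc
      have h1 : c ^ 2 = 1 := by rw [pow_two]; nth_rewrite 1 [hsc]; exact inv_mul_cancel c
      exact h.c_ne_one (by
        have := h.pow_c
        rwa [pow_succ, h1, one_mul] at this)
    have hpow : ∀ q : G, q * q = 1 → q ^ 16 = 1 := fun q hq => by
      rw [show 16 = 2 * 8 from rfl, pow_mul, pow_two, hq, one_pow]
    have hmem : ∀ (g : G), (g * c = c⁻¹ * g ∨ g * c = c * g) → ∀ x : Ω, c • x = x →
        c • g • x = g • x := by
      rintro g (hg | hg) x hx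
      · have h1 : c * g = g * c⁻¹ := by
          rw [eq_mul_inv_iff_mul_eq, mul_assoc, hg, mul_inv_cancel_left]
        rw [smul_smul, h1, mul_smul, inv_smul_eq_iff.2 hx.symm]
      · rw [smul_smul, ← hg, mul_smul, hx]
    refine four_dvd_ncard_of_involutive (σ := s) (τ := t) (congrArg Subtype.val hss)
      (congrArg Subtype.val ht2) (congrArg Subtype.val hst) ?_ ?_ ?_ ?_ ?_
    · rintro x ⟨hx, hx'⟩
      refine ⟨hmem s (Or.inl hsc) x hx, fun hc => hx' ?_⟩
      have h1 : t • s • x = s • x := hc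
      rw [smul_smul, ← hst, mul_smul] at h1
      exact smul_left_cancel s h1
    · rintro x ⟨hx, hx'⟩
      exact ⟨hmem t (Or.inr htc) x hx, fun hc => hx' (smul_left_cancel t hc)⟩
    · rintro x - hx
      exact hs1 (hfree2 s hsT (hpow s hss) x hx)
    · rintro x ⟨-, hx'⟩ hx
      exact hx' hx
    · rintro x ⟨hx, -⟩ hx'
      have hx'' : (s * t) • x = x := hx'
      obtain ⟨g, hg⟩ := MulAction.exists_smul_eq T v x
      have hg' : (g : G) • v = x := hg
      -- conjugating into the stabiliser of `v`, where `c` is not inverted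
      set d := (g : G)⁻¹ * c * g
      set r := (g : G)⁻¹ * (s * t) * g
      have hd : d ∈ B := hconj g x hg' c hcT hx
      have hrv : r • v = v := by
        change ((g : G)⁻¹ * (s * t) * g) • v = v
        rw [mul_smul, hg', mul_smul, hx'', ← hg', inv_smul_smul]
      have hrd : r * d * r⁻¹ = d⁻¹ := by
        have h1 : s * t * c * (s * t)⁻¹ = c⁻¹ := by
          rw [mul_assoc s, htc, ← mul_assoc, hsc, mul_assoc c⁻¹, mul_inv_cancel_right]
        calc r * d * r⁻¹ = (g : G)⁻¹ * (s * t * c * (s * t)⁻¹) * g := by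
              simp only [r, d]; group
          _ = d⁻¹ := by rw [h1]; simp only [d]; group
      have hra : ∃ l : ℕ, r⁻¹ * a * r = a ^ l := by
        refine h.eq_pow_of_pow ?_ ?_
        · have h1 := hn.conj_mem a haT r⁻¹
          rw [inv_inv] at h1
          refine (hB _ h1).2 ?_
          rw [mul_smul, hrv, mul_smul, hav, inv_smul_eq_iff, hrv]
        · have := conj_pow (a := r⁻¹) (b := a) (i := 13)
          rw [inv_inv] at this
          rw [this, h.pow_a]
          group
      obtain ⟨l, hl⟩ := hra
      obtain ⟨i, j, hij⟩ := (h.mem_iff d).1 hd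
      have hda : d * a * d⁻¹ = a ^ 3 ^ j := by
        have h2 := pow_conj_pow_eq h.conj j 1
        rw [mul_one, pow_one] at h2
        rw [hij, mul_assoc (a ^ i), h2, mul_inv_rev, ← mul_assoc, ← mul_assoc (a ^ i),
          mul_assoc _ (c ^ j), mul_inv_cancel, mul_one, ← pow_add, add_comm, pow_add,
          mul_inv_cancel_right]
      have h1 := conj_conj_eq hda hl
      rw [hrd, inv_inv] at h1
      have h2 : a ^ (3 ^ j * 3 ^ j) = a := by
        rw [pow_mul, ← hda, conj_pow, ← h1]
        group
      have h3 : 3 ^ j * 3 ^ j ≡ 1 [MOD 13] := (h.pow_eq_pow_iff _ _).1 (by rw [h2, pow_one])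
      have h5 : c ^ j * c ^ j * c = c := by
        rw [← pow_add, ← pow_succ]
        refine h.c_pow_eq ((h.pow_eq_pow_iff _ _).2 ?_)
        rw [pow_succ, pow_add]
        exact h3.mul_right 3
      have h6 : c ^ j = 1 := by
        rw [mul_eq_right, ← pow_add, ← two_mul] at h5
        have h7 : c ^ (3 * j) = 1 := by rw [pow_mul, h.pow_c, one_pow]
        rwa [show 3 * j = 2 * j + j by ring, pow_add, h5, one_mul] at h7
      have h7 : d ^ 13 = 1 := by
        rw [hij, h6, mul_one, ← pow_mul, mul_comm, pow_mul, h.pow_a, one_pow]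
      have h8 : c ^ 13 = 1 := by
        have h9 := conj_pow (a := (g : G)⁻¹) (b := c) (i := 13)
        rw [inv_inv] at h9
        rw [h9, mul_assoc, inv_mul_eq_one, eq_comm, mul_eq_right] at h7
        exact h7
      refine h.c_ne_one ?_
      rwa [show 13 = 3 * 4 + 1 from rfl, pow_succ, pow_mul, h.pow_c, one_pow, one_mul] at h8

end SingerAction

end SaxlHypergraph

namespace SaxlHypergraph

/-! ### The field of order 27 inside the 3 by 3 matrices over GF(3). -/

section SingerMatrix

open Matrix

local notation "M₃" => Matrix (Fin 3) (Fin 3) (ZMod 3)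
local notation "S₃" => SpecialLinearGroup (Fin 3) (ZMod 3)

/-- The companion matrix of `X ^ 3 - X - 1`. -/
def singerMat : M₃ := !![0, 0, 1; 1, 0, 1; 0, 1, 0]

/-- The polynomial `x + y C + z C ^ 2` in the companion matrix. -/
def singerPoly (x y z : ZMod 3) : M₃ := !![x, z, y; y, x + z, y + z; z, y, x + z]

/-- The companion matrix as an element of `SL_3(3)`. -/
def singerA : S₃ := ⟨singerMat, by decide⟩

/-- A matrix that normalises the algebra generated by the companion matrix. -/
def singerC : S₃ := ⟨!![1, 1, 1; 0, 1, 2; 0, 0, 1], by decide⟩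

theorem coe_singerA : (singerA : M₃) = singerMat := rfl

/-- The first basis vector is cyclic for the companion matrix, so a commuting matrix is a polynomial
in it determined by its first column. -/
theorem eq_singerPoly_of_commute {N : M₃} (h : N * singerMat = singerMat * N) :
    N = singerPoly (N 0 0) (N 1 0) (N 2 0) := by
  have e : ∀ i j, (N * singerMat) i j = (singerMat * N) i j := fun i j => by rw [h]
  have h00 := e 0 0
  have h10 := e 1 0
  have h20 := e 2 0
  have h01 := e 0 1
  have h11 := e 1 1
  have h21 := e 2 1
  simp [singerMat, Matrix.mul_apply, Fin.sum_univ_three] at h00 h10 h20 h01 h11 h21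
  ext i j
  fin_cases i <;> fin_cases j <;> simp [singerPoly, *] <;> ring

/-- The determinant is the norm to GF(3), and the elements of norm 1 form the group of order 13
generated by the companion matrix. -/
theorem exists_pow_eq_singerPoly (x y z : ZMod 3) (h : (singerPoly x y z).det = 1) :
    ∃ m < 13, singerPoly x y z = singerMat ^ m := by
  revert x y z
  decide +kernel

/-- The roots of X^3 = X + 1 in the field are the Galois conjugates of the companion matrix, and
conjugation by `singerC` realises the Galois action. -/
theorem eq_of_singerPoly_pow (x y z : ZMod 3)
    (h : singerPoly x y z ^ 3 = singerPoly x y z + 1) :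
    ∃ j < 3, (singerC : M₃) ^ j * singerMat = singerPoly x y z * (singerC : M₃) ^ j := by
  revert x y z
  decide +kernel

theorem singerPoly_mul_eq_one (x y z : ZMod 3) (h : ¬ (x = 0 ∧ y = 0 ∧ z = 0)) :
    ∃ p q r : ZMod 3, x * p + y * r + z * q = 1 ∧ x * q + y * p + y * r + z * q + z * r = 0 ∧
      x * r + y * q + z * p + z * r = 0 := by
  revert x y z
  decide +kernel

theorem singerMat_pow_three : singerMat ^ 3 = singerMat + 1 := by decide +kernel

theorem singerA_pow : singerA ^ 13 = 1 := by decide +kernel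

theorem singerC_conj : singerC * singerA * singerC⁻¹ = singerA ^ 3 := by decide +kernel

/-- The conjugate of the companion matrix by M lies in the field and satisfies the same cubic, so it
is a Galois conjugate. After removal of a power of `singerC`, M commutes with the companion matrix
and has determinant 1, hence is a power of it. -/
theorem exists_eq_pow_mul_pow {M : S₃}
    (h : (M * singerA * M⁻¹) * singerA = singerA * (M * singerA * M⁻¹)) :
    ∃ i j : ℕ, M = singerA ^ i * singerC ^ j := by
  have h1 := eq_singerPoly_of_commute (N := ((M * singerA * M⁻¹ : S₃) : M₃)) (by
    have := congrArg (fun z : S₃ => (z : M₃)) h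
    simpa only [Matrix.SpecialLinearGroup.coe_mul, coe_singerA] using this)
  set x := ((M * singerA * M⁻¹ : S₃) : M₃) 0 0
  set y := ((M * singerA * M⁻¹ : S₃) : M₃) 1 0
  set z := ((M * singerA * M⁻¹ : S₃) : M₃) 2 0
  have h2 : ((M * singerA * M⁻¹ : S₃) : M₃) = M * singerMat * (M⁻¹ : S₃) := rfl
  have h3 : singerPoly x y z ^ 3 = singerPoly x y z + 1 := by
    rw [← h1, h2]
    have h4 : (M * singerMat * (M⁻¹ : S₃) : M₃) ^ 3 = M * singerMat ^ 3 * (M⁻¹ : S₃) := by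
      have := conj_pow (a := M) (b := singerA) (i := 3)
      have := congrArg (fun z : S₃ => (z : M₃)) this
      simpa only [Matrix.SpecialLinearGroup.coe_mul, Matrix.SpecialLinearGroup.coe_pow, coe_singerA] using this
    rw [h4, singerMat_pow_three, Matrix.mul_add, Matrix.add_mul, Matrix.mul_one, sl_mul_inv_coe]
  obtain ⟨j, -, hj⟩ := eq_of_singerPoly_pow x y z h3
  have h5 : singerC ^ j * singerA = M * singerA * M⁻¹ * singerC ^ j := by
    refine Subtype.ext ?_
    rw [← h1] at hj
    simpa only [Matrix.SpecialLinearGroup.coe_mul, Matrix.SpecialLinearGroup.coe_pow, coe_singerA] using hj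
  set N : S₃ := M⁻¹ * singerC ^ j with hN
  have h6 : N * singerA = singerA * N := by
    rw [hN, mul_assoc, h5]
    group
  have h7 := eq_singerPoly_of_commute (N := (N : M₃)) (by
    have := congrArg (fun z : S₃ => (z : M₃)) h6
    simpa only [Matrix.SpecialLinearGroup.coe_mul, coe_singerA] using this)
  obtain ⟨m, hm, h8⟩ := exists_pow_eq_singerPoly ((N : M₃) 0 0) ((N : M₃) 1 0) ((N : M₃) 2 0)
    (by rw [← h7]; exact N.2)
  have h9 : N = singerA ^ m := by
    refine Subtype.ext ?_
    rw [← h7] at h8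
    rw [Matrix.SpecialLinearGroup.coe_pow]
    exact h8
  refine ⟨3 ^ j * (12 * m), j, ?_⟩
  have h10 : singerA ^ (12 * m) = N⁻¹ := eq_inv_of_mul_eq_one_left (by
    rw [h9, ← pow_add, show 12 * m + m = 13 * m by ring, pow_mul, singerA_pow, one_pow])
  rw [← pow_conj_pow_eq singerC_conj, h10, hN]
  group

theorem singerPoly_eq (x y z : ZMod 3) :
    singerPoly x y z = x • (1 : M₃) + y • singerMat + z • singerMat ^ 2 := by
  revert x y z
  decide +kernel

theorem singerC_mul_singerPoly (x y z : ZMod 3) :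
    (singerC : M₃) * singerPoly x y z * (singerC⁻¹ : S₃) * singerMat =
      singerMat * ((singerC : M₃) * singerPoly x y z * (singerC⁻¹ : S₃)) ∧
    ((singerC⁻¹ : S₃) : M₃) * singerPoly x y z * (singerC : S₃) * singerMat =
      singerMat * (((singerC⁻¹ : S₃) : M₃) * singerPoly x y z * (singerC : S₃)) := by
  revert x y z
  decide +kernel

/-- An element of order eight of `SL_3(3)`. -/
def sdX : S₃ := ⟨!![0, 1, 0; 1, 1, 0; 0, 0, 2], by decide⟩

/-- An involution of `SL_3(3)` that together with `sdX` generates a Sylow `2`-subgroup. -/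
def sdU : S₃ := ⟨!![1, 1, 0; 0, 2, 0; 0, 0, 2], by decide⟩

/-- An involution of `SL_3(3)` that inverts `singerC`. -/
def singerS : S₃ := ⟨!![2, 0, 0; 0, 1, 0; 0, 0, 2], by decide⟩

/-- `singerC` is a single unipotent Jordan block up to conjugacy. Its commuting matrices are upper
triangular with constant diagonal x, and determinant x^3 = x = 1 makes them unipotent. -/
theorem pow_three_of_commute_singerC {g : S₃} (h : g * singerC = singerC * g) : g ^ 3 = 1 := by
  have e : ∀ i j, ((g : M₃) * (!![1, 1, 1; 0, 1, 2; 0, 0, 1] : M₃)) i j =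
      ((!![1, 1, 1; 0, 1, 2; 0, 0, 1] : M₃) * g) i j := fun i j =>
    congrArg (fun z : S₃ => (z : M₃) i j) h
  obtain ⟨x, hx⟩ : ∃ x, x = (g : M₃) 0 0 := ⟨_, rfl⟩
  obtain ⟨y, hy⟩ : ∃ x, x = (g : M₃) 0 1 := ⟨_, rfl⟩
  obtain ⟨z, hz⟩ : ∃ x, x = (g : M₃) 0 2 := ⟨_, rfl⟩
  have hg : (g : M₃) = !![x, y, z; 0, x, 2 * y; 0, 0, x] := by
    have h00 := e 0 0
    have h01 := e 0 1
    have h02 := e 0 2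
    have h10 := e 1 0
    have h11 := e 1 1
    have h12 := e 1 2
    have h21 := e 2 1
    have h22 := e 2 2
    simp [Matrix.mul_apply, Fin.sum_univ_three, ← hx, ← hy, ← hz] at h00 h01 h02 h10 h11 h12 h21 h22
    have h3 : (3 : ZMod 3) = 0 := rfl
    have k20 : (g : M₃) 2 0 = 0 := h21
    have k10 : (g : M₃) 1 0 = 0 := by linear_combination -h00 - k20
    have k21 : (g : M₃) 2 1 = 0 := by
      linear_combination 2 * h22 - 2 * k20 - (g : M₃) 2 1 * h3
    have k11 : (g : M₃) 1 1 = x := by linear_combination -h01 - k21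
    have k22 : (g : M₃) 2 2 = x := by
      linear_combination -2 * h12 + 2 * k10 + 4 * k11 + (x - (g : M₃) 2 2) * h3
    have k12 : (g : M₃) 1 2 = 2 * y := by linear_combination -h02 - k22
    ext i j
    fin_cases i <;> fin_cases j <;> simp [← hx, ← hy, ← hz, k10, k11, k12, k20, k21, k22]
  have hdet : (!![x, y, z; 0, x, 2 * y; 0, 0, x] : M₃).det = 1 := hg ▸ g.2
  refine Subtype.ext ?_
  rw [Matrix.SpecialLinearGroup.coe_pow, hg]
  clear * - hdet
  revert x y z
  decide +kernel

/-- This is the additive form of Hilbert 90: if y has trace s ≠ 0 in GF(3), then x = s(y^9 - y^3)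
satisfies x^3 - x = s^2 = 1. -/
theorem exists_pow_three_eq_add_one {R : Type*} [Field R] (hR : Nat.card R = 27) :
    ∃ x : R, x ^ 3 = x + 1 := by
  have : Finite R := Nat.finite_of_card_ne_zero (by omega)
  have := Fintype.ofFinite R
  have h3 : (3 : R) = 0 := by
    have h : ((Nat.card R : ℕ) : R) = 0 := by
      rw [Nat.card_eq_fintype_card]; exact FiniteField.cast_card_eq_zero R
    rw [hR] at h
    have : (3 : R) ^ 3 = 0 := by rw [← h]; norm_num
    exact pow_eq_zero_iff (by norm_num) |>.1 this
  have h27 : ∀ y : R, y ^ 27 = y := fun y => by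
    have := FiniteField.pow_card y
    rwa [← Nat.card_eq_fintype_card, hR] at this
  obtain ⟨y, hy⟩ : ∃ y : R, y ^ 9 + y ^ 3 + y ≠ 0 := by
    by_contra! hall
    have h1 : ∀ y : R, y ∈ ({0, 1, -1} : Set R) := by
      intro y
      have e1 := hall y
      have e2 := hall (y ^ 2)
      have e3 : (y * (y ^ 2 - 1)) ^ 2 = 0 := by
        -- Vanishing of the traces of both y and y^2 leaves y in GF(3), too few elements for the
        -- whole field.
        linear_combination (-1 : R) * e2 + (y ^ 9 - y ^ 3 - y) * e1 + (y ^ 6 + y ^ 2) * h3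
      rcases mul_eq_zero.1 (pow_eq_zero_iff (by norm_num) |>.1 e3) with h | h
      · exact Or.inl h
      · have : (y - 1) * (y + 1) = 0 := by linear_combination h
        rcases mul_eq_zero.1 this with h | h
        · exact Or.inr (Or.inl (by linear_combination h))
        · exact Or.inr (Or.inr (by
            rw [Set.mem_singleton_iff]; linear_combination h))
    have h2 : Nat.card R ≤ 3 := by
      rw [← Set.ncard_univ, ← Set.eq_univ_of_forall h1]
      exact ncard_triple_le _ _ _
    omega
  set s := y ^ 9 + y ^ 3 + y with hs
  have hs3 : s ^ 3 = s := by
    have : s ^ 3 = y ^ 27 + y ^ 9 + y ^ 3 := by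
      rw [hs]
      linear_combination (y ^ 21 + y ^ 19 + y ^ 15 + 2 * y ^ 13 + y ^ 11 + y ^ 7 + y ^ 5) * h3
    rw [this, h27, hs]
    ring
  have hs2 : s * s = 1 := mul_right_cancel₀ hy (by linear_combination hs3)
  refine ⟨s * (y ^ 9 - y ^ 3), ?_⟩
  have h1 : (y ^ 9 - y ^ 3) ^ 3 = y - y ^ 9 := by
    have := h27 y
    linear_combination this + (-y ^ 21 + y ^ 15) * h3
  rw [mul_pow, hs3, h1]
  linear_combination hs2 + s * (-hs) - s * y ^ 9 * h3

/-- The columns e, Xe, X^2e, for the first basis vector e, carry the companion matrix to X. A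
dependency among them would be a non-zero polynomial in X killing e, but non-zero polynomials of
degree at most two in X are invertible. -/
theorem exists_conj_singerMat {X : M₃} (hX : X ^ 3 = X + 1) : ∃ g : S₃, X * g = g * singerMat := by
  have hX4 : X ^ 4 = X ^ 2 + X := by rw [pow_succ, hX, add_mul, one_mul, pow_two]
  set g : M₃ := Matrix.of fun i j => (X ^ (j : ℕ)) i 0 with hg
  have hgX : X * g = g * singerMat := by
    ext i j
    have h1 : ∀ k : ℕ, (X ^ (k + 1)) i 0 = ∑ l, X i l * (X ^ k) l 0 := fun k => by
      rw [pow_succ', Matrix.mul_apply]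
    fin_cases j
    · simpa [hg, singerMat, Matrix.mul_apply, Fin.sum_univ_three] using (h1 0).symm
    · simpa [hg, singerMat, Matrix.mul_apply, Fin.sum_univ_three] using (h1 1).symm
    · have h2 := h1 2
      rw [show 2 + 1 = 3 from rfl, hX] at h2
      simpa [hg, singerMat, Matrix.mul_apply, Fin.sum_univ_three, add_comm] using h2.symm
  have hdet : g.det ≠ 0 := by
    intro h
    obtain ⟨w, hw, h1⟩ := Matrix.exists_mulVec_eq_zero_iff.2 h
    have hw' : ¬ (w 0 = 0 ∧ w 1 = 0 ∧ w 2 = 0) := fun h2 => hw (by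
      ext i
      fin_cases i
      exacts [h2.1, h2.2.1, h2.2.2])
    obtain ⟨p, q, r, e1, e2, e3⟩ := singerPoly_mul_eq_one _ _ _ hw'
    have h2 : (p • (1 : M₃) + q • X + r • X ^ 2) *
        (w 0 • (1 : M₃) + w 1 • X + w 2 • X ^ 2) = 1 := by
      have h3 : (p • (1 : M₃) + q • X + r • X ^ 2) *
          (w 0 • (1 : M₃) + w 1 • X + w 2 • X ^ 2) = (p * w 0) • (1 : M₃) +
          (p * w 1 + q * w 0) • X + (p * w 2 + q * w 1 + r * w 0) • X ^ 2 +
          (q * w 2 + r * w 1) • X ^ 3 + (r * w 2) • X ^ 4 := by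
        have f1 : X * X ^ 2 = X ^ 3 := (pow_succ' X 2).symm
        have f2 : X ^ 2 * X = X ^ 3 := (pow_succ X 2).symm
        have f3 : X ^ 2 * X ^ 2 = X ^ 4 := (pow_add X 2 2).symm
        simp only [add_mul, mul_add, smul_mul_assoc, mul_smul_comm, smul_smul, one_mul, mul_one,
          ← pow_two X, f1, f2, f3]
        module
      have h4 : (p * w 0) • (1 : M₃) +
          (p * w 1 + q * w 0) • X + (p * w 2 + q * w 1 + r * w 0) • X ^ 2 +
          (q * w 2 + r * w 1) • (X + 1) + (r * w 2) • (X ^ 2 + X) =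
          (w 0 * p + w 1 * r + w 2 * q) • (1 : M₃) +
          (w 0 * q + w 1 * p + w 1 * r + w 2 * q + w 2 * r) • X +
          (w 0 * r + w 1 * q + w 2 * p + w 2 * r) • X ^ 2 := by module
      rw [h3, hX, hX4, h4, e1, e2, e3, one_smul, zero_smul, zero_smul, add_zero, add_zero]
    have h3 : (w 0 • (1 : M₃) + w 1 • X + w 2 • X ^ 2) *ᵥ Pi.single 0 1 = 0 := by
      rw [← h1]
      ext i
      simp [hg, Matrix.mulVec, dotProduct, Fin.sum_univ_three, mul_comm]
    have h4 : (1 : M₃) *ᵥ Pi.single 0 1 = 0 := by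
      rw [← h2, ← Matrix.mulVec_mulVec, h3, Matrix.mulVec_zero]
    rw [Matrix.one_mulVec] at h4
    exact one_ne_zero (α := ZMod 3) (by simpa using congrFun h4 0)
  -- In odd dimension, negating the matrix changes the determinant from -1 to 1.
  have h12 : ∀ d : ZMod 3, d ≠ 0 → d = 1 ∨ -d = 1 := by decide
  rcases h12 _ hdet with h | h
  · exact ⟨⟨g, h⟩, hgX⟩
  · refine ⟨⟨-g, by
      rw [Matrix.det_neg, Fintype.card_fin, Odd.neg_one_pow (by decide), neg_one_mul, h]⟩, ?_⟩
    change X * -g = -g * singerMat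
    rw [Matrix.mul_neg, hgX, Matrix.neg_mul]

/-- A contains a root of X^3 = X + 1, which is conjugate to the companion matrix. Commutativity puts
A inside the commutant of this root, and the commutant consists of polynomials in it. -/
theorem exists_conj_mem_iff {A : Subalgebra (ZMod 3) M₃} (hA : IsField A)
    (hr : Module.finrank (ZMod 3) A = 3) :
    ∃ g : S₃, ∀ N : M₃, (g : M₃) * N * (g⁻¹ : S₃) ∈ A ↔ N * singerMat = singerMat * N := by
  have hcard : Nat.card A = 27 := by
    rw [Module.natCard_eq_pow_finrank (K := ZMod 3), hr, Nat.card_zmod]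
    norm_num
  obtain ⟨X, hX⟩ := @exists_pow_three_eq_add_one A hA.toField hcard
  have hX' : (X : M₃) ^ 3 = X + 1 := congrArg Subtype.val hX
  obtain ⟨g, hg⟩ := exists_conj_singerMat hX'
  have hgX : (g : M₃) * singerMat * (g⁻¹ : S₃) = X := by
    rw [← hg, Matrix.mul_assoc, sl_mul_inv_coe, Matrix.mul_one]
  refine ⟨g, fun N => ⟨fun hN => ?_, fun hN => ?_⟩⟩
  · have h1 : (g : M₃) * N * (g⁻¹ : S₃) * X = X * (g * N * (g⁻¹ : S₃)) :=
      congrArg Subtype.val (hA.mul_comm ⟨_, hN⟩ X)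
    have h2 : ∀ P Q : M₃, (g : M₃) * P * (g⁻¹ : S₃) * (g * Q * (g⁻¹ : S₃)) =
        g * (P * Q) * (g⁻¹ : S₃) := fun P Q => by
      simp only [Matrix.mul_assoc]
      rw [← Matrix.mul_assoc ((g⁻¹ : S₃) : M₃), sl_inv_mul_coe, Matrix.one_mul]
    rw [← hgX, h2, h2] at h1
    have h3 := congrArg (fun P : M₃ => ((g⁻¹ : S₃) : M₃) * P * g) h1
    simp only [Matrix.mul_assoc] at h3
    rw [sl_inv_mul_coe] at h3
    simpa only [← Matrix.mul_assoc, sl_inv_mul_coe, Matrix.one_mul, Matrix.mul_one] using h3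
  · rw [eq_singerPoly_of_commute hN, singerPoly_eq]
    have h1 : (g : M₃) * singerMat ^ 2 * (g⁻¹ : S₃) = (X : M₃) ^ 2 := by
      rw [pow_two, pow_two, ← hgX]
      simp only [Matrix.mul_assoc]
      rw [← Matrix.mul_assoc ((g⁻¹ : S₃) : M₃), sl_inv_mul_coe, Matrix.one_mul]
    simp only [Matrix.mul_add, Matrix.add_mul, Matrix.mul_smul, Matrix.smul_mul, Matrix.mul_one, h1,
      hgX, sl_mul_inv_coe]
    exact add_mem (add_mem (A.smul_mem (one_mem A) _) (A.smul_mem X.2 _))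
      (A.smul_mem (pow_mem X.2 2) _)

theorem mem_slNormalizer_iff_exists_pow {A : Subalgebra (ZMod 3) M₃} {g : S₃}
    (hg : ∀ N : M₃, (g : M₃) * N * (g⁻¹ : S₃) ∈ A ↔ N * singerMat = singerMat * N) (M : S₃) :
    g * M * g⁻¹ ∈ slNormalizer A ↔ ∃ i j : ℕ, M = singerA ^ i * singerC ^ j := by
  have key : ∀ (M : S₃) (x : M₃), ((g * M * g⁻¹ : S₃) : M₃) * x * ((g * M * g⁻¹)⁻¹ : S₃) =
      (g : M₃) * ((M : M₃) * (((g⁻¹ : S₃) : M₃) * x * g) * (M⁻¹ : S₃)) * (g⁻¹ : S₃) := by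
    intro M x
    rw [_root_.mul_inv_rev, _root_.mul_inv_rev, inv_inv]
    simp only [Matrix.SpecialLinearGroup.coe_mul, Matrix.mul_assoc]
  have key' : ∀ x : M₃, (g : M₃) * (((g⁻¹ : S₃) : M₃) * x * g) * (g⁻¹ : S₃) = x := by
    intro x
    simp only [Matrix.mul_assoc]
    rw [sl_mul_inv_coe, Matrix.mul_one, ← Matrix.mul_assoc, sl_mul_inv_coe, Matrix.one_mul]
  have hiff : ∀ x : M₃, x ∈ A ↔ (((g⁻¹ : S₃) : M₃) * x * g) * singerMat =
      singerMat * (((g⁻¹ : S₃) : M₃) * x * g) := fun x => by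
    rw [← hg, key']
  constructor
  · intro h
    have h1 := (h ((g : M₃) * singerMat * (g⁻¹ : S₃))).1 ((hg _).2 rfl)
    rw [key, hg] at h1
    have h2 : ((g⁻¹ : S₃) : M₃) * ((g : M₃) * singerMat * (g⁻¹ : S₃)) * g = singerMat := by
      simp only [Matrix.mul_assoc]
      rw [sl_inv_mul_coe, Matrix.mul_one, ← Matrix.mul_assoc, sl_inv_mul_coe, Matrix.one_mul]
    rw [h2] at h1
    refine exists_eq_pow_mul_pow (Subtype.ext ?_)
    simpa only [Matrix.SpecialLinearGroup.coe_mul, coe_singerA] using h1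
  · have hmem : ∀ M : S₃, (∀ N : M₃, N * singerMat = singerMat * N →
        ((M : M₃) * N * (M⁻¹ : S₃)) * singerMat = singerMat * ((M : M₃) * N * (M⁻¹ : S₃)) ∧
        (((M⁻¹ : S₃) : M₃) * N * M) * singerMat = singerMat * (((M⁻¹ : S₃) : M₃) * N * M)) →
        g * M * g⁻¹ ∈ slNormalizer A := by
      intro M hM
      refine mem_slNormalizer_of_forall (fun x hx => ?_) fun x hx => ?_
      · rw [key, hg]
        exact (hM _ ((hiff x).1 hx)).1
      · have h1 := key M⁻¹ x
        rw [show g * M⁻¹ * g⁻¹ = (g * M * g⁻¹)⁻¹ by group, inv_inv, inv_inv] at h1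
        rw [h1, hg]
        exact (hM _ ((hiff x).1 hx)).2
    have hC : g * singerC * g⁻¹ ∈ slNormalizer A := hmem _ fun N hN => by
      rw [eq_singerPoly_of_commute hN]
      exact singerC_mul_singerPoly _ _ _
    have hA' : g * singerA * g⁻¹ ∈ slNormalizer A := hmem _ fun N hN => by
      have h1 : (singerA : M₃) * N * (singerA⁻¹ : S₃) = N := by
        rw [coe_singerA, ← hN, ← coe_singerA, Matrix.mul_assoc, sl_mul_inv_coe, Matrix.mul_one]
      have h2 : ((singerA⁻¹ : S₃) : M₃) * N * singerA = N := by
        rw [Matrix.mul_assoc, coe_singerA, hN, ← coe_singerA, ← Matrix.mul_assoc, sl_inv_mul_coe,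
          Matrix.one_mul]
      rw [h1, h2]
      exact ⟨hN, hN⟩
    rintro ⟨i, j, rfl⟩
    rw [← conj_mul, ← conj_pow, ← conj_pow]
    exact mul_mem (pow_mem hA' i) (pow_mem hC j)

theorem isSingerPair_singerA {B : Subgroup S₃}
    (hB : ∀ M, M ∈ B ↔ ∃ i j : ℕ, M = singerA ^ i * singerC ^ j) :
    IsSingerPair ⊤ B singerA singerC where
  le := le_top
  mem_iff := hB
  pow_a := singerA_pow
  a_ne_one := by decide
  pow_c := by decide +kernel
  c_ne_one := by decide
  conj := singerC_conj
  mem_of_normalizes := by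
    rintro h - ⟨k, hk⟩
    rw [← inv_mem_iff, hB]
    refine exists_eq_pow_mul_pow ?_
    rw [inv_inv, hk, ← pow_succ, ← pow_succ']
  pow_of_commute g _ := pow_three_of_commute_singerC
  exists_inverting := ⟨singerS, trivial, by decide, by decide +kernel⟩
  exists_semidihedral := by
    have hx : orderOf sdX = 8 := by
      have : Fact (Nat.Prime 2) := ⟨Nat.prime_two⟩
      exact orderOf_eq_prime_pow (p := 2) (n := 2) (by decide +kernel) (by decide +kernel)
    exact ⟨_, _, _, le_top, isSemidihedral_semidihedral hx (u := sdU) (by decide)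
      (by decide +kernel)⟩

theorem card_sl_three : Nat.card S₃ = 16 * 351 := by
  have hGL : Nat.card (GL (Fin 3) (ZMod 3)) = 11232 := by
    rw [Matrix.card_GL_field]
    simp [Fin.prod_univ_three]
  have hker : Nat.card (Matrix.GeneralLinearGroup.det : GL (Fin 3) (ZMod 3) →* (ZMod 3)ˣ).ker =
      Nat.card S₃ := by
    refine (Nat.card_congr (Equiv.ofBijective (fun M : S₃ => ⟨Matrix.SpecialLinearGroup.toGL M,
      MonoidHom.mem_ker.2 (Units.ext M.2)⟩)
      ⟨fun M N h => ?_, fun M => ?_⟩)).symm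
    · exact Matrix.SpecialLinearGroup.toGL_injective (congrArg Subtype.val h)
    · exact ⟨⟨M.1, congrArg Units.val (MonoidHom.mem_ker.1 M.2)⟩, Subtype.ext (Units.ext rfl)⟩
  have h1 := Subgroup.card_mul_index
    (Matrix.GeneralLinearGroup.det : GL (Fin 3) (ZMod 3) →* (ZMod 3)ˣ).ker
  rw [Subgroup.index_ker, MonoidHom.range_eq_top.2 Matrix.GeneralLinearGroup.det_surjective,
    Subgroup.card_top, hker, hGL, Nat.card_eq_fintype_card (α := (ZMod 3)ˣ),
    show Fintype.card (ZMod 3)ˣ = 2 from rfl] at h1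
  omega

end SingerMatrix

end SaxlHypergraph

namespace SaxlHypergraph

/-! ### The family PSL_3(3).2. -/

section SingerCase

open Matrix

variable {Ω : Type*} [Finite Ω] {G : Subgroup (Equiv.Perm Ω)}

theorem IsPSL33Case.even_degree (hprim : MulAction.IsPreprimitive G Ω) (h : IsPSL33Case G) (v : Ω) :
    Even (degree (saxlHypergraph G) v) := by
  obtain ⟨T, P, hTi, ⟨A, hA, hr, rfl⟩, hT, ω, φ, hφ⟩ := h
  obtain ⟨g, hg⟩ := exists_conj_mem_iff hA hr
  have hcenter : Subgroup.center (SpecialLinearGroup (Fin 3) (ZMod 3)) = ⊥ := by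
    rw [eq_bot_iff]
    intro M hM
    obtain ⟨r, hr1, hr2⟩ := Matrix.SpecialLinearGroup.mem_center_iff.1 hM
    have h1 : ∀ r : ZMod 3, r ^ 3 = 1 → r = 1 := by decide
    rw [Fintype.card_fin] at hr1
    rw [h1 r hr1, map_one] at hr2
    exact Subgroup.mem_bot.2 (Subtype.ext hr2.symm)
  set π : SpecialLinearGroup (Fin 3) (ZMod 3) →* PSL 3 (ZMod 3) := QuotientGroup.mk' _ with hπ
  have hπi : Function.Injective π := by
    rw [← MonoidHom.ker_eq_bot_iff, hπ, QuotientGroup.ker_mk', hcenter]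
  set f : SpecialLinearGroup (Fin 3) (ZMod 3) →* G :=
    T.subtype.comp (φ.symm.toMonoidHom.comp π) with hf
  have hfi : Function.Injective f :=
    T.subtype_injective.comp (φ.symm.injective.comp hπi)
  have hfT : (⊤ : Subgroup (SpecialLinearGroup (Fin 3) (ZMod 3))).map f = T := by
    ext x
    constructor
    · rintro ⟨M, -, rfl⟩
      exact (φ.symm (π M)).2
    · intro hx
      obtain ⟨M, hM⟩ := QuotientGroup.mk'_surjective _ (φ ⟨x, hx⟩)
      refine ⟨M, trivial, ?_⟩
      change ((φ.symm (π M) : T) : G) = x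
      rw [show π M = φ ⟨x, hx⟩ from hM, φ.symm_apply_apply]
  have hfω : ∀ M, f M • ω = ω ↔ M ∈ slNormalizer A := fun M =>
    (symm_smul_eq_iff φ hφ (π M)).trans (mk_mem_map_slNormalizer_iff A M)
  set B := (slNormalizer A).comap (MulAut.conj g).toMonoidHom with hBdef
  have hB : ∀ M, M ∈ B ↔ ∃ i j : ℕ, M = singerA ^ i * singerC ^ j := fun M =>
    mem_slNormalizer_iff_exists_pow hg M
  have hpair := (isSingerPair_singerA hB).map f hfi
  rw [hfT] at hpair
  have hcard : Nat.card T = 16 * 351 := by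
    rw [← card_sl_three, ← hfT, ← Subgroup.card_top (G := SpecialLinearGroup (Fin 3) (ZMod 3))]
    exact (Nat.card_congr (Subgroup.equivMapOfInjective ⊤ f hfi).toEquiv).symm
  have hω := hpair.even_degree (v := f g⁻¹ • ω) hT hprim hTi (fun x hx => by
    rw [← hfT] at hx
    obtain ⟨M, -, rfl⟩ := hx
    rw [Subgroup.mem_map_iff_mem hfi]
    change g * M * g⁻¹ ∈ slNormalizer A ↔ _
    rw [← hfω, map_mul, map_mul, map_inv, mul_smul, mul_smul, ← eq_inv_smul_iff])
    hcard (by decide)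
  have htr : MulAction.IsPretransitive G Ω := hprim.toIsPretransitive
  rwa [hasValency_degree (G := G) (f g⁻¹ • ω) v (Set.mem_univ v)]

end SingerCase

end SaxlHypergraph

namespace SaxlHypergraph

/-! ### The seven-dimensional representation of the Ree groups. -/

section ReeRepresentation

variable {F : Type*} [Field F] (θ : F →+* F)

/-- The fifth coordinate of the seven-dimensional representation of the Ree group. -/
def reeU (x y z : F) : F := x ^ 2 * y - x * z + θ y - θ x * x ^ 3

/-- The sixth coordinate of the seven-dimensional representation of the Ree group. -/
def reeV (x y z : F) : F := θ x * θ y - θ z + x * y ^ 2 + y * z - θ x ^ 2 * x ^ 3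

/-- The last coordinate of the seven-dimensional representation of the Ree group. -/
def reeW (x y z : F) : F := y * reeU θ x y z + x * reeV θ x y z + z ^ 2

/-- The point of the seven-dimensional space that represents a point of the Ree ovoid. -/
def reeVec (p : OnePoint (F × F × F)) : Fin 7 → F :=
  p.elim ![0, 0, 0, 0, 0, 0, 1] fun r =>
    ![1, r.1, r.2.1, r.2.2, reeU θ r.1 r.2.1 r.2.2, reeV θ r.1 r.2.1 r.2.2, reeW θ r.1 r.2.1 r.2.2]

/-- In characteristic three, the bilinear form that the Ree group preserves up to scalars. -/
def reeForm (a b : Fin 7 → F) : F :=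
  a 0 * b 6 + a 6 * b 0 - a 2 * b 4 - a 4 * b 2 - a 1 * b 5 - a 5 * b 1 + a 3 * b 3

/-- The permutations of the Ree ovoid that are induced by linear similitudes. -/
def IsReeLinear (π : Equiv.Perm (OnePoint (F × F × F))) : Prop :=
  ∃ (M : (Fin 7 → F) →ₗ[F] (Fin 7 → F)) (l : F), l ≠ 0 ∧
    (∀ a b, reeForm (M a) (M b) = l * reeForm a b) ∧
    ∀ p, ∃ c : F, c ≠ 0 ∧ M (reeVec θ p) = c • reeVec θ (π p)

theorem reeVec_infty : reeVec θ ∞ = ![0, 0, 0, 0, 0, 0, 1] := rfl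

theorem reeVec_coe (x y z : F) : reeVec θ ((x, y, z) : F × F × F) =
    ![1, x, y, z, reeU θ x y z, reeV θ x y z, reeW θ x y z] := rfl

theorem isReeLinear_one : IsReeLinear θ 1 :=
  ⟨LinearMap.id, 1, one_ne_zero, fun a b => by simp, fun p => ⟨1, one_ne_zero, by simp⟩⟩

variable {θ}

theorem IsReeLinear.mul {π ρ : Equiv.Perm (OnePoint (F × F × F))} (hπ : IsReeLinear θ π)
    (hρ : IsReeLinear θ ρ) : IsReeLinear θ (π * ρ) := by
  obtain ⟨M, l, hl, hM, h⟩ := hπ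
  obtain ⟨N, m, hm, hN, h'⟩ := hρ
  refine ⟨M ∘ₗ N, l * m, mul_ne_zero hl hm, fun a b => ?_, fun p => ?_⟩
  · rw [LinearMap.comp_apply, LinearMap.comp_apply, hM, hN, mul_assoc]
  · obtain ⟨c, hc, h1⟩ := h' p
    obtain ⟨d, hd, h2⟩ := h (ρ p)
    refine ⟨c * d, mul_ne_zero hc hd, ?_⟩
    rw [LinearMap.comp_apply, h1, map_smul, h2, smul_smul]
    rfl

theorem IsReeLinear.pow {π : Equiv.Perm (OnePoint (F × F × F))} (hπ : IsReeLinear θ π) (n : ℕ) :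
    IsReeLinear θ (π ^ n) := by
  induction n with
  | zero => exact isReeLinear_one θ
  | succ n ih => rw [pow_succ]; exact ih.mul hπ

/-- In a finite group an inverse is a positive power, so closure under products suffices. -/
theorem isReeLinear_of_mem_closure [Finite F] {S : Set (Equiv.Perm (OnePoint (F × F × F)))}
    (hS : ∀ π ∈ S, IsReeLinear θ π) {π} (hπ : π ∈ Subgroup.closure S) : IsReeLinear θ π := by
  have : Finite (OnePoint (F × F × F)) := inferInstanceAs (Finite (Option (F × F × F)))
  induction hπ using Subgroup.closure_induction with
  | mem x hx => exact hS x hx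
  | one => exact isReeLinear_one θ
  | mul x y _ _ hx hy => exact hx.mul hy
  | inv x _ hx =>
    rw [inv_eq_of_mul_eq_one_left (a := x ^ (orderOf x - 1)) (by
      rw [← pow_succ, Nat.sub_add_cancel (orderOf_pos x), pow_orderOf_eq_one])]
    exact hx.pow _

/-- The matrix of the translation by `(a, 0, 0)`, where `A = a ^ θ`. -/
def reeMatA (a A : F) : (Fin 7 → F) →ₗ[F] (Fin 7 → F) where
  toFun v := ![v 0, v 1 + a * v 0, v 2 + A * v 1, v 3 - a * v 2 - A * a * v 1,
    v 4 - a * v 3 - a ^ 2 * v 2 - A * a ^ 2 * v 1 - A * a ^ 3 * v 0,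
    v 5 - A * v 4 - A ^ 2 * a ^ 3 * v 0,
    v 6 + a * v 5 - A * a * v 4 - A * a ^ 3 * v 2 + A ^ 2 * a ^ 3 * v 1 - A ^ 2 * a ^ 4 * v 0]
  map_add' v w := by
    ext i
    fin_cases i <;> simp <;> ring
  map_smul' k v := by
    ext i
    fin_cases i <;> simp <;> ring

/-- The matrix of the translation by `(0, b, c)`, where `B = b ^ θ` and `C = c ^ θ`. -/
def reeMatB (b B c C : F) : (Fin 7 → F) →ₗ[F] (Fin 7 → F) where
  toFun v := ![v 0, v 1, v 2 + b * v 0, v 3 + c * v 0 + b * v 1, v 4 - c * v 1 + B * v 0,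
    v 5 + (b * c - C) * v 0 - b ^ 2 * v 1 + c * v 2 + b * v 3,
    v 6 - (C + b * c) * v 1 + b * v 4 + B * v 2 + (B * b + c ^ 2) * v 0 - c * v 3]
  map_add' v w := by
    ext i
    fin_cases i <;> simp <;> ring
  map_smul' k v := by
    ext i
    fin_cases i <;> simp <;> ring

/-- The matrix of the inversion. -/
def reeMatN : (Fin 7 → F) →ₗ[F] (Fin 7 → F) where
  toFun v := ![v 6, -v 5, -v 4, -v 3, -v 2, -v 1, v 0]
  map_add' v w := by
    ext i
    fin_cases i <;> simp <;> ring
  map_smul' k v := by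
    ext i
    fin_cases i <;> simp

/-- The matrix of a torus element, where `K = κ ^ θ`. -/
def reeMatD (κ K : F) : (Fin 7 → F) →ₗ[F] (Fin 7 → F) where
  toFun v := ![v 0, κ * v 1, K * κ * v 2, K * κ ^ 2 * v 3, K * κ ^ 3 * v 4, K ^ 2 * κ ^ 3 * v 5,
    K ^ 2 * κ ^ 4 * v 6]
  map_add' v w := by
    ext i
    fin_cases i <;> simp <;> ring
  map_smul' k v := by
    ext i
    fin_cases i <;> simp <;> ring

variable [CharP F 3]

theorem reeForm_reeMatA (a A : F) (v w : Fin 7 → F) :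
    reeForm (reeMatA a A v) (reeMatA a A w) = reeForm v w := by
  simp only [reeForm, reeMatA, LinearMap.coe_mk, AddHom.coe_mk, Matrix.cons_val]
  grind

theorem reeForm_reeMatB (b B c C : F) (v w : Fin 7 → F) :
    reeForm (reeMatB b B c C v) (reeMatB b B c C w) = reeForm v w := by
  simp only [reeForm, reeMatB, LinearMap.coe_mk, AddHom.coe_mk, Matrix.cons_val]
  grind

theorem reeForm_reeMatD (κ K : F) (v w : Fin 7 → F) :
    reeForm (reeMatD κ K v) (reeMatD κ K w) = K ^ 2 * κ ^ 4 * reeForm v w := by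
  simp only [reeForm, reeMatD, LinearMap.coe_mk, AddHom.coe_mk, Matrix.cons_val]
  ring

theorem reeForm_reeMatN (v w : Fin 7 → F) :
    reeForm (reeMatN v) (reeMatN w) = 1 * reeForm v w := by
  simp only [reeForm, reeMatN, LinearMap.coe_mk, AddHom.coe_mk, Matrix.cons_val]
  ring

theorem reeMatA_reeVec (hθ : ∀ x, θ (θ x) = x ^ 3) (a x y z : F) :
    reeMatA a (θ a) (reeVec θ ((x, y, z) : F × F × F)) =
      reeVec θ ((x + a, y + θ a * x, z - a * y - θ a * a * x) : F × F × F) := by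
  rw [reeVec_coe, reeVec_coe]
  ext i
  fin_cases i <;> simp [reeMatA, reeU, reeV, reeW, hθ] <;> grind

theorem reeMatB_reeVec (hθ : ∀ x, θ (θ x) = x ^ 3) (b c x y z : F) :
    reeMatB b (θ b) c (θ c) (reeVec θ ((x, y, z) : F × F × F)) =
      reeVec θ ((x, y + b, z + c + b * x) : F × F × F) := by
  rw [reeVec_coe, reeVec_coe]
  ext i
  fin_cases i <;> simp [reeMatB, reeU, reeV, reeW] <;> grind

theorem reeMatD_reeVec (hθ : ∀ x, θ (θ x) = x ^ 3) (κ x y z : F) :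
    reeMatD κ (θ κ) (reeVec θ ((x, y, z) : F × F × F)) =
      reeVec θ ((κ * x, θ κ * κ * y, θ κ * κ ^ 2 * z) : F × F × F) := by
  rw [reeVec_coe, reeVec_coe]
  ext i
  fin_cases i <;> simp [reeMatD, reeU, reeV, reeW, hθ] <;> ring

/-- The matrix reverses the coordinates up to sign. What has to be checked is that the reversed
vector, divided by w, again has the fifth, sixth and seventh coordinates prescribed by its first
ones. -/
theorem reeMatN_reeVec (hθ : ∀ x, θ (θ x) = x ^ 3) {x y z : F} (hw : reeW θ x y z ≠ 0) :
    reeMatN (reeVec θ ((x, y, z) : F × F × F)) = reeW θ x y z • reeVec θ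
      ((-reeV θ x y z / reeW θ x y z, -reeU θ x y z / reeW θ x y z, -z / reeW θ x y z) :
        F × F × F) := by
  obtain ⟨u, hu⟩ : ∃ u, u = reeU θ x y z := ⟨_, rfl⟩
  obtain ⟨v, hv⟩ : ∃ v, v = reeV θ x y z := ⟨_, rfl⟩
  obtain ⟨w, hw'⟩ : ∃ w, w = reeW θ x y z := ⟨_, rfl⟩
  -- This and the next identity are polynomial identities in x, y, z and their images under θ. With
  -- denominators cleared they give the fifth and sixth coordinates of the image.
  have h1 : θ u * w ^ 3 + θ v * v ^ 3 + θ w * (v ^ 2 * u + v * z * w - y * w ^ 2) = 0 := by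
    rw [hw', reeW, ← hu, ← hv]
    simp only [map_add, map_mul, map_pow]
    rw [hu, hv, reeU, reeV]
    simp only [map_add, map_sub, map_mul, map_pow, hθ]
    grind
  have h2 : θ z * w ^ 3 - θ v * (v ^ 2 * u + v * z * w - y * w ^ 2) +
      θ w * (x * w ^ 2 + u * z * w - u ^ 2 * v) = 0 := by
    rw [hw', reeW, ← hu, ← hv]
    simp only [map_add, map_mul, map_pow]
    rw [hu, hv, reeU, reeV]
    simp only [map_add, map_sub, map_mul, map_pow, hθ]
    grind
  have hwr : w = y * u + x * v + z ^ 2 := by rw [hw', reeW, ← hu, ← hv]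
  rw [← hw'] at hw
  rw [reeVec_coe, ← hw', ← hu, ← hv]
  have hW : θ w ≠ 0 := (map_ne_zero θ).2 hw
  have hU' : w * reeU θ (-v / w) (-u / w) (-z / w) = -y := by
    simp only [reeU, map_div₀, map_neg]
    field_simp
    linear_combination -h1
  have hV' : w * reeV θ (-v / w) (-u / w) (-z / w) = -x := by
    simp only [reeV, map_div₀, map_neg]
    field_simp
    linear_combination θ v * h1 + θ w * h2
  have hW' : w * reeW θ (-v / w) (-u / w) (-z / w) = 1 := by
    have : w * reeW θ (-v / w) (-u / w) (-z / w) =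
      (-u / w) * (w * reeU θ (-v / w) (-u / w) (-z / w)) +
      (-v / w) * (w * reeV θ (-v / w) (-u / w) (-z / w)) + w * (-z / w) ^ 2 := by
      rw [reeW]; ring
    rw [this, hU', hV']
    field_simp
    linear_combination -hwr
  rw [reeVec_coe]
  ext i
  fin_cases i <;> simp [reeMatN, hU', hV', hW']
  all_goals field_simp

end ReeRepresentation

end SaxlHypergraph

namespace SaxlHypergraph

/-! ### Polynomial identities in s and θ(s). -/

section ReeTorus

variable {F : Type*} [Field F] {θ : F →+* F}

/-- The properties of the field automorphism `θ` with `θ ^ 2 = Frob` that define a Ree group. -/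
structure IsReeTwist (θ : F →+* F) : Prop where
  map_map : ∀ x, θ (θ x) = x ^ 3
  lt_card : 9 < Nat.card F
  map_eq_pow : ∃ t : ℕ, ∀ x, θ x = x ^ t

theorem IsReeTwist.finite (h : IsReeTwist θ) : Finite F :=
  Nat.finite_of_card_ne_zero (by have := h.lt_card; omega)

theorem IsReeTwist.eq_of_map_eq (h : IsReeTwist θ) {r : F} (hr : θ r = r) :
    r = 0 ∨ r = 1 ∨ r = -1 := by
  have h1 := h.map_map r
  rw [hr, hr] at h1
  have h2 : r * ((r - 1) * (r + 1)) = 0 := by linear_combination -h1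
  rcases mul_eq_zero.1 h2 with h2 | h2
  · exact Or.inl h2
  · rcases mul_eq_zero.1 h2 with h2 | h2
    · exact Or.inr (Or.inl (sub_eq_zero.1 h2))
    · exact Or.inr (Or.inr (eq_neg_of_add_eq_zero_left h2))

theorem IsReeTwist.eq_of_mul_eq (h : IsReeTwist θ) {a b : F} (hb : b ≠ 0)
    (hab : θ a * b = θ b * a) : a = 0 ∨ a = b ∨ a = -b := by
  have hb' : θ b ≠ 0 := (map_ne_zero θ).2 hb
  have h1 : θ (a / b) = a / b := by
    rw [map_div₀, div_eq_div_iff hb' hb, hab, mul_comm]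
  rcases h.eq_of_map_eq h1 with h1 | h1 | h1
  · exact Or.inl ((div_eq_zero_iff.1 h1).resolve_right hb)
  · exact Or.inr (Or.inl ((div_eq_one_iff_eq hb).1 h1))
  · exact Or.inr (Or.inr (by rw [div_eq_iff hb] at h1; rw [h1, neg_one_mul]))

/-- The sums of two sets with at most three elements number at most nine, and the field is larger.
-/
theorem IsReeTwist.false_of_subset (h : IsReeTwist θ) {a b : F}
    (hab : ∀ x, ∃ i j, x = i + j ∧ (i = 0 ∨ i = a ∨ i = -a) ∧ (j = 0 ∨ j = b ∨ j = -b)) :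
    False := by
  classical
  have := h.finite
  have := Fintype.ofFinite F
  have h1 : (Finset.univ : Finset F) ⊆ ({0, a, -a} : Finset F) + ({0, b, -b} : Finset F) := by
    intro x _
    obtain ⟨i, j, rfl, hi, hj⟩ := hab x
    exact Finset.add_mem_add (by simpa using hi) (by simpa using hj)
  have h2 := (Finset.card_le_card h1).trans (Finset.card_add_le)
  have h3 := Nat.mul_le_mul (Finset.card_le_three (a := (0 : F)) (b := a) (c := -a))
    (Finset.card_le_three (a := (0 : F)) (b := b) (c := -b))
  have h4 := h.lt_card
  rw [Nat.card_eq_fintype_card, ← Finset.card_univ] at h4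
  omega

theorem IsReeTwist.exists_map_ne (h : IsReeTwist θ) : ∃ w, θ w ≠ w := by
  by_contra! hc
  exact h.false_of_subset (a := 1) (b := 0) fun x =>
    ⟨x, 0, by simp, h.eq_of_map_eq (hc x), Or.inl rfl⟩

/-- Since θ is not the identity, s and θ(s) are linearly independent as functions: evaluation at 1
and at a moved element w suffices. -/
theorem IsReeTwist.eq_zero_of_forall (h : IsReeTwist θ) {A B : F}
    (hAB : ∀ s, A * s + B * θ s = 0) : A = 0 ∧ B = 0 := by
  obtain ⟨w, hw⟩ := h.exists_map_ne
  have h1 := hAB 1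
  rw [map_one] at h1
  have h2 : A * (θ w - w) = 0 := by linear_combination θ w * h1 - hAB w
  have h3 := (mul_eq_zero.1 h2).resolve_right (sub_ne_zero.2 hw)
  exact ⟨h3, by rw [h3] at h1; simpa using h1⟩

theorem IsReeTwist.eq_zero_of_forall_const (h : IsReeTwist θ) {A B C : F}
    (hAB : ∀ s, A * s + B * θ s + C = 0) : A = 0 ∧ B = 0 := by
  have h0 := hAB 0
  rw [map_zero, mul_zero, mul_zero, zero_add, zero_add] at h0
  refine h.eq_zero_of_forall fun s => ?_
  rw [← hAB s, h0, add_zero]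

theorem IsReeTwist.surjective (h : IsReeTwist θ) : Function.Surjective θ :=
  have := h.finite
  Finite.surjective_of_injective θ.injective

/-- Comparing the values at xw and at x eliminates the linear term. As x^3 = θ(θ(x)), the remainder
is a relation between θ(x) and its own image under θ, where independence applies. -/
theorem IsReeTwist.eq_zero_of_forall_cube (h : IsReeTwist θ) {A B C : F}
    (hAB : ∀ s, A * s ^ 3 + B * θ s + C * s = 0) : A = 0 := by
  obtain ⟨w, hw⟩ := h.exists_map_ne
  have key : ∀ s, (B * (θ w - w)) * s + (A * (w ^ 3 - w)) * θ s = 0 := by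
    intro s
    obtain ⟨x, rfl⟩ := h.surjective s
    have h1 := hAB (x * w)
    rw [map_mul] at h1
    rw [h.map_map]
    linear_combination h1 - w * hAB x
  have h2 := (h.eq_zero_of_forall key).2
  refine (mul_eq_zero.1 h2).resolve_right fun h3 => hw ?_
  have h4 : w * ((w - 1) * (w + 1)) = 0 := by linear_combination h3
  rcases mul_eq_zero.1 h4 with h4 | h4
  · simp [h4]
  · rcases mul_eq_zero.1 h4 with h4 | h4
    · simp [sub_eq_zero.1 h4]
    · simp [eq_neg_of_add_eq_zero_left h4]

variable [CharP F 3]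

/-- The linear part of a similitude of the Ree ovoid on the third coordinate axis. -/
theorem IsReeTwist.axis (h : IsReeTwist θ) {p₁ q₁ p₂ q₂ p₃ q₃ p₄ q₄ p₅ q₅ ν : F} (hν : ν ≠ 0)
    (hU : ∀ s, p₄ * s + q₄ * θ s = reeU θ (p₁ * s + q₁ * θ s) (p₂ * s + q₂ * θ s)
      (p₃ * s + q₃ * θ s))
    (hV : ∀ s, p₅ * s + q₅ * θ s = reeV θ (p₁ * s + q₁ * θ s) (p₂ * s + q₂ * θ s)
      (p₃ * s + q₃ * θ s))
    (hW : ∀ s, ν * s ^ 2 = reeW θ (p₁ * s + q₁ * θ s) (p₂ * s + q₂ * θ s)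
      (p₃ * s + q₃ * θ s)) :
    (∀ s, p₁ * s + q₁ * θ s = 0) ∧ (∀ s, p₂ * s + q₂ * θ s = 0) ∧
      ∀ s, p₃ * s + q₃ * θ s = (p₃ + q₃) * s := by
  have h3 : (3 : F) = 0 := by exact_mod_cast CharP.cast_eq_zero F 3
  have h2 : (2 : F) ≠ 0 := by
    intro h
    exact one_ne_zero (α := F) (by linear_combination h3 - h)
  obtain ⟨X, hX⟩ : ∃ X : F → F, X = fun s => p₁ * s + q₁ * θ s := ⟨_, rfl⟩
  obtain ⟨Y, hY⟩ : ∃ Y : F → F, Y = fun s => p₂ * s + q₂ * θ s := ⟨_, rfl⟩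
  obtain ⟨Z, hZ⟩ : ∃ Z : F → F, Z = fun s => p₃ * s + q₃ * θ s := ⟨_, rfl⟩
  have hXn : ∀ s, X (-s) = -X s := fun s => by rw [hX]; simp; ring
  have hYn : ∀ s, Y (-s) = -Y s := fun s => by rw [hY]; simp; ring
  have hZn : ∀ s, Z (-s) = -Z s := fun s => by rw [hZ]; simp; ring
  have hXa : ∀ s t, X (s + t) = X s + X t := fun s t => by rw [hX]; simp; ring
  have hYa : ∀ s t, Y (s + t) = Y s + Y t := fun s t => by rw [hY]; simp; ring
  have hZa : ∀ s t, Z (s + t) = Z s + Z t := fun s t => by rw [hZ]; simp; ring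
  have hU' : ∀ s, p₄ * s + q₄ * θ s = reeU θ (X s) (Y s) (Z s) := fun s => by
    rw [hU, hX, hY, hZ]
  have hV' : ∀ s, p₅ * s + q₅ * θ s = reeV θ (X s) (Y s) (Z s) := fun s => by
    rw [hV, hX, hY, hZ]
  have hW' : ∀ s, ν * s ^ 2 = reeW θ (X s) (Y s) (Z s) := fun s => by rw [hW, hX, hY, hZ]
  -- The left side of the equation for U is odd in s, so the even part of the right side vanishes.
  have hXZ : ∀ s, X s ≠ 0 → Z s = -θ (X s) * X s ^ 2 := by
    intro s hs
    have h1 := hU' (-s)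
    rw [hXn, hYn, hZn, map_neg] at h1
    have h2 := hU' s
    simp only [reeU, map_neg] at h1 h2
    have h5 : X s * (Z s + θ (X s) * X s ^ 2) = 0 := by
      linear_combination (X s * Z s + θ (X s) * X s ^ 3) * h3 - h1 - h2
    linear_combination (mul_eq_zero.1 h5).resolve_left hs
  have hYZ : ∀ s, X s = 0 → Y s * Z s = 0 := by
    intro s hs
    have h1 := hV' (-s)
    rw [hXn, hYn, hZn, map_neg] at h1
    have h2 := hV' s
    simp only [reeV, map_neg, hs, map_zero] at h1 h2
    linear_combination h1 + h2 + (Y s * Z s) * h3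
  -- Additivity of X and Z turns the formula for Z into θ(X t) X s = θ(X s) X t, so X takes at most
  -- three values. Its zeros also number at most three, and then the field would have at most nine
  -- elements.
  have hX0 : ∀ s, X s = 0 := by
    by_contra! hc
    obtain ⟨s, hs⟩ := hc
    have hval : ∀ t, X t = 0 ∨ X t = X s ∨ X t = -X s := by
      intro t
      by_contra! ht
      obtain ⟨ht0, ht1, ht2⟩ := ht
      have h4 := hXZ (s + t) (by
        rw [hXa]
        exact fun h => ht2 (eq_neg_of_add_eq_zero_right h))
      have h5 := hXZ (s + -t) (by
        rw [hXa, hXn]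
        exact fun h => ht1 (add_neg_eq_zero.1 h).symm)
      rw [hZa, hXa, hXZ s hs, hXZ t ht0, map_add] at h4
      rw [hZa, hXa, hXn, hZn, hXZ s hs, hXZ t ht0, map_add, map_neg] at h5
      have h6 : X t * (θ (X t) * X s - θ (X s) * X t) = 0 := by
        linear_combination h4 + h5 - (θ (X s) * X t ^ 2 + θ (X t) * X s * X t) * h3
      have h7 := sub_eq_zero.1 ((mul_eq_zero.1 h6).resolve_left ht0)
      rcases h.eq_of_mul_eq hs h7 with h8 | h8 | h8
      · exact ht0 h8
      · exact ht1 h8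
      · exact ht2 h8
    obtain ⟨k, hk⟩ : ∃ k, ∀ t, X t = 0 → t = 0 ∨ t = k ∨ t = -k := by
      by_cases hk : ∃ k, X k = 0 ∧ k ≠ 0
      · obtain ⟨k, hk, hk0⟩ := hk
        refine ⟨k, fun t ht => h.eq_of_mul_eq hk0 ?_⟩
        rw [hX] at hk ht hs
        simp only at hk ht hs
        by_cases hq : q₁ = 0
        · rw [hq, zero_mul, add_zero] at hk hs
          exact absurd ((mul_eq_zero.1 hk).resolve_right hk0) (left_ne_zero_of_mul hs)
        · refine mul_left_cancel₀ hq ?_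
          linear_combination k * ht - t * hk
      · push Not at hk
        exact ⟨0, fun t ht => Or.inl (hk t ht)⟩
    refine h.false_of_subset (a := s) (b := k) fun x => ?_
    rcases hval x with hx | hx | hx
    · exact ⟨0, x, by simp, Or.inl rfl, hk x hx⟩
    · refine ⟨s, x + -s, by ring, Or.inr (Or.inl rfl), hk _ ?_⟩
      rw [hXa, hXn, hx, add_neg_cancel]
    · refine ⟨-s, x + s, by ring, Or.inr (Or.inr rfl), hk _ ?_⟩
      rw [hXa, hx, neg_add_cancel]
  have hW0 : ∀ s, ν * s ^ 2 = Y s * θ (Y s) + Z s ^ 2 := by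
    intro s
    rw [hW', reeW, reeU, hX0]
    simp
  obtain ⟨w, hw⟩ := h.exists_map_ne
  -- By additivity and YZ = 0, either Y or Z vanishes identically. If Z does, Y θ(Y) is the
  -- quadratic form ν s^2; polarising at 1 and w shows that Y w is a GF(3)-multiple of Y 1, and
  -- hence that w lies in GF(3).
  have hY0 : ∀ s, Y s = 0 := by
    by_contra! hc
    obtain ⟨s, hs⟩ := hc
    have hZ0 : ∀ t, Z t = 0 := by
      by_contra! hc
      obtain ⟨t, ht⟩ := hc
      have h1 := (mul_eq_zero.1 (hYZ s (hX0 s))).resolve_left hs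
      have h4 := (mul_eq_zero.1 (hYZ t (hX0 t))).resolve_right ht
      have h5 := hYZ (s + t) (hX0 _)
      rw [hYa, hZa, h1, h4, add_zero, zero_add] at h5
      exact mul_ne_zero hs ht h5
    simp only [hZ0] at hW0
    have h1 := hW0 1
    have h4 := hW0 w
    have h5 := hW0 (1 + w)
    rw [hYa, map_add] at h5
    have h6 : Y 1 * θ (Y w) + Y w * θ (Y 1) = 2 * (ν * w) := by
      linear_combination h1 + h4 - h5
    have h7 : (θ (Y w) * Y 1 - θ (Y 1) * Y w) ^ 2 = 0 := by
      linear_combination (Y 1 * θ (Y w) + Y w * θ (Y 1) + 2 * (ν * w)) * h6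
        + 4 * (ν * w ^ 2) * h1 + 4 * Y 1 * θ (Y 1) * h4
    have h8 := sub_eq_zero.1 (pow_eq_zero_iff two_ne_zero |>.1 h7)
    have hY1 : Y 1 ≠ 0 := by
      intro h0
      rw [h0, zero_mul] at h1
      exact hν (by linear_combination h1)
    have h9 : ν * (w * ((w - 1) * (w + 1))) = 0 := by
      rcases h.eq_of_mul_eq hY1 h8 with h9 | h9 | h9 <;> rw [h9] at h4
      · linear_combination (w - w⁻¹) * h4 + (ν * w) * (inv_mul_cancel₀ (a := w) (by
          rintro rfl; simp at hw))
      · linear_combination w * h4 - w * h1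
      · rw [map_neg] at h4
        linear_combination w * h4 - w * h1
    rcases mul_eq_zero.1 ((mul_eq_zero.1 h9).resolve_left hν) with h9 | h9
    · exact hw (by simp [h9])
    · rcases mul_eq_zero.1 h9 with h9 | h9
      · exact hw (by simp [sub_eq_zero.1 h9])
      · exact hw (by simp [eq_neg_of_add_eq_zero_left h9])
  refine ⟨fun s => by rw [← hX0 s, hX], fun s => by rw [← hY0 s, hY], fun s => ?_⟩
  simp only [hY0, zero_mul, zero_add] at hW0
  have h1 := hW0 1
  have h4 := hW0 s
  have h5 := hW0 (1 + s)
  rw [hZa] at h5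
  have hZ1 : Z 1 ≠ 0 := by
    intro h0
    rw [h0] at h1
    exact hν (by linear_combination h1)
  have h6 : 2 * Z 1 * (Z s - Z 1 * s) = 0 := by
    linear_combination h5 - h1 - h4 + 2 * s * h1 - 2 * (h5 - h1 - h4)
  have h7 := sub_eq_zero.1 ((mul_eq_zero.1 h6).resolve_left (mul_ne_zero h2 hZ1))
  rw [hZ] at h7
  simpa using h7

end ReeTorus

end SaxlHypergraph

namespace SaxlHypergraph

/-! ### Translations, the torus, and the stabiliser of two points. -/

section ReeModel

/-- A permutation of `X`, extended to `X ∪ {∞}`. -/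
def extendPerm {X : Type*} : Equiv.Perm X →* Equiv.Perm (OnePoint X) where
  toFun e :=
    { toFun := OnePoint.map e
      invFun := OnePoint.map e.symm
      left_inv := fun x => by induction x using OnePoint.rec <;> simp
      right_inv := fun x => by induction x using OnePoint.rec <;> simp }
  map_one' := Equiv.ext fun x => by induction x using OnePoint.rec <;> simp
  map_mul' e f := Equiv.ext fun x => by induction x using OnePoint.rec <;> simp

@[simp] theorem extendPerm_infty {X : Type*} (e : Equiv.Perm X) :
    extendPerm e (∞ : OnePoint X) = ∞ := rfl

@[simp] theorem extendPerm_coe {X : Type*} (e : Equiv.Perm X) (x : X) :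
    extendPerm e (x : OnePoint X) = (e x : X) := rfl

theorem extendPerm_injective {X : Type*} : Function.Injective (extendPerm (X := X)) := by
  intro e f h
  ext x
  have := congrArg (fun π => π (x : OnePoint X)) h
  simpa using this

theorem exists_eq_extendPerm {X : Type*} {π : Equiv.Perm (OnePoint X)} (h : π ∞ = ∞) :
    ∃ e : Equiv.Perm X, π = extendPerm e := by
  have key : ∀ π : Equiv.Perm (OnePoint X), π ∞ = ∞ → ∀ x : X, ∃ y : X, π x = y := by
    intro π h x
    have hx : π x ≠ ∞ := fun h1 => OnePoint.coe_ne_infty x (π.injective (h1.trans h.symm))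
    obtain ⟨y, hy⟩ := OnePoint.ne_infty_iff_exists.1 hx
    exact ⟨y, hy.symm⟩
  choose f hf using key π h
  choose g hg using key π.symm (by rw [Equiv.symm_apply_eq, h])
  refine ⟨⟨f, g, fun x => ?_, fun x => ?_⟩, ?_⟩
  · rw [← OnePoint.coe_eq_coe, ← hg, ← hf, Equiv.symm_apply_apply]
  · rw [← OnePoint.coe_eq_coe, ← hf, ← hg, Equiv.apply_symm_apply]
  · ext x
    induction x using OnePoint.rec with
    | infty => simp [h]
    | coe x => simp [hf]

variable {F : Type*} [Field F] (θ : F →+* F)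

/-- The translation of the Ree ovoid that takes the origin to `r`. -/
def reeTr (r : F × F × F) : Equiv.Perm (F × F × F) where
  toFun p := (p.1 + r.1, p.2.1 + r.2.1 + θ r.1 * p.1,
    p.2.2 + r.2.2 - r.1 * p.2.1 + r.2.1 * p.1 - θ r.1 * r.1 * p.1)
  invFun p := (p.1 - r.1, p.2.1 - r.2.1 - θ r.1 * (p.1 - r.1),
    p.2.2 - r.2.2 + r.1 * (p.2.1 - r.2.1 - θ r.1 * (p.1 - r.1)) - r.2.1 * (p.1 - r.1) +
      θ r.1 * r.1 * (p.1 - r.1))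
  left_inv p := by ext <;> simp <;> ring
  right_inv p := by ext <;> simp <;> ring

/-- The torus element with parameter `κ`. -/
def reeD (κ : Fˣ) : Equiv.Perm (F × F × F) where
  toFun p := (κ * p.1, θ κ * κ * p.2.1, θ κ * κ ^ 2 * p.2.2)
  invFun p := ((κ : F)⁻¹ * p.1, (θ κ * κ)⁻¹ * p.2.1, (θ κ * κ ^ 2)⁻¹ * p.2.2)
  left_inv p := by
    have := (map_ne_zero θ).2 κ.ne_zero
    ext <;> simp <;> field_simp
  right_inv p := by
    have := (map_ne_zero θ).2 κ.ne_zero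
    ext <;> simp <;> field_simp

theorem reeTr_apply (a b c x y z : F) : reeTr θ (a, b, c) (x, y, z) =
    (x + a, y + b + θ a * x, z + c - a * y + b * x - θ a * a * x) := rfl

theorem reeD_apply (κ : Fˣ) (x y z : F) :
    reeD θ κ (x, y, z) = (κ * x, θ κ * κ * y, θ κ * κ ^ 2 * z) := rfl

theorem reeTr_zero_right (r : F × F × F) : reeTr θ r 0 = r := by
  ext <;> simp [reeTr]

theorem reeD_zero_right (κ : Fˣ) : reeD θ κ 0 = 0 := by
  ext <;> simp [reeD]

variable {θ} [CharP F 3]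

/-- The vectors of ∞ and of the origin are eigenvectors, and pairing with them controls the
coordinates 0 and 6. Along the third axis `IsReeTwist.axis` controls the rows 3 and 5 of the matrix.
The invariant form pairs coordinate 1 with 5 and 3 with itself, so the first and third coordinates
of every point are scaled. Comparing coefficients in the equation for the fifth coordinate settles
the second. -/
theorem IsReeLinear.eq_reeD (h : IsReeTwist θ) {e : Equiv.Perm (F × F × F)}
    (he : IsReeLinear θ (extendPerm e)) (h0 : e 0 = 0) : ∃ κ : Fˣ, e = reeD θ κ := by
  obtain ⟨N, l, hl, hN, hp⟩ := he
  obtain ⟨k, hk, hk0⟩ := hp ((0 : F × F × F) : OnePoint (F × F × F))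
  rw [extendPerm_coe, h0] at hk0
  obtain ⟨n, hn, hn6⟩ := hp ∞
  rw [extendPerm_infty] at hn6
  obtain ⟨M, hM⟩ : ∃ M, M = k⁻¹ • N := ⟨_, rfl⟩
  obtain ⟨ν, hν⟩ : ∃ ν, ν = k⁻¹ * n := ⟨_, rfl⟩
  obtain ⟨m, hm⟩ : ∃ m, m = k⁻¹ * k⁻¹ * l := ⟨_, rfl⟩
  have hν0 : ν ≠ 0 := by rw [hν]; exact mul_ne_zero (inv_ne_zero hk) hn
  have hform : ∀ a b, reeForm (M a) (M b) = m * reeForm a b := by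
    intro a b
    rw [hm, mul_assoc, ← hN, hM, reeForm, reeForm]
    simp only [LinearMap.smul_apply, Pi.smul_apply, smul_eq_mul]
    ring
  have hM0 : M (reeVec θ ((0 : F × F × F) : OnePoint (F × F × F))) =
      reeVec θ ((0 : F × F × F) : OnePoint (F × F × F)) := by
    rw [hM, LinearMap.smul_apply, hk0, smul_smul, inv_mul_cancel₀ hk, one_smul]
  have hM6 : M (reeVec θ ∞) = ν • reeVec θ ∞ := by
    rw [hM, LinearMap.smul_apply, hn6, smul_smul, hν]
  have hform6 : ∀ a : Fin 7 → F, reeForm a (reeVec θ ∞) = a 0 := by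
    intro a
    simp [reeForm, reeVec_infty]
  have hform0 : ∀ a : Fin 7 → F,
      reeForm a (reeVec θ ((0 : F × F × F) : OnePoint (F × F × F))) = a 6 := by
    intro a
    rw [show (0 : F × F × F) = (0, 0, 0) from rfl, reeVec_coe]
    simp [reeForm, reeU, reeV, reeW]
  have hform0' : ∀ a : Fin 7 → F, reeForm a (M (reeVec θ ∞)) = ν * a 0 := by
    intro a
    rw [hM6, ← hform6 a, reeForm, reeForm]
    simp only [Pi.smul_apply, smul_eq_mul]
    ring
  have hmν : m = ν := by
    have h1 := hform (reeVec θ ((0 : F × F × F) : OnePoint (F × F × F))) (reeVec θ ∞)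
    rw [hform0', hM0, hform6] at h1
    have : reeVec θ ((0 : F × F × F) : OnePoint (F × F × F)) 0 = 1 := rfl
    rw [this] at h1
    linear_combination -h1
  rw [hmν] at hform
  have hMa0 : ∀ a, M a 0 = a 0 := by
    intro a
    have h1 := hform a (reeVec θ ∞)
    rw [hform0', hform6] at h1
    exact mul_left_cancel₀ hν0 h1
  have hMa6 : ∀ a, M a 6 = ν * a 6 := by
    intro a
    have h1 := hform a (reeVec θ ((0 : F × F × F) : OnePoint (F × F × F)))
    rwa [hM0, hform0, hform0] at h1
  have hvec : ∀ p : F × F × F, M (reeVec θ (p : OnePoint (F × F × F))) =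
      reeVec θ (e p : F × F × F) := by
    intro p
    obtain ⟨c, hc, hcp⟩ := hp p
    have h1 : M (reeVec θ (p : OnePoint (F × F × F))) = (k⁻¹ * c) • reeVec θ (e p : F × F × F) := by
      rw [hM, LinearMap.smul_apply, hcp, smul_smul, extendPerm_coe]
    have h2 := hMa0 (reeVec θ (p : OnePoint (F × F × F)))
    have h3 : ∀ p : F × F × F, reeVec θ (p : OnePoint (F × F × F)) 0 = 1 := fun p => rfl
    rw [h1, Pi.smul_apply, h3, h3, smul_eq_mul, mul_one] at h2
    rw [h1, h2, one_smul]
  -- Here C j i is coordinate i of the image of the j-th basis vector.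
  obtain ⟨C, hC⟩ : ∃ C : Fin 7 → Fin 7 → F, ∀ v i, M v i = ∑ j, v j * C j i :=
    ⟨fun j => M fun i => if j = i then 1 else 0, fun v i => by
      conv_lhs => rw [LinearMap.pi_apply_eq_sum_univ M v]
      simp⟩
  have hC0 : ∀ i, C 0 i = if i = 0 then 1 else 0 := by
    intro i
    have h1 := congrFun hM0 i
    rw [hC, show (0 : F × F × F) = (0, 0, 0) from rfl, reeVec_coe] at h1
    simp [Fin.sum_univ_seven, reeU, reeV, reeW] at h1
    rw [h1]
    fin_cases i <;> simp
  have hC6 : ∀ i, C 6 i = if i = 6 then ν else 0 := by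
    intro i
    have h1 := congrFun hM6 i
    rw [hC, reeVec_infty] at h1
    simp [Fin.sum_univ_seven] at h1
    rw [h1]
    fin_cases i <;> simp
  have hax : ∀ s i, reeVec θ (e (0, 0, s) : F × F × F) i =
      (if i = 0 then 1 else 0) + (C 3 i * s + -C 5 i * θ s) + if i = 6 then ν * s ^ 2 else 0 := by
    intro s i
    rw [← hvec, hC, reeVec_coe]
    simp [Fin.sum_univ_seven, reeU, reeV, reeW, hC0, hC6]
    split_ifs <;> ring
  have hax1 : ∀ s, (e (0, 0, s)).1 = C 3 1 * s + -C 5 1 * θ s := fun s => by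
    exact (hax s 1).trans (by simp)
  have hax2 : ∀ s, (e (0, 0, s)).2.1 = C 3 2 * s + -C 5 2 * θ s := fun s => by
    exact (hax s 2).trans (by simp)
  have hax3 : ∀ s, (e (0, 0, s)).2.2 = C 3 3 * s + -C 5 3 * θ s := fun s => by
    exact (hax s 3).trans (by simp)
  have hC06 : ∀ j, C j 0 = if j = 0 then 1 else 0 := fun j => by
    have h1 := hMa0 (Pi.single j 1)
    rw [hC] at h1
    simpa [Pi.single_apply, eq_comm] using h1
  have hC66 : ∀ j, C j 6 = if j = 6 then ν else 0 := fun j => by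
    have h1 := hMa6 (Pi.single j 1)
    rw [hC] at h1
    simpa [Pi.single_apply, eq_comm] using h1
  have hax4 : ∀ s, C 3 4 * s + -C 5 4 * θ s = reeU θ (C 3 1 * s + -C 5 1 * θ s)
      (C 3 2 * s + -C 5 2 * θ s) (C 3 3 * s + -C 5 3 * θ s) := fun s => by
    rw [← hax1, ← hax2, ← hax3]
    exact Eq.trans (by simp) (hax s 4).symm
  have hax5 : ∀ s, C 3 5 * s + -C 5 5 * θ s = reeV θ (C 3 1 * s + -C 5 1 * θ s)
      (C 3 2 * s + -C 5 2 * θ s) (C 3 3 * s + -C 5 3 * θ s) := fun s => by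
    rw [← hax1, ← hax2, ← hax3]
    exact Eq.trans (by simp) (hax s 5).symm
  have hax6 : ∀ s, ν * s ^ 2 = reeW θ (C 3 1 * s + -C 5 1 * θ s)
      (C 3 2 * s + -C 5 2 * θ s) (C 3 3 * s + -C 5 3 * θ s) := fun s => by
    rw [← hax1, ← hax2, ← hax3]
    exact Eq.trans (by simp [hC66]) (hax s 6).symm
  obtain ⟨k1, k2, k3⟩ := h.axis hν0 hax4 hax5 hax6
  obtain ⟨γ, hγ⟩ : ∃ γ, γ = C 3 3 + -C 5 3 := ⟨_, rfl⟩
  rw [← hγ] at k3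
  obtain ⟨h31, h51⟩ := h.eq_zero_of_forall k1
  obtain ⟨h32, h52⟩ := h.eq_zero_of_forall k2
  obtain ⟨h33, h53⟩ := h.eq_zero_of_forall (A := C 3 3 - γ) (B := -C 5 3)
    fun s => by linear_combination k3 s
  simp only [k1, k2, k3] at hax4 hax5 hax6
  obtain ⟨h34, h54⟩ := h.eq_zero_of_forall fun s => (hax4 s).trans (by simp [reeU])
  obtain ⟨h35, h55⟩ := h.eq_zero_of_forall (A := C 3 5) (B := -C 5 5 + θ γ)
    fun s => by
      have h1 := hax5 s
      simp only [reeV, map_zero, map_mul] at h1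
      linear_combination h1
  have hνγ : ν = γ ^ 2 := by
    have h1 := hax6 1
    simpa [reeW] using h1
  have hγ0 : γ ≠ 0 := by
    rintro rfl
    exact hν0 (by rw [hνγ]; ring)
  have hθγ : θ γ ≠ 0 := (map_ne_zero θ).2 hγ0
  rw [neg_eq_zero] at h51 h52 h53 h54
  have h33 : C 3 3 = γ := sub_eq_zero.1 h33
  have h55 : C 5 5 = θ γ := by linear_combination -h55
  have hMs : ∀ j i, M (Pi.single j 1) i = C j i := fun j i => by
    rw [hC]
    simp [Pi.single_apply]
  -- The torus element κ scales the third coordinate by γ = θ(κ) κ^2; with θ^2 the cubing map this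
  -- gives κ = γ^2 / θ(γ).
  obtain ⟨κ, hκ⟩ : ∃ κ, κ = γ ^ 2 / θ γ := ⟨_, rfl⟩
  have hκ0 : κ ≠ 0 := by rw [hκ]; exact div_ne_zero (pow_ne_zero 2 hγ0) hθγ
  have hMa1 : ∀ a, M a 1 = κ * a 1 := by
    intro a
    have h1 := hform a (Pi.single 5 1)
    simp [reeForm, hMs, hC06, hC66, h51, h52, h53, h54, h55] at h1
    rw [hκ, div_mul_eq_mul_div, eq_div_iff hθγ, ← hνγ, h1]
  have hMa3 : ∀ a, M a 3 = γ * a 3 := by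
    intro a
    have h1 := hform a (Pi.single 3 1)
    simp [reeForm, hMs, hC06, hC66, h31, h32, h33, h34, h35] at h1
    rw [hνγ] at h1
    exact mul_right_cancel₀ hγ0 (by linear_combination h1)
  have he1 : ∀ x y z, (e (x, y, z)).1 = κ * x := fun x y z => by
    have h1 := hMa1 (reeVec θ ((x, y, z) : F × F × F))
    rw [hvec] at h1
    exact h1
  have he3 : ∀ x y z, (e (x, y, z)).2.2 = γ * z := fun x y z => by
    have h1 := hMa3 (reeVec θ ((x, y, z) : F × F × F))
    rw [hvec] at h1
    exact h1
  have he2 : ∀ x y z, (e (x, y, z)).2.1 = C 1 2 * x + C 2 2 * y + C 4 2 * reeU θ x y z :=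
    fun x y z => by
      have h1 := congrFun (hvec (x, y, z)) 2
      rw [hC, reeVec_coe, Fin.sum_univ_seven] at h1
      simp [hC0, hC6, h32, h52] at h1
      exact h1.symm.trans (by ring)
  -- The fifth coordinate of the image is expressed both through the image point and through the
  -- matrix; special values of x, y, z then determine the remaining entries.
  have he4 : ∀ x y z, reeU θ (κ * x) (C 1 2 * x + C 2 2 * y + C 4 2 * reeU θ x y z) (γ * z) =
      C 1 4 * x + C 2 4 * y + C 4 4 * reeU θ x y z := fun x y z => by
    have h1 := congrFun (hvec (x, y, z)) 4
    rw [hC, reeVec_coe, Fin.sum_univ_seven] at h1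
    simp [hC0, hC6, h34, h54] at h1
    rw [← he1 x y z, ← he2, ← he3 x y z]
    exact h1.symm.trans (by ring)
  simp only [reeU, map_add, map_sub, map_mul, map_pow] at he4
  have hb4 : C 4 2 = 0 := by
    have h1 := (h.eq_zero_of_forall_const (A := -κ ^ 2 * C 4 2 - κ * γ + C 4 4) (B := -θ (C 4 2))
      (C := κ ^ 2 * (C 1 2 - C 4 2) + θ (C 1 2) - θ (C 4 2) - θ κ * κ ^ 3 - C 1 4 + C 4 4)
      fun s => by
        have h1 := he4 1 0 s
        simp only [map_one, map_zero] at h1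
        linear_combination h1).2
    rwa [neg_eq_zero, map_eq_zero] at h1
  simp only [hb4, map_zero, zero_mul, add_zero] at he4
  have hd4 : C 4 4 = κ * γ := by
    have h1 := he4 1 0 1
    have h2 := he4 1 0 0
    simp only [map_one, map_zero] at h1 h2
    linear_combination h1 - h2
  obtain ⟨hd2, hb2⟩ := h.eq_zero_of_forall (A := -C 2 4) (B := θ (C 2 2) - C 4 4) fun s => by
    have h1 := he4 0 s 0
    simp only [map_zero] at h1
    linear_combination h1
  have hd2 : C 2 4 = 0 := neg_eq_zero.1 hd2
  have hb2' : C 4 4 = κ ^ 2 * C 2 2 := by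
    have h1 := he4 1 1 0
    have h2 := he4 1 0 0
    simp only [map_one, map_zero] at h1 h2
    linear_combination h2 - h1 + hb2 - hd2
  have h20 : (2 : F) ≠ 0 := by
    intro h
    have h3 : (3 : F) = 0 := by exact_mod_cast CharP.cast_eq_zero F 3
    exact one_ne_zero (α := F) (by linear_combination h3 - h)
  have hb4' : C 4 4 = θ κ * κ ^ 3 := by
    have h1 := he4 1 0 0
    have h2 := he4 (-1) 0 0
    simp only [map_one, map_zero, map_neg] at h1 h2
    exact mul_left_cancel₀ h20 (by linear_combination h1 + h2)
  have hb1 : C 1 2 = 0 := by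
    have h1 := h.eq_zero_of_forall_cube (A := κ ^ 2 * C 1 2) (B := θ (C 1 2)) (C := -C 1 4)
      fun x => by
        have h1 := he4 x 0 0
        simp only [map_zero] at h1
        linear_combination h1 - (θ x * x ^ 3) * hb4'
    exact (mul_eq_zero.1 h1).resolve_left (pow_ne_zero 2 hκ0)
  have hb2 : C 2 2 = θ κ * κ := by
    refine mul_left_cancel₀ (pow_ne_zero 2 hκ0) ?_
    rw [← hb2', hb4']
    ring
  have hγκ : γ = θ κ * κ ^ 2 := by
    refine mul_left_cancel₀ hκ0 ?_
    rw [← hd4, hb4']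
    ring
  refine ⟨Units.mk0 κ hκ0, Equiv.ext fun p => ?_⟩
  obtain ⟨x, y, z⟩ := p
  rw [reeD_apply, Units.val_mk0, ← hb2, ← hγκ]
  refine Prod.ext (he1 x y z) (Prod.ext ?_ (he3 x y z))
  rw [he2, hb1, hb4]
  ring

end ReeModel

end SaxlHypergraph

namespace SaxlHypergraph

/-! ### Automorphisms of the translation group that normalise the torus. -/

section ReeAut

variable {F : Type*} [Field F]

/-- `e` is an automorphism of the group of translations of the Ree ovoid that normalises the
torus. -/
def IsReeAut (θ : F →+* F) (e : Equiv.Perm (F × F × F)) : Prop :=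
  (∀ p r, e (reeTr θ p r) = reeTr θ (e p) (e r)) ∧
    ∀ κ : Fˣ, ∃ κ' : Fˣ, ∀ p, e (reeD θ κ p) = reeD θ κ' (e p)

variable {θ : F →+* F} [CharP F 3] {e : Equiv.Perm (F × F × F)}

theorem three_eq_zero : (3 : F) = 0 := by exact_mod_cast CharP.cast_eq_zero F 3

theorem eq_zero_of_eq_neg {a : F} (h : a = -a) : a = 0 := by
  linear_combination 2 * h - a * three_eq_zero (F := F)

theorem reeD_neg_one_apply (x y z : F) : reeD θ (-1) (x, y, z) = (-x, y, -z) := by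
  rw [reeD_apply]
  simp

theorem IsReeAut.map_zero (he : IsReeAut θ e) : e 0 = 0 := by
  have h1 := he.1 0 0
  rw [reeTr_zero_right] at h1
  obtain ⟨⟨a, b, c⟩, hr⟩ : ∃ r, r = e 0 := ⟨_, rfl⟩
  rw [← hr, reeTr_apply] at h1
  simp only [Prod.mk.injEq] at h1
  obtain ⟨h2, h3, h4⟩ := h1
  have ha : a = 0 := by linear_combination -h2
  subst ha
  have hb : b = 0 := by linear_combination -h3
  subst hb
  have hc : c = 0 := by linear_combination -h4
  subst hc
  rw [← hr]
  rfl

/-- The parameter -1 belongs to the only involution of the torus, so it is preserved. -/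
theorem IsReeAut.map_neg (he : IsReeAut θ e) (p : F × F × F) :
    e (reeD θ (-1) p) = reeD θ (-1) (e p) := by
  obtain ⟨κ, hκ⟩ := he.2 (-1)
  have h1 : ∀ p, reeD θ κ (reeD θ κ (e p)) = e p := fun p => by
    rw [← hκ, ← hκ]
    congr 1
    obtain ⟨x, y, z⟩ := p
    rw [reeD_neg_one_apply, reeD_neg_one_apply, neg_neg, neg_neg]
  have h2 := h1 (e.symm (1, 0, 0))
  rw [e.apply_symm_apply, reeD_apply, reeD_apply] at h2
  have h3 : ((κ : F) - 1) * (κ + 1) = 0 := by linear_combination congrArg Prod.fst h2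
  rcases mul_eq_zero.1 h3 with h3 | h3
  · have h4 := hκ (1, 0, 0)
    have h5 : κ = 1 := Units.ext (sub_eq_zero.1 h3)
    rw [h5, reeD_neg_one_apply, reeD_apply] at h4
    simp only [Units.val_one, map_one, one_mul, one_pow, Prod.mk.eta] at h4
    have h6 := congrArg Prod.fst (e.injective h4)
    exact absurd (eq_zero_of_eq_neg h6.symm) one_ne_zero
  · have h5 : κ = -1 := Units.ext (eq_neg_of_add_eq_zero_left h3)
    rw [hκ, h5]

/-- Three subsets of the translation group are preserved: elements inverted by the torus involution
have second coordinate -θ(x)x, elements fixed by it are (0, y, 0), and the centre consists of the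
elements (0, 0, z). -/
theorem IsReeAut.exists_coords (h : IsReeTwist θ) (he : IsReeAut θ e) :
    ∃ α β γ μ : F → F, (∀ x, e (x, -(θ x * x), 0) = (α x, -(θ (α x) * α x), μ x)) ∧
      (∀ y, e (0, y, 0) = (0, β y, 0)) ∧ ∀ z, e (0, 0, z) = (0, 0, γ z) := by
  refine ⟨fun x => (e (x, -(θ x * x), 0)).1, fun y => (e (0, y, 0)).2.1,
    fun z => (e (0, 0, z)).2.2, fun x => (e (x, -(θ x * x), 0)).2.2, fun x => ?_, fun y => ?_,
    fun z => ?_⟩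
  · have h1 : reeTr θ (x, -(θ x * x), 0) (reeD θ (-1) (x, -(θ x * x), 0)) = 0 := by
      rw [reeD_neg_one_apply, reeTr_apply]
      refine Prod.ext ?_ (Prod.ext ?_ ?_)
      · simp
      · change _ = (0 : F)
        linear_combination -θ x * x * three_eq_zero (F := F)
      · change _ = (0 : F)
        linear_combination θ x * x ^ 2 * three_eq_zero (F := F)
    have h2 := he.1 (x, -(θ x * x), 0) (reeD θ (-1) (x, -(θ x * x), 0))
    rw [h1, he.map_zero, he.map_neg] at h2
    obtain ⟨⟨a, b, c⟩, hr⟩ : ∃ r, r = e (x, -(θ x * x), 0) := ⟨_, rfl⟩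
    rw [← hr, reeD_neg_one_apply, reeTr_apply] at h2
    rw [← hr]
    have h3 : (0 : F) = b + b + θ a * -a := congrArg (fun p => p.2.1) h2
    have h4 : b = -(θ a * a) := by linear_combination h3 + b * three_eq_zero (F := F)
    simp only [← hr, h4]
  · have h1 := he.map_neg (0, y, 0)
    rw [reeD_neg_one_apply, neg_zero] at h1
    obtain ⟨⟨a, b, c⟩, hr⟩ : ∃ r, r = e (0, y, 0) := ⟨_, rfl⟩
    rw [← hr, reeD_neg_one_apply] at h1
    have h2 : a = 0 := eq_zero_of_eq_neg (congrArg Prod.fst h1)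
    have h3 : c = 0 := eq_zero_of_eq_neg (congrArg (fun p => p.2.2) h1)
    simp only [← hr, h2, h3]
  · obtain ⟨⟨a, b, c⟩, hr⟩ : ∃ r, r = e (0, 0, z) := ⟨_, rfl⟩
    have h1 : ∀ r, reeTr θ (a, b, c) r = reeTr θ r (a, b, c) := by
      intro r
      obtain ⟨p, rfl⟩ := e.surjective r
      rw [hr, ← he.1, ← he.1]
      congr 1
      obtain ⟨x, y, t⟩ := p
      rw [reeTr_apply, reeTr_apply]
      refine Prod.ext ?_ (Prod.ext ?_ ?_) <;> simp <;> ring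
    have h2 : ∀ s, b + θ a * s = b + θ s * a := fun s => by
      have h3 := congrArg (fun p => p.2.1) (h1 (s, 0, 0))
      simp only [reeTr_apply] at h3
      linear_combination h3
    have ha : a = 0 := by
      obtain ⟨w, hw⟩ := h.exists_map_ne
      have h3 := h2 1
      rw [map_one] at h3
      have h4 : a * (θ w - w) = 0 := by linear_combination w * h3 - h2 w
      exact (mul_eq_zero.1 h4).resolve_right (sub_ne_zero.2 hw)
    have h3 := congrArg (fun p => p.2.2) (h1 (1, 0, 0))
    simp only [reeTr_apply, ha, map_one, _root_.map_zero] at h3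
    have hb : b = 0 := eq_zero_of_eq_neg (by linear_combination h3)
    simp only [← hr, ha, hb]

/-- Every translation is a product of a central one, one fixed by the torus involution, and one of
the form (x, -θ(x)x, 0). -/
theorem IsReeAut.apply_of_coords (he : IsReeAut θ e) {α β γ μ : F → F}
    (hα : ∀ x, e (x, -(θ x * x), 0) = (α x, -(θ (α x) * α x), μ x))
    (hβ : ∀ y, e (0, y, 0) = (0, β y, 0)) (hγ : ∀ z, e (0, 0, z) = (0, 0, γ z)) (x y z : F) :
    e (x, y, z) = (α x, -(θ (α x) * α x) + β (y + θ x * x),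
      μ x + γ (z - (y + θ x * x) * x) + β (y + θ x * x) * α x) := by
  have hy : ∀ y z, e (0, y, z) = (0, β y, γ z) := by
    intro y z
    have h2 := he.1 (0, 0, z) (0, y, 0)
    rw [hβ, hγ, reeTr_apply, reeTr_apply] at h2
    simpa using h2
  have h2 := he.1 (0, y + θ x * x, z - (y + θ x * x) * x) (x, -(θ x * x), 0)
  rw [hα, hy, reeTr_apply, reeTr_apply] at h2
  simpa using h2

/-- The automorphisms of the translation group that normalise the torus and take the first
coordinate `1` to `1` are field automorphisms. -/
theorem IsReeAut.exists_eq_of_map_one (h : IsReeTwist θ) (he : IsReeAut θ e)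
    (h1 : (e (1, -1, 0)).1 = 1) :
    ∃ σ : F →+* F, ∀ x y z, e (x, y, z) = (σ x, σ y, σ z) := by
  obtain ⟨α, β, γ, μ, hα, hβ, hγ⟩ := he.exists_coords h
  have h3 := three_eq_zero (F := F)
  have hθθ := h.map_map
  have hα1 : α 1 = 1 := by
    have := hα 1
    rw [map_one, one_mul] at this
    rw [this] at h1
    exact h1
  have hgen := he.apply_of_coords hα hβ hγ
  have hαa : ∀ a x, α (a + x) = α a + α x := by
    intro a x
    have h2 := congrArg Prod.fst (he.1 (x, 0, 0) (a, 0, 0))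
    rw [reeTr_apply, hgen, hgen, hgen, reeTr_apply] at h2
    exact h2
  have hβa : ∀ a x, β (a + x) = β a + β x := by
    intro a x
    have h2 := congrArg (fun p => p.2.1) (he.1 (0, x, 0) (0, a, 0))
    rw [reeTr_apply, hβ, hβ, reeTr_apply] at h2
    simp only [_root_.map_zero, zero_mul, add_zero, mul_zero, sub_zero, zero_add] at h2
    rw [hβ] at h2
    exact h2
  have hα0 : α 0 = 0 := by simpa using hαa 0 0
  have hD : ∀ κ : Fˣ, (∀ x, α (κ * x) = α κ * α x) ∧
      (∀ y, β (θ κ * κ * y) = θ (α κ) * α κ * β y) ∧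
      (∀ z, γ (θ κ * κ ^ 2 * z) = θ (α κ) * α κ ^ 2 * γ z) ∧
      ∀ x, μ (κ * x) = θ (α κ) * α κ ^ 2 * μ x := by
    intro κ
    obtain ⟨κ', hκ⟩ := he.2 κ
    have hx : ∀ x, α (κ * x) = κ' * α x ∧ μ (κ * x) = θ κ' * κ' ^ 2 * μ x := by
      intro x
      have h2 := hκ (x, -(θ x * x), 0)
      rw [reeD_apply, show θ κ * κ * -(θ x * x) = -(θ (κ * x) * (κ * x)) by rw [map_mul]; ring,
        mul_zero, hα, hα, reeD_apply] at h2
      exact ⟨congrArg Prod.fst h2, congrArg (fun p => p.2.2) h2⟩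
    have hακ : α κ = κ' := by
      have h2 := (hx 1).1
      rwa [mul_one, hα1, mul_one] at h2
    rw [hακ]
    refine ⟨fun x => (hx x).1, fun y => ?_, fun z => ?_, fun x => (hx x).2⟩
    · have h2 := hκ (0, y, 0)
      rw [reeD_apply, mul_zero, mul_zero, hβ, hβ, reeD_apply] at h2
      exact congrArg (fun p => p.2.1) h2
    · have h2 := hκ (0, 0, z)
      rw [reeD_apply, mul_zero, mul_zero, hγ, hγ, reeD_apply] at h2
      exact congrArg (fun p => p.2.2) h2
  obtain ⟨σ, hσ⟩ : ∃ σ : F →+* F, ∀ x, α x = σ x :=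
    ⟨{ toFun := α
       map_one' := hα1
       map_zero' := hα0
       map_add' := hαa
       map_mul' := fun x y => by
        by_cases hx : x = 0
        · rw [hx, zero_mul, hα0, zero_mul]
        · exact (hD (Units.mk0 x hx)).1 y }, fun x => rfl⟩
  have hσθ : ∀ x, σ (θ x) = θ (σ x) := by
    obtain ⟨t, ht⟩ := h.map_eq_pow
    intro x
    rw [ht, ht, map_pow]
  simp only [hσ] at hgen hD hα
  have hθ0 : ∀ x : F, x ≠ 0 → θ x ≠ 0 := fun x hx => (map_ne_zero θ).2 hx
  -- The torus parameter θ(m)/m scales the second coordinate by m^2, because θ^2 is cubing.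
  have hsq : ∀ m, β (m ^ 2) = σ (m ^ 2) * β 1 := by
    intro m
    by_cases hm : m = 0
    · rw [hm, zero_pow two_ne_zero, _root_.map_zero, zero_mul]
      simpa using hβa 0 0
    · have h2 := (hD (Units.mk0 (θ m / m) (div_ne_zero (hθ0 m hm) hm))).2.1 1
      rw [Units.val_mk0, mul_one, ← hσθ, ← map_mul] at h2
      have h4 : θ (θ m / m) * (θ m / m) = m ^ 2 := by
        rw [map_div₀, hθθ]
        have := hθ0 m hm
        field_simp
      rwa [h4] at h2
  have hβσ : ∀ y, β y = σ y * β 1 := by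
    intro y
    have h2 := hβa y ((y - 1) ^ 2)
    -- In characteristic three y is the difference of the squares of y + 1 and y - 1, so additivity
    -- extends the rule from squares to all elements.
    rw [show y + (y - 1) ^ 2 = (y + 1) ^ 2 by linear_combination -y * h3, hsq, hsq] at h2
    simp only [map_pow, map_add, map_sub, map_one] at h2
    linear_combination -h2 + σ y * β 1 * h3
  have hγσ : ∀ z, γ z = σ z * γ 1 := by
    intro z
    by_cases hz : z = 0
    · have h2 := hγ 0
      have h4 : e (0, 0, 0) = 0 := he.map_zero
      rw [h4] at h2
      rw [hz, _root_.map_zero, zero_mul]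
      exact (congrArg (fun p => p.2.2) h2).symm
    -- The torus parameter z^2/θ(z) scales the third coordinate by exactly z.
    · have h2 := (hD (Units.mk0 (z ^ 2 / θ z) (div_ne_zero (pow_ne_zero 2 hz) (hθ0 z hz)))).2.2.1 1
      rw [Units.val_mk0, mul_one, ← hσθ, ← map_pow, ← map_mul] at h2
      have h4 : θ (z ^ 2 / θ z) * (z ^ 2 / θ z) ^ 2 = z := by
        rw [map_div₀, map_pow, hθθ]
        have := hθ0 z hz
        field_simp
      rwa [h4] at h2
  have hμσ : ∀ x, x ≠ 0 → μ x = θ (σ x) * σ x ^ 2 * μ 1 := by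
    intro x hx
    have h2 := (hD (Units.mk0 x hx)).2.2.2 1
    rwa [Units.val_mk0, mul_one] at h2
  obtain ⟨w, hw⟩ := h.exists_map_ne
  have hσw : θ (σ w) ≠ σ w := by
    rw [← hσθ]
    exact fun h => hw (σ.injective h)
  have hw0 : w ≠ 0 := by rintro rfl; simp at hw
  have hw1 : σ w ≠ 1 := by
    intro h
    rw [h, map_one] at hσw
    exact hσw rfl
  have hw2 : 1 + σ w ≠ 0 := by
    intro h
    rw [eq_neg_of_add_eq_zero_right h, _root_.map_neg, map_one] at hσw
    exact hσw rfl
  -- Multiplicativity on two elements (a, -θ(a)a, 0) and (x, -θ(x)x, 0). Evaluation at 1 and an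
  -- element w moved by θ gives β(1) = γ(1) = 1 and μ(1) = 0.
  have hmul : ∀ a x, β 1 * (σ a * θ (σ x) - θ (σ a) * σ x) = σ a * θ (σ x) - θ (σ a) * σ x ∧
      μ (a + x) - μ a - μ x = (1 - γ 1) *
        (2 * (σ a * θ (σ a) * σ x) - σ a ^ 2 * θ (σ x) + θ (σ a) * σ x ^ 2) := by
    intro a x
    have h2 := he.1 (a, -(θ a * a), 0) (x, -(θ x * x), 0)
    rw [reeTr_apply, hgen, hα, hα, reeTr_apply, hβσ, hγσ] at h2
    simp only [map_add, map_sub, map_mul, _root_.map_neg, _root_.map_zero, hσθ,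
      Prod.mk.injEq] at h2
    obtain ⟨-, h4, h5⟩ := h2
    have h6 : β 1 * (σ a * θ (σ x) - θ (σ a) * σ x) = σ a * θ (σ x) - θ (σ a) * σ x := by
      linear_combination h4 + (θ (σ a) * σ x - β 1 * θ (σ a) * σ x) * h3
    refine ⟨h6, ?_⟩
    rw [add_comm a x]
    linear_combination h5 - (σ x + σ a) * h6 + (2 * σ a * σ x * θ (σ a) * γ 1 -
      σ a * σ x * θ (σ a) - σ a * σ x * θ (σ a) * β 1 - σ x ^ 2 * θ (σ a) * β 1 +
      σ x ^ 2 * θ (σ a) * γ 1) * h3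
  have hβ1 : β 1 = 1 := by
    have h2 := (hmul 1 w).1
    rw [map_one, map_one, one_mul, one_mul] at h2
    exact mul_right_cancel₀ (sub_ne_zero.2 hσw) (by rw [h2, one_mul])
  have hγ1 : 1 - γ 1 = 0 := by
    have h2 := (hmul 1 w).2
    have h4 := (hmul w 1).2
    rw [add_comm w 1] at h4
    simp only [map_one] at h2 h4
    have h5 : (1 - γ 1) * ((1 + σ w) * (θ (σ w) - σ w)) = 0 := by
      linear_combination h4 - h2 + (1 - γ 1) * (θ (σ w) * σ w - σ w + θ (σ w) - σ w ^ 2) * h3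
    exact (mul_eq_zero.1 h5).resolve_right (mul_ne_zero hw2 (sub_ne_zero.2 hσw))
  have hμ1 : μ 1 = 0 := by
    have h2 := (hmul 1 w).2
    rw [hγ1, zero_mul, hμσ (1 + w) (by
      intro h0
      apply hw2
      rw [← map_one σ, ← map_add, h0, _root_.map_zero]), hμσ w hw0] at h2
    simp only [map_add, map_one] at h2
    have h5 : μ 1 * ((θ (σ w) - σ w) * (1 - σ w)) = 0 := by
      linear_combination h2 - μ 1 * (θ (σ w) * σ w + σ w) * h3
    exact (mul_eq_zero.1 h5).resolve_right
      (mul_ne_zero (sub_ne_zero.2 hσw) (sub_ne_zero.2 hw1.symm))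
  have hμ0 : ∀ x, μ x = 0 := by
    intro x
    by_cases hx : x = 0
    · have h2 := hα 0
      rw [_root_.map_zero, zero_mul, neg_zero] at h2
      have h4 : e (0, 0, 0) = 0 := he.map_zero
      rw [h4] at h2
      rw [hx]
      exact (congrArg (fun p => p.2.2) h2).symm
    · rw [hμσ x hx, hμ1, mul_zero]
  refine ⟨σ, fun x y z => ?_⟩
  rw [hgen, hβσ, hγσ, hμ0, hβ1, ← sub_eq_zero.1 hγ1]
  simp only [map_add, map_sub, map_mul, hσθ]
  refine Prod.ext rfl (Prod.ext ?_ ?_) <;> ring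

theorem IsReeAut.exists_eq (h : IsReeTwist θ) (he : IsReeAut θ e) :
    ∃ (κ : Fˣ) (σ : F →+* F), ∀ x y z, e (x, y, z) = reeD θ κ (σ x, σ y, σ z) := by
  -- If this coordinate vanished, the torus would carry the vanishing to all elements (x, -θ(x)x,
  -- 0), and the first coordinate of e would be identically zero.
  have hne : (e (1, -1, 0)).1 ≠ 0 := by
    intro h0
    obtain ⟨α, β, γ, μ, hα, hβ, hγ⟩ := he.exists_coords h
    have hα1 : α 1 = 0 := by
      have := hα 1
      rw [map_one, one_mul] at this
      rw [← h0, this]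
    obtain ⟨⟨x, y, z⟩, hp⟩ := e.surjective (1, 0, 0)
    have h2 := he.apply_of_coords hα hβ hγ x y z
    rw [hp] at h2
    have h4 : (1 : F) = α x := congrArg Prod.fst h2
    by_cases hx : x = 0
    · have h5 := hα 0
      rw [_root_.map_zero, zero_mul, neg_zero] at h5
      have h6 : e (0, 0, 0) = 0 := he.map_zero
      rw [h6] at h5
      have h7 : (0 : F) = α 0 := congrArg Prod.fst h5
      rw [hx, ← h7] at h4
      exact one_ne_zero h4
    · obtain ⟨κ, hκ⟩ := he.2 (Units.mk0 x hx)
      have h5 := hκ (1, -1, 0)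
      have h6 := hα 1
      have h7 := hα x
      rw [map_one, one_mul, hα1] at h6
      rw [reeD_apply, h6, reeD_apply, Units.val_mk0, mul_one, mul_neg_one, mul_zero, h7] at h5
      have h8 : α x = κ * 0 := congrArg Prod.fst h5
      rw [h8, mul_zero] at h4
      exact one_ne_zero h4
  obtain ⟨κ, hκ⟩ : ∃ κ : Fˣ, (κ : F) = (e (1, -1, 0)).1 := ⟨Units.mk0 _ hne, rfl⟩
  have hinv' : ∀ p, reeD θ κ (reeD θ κ⁻¹ p) = p := by
    rintro ⟨x, y, z⟩
    have := (map_ne_zero θ).2 κ.ne_zero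
    rw [reeD_apply, reeD_apply, Units.val_inv_eq_inv_val, map_inv₀]
    refine Prod.ext ?_ (Prod.ext ?_ ?_) <;> simp <;> field_simp
  have hTr : ∀ p r, reeD θ κ⁻¹ (reeTr θ p r) = reeTr θ (reeD θ κ⁻¹ p) (reeD θ κ⁻¹ r) := by
    rintro ⟨a, b, c⟩ ⟨x, y, z⟩
    simp only [reeD_apply, reeTr_apply, map_mul]
    refine Prod.ext ?_ (Prod.ext ?_ ?_) <;> ring
  have hcomm : ∀ (κ l : Fˣ) p, reeD θ κ (reeD θ l p) = reeD θ l (reeD θ κ p) := by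
    rintro κ l ⟨x, y, z⟩
    simp only [reeD_apply]
    refine Prod.ext ?_ (Prod.ext ?_ ?_) <;> ring
  have he' : IsReeAut θ (reeD θ κ⁻¹ * e) := by
    refine ⟨fun p r => ?_, fun l => ?_⟩
    · simp only [Equiv.Perm.mul_apply]
      rw [he.1, hTr]
    · obtain ⟨l', hl⟩ := he.2 l
      refine ⟨l', fun p => ?_⟩
      simp only [Equiv.Perm.mul_apply]
      rw [hl, hcomm]
  obtain ⟨σ, hσ⟩ := he'.exists_eq_of_map_one h (by
    rw [Equiv.Perm.mul_apply]
    obtain ⟨⟨a, b, c⟩, hr⟩ : ∃ r, r = e (1, -1, 0) := ⟨_, rfl⟩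
    rw [← hr] at hκ ⊢
    rw [reeD_apply]
    change (κ⁻¹ : Fˣ) * a = 1
    rw [← show (κ : F) = a from hκ]
    simp)
  refine ⟨κ, σ, fun x y z => ?_⟩
  rw [← hσ, Equiv.Perm.mul_apply, hinv']

end ReeAut

end SaxlHypergraph

namespace SaxlHypergraph

/-! ### Groups normalising a Ree group. -/

section ReeGroupModel

variable {F : Type*} [Field F]

/-- `G` normalises a group `R` that has the properties of the Ree group that are needed here. -/
structure IsReeModel (θ : F →+* F) (R G : Subgroup (Equiv.Perm (OnePoint (F × F × F)))) :
    Prop where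
  twist : IsReeTwist θ
  le : R ≤ G
  conj_mem : ∀ g ∈ G, ∀ r ∈ R, g * r * g⁻¹ ∈ R
  tr_mem : ∀ p, extendPerm (reeTr θ p) ∈ R
  d_mem : ∀ κ, extendPerm (reeD θ κ) ∈ R
  linear : ∀ r ∈ R, IsReeLinear θ r
  exists_ne : ∃ r ∈ R, r ∞ ≠ ∞

variable {θ : F →+* F} {R G : Subgroup (Equiv.Perm (OnePoint (F × F × F)))}

theorem reeD_one : reeD θ 1 = 1 := Equiv.ext fun p => by
  ext <;> simp [reeD]

/-- Applying θ gives κ^3 θ(κ)^2 = 1, squaring gives κ^4 θ(κ)^2 = 1, and the quotient is κ = 1. -/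
theorem IsReeTwist.eq_one_of_torus (h : IsReeTwist θ) {κ : Fˣ} (hκ : θ κ * (κ : F) ^ 2 = 1) :
    κ = 1 := by
  have h1 := congrArg θ hκ
  rw [map_mul, map_pow, h.map_map, map_one] at h1
  have h2 : (θ κ * (κ : F) ^ 2) ^ 2 = 1 := by rw [hκ, one_pow]
  have h3 : (κ : F) ^ 3 * θ κ ^ 2 * (κ - 1) = 0 := by linear_combination h2 - h1
  refine Units.ext (sub_eq_zero.1 ((mul_eq_zero.1 h3).resolve_left ?_))
  exact mul_ne_zero (pow_ne_zero 3 κ.ne_zero) (pow_ne_zero 2 ((map_ne_zero θ).2 κ.ne_zero))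

variable [CharP F 3]

theorem reeTr_pow_nine (p : F × F × F) : reeTr θ p ^ 9 = 1 := by
  have h3 := three_eq_zero (F := F)
  obtain ⟨a, b, c⟩ := p
  have h1 : reeTr θ (a, b, c) ^ 3 = reeTr θ (0, 0, -(θ a * a ^ 2)) := Equiv.ext fun p => by
    obtain ⟨x, y, z⟩ := p
    simp only [pow_succ, pow_zero, one_mul, Equiv.Perm.mul_apply, reeTr_apply]
    refine Prod.ext ?_ (Prod.ext ?_ ?_) <;> simp only [map_zero] <;> grind
  have h2 : reeTr θ (0, 0, -(θ a * a ^ 2)) ^ 3 = 1 := Equiv.ext fun p => by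
    obtain ⟨x, y, z⟩ := p
    simp only [pow_succ, pow_zero, one_mul, Equiv.Perm.mul_apply, reeTr_apply]
    refine Prod.ext ?_ (Prod.ext ?_ ?_) <;> simp only [map_zero, Equiv.Perm.one_apply] <;> grind
  rw [show 9 = 3 * 3 from rfl, pow_mul, h1, h2]

theorem eq_one_of_pow_nine {κ : F} (h : κ ^ 9 = 1) : κ = 1 := by
  have h3 := three_eq_zero (F := F)
  have key : ∀ x : F, x ^ 3 = 1 → x = 1 := fun x hx => by
    have : (x - 1) ^ 3 = 0 := by linear_combination hx - (x ^ 2 - x) * h3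
    exact sub_eq_zero.1 (pow_eq_zero_iff three_ne_zero |>.1 this)
  exact key _ (key _ (by rw [← pow_mul, h]))

namespace IsReeModel

theorem exists_eq_tr_mul_d (h : IsReeModel θ R G) {e : Equiv.Perm (F × F × F)}
    (he : extendPerm e ∈ R) : ∃ p κ, e = reeTr θ p * reeD θ κ := by
  have h1 : extendPerm ((reeTr θ (e 0))⁻¹ * e) ∈ R := by
    rw [map_mul, map_inv]
    exact mul_mem (inv_mem (h.tr_mem _)) he
  obtain ⟨κ, hκ⟩ := (h.linear _ h1).eq_reeD h.twist (by
    rw [Equiv.Perm.mul_apply, Equiv.Perm.inv_eq_iff_eq, reeTr_zero_right])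
  exact ⟨e 0, κ, inv_mul_eq_iff_eq_mul.1 hκ⟩

/-- In the stabiliser of ∞ in R the ninth power kills translations, while an element with torus part
κ can satisfy this only if κ^9 = 1, hence κ = 1. So conjugation preserves translations, and it
preserves the torus as the stabiliser of ∞ and the origin. -/
theorem isReeAut (h : IsReeModel θ R G) {e : Equiv.Perm (F × F × F)} (he : extendPerm e ∈ G)
    (h0 : e 0 = 0) : IsReeAut θ e := by
  have hinv : e⁻¹ 0 = 0 := by rw [Equiv.Perm.inv_eq_iff_eq, h0]
  have hconj : ∀ f, extendPerm f ∈ R → extendPerm (e * f * e⁻¹) ∈ R := fun f hf => by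
    rw [map_mul, map_mul, map_inv]
    exact h.conj_mem _ he _ hf
  refine ⟨fun p r => ?_, fun κ => ?_⟩
  · obtain ⟨s, κ, hs⟩ := h.exists_eq_tr_mul_d (hconj _ (h.tr_mem p))
    have h9 : (reeTr θ s * reeD θ κ) ^ 9 = 1 := by
      rw [← hs, conj_pow, reeTr_pow_nine, mul_one, mul_inv_cancel]
    have hpow : ∀ n, ∃ c, ∀ q, (((reeTr θ s * reeD θ κ) ^ n) q).1 = (κ : F) ^ n * q.1 + c := by
      intro n
      induction n with
      | zero => exact ⟨0, fun q => by simp⟩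
      | succ n ih =>
        obtain ⟨c, hc⟩ := ih
        refine ⟨κ * c + s.1, fun q => ?_⟩
        rw [pow_succ', Equiv.Perm.mul_apply, Equiv.Perm.mul_apply]
        change κ * _ + s.1 = _
        rw [hc]
        ring
    obtain ⟨c, hc⟩ := hpow 9
    rw [h9] at hc
    have h1 := hc (0, 0, 0)
    have h2 := hc (1, 0, 0)
    simp only [Equiv.Perm.one_apply, mul_zero, zero_add, mul_one] at h1 h2
    have hκ : κ = 1 := Units.ext (eq_one_of_pow_nine (by rw [← h1, add_zero] at h2; exact h2.symm))
    rw [hκ, reeD_one, mul_one] at hs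
    have h4 := congrArg (fun f => f 0) hs
    simp only [Equiv.Perm.mul_apply, hinv, reeTr_zero_right] at h4
    rw [h4, ← hs]
    simp
  · have h1 := hconj _ (h.d_mem κ)
    obtain ⟨κ', hκ⟩ := (h.linear _ h1).eq_reeD h.twist (by
      rw [Equiv.Perm.mul_apply, Equiv.Perm.mul_apply, hinv, reeD_zero_right, h0])
    refine ⟨κ', fun p => ?_⟩
    rw [← hκ]
    simp

theorem exists_eq_semilinear (h : IsReeModel θ R G) {g} (hg : g ∈ G) (hi : g ∞ = ∞)
    (h0 : g ((0 : F × F × F) : OnePoint (F × F × F)) = (0 : F × F × F)) :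
    ∃ (κ : Fˣ) (σ : F →+* F), ∀ x y z,
      g ((x, y, z) : F × F × F) = (reeD θ κ (σ x, σ y, σ z) : F × F × F) := by
  obtain ⟨e, rfl⟩ := exists_eq_extendPerm hi
  obtain ⟨κ, σ, hσ⟩ := (h.isReeAut hg (by simpa using h0)).exists_eq h.twist
  exact ⟨κ, σ, fun x y z => by rw [extendPerm_coe, hσ]⟩

theorem exists_map_infty (h : IsReeModel θ R G) (x : OnePoint (F × F × F)) :
    ∃ r ∈ R, r x = ∞ := by
  obtain ⟨r, hr, hri⟩ := h.exists_ne
  obtain ⟨p, hp⟩ := OnePoint.ne_infty_iff_exists.1 (show r⁻¹ ∞ ≠ ∞ by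
    rw [Ne, Equiv.Perm.inv_eq_iff_eq]
    exact fun h => hri h.symm)
  induction x using OnePoint.rec with
  | infty => exact ⟨1, one_mem _, rfl⟩
  | coe x =>
    refine ⟨r * extendPerm (reeTr θ p * (reeTr θ x)⁻¹), mul_mem hr ?_, ?_⟩
    · rw [map_mul, map_inv]
      exact mul_mem (h.tr_mem p) (inv_mem (h.tr_mem x))
    · rw [Equiv.Perm.mul_apply, extendPerm_coe, Equiv.Perm.mul_apply,
        (Equiv.Perm.inv_eq_iff_eq (f := reeTr θ x) (y := 0)).2 (reeTr_zero_right θ x).symm,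
        reeTr_zero_right, hp, ← Equiv.Perm.mul_apply, mul_inv_cancel, Equiv.Perm.one_apply]

theorem exists_map_pair (h : IsReeModel θ R G) (x y : OnePoint (F × F × F)) :
    ∃ r ∈ R, r x = ∞ ∧ (r y = ∞ ∨ r y = (0 : F × F × F)) := by
  obtain ⟨r, hr, hx⟩ := h.exists_map_infty x
  by_cases hy : r y = ∞
  · exact ⟨r, hr, hx, Or.inl hy⟩
  · obtain ⟨p, hp⟩ := OnePoint.ne_infty_iff_exists.1 hy
    refine ⟨extendPerm (reeTr θ p)⁻¹ * r, mul_mem ?_ hr, ?_, Or.inr ?_⟩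
    · rw [map_inv]
      exact inv_mem (h.tr_mem p)
    · rw [Equiv.Perm.mul_apply, hx, extendPerm_infty]
    · rw [Equiv.Perm.mul_apply, ← hp, extendPerm_coe,
        (Equiv.Perm.inv_eq_iff_eq (f := reeTr θ p) (y := 0)).2 (reeTr_zero_right θ p).symm]

theorem reeD_neg_one_ne : extendPerm (reeD θ (-1)) ≠ 1 := by
  intro h
  rw [← map_one (extendPerm (X := F × F × F))] at h
  have h1 := congrArg (fun f => f (1, 0, 0)) (extendPerm_injective h)
  rw [reeD_neg_one_apply] at h1
  exact one_ne_zero (eq_zero_of_eq_neg (congrArg Prod.fst h1).symm)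

/-- By double transitivity it suffices that the torus involution fixes ∞ and the origin. -/
theorem not_isBase_pair (h : IsReeModel θ R G) (x y : OnePoint (F × F × F)) :
    ¬ IsBase G {x, y} := by
  intro hb
  obtain ⟨r, hr, hx, hy⟩ := h.exists_map_pair x y
  have h1 := isBase_iff.1 hb (r⁻¹ * extendPerm (reeD θ (-1)) * r)
    (mul_mem (mul_mem (inv_mem (h.le hr)) (h.le (h.d_mem _))) (h.le hr)) (by
      rintro _ (rfl | rfl)
      · rw [Equiv.Perm.mul_apply, Equiv.Perm.mul_apply, Equiv.Perm.inv_eq_iff_eq, hx,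
          extendPerm_infty]
      · rw [Equiv.Perm.mul_apply, Equiv.Perm.mul_apply, Equiv.Perm.inv_eq_iff_eq]
        rcases hy with hy | hy <;> rw [hy]
        · rw [extendPerm_infty]
        · rw [extendPerm_coe, reeD_zero_right])
  refine reeD_neg_one_ne (θ := θ) ?_
  rwa [mul_assoc, inv_mul_eq_one, eq_comm, mul_eq_right] at h1

theorem isBase_triple_iff {p : F × F × F} :
    IsBase G {∞, ((0 : F × F × F) : OnePoint (F × F × F)), (p : OnePoint (F × F × F))} ↔
      ∀ g ∈ G, g ∞ = ∞ → g ((0 : F × F × F) : OnePoint (F × F × F)) = (0 : F × F × F) →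
        g p = p → g = 1 := by
  rw [isBase_iff]
  refine forall₂_congr fun g hg => ?_
  simp only [Set.mem_insert_iff, Set.mem_singleton_iff, forall_eq_or_imp, forall_eq, and_imp]

/-- For the third point (1, y, 0) with y a generator of the field, the first coordinate forces κ = 1
and the second forces the field automorphism to be trivial. -/
theorem baseSize_eq (h : IsReeModel θ R G) : baseSize G = 3 := by
  classical
  have := h.twist.finite
  have : Finite (OnePoint (F × F × F)) := inferInstanceAs (Finite (Option (F × F × F)))
  obtain ⟨y, hy⟩ := IsCyclic.exists_generator (α := Fˣ)
  refine baseSize_eq_three h.not_isBase_pair (isBase_triple_iff (p := (1, (y : F), 0)).2 ?_)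
  intro g hg hi h0 hp
  obtain ⟨κ, σ, hσ⟩ := h.exists_eq_semilinear hg hi h0
  rw [hσ, OnePoint.coe_eq_coe, reeD_apply] at hp
  have hκ : κ = 1 := Units.ext (by simpa using congrArg Prod.fst hp)
  have hσy : σ y = y := by
    have := congrArg (fun p => p.2.1) hp
    simpa [hκ] using this
  have hσ1 : ∀ x, σ x = x := by
    intro x
    by_cases hx : x = 0
    · rw [hx, map_zero]
    · obtain ⟨k, hk⟩ := Subgroup.mem_zpowers_iff.1 (hy (Units.mk0 x hx))
      have hk : x = (y : F) ^ k := by rw [← Units.val_zpow_eq_zpow_val, hk, Units.val_mk0]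
      rw [hk, map_zpow₀, hσy]
  ext q
  induction q using OnePoint.rec with
  | infty => rw [hi, Equiv.Perm.one_apply]
  | coe q =>
    obtain ⟨x, y, z⟩ := q
    rw [hσ, hσ1, hσ1, hσ1, hκ, reeD_one]
    rfl

end IsReeModel

end ReeGroupModel

end SaxlHypergraph

namespace SaxlHypergraph

/-! ### Counting third base points modulo four. -/

section ReeCount

variable {F : Type*} [Field F]

/-- The permutation of `F ^ 3` that multiplies the coordinates by the signs `a`, `b` and `c`. -/
def signPerm (a b c : ℤˣ) : Equiv.Perm (F × F × F) where
  toFun p := (((a : ℤ) : F) * p.1, ((b : ℤ) : F) * p.2.1, ((c : ℤ) : F) * p.2.2)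
  invFun p := (((a : ℤ) : F) * p.1, ((b : ℤ) : F) * p.2.1, ((c : ℤ) : F) * p.2.2)
  left_inv p := by
    have key : ∀ (a : ℤˣ) (x : F), ((a : ℤ) : F) * (((a : ℤ) : F) * x) = x := fun a x => by
      rcases Int.units_eq_one_or a with rfl | rfl <;> simp
    ext <;> exact key _ _
  right_inv p := by
    have key : ∀ (a : ℤˣ) (x : F), ((a : ℤ) : F) * (((a : ℤ) : F) * x) = x := fun a x => by
      rcases Int.units_eq_one_or a with rfl | rfl <;> simp
    ext <;> exact key _ _

theorem signPerm_apply (a b c : ℤˣ) (x y z : F) :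
    signPerm a b c (x, y, z) = (((a : ℤ) : F) * x, ((b : ℤ) : F) * y, ((c : ℤ) : F) * z) := rfl

theorem signPerm_mul (a b c a' b' c' : ℤˣ) : (signPerm a b c * signPerm a' b' c' :
    Equiv.Perm (F × F × F)) = signPerm (a * a') (b * b') (c * c') :=
  Equiv.ext fun p => by
    simp [signPerm, mul_assoc]

theorem signPerm_one : (signPerm 1 1 1 : Equiv.Perm (F × F × F)) = 1 :=
  Equiv.ext fun p => by simp [signPerm]

theorem four_dvd_ncard_of_signPerm [Finite F] {S : Set (F × F × F)} {a b c a' b' c' : ℤˣ}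
    (h : ∀ x ∈ S, signPerm a b c x ∈ S) (h' : ∀ x ∈ S, signPerm a' b' c' x ∈ S)
    (h1 : ∀ x ∈ S, signPerm a b c x ≠ x) (h2 : ∀ x ∈ S, signPerm a' b' c' x ≠ x)
    (h3 : ∀ x ∈ S, signPerm (a * a') (b * b') (c * c') x ≠ x) : 4 ∣ S.ncard := by
  refine four_dvd_ncard_of_involutive (σ := signPerm a b c) (τ := signPerm a' b' c') ?_ ?_ ?_ h h'
    h1 h2 fun x hx => ?_
  · rw [signPerm_mul, Int.units_mul_self, Int.units_mul_self, Int.units_mul_self, signPerm_one]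
  · rw [signPerm_mul, Int.units_mul_self, Int.units_mul_self, Int.units_mul_self, signPerm_one]
  · rw [signPerm_mul, signPerm_mul, mul_comm a, mul_comm b, mul_comm c]
  · rw [← Equiv.Perm.mul_apply, signPerm_mul]
    exact h3 x hx

variable {θ : F →+* F} {R G : Subgroup (Equiv.Perm (OnePoint (F × F × F)))} [CharP F 3]

theorem signPerm_ne {a b c : ℤˣ} {x y z : F}
    (h : (a = -1 ∧ x ≠ 0) ∨ (b = -1 ∧ y ≠ 0) ∨ (c = -1 ∧ z ≠ 0)) :
    signPerm a b c (x, y, z) ≠ (x, y, z) := by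
  intro he
  rw [signPerm_apply] at he
  simp only [Prod.mk.injEq] at he
  obtain ⟨h1, h2, h3⟩ := he
  rcases h with ⟨rfl, h⟩ | ⟨rfl, h⟩ | ⟨rfl, h⟩
  · exact h (eq_zero_of_eq_neg (by simpa using h1.symm))
  · exact h (eq_zero_of_eq_neg (by simpa using h2.symm))
  · exact h (eq_zero_of_eq_neg (by simpa using h3.symm))

namespace IsReeModel

/-- The points that form a base together with `∞` and the origin. -/
def basePoints (G : Subgroup (Equiv.Perm (OnePoint (F × F × F)))) : Set (F × F × F) :=
  {p | IsBase G {∞, ((0 : F × F × F) : OnePoint (F × F × F)), (p : OnePoint (F × F × F))}}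

/-- Sign changes commute with scalings of the coordinates and with field automorphisms, so they
preserve stabilisers in the stabiliser of ∞ and the origin. -/
theorem signPerm_mem (h : IsReeModel θ R G) (a b c : ℤˣ) {p : F × F × F} (hp : p ∈ basePoints G) :
    signPerm a b c p ∈ basePoints G := by
  refine isBase_triple_iff.2 fun g hg hi h0 hgp => isBase_triple_iff.1 hp g hg hi h0 ?_
  obtain ⟨κ, σ, hσ⟩ := h.exists_eq_semilinear hg hi h0
  obtain ⟨x, y, z⟩ := p
  rw [signPerm_apply, hσ, OnePoint.coe_eq_coe] at hgp
  rw [hσ, OnePoint.coe_eq_coe]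
  refine (signPerm a b c).injective (Eq.trans ?_ hgp)
  simp only [signPerm_apply, reeD_apply, map_mul, map_intCast]
  refine Prod.ext ?_ (Prod.ext ?_ ?_) <;> ring

theorem ne_zero_of_mem (h : IsReeModel θ R G) {x y z : F} (hp : (x, y, z) ∈ basePoints G) :
    x ≠ 0 ∨ z ≠ 0 := by
  by_contra! hc
  obtain ⟨rfl, rfl⟩ := hc
  refine reeD_neg_one_ne (θ := θ) (isBase_triple_iff.1 hp _ (h.le (h.d_mem (-1))) rfl ?_ ?_)
  · rw [extendPerm_coe, reeD_zero_right]
  · rw [extendPerm_coe, reeD_neg_one_apply, neg_zero]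

/-- On a regular orbit an element is determined by the image of one point. -/
theorem eq_d_of_scale (h : IsReeModel θ R G) {p : F × F × F} (hp : p ∈ basePoints G)
    {g} (hg : g ∈ G) (hi : g ∞ = ∞)
    (h0 : g ((0 : F × F × F) : OnePoint (F × F × F)) = (0 : F × F × F)) {l : Fˣ}
    (hl : g p = (reeD θ l p : F × F × F)) : g = extendPerm (reeD θ l) := by
  have h1 := isBase_triple_iff.1 hp ((extendPerm (reeD θ l))⁻¹ * g)
    (mul_mem (inv_mem (h.le (h.d_mem l))) hg)
    (by rw [Equiv.Perm.mul_apply, Equiv.Perm.inv_eq_iff_eq, hi, extendPerm_infty])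
    (by rw [Equiv.Perm.mul_apply, Equiv.Perm.inv_eq_iff_eq, h0, extendPerm_coe, reeD_zero_right])
    (by rw [Equiv.Perm.mul_apply, Equiv.Perm.inv_eq_iff_eq, hl, extendPerm_coe])
  rw [inv_mul_eq_one] at h1
  exact h1.symm

/-- On each of the two axes the torus is transitive on the non-zero points. If one axis contains a
base point, every element of the two-point stabiliser agrees there with a torus element and thus
lies in the torus; and non-trivial torus elements fix no non-zero point of either axis. -/
theorem swap_mem (h : IsReeModel θ R G) {x z : F} (hp : (x, 0, z) ∈ basePoints G)
    (hxz : x = 0 ∨ z = 0) : (z, 0, x) ∈ basePoints G := by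
  have hθ0 : ∀ x : F, x ≠ 0 → θ x ≠ 0 := fun x hx => (map_ne_zero θ).2 hx
  refine isBase_triple_iff.2 fun g hg hi h0 hgp => ?_
  obtain ⟨κ, σ, hσ⟩ := h.exists_eq_semilinear hg hi h0
  have hg1 := hσ x 0 z
  rw [reeD_apply, map_zero, mul_zero] at hg1
  have key : ∀ l : Fˣ, κ * σ x = l * x → θ κ * κ ^ 2 * σ z = θ l * l ^ 2 * z →
      g = extendPerm (reeD θ l) := fun l hl hl' =>
    h.eq_d_of_scale hp hg hi h0 (by rw [hg1, reeD_apply, hl, hl', mul_zero])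
  rcases hxz with rfl | rfl
  · have hz : z ≠ 0 := (h.ne_zero_of_mem hp).resolve_left (fun h => h rfl)
    obtain ⟨ζ, hζ⟩ : ∃ ζ, ζ = θ κ * κ ^ 2 * σ z / z := ⟨_, rfl⟩
    have hζ0 : ζ ≠ 0 := by
      rw [hζ]
      exact div_ne_zero (mul_ne_zero (mul_ne_zero (hθ0 _ κ.ne_zero) (pow_ne_zero 2 κ.ne_zero))
        ((map_ne_zero σ).2 hz)) hz
    have hg2 := key (Units.mk0 (ζ ^ 2 / θ ζ) (div_ne_zero (pow_ne_zero 2 hζ0) (hθ0 ζ hζ0)))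
      (by simp) (by
        have h4 : θ (ζ ^ 2 / θ ζ) * (ζ ^ 2 / θ ζ) ^ 2 = ζ := by
          rw [map_div₀, map_pow, h.twist.map_map]
          have := hθ0 ζ hζ0
          field_simp
        rw [Units.val_mk0, h4, hζ, div_mul_cancel₀ _ hz])
    generalize Units.mk0 (ζ ^ 2 / θ ζ) (div_ne_zero (pow_ne_zero 2 hζ0) (hθ0 ζ hζ0)) = l at hg2
    rw [hg2, extendPerm_coe, reeD_apply, OnePoint.coe_eq_coe] at hgp
    have hl : (l : F) * z = z := congrArg Prod.fst hgp
    rw [hg2, Units.ext (mul_right_cancel₀ hz (by rw [hl, Units.val_one, one_mul]) :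
      (l : F) = (1 : Fˣ)), reeD_one, map_one]
  · have hx : x ≠ 0 := (h.ne_zero_of_mem hp).resolve_right (fun h => h rfl)
    have hg2 := key (Units.mk0 (κ * σ x / x) (div_ne_zero (mul_ne_zero κ.ne_zero
      ((map_ne_zero σ).2 hx)) hx)) (by rw [Units.val_mk0, div_mul_cancel₀ _ hx]) (by simp)
    generalize Units.mk0 (κ * σ x / x) (div_ne_zero (mul_ne_zero κ.ne_zero
      ((map_ne_zero σ).2 hx)) hx) = l at hg2
    rw [hg2, extendPerm_coe, reeD_apply, OnePoint.coe_eq_coe] at hgp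
    have hl : θ l * (l : F) ^ 2 * x = x := congrArg (fun p => p.2.2) hgp
    have hl1 : l = 1 := h.twist.eq_one_of_torus (mul_right_cancel₀ hx (by rw [hl, one_mul]))
    rw [hg2, hl1, reeD_one, map_one]

/-- The permutation of `F ^ 3` that exchanges the first and the last coordinate. -/
def flipPerm : Equiv.Perm (F × F × F) where
  toFun p := (p.2.2, p.2.1, p.1)
  invFun p := (p.2.2, p.2.1, p.1)
  left_inv _ := rfl
  right_inv _ := rfl

/-- Where at least two coordinates are non-zero, in the three patterns A, B and C, two independent
sign changes act freely. The rest, D, lies on the first and third axes, where exchanging these axes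
joins the total sign change. Points with only the second coordinate non-zero are not base points. -/
theorem four_dvd_ncard_basePoints (h : IsReeModel θ R G) : 4 ∣ (basePoints G).ncard := by
  have := h.twist.finite
  obtain ⟨A, hA⟩ : ∃ A : Set (F × F × F), A = {p ∈ basePoints G | p.1 ≠ 0 ∧ p.2.2 ≠ 0} := ⟨_, rfl⟩
  obtain ⟨B, hB⟩ : ∃ B : Set (F × F × F), B = {p ∈ basePoints G | p.1 = 0 ∧ p.2.1 ≠ 0} := ⟨_, rfl⟩
  obtain ⟨C, hC⟩ : ∃ C : Set (F × F × F),
    C = {p ∈ basePoints G | p.1 ≠ 0 ∧ p.2.1 ≠ 0 ∧ p.2.2 = 0} := ⟨_, rfl⟩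
  obtain ⟨D, hD⟩ : ∃ D : Set (F × F × F),
    D = {p ∈ basePoints G | p.2.1 = 0 ∧ (p.1 = 0 ∨ p.2.2 = 0)} := ⟨_, rfl⟩
  have hsign : ∀ (a b c : ℤˣ) (x y z : F), (x, y, z) ∈ basePoints G →
      (((a : ℤ) : F) * x, ((b : ℤ) : F) * y, ((c : ℤ) : F) * z) ∈ basePoints G :=
    fun a b c x y z hp => h.signPerm_mem a b c hp
  have hU : basePoints G = A ∪ (B ∪ (C ∪ D)) := by
    ext ⟨x, y, z⟩
    simp only [hA, hB, hC, hD, Set.mem_union, Set.mem_setOf_eq]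
    tauto
  have h1 : Disjoint A (B ∪ (C ∪ D)) := by
    rw [Set.disjoint_left]
    rintro ⟨x, y, z⟩
    simp only [hA, hB, hC, hD, Set.mem_union, Set.mem_setOf_eq]
    tauto
  have h2 : Disjoint B (C ∪ D) := by
    rw [Set.disjoint_left]
    rintro ⟨x, y, z⟩
    simp only [hB, hC, hD, Set.mem_union, Set.mem_setOf_eq]
    tauto
  have h3 : Disjoint C D := by
    rw [Set.disjoint_left]
    rintro ⟨x, y, z⟩
    simp only [hC, hD, Set.mem_union, Set.mem_setOf_eq]
    tauto
  rw [hU, Set.ncard_union_eq h1, Set.ncard_union_eq h2, Set.ncard_union_eq h3]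
  refine dvd_add ?_ (dvd_add ?_ (dvd_add ?_ ?_))
  · refine four_dvd_ncard_of_signPerm (a := -1) (b := 1) (c := 1) (a' := 1) (b' := 1) (c' := -1)
      ?_ ?_ ?_ ?_ ?_ <;> rintro ⟨x, y, z⟩ hp <;> rw [hA] at hp <;> obtain ⟨hp, hx, hz⟩ := hp
    · rw [hA]
      exact ⟨hsign _ _ _ _ _ _ hp, by simpa [signPerm_apply] using hx,
        by simpa [signPerm_apply] using hz⟩
    · rw [hA]
      exact ⟨hsign _ _ _ _ _ _ hp, by simpa [signPerm_apply] using hx,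
        by simpa [signPerm_apply] using hz⟩
    all_goals exact signPerm_ne (by simp [show x ≠ 0 from hx, show z ≠ 0 from hz])
  · refine four_dvd_ncard_of_signPerm (a := 1) (b := -1) (c := 1) (a' := 1) (b' := 1) (c' := -1)
      ?_ ?_ ?_ ?_ ?_ <;> rintro ⟨x, y, z⟩ hp <;> rw [hB] at hp <;> obtain ⟨hp, hx, hy⟩ := hp <;>
      have hz : z ≠ 0 := (h.ne_zero_of_mem hp).resolve_left (fun h => h hx)
    · rw [hB]
      exact ⟨hsign _ _ _ _ _ _ hp, by simpa [signPerm_apply] using hx,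
        by simpa [signPerm_apply] using hy⟩
    · rw [hB]
      exact ⟨hsign _ _ _ _ _ _ hp, by simpa [signPerm_apply] using hx,
        by simpa [signPerm_apply] using hy⟩
    all_goals exact signPerm_ne (by simp [show y ≠ 0 from hy, hz])
  · refine four_dvd_ncard_of_signPerm (a := -1) (b := 1) (c := 1) (a' := 1) (b' := -1) (c' := 1)
      ?_ ?_ ?_ ?_ ?_ <;> rintro ⟨x, y, z⟩ hp <;> rw [hC] at hp <;> obtain ⟨hp, hx, hy, hz⟩ := hp
    · rw [hC]
      exact ⟨hsign _ _ _ _ _ _ hp, by simpa [signPerm_apply] using hx,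
        by simpa [signPerm_apply] using hy, by simpa [signPerm_apply] using hz⟩
    · rw [hC]
      exact ⟨hsign _ _ _ _ _ _ hp, by simpa [signPerm_apply] using hx,
        by simpa [signPerm_apply] using hy, by simpa [signPerm_apply] using hz⟩
    all_goals exact signPerm_ne (by simp [show x ≠ 0 from hx, show y ≠ 0 from hy])
  · have hmem : ∀ p ∈ D, ∃ x z, p = (x, 0, z) ∧ (x, 0, z) ∈ basePoints G ∧ (x = 0 ∨ z = 0) ∧
        (x ≠ 0 ∨ z ≠ 0) := by
      rintro ⟨x, y, z⟩ hp
      rw [hD] at hp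
      obtain ⟨hp, hy, hxz⟩ := hp
      obtain rfl : y = 0 := hy
      exact ⟨x, z, rfl, hp, hxz, h.ne_zero_of_mem hp⟩
    refine four_dvd_ncard_of_involutive (σ := flipPerm) (τ := signPerm (-1) (-1) (-1))
      (Equiv.ext fun p => rfl) ?_ (Equiv.ext fun p => rfl) ?_ ?_ ?_ ?_ ?_
    · rw [signPerm_mul]
      simp [signPerm_one]
    all_goals
      intro p hp
      obtain ⟨x, z, rfl, hp, hxz, hne⟩ := hmem p hp
    · rw [hD]
      exact ⟨h.swap_mem hp hxz, rfl, hxz.symm⟩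
    · rw [hD]
      exact ⟨hsign _ _ _ _ _ _ hp, by simp [signPerm_apply], by simpa [signPerm_apply] using hxz⟩
    · intro he
      have he1 : z = x := congrArg Prod.fst he
      subst he1
      tauto
    · exact signPerm_ne (by tauto)
    · intro he
      have he1 : (((-1 : ℤˣ) : ℤ) : F) * z = x := congrArg Prod.fst he
      have he2 : -z = x := by simpa using he1
      rcases hxz with rfl | rfl <;> simp at he2 <;> simp [he2] at hne

/-- Ordered pairs of finite points that complete ∞ to a base number twice the degree. Translations
fix ∞ and make the second entry independent of the first, so the number of pairs is a multiple of
the number of third base points. -/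
theorem even_degree (h : IsReeModel θ R G) : Even (degree (saxlHypergraph G) ∞) := by
  have := h.twist.finite
  have : Finite (OnePoint (F × F × F)) := inferInstanceAs (Finite (Option (F × F × F)))
  obtain ⟨P, hP⟩ : ∃ P : Set ((F × F × F) × (F × F × F)),
    P = {x | IsBase G {∞, (x.1 : OnePoint (F × F × F)), (x.2 : OnePoint (F × F × F))}} := ⟨_, rfl⟩
  have h1 : P.ncard = (basePoints G).ncard * (Set.univ : Set (F × F × F)).ncard := by
    refine ncard_eq_mul_of_fiber (f := Prod.fst) Set.finite_univ (fun x _ => Set.mem_univ _) ?_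
    intro r _
    have hset : {x ∈ P | x.1 = r} = (fun p => (r, reeTr θ r p)) '' basePoints G := by
      have key : ∀ p, (r, reeTr θ r p) ∈ P ↔ p ∈ basePoints G := by
        intro p
        have hn : extendPerm (reeTr θ r) ∈ Subgroup.normalizer (G : Set (Equiv.Perm _)) :=
          Subgroup.le_normalizer (h.le (h.tr_mem r))
        rw [hP, basePoints, Set.mem_setOf_eq, Set.mem_setOf_eq, ← isBase_image_iff hn
          {∞, ((0 : F × F × F) : OnePoint (F × F × F)), (p : OnePoint (F × F × F))},
          Set.image_insert_eq, Set.image_pair, extendPerm_infty, extendPerm_coe, extendPerm_coe,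
          reeTr_zero_right]
      ext ⟨s, t⟩
      constructor
      · rintro ⟨hx, rfl⟩
        refine ⟨(reeTr θ s)⁻¹ t, (key _).1 ?_, ?_⟩ <;> simpa using hx
      · rintro ⟨p, hp, hpe⟩
        rw [← hpe]
        exact ⟨(key p).2 hp, rfl⟩
    rw [hset, Set.ncard_image_of_injective]
    intro p q hpq
    exact (reeTr θ r).injective (congrArg Prod.snd hpq)
  have hne : ∀ x ∈ P, x.1 ≠ x.2 := by
    rintro ⟨r, s⟩ hx hrs
    obtain rfl : r = s := hrs
    rw [hP, Set.mem_setOf_eq, Set.pair_eq_singleton] at hx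
    exact h.not_isBase_pair _ _ hx
  have h2 : P.ncard = 2 * ((fun x : (F × F × F) × (F × F × F) =>
      ({∞, (x.1 : OnePoint (F × F × F)), (x.2 : OnePoint (F × F × F))} :
        Set (OnePoint (F × F × F)))) '' P).ncard := by
    refine ncard_eq_two_mul_image (τ := Prod.swap) ?_ ?_ ?_
    · rintro ⟨r, s⟩ hx
      rw [hP, Set.mem_setOf_eq] at hx ⊢
      rwa [Prod.fst_swap, Prod.snd_swap, Set.pair_comm]
    · rintro ⟨r, s⟩ hx he
      exact hne _ hx (congrArg Prod.fst he)
    · rintro ⟨r, s⟩ _ ⟨r', s'⟩ _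
      have key : ∀ r s : F × F × F, (fun p : F × F × F => (p : OnePoint (F × F × F))) ⁻¹'
          {∞, (r : OnePoint (F × F × F)), (s : OnePoint (F × F × F))} = {r, s} := by
        intro r s
        ext p
        simp [OnePoint.coe_eq_coe]
      constructor
      · intro he
        have he' := congrArg (fun S => (fun p : F × F × F => (p : OnePoint (F × F × F))) ⁻¹' S) he
        simp only [key] at he'
        rw [Set.pair_eq_pair_iff] at he'
        simpa using he'
      · rintro (he | he)
        · rw [he]
        · rw [he]
          simp [Set.pair_comm]
  have h3 : degree (saxlHypergraph G) ∞ = ((fun x : (F × F × F) × (F × F × F) =>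
      ({∞, (x.1 : OnePoint (F × F × F)), (x.2 : OnePoint (F × F × F))} :
        Set (OnePoint (F × F × F)))) '' P).ncard := by
    rw [degree]
    congr 1
    ext e
    simp only [Set.mem_setOf_eq, mem_edgeSet, h.baseSize_eq, Set.mem_image]
    constructor
    · rintro ⟨⟨-, hb, hc⟩, hi⟩
      obtain ⟨x, y, hx, hy, hxy, rfl⟩ := exists_eq_triple hc hi
      obtain ⟨r, rfl⟩ := OnePoint.ne_infty_iff_exists.1 hx
      obtain ⟨s, rfl⟩ := OnePoint.ne_infty_iff_exists.1 hy
      exact ⟨(r, s), by rw [hP]; exact hb, rfl⟩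
    · rintro ⟨⟨r, s⟩, hx, rfl⟩
      have hrs := hne _ hx
      rw [hP] at hx
      refine ⟨⟨Set.toFinite _, hx, ?_⟩, by simp⟩
      rw [Set.ncard_eq_three]
      exact ⟨_, _, _, OnePoint.infty_ne_coe _, OnePoint.infty_ne_coe _,
        fun h => hrs (OnePoint.coe_eq_coe.1 h), rfl⟩
  rw [← h3, h1] at h2
  have h4 : 4 ∣ 2 * degree (saxlHypergraph G) ∞ := h2 ▸ h.four_dvd_ncard_basePoints.mul_right _
  rw [even_iff_two_dvd]
  omega

end IsReeModel

end ReeCount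

end SaxlHypergraph

namespace SaxlHypergraph

/-! ### The concrete Ree group satisfies the model. -/

section ReeGroup

variable {F : Type*} [Field F] [CharP F 3] {n : ℕ}

theorem isReeTwist_iterateFrobenius (hn : 1 ≤ n) (hF : Nat.card F = 3 ^ (2 * n + 1)) :
    IsReeTwist (iterateFrobenius F 3 (n + 1)) := by
  have : Finite F := Nat.finite_of_card_ne_zero (by rw [hF]; positivity)
  have := Fintype.ofFinite F
  refine ⟨fun x => ?_, ?_, 3 ^ (n + 1), fun x => iterateFrobenius_def ..⟩
  · rw [iterateFrobenius_def, iterateFrobenius_def, ← pow_mul, ← pow_add,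
      show n + 1 + (n + 1) = 2 * n + 1 + 1 by ring, pow_succ, ← hF, pow_mul,
      Nat.card_eq_fintype_card, FiniteField.pow_card]
  · rw [hF]
    calc 9 < 3 ^ 3 := by norm_num
      _ ≤ 3 ^ (2 * n + 1) := Nat.pow_le_pow_right (by norm_num) (by omega)

theorem reeTranslation_eq (a b c : F) : reeTranslation (3 ^ (n + 1)) a b c =
    extendPerm (reeTr (iterateFrobenius F 3 (n + 1)) (a, b, c)) := by
  ext p
  induction p using OnePoint.rec with
  | infty => rfl
  | coe p =>
    obtain ⟨x, y, z⟩ := p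
    rw [extendPerm_coe, reeTr_apply, iterateFrobenius_def, ← pow_succ]
    rfl

theorem reeTorus_eq (κ : Fˣ) : reeTorus (3 ^ (n + 1)) (κ : F) =
    extendPerm (reeD (iterateFrobenius F 3 (n + 1)) κ) := by
  ext p
  induction p using OnePoint.rec with
  | infty => rfl
  | coe p =>
    obtain ⟨x, y, z⟩ := p
    rw [extendPerm_coe, reeD_apply, iterateFrobenius_def, ← pow_succ, ← pow_add]
    rfl

theorem reeInversion_coe {x y z : F} (h : (x, y, z) ≠ ((0, 0, 0) : F × F × F)) {θ : F →+* F}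
    (hθ : θ = iterateFrobenius F 3 (n + 1)) :
    reeInversion (3 ^ (n + 1)) ((x, y, z) : F × F × F) =
      (((-reeV θ x y z / reeW θ x y z, -reeU θ x y z / reeW θ x y z, -z / reeW θ x y z) :
        F × F × F) : OnePoint (F × F × F)) := by
  have h3 := three_eq_zero (F := F)
  have hpow : ∀ x : F, x ^ 3 ^ (n + 1) = θ x := fun x => by rw [hθ, iterateFrobenius_def]
  have hadd : ∀ (x : F) k, x ^ (3 ^ (n + 1) + k) = θ x * x ^ k := fun x k => by
    rw [← hpow]; exact pow_add ..
  have hdbl : ∀ (x : F) k, x ^ (2 * 3 ^ (n + 1) + k) = θ x ^ 2 * x ^ k := fun x k => by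
    rw [← hpow, ← pow_mul, mul_comm (3 ^ (n + 1))]; exact pow_add ..
  have hu : x ^ 2 * y - x * z + y ^ 3 ^ (n + 1) - x ^ (3 ^ (n + 1) + 3) = reeU θ x y z := by
    rw [hadd, hpow, reeU]
  have hv : x ^ 3 ^ (n + 1) * y ^ 3 ^ (n + 1) - z ^ 3 ^ (n + 1) + x * y ^ 2 + y * z -
      x ^ (2 * 3 ^ (n + 1) + 3) = reeV θ x y z := by
    rw [hdbl, hpow, hpow, hpow, reeV]
  have hw : -(x * z ^ 3 ^ (n + 1)) + x ^ (3 ^ (n + 1) + 1) * y ^ 3 ^ (n + 1) -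
      x ^ (3 ^ (n + 1) + 3) * y - x ^ 2 * y ^ 2 + y ^ (3 ^ (n + 1) + 1) + z ^ 2 -
      x ^ (2 * 3 ^ (n + 1) + 4) = reeW θ x y z := by
    rw [hadd, hadd, hadd, hdbl, hpow, hpow, reeW, reeU, reeV]
    linear_combination -(x ^ 2 * y ^ 2) * h3
  rw [← hu, ← hv, ← hw]
  exact if_neg h

/-- The translation by (a, b, c) is the one by (a, 0, 0) followed by the one by (0, b, c - ba); the
correction -ba compensates the shift of the first coordinate. -/
theorem isReeLinear_tr {θ : F →+* F} (h : IsReeTwist θ) (r : F × F × F) :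
    IsReeLinear θ (extendPerm (reeTr θ r)) := by
  obtain ⟨a, b, c⟩ := r
  refine ⟨reeMatB b (θ b) (c - b * a) (θ (c - b * a)) ∘ₗ reeMatA a (θ a), 1, one_ne_zero,
    fun v w => by
      rw [LinearMap.comp_apply, LinearMap.comp_apply, reeForm_reeMatB, reeForm_reeMatA, one_mul],
    fun p => ⟨1, one_ne_zero, ?_⟩⟩
  rw [one_smul, LinearMap.comp_apply]
  induction p using OnePoint.rec with
  | infty =>
    rw [extendPerm_infty, reeVec_infty]
    ext i
    fin_cases i <;> simp [reeMatA, reeMatB]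
  | coe p =>
    obtain ⟨x, y, z⟩ := p
    rw [reeMatA_reeVec h.map_map, reeMatB_reeVec h.map_map, extendPerm_coe, reeTr_apply]
    congr 2
    refine Prod.ext rfl (Prod.ext ?_ ?_) <;> ring

theorem isReeLinear_d {θ : F →+* F} (h : IsReeTwist θ) (κ : Fˣ) :
    IsReeLinear θ (extendPerm (reeD θ κ)) := by
  have hθκ : θ κ ≠ 0 := (map_ne_zero θ).2 κ.ne_zero
  have hl : θ κ ^ 2 * (κ : F) ^ 4 ≠ 0 :=
    mul_ne_zero (pow_ne_zero 2 hθκ) (pow_ne_zero 4 κ.ne_zero)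
  refine ⟨reeMatD κ (θ κ), _, hl, reeForm_reeMatD _ _, fun p => ?_⟩
  induction p using OnePoint.rec with
  | infty =>
    refine ⟨_, hl, ?_⟩
    rw [extendPerm_infty, reeVec_infty]
    ext i
    fin_cases i <;> simp [reeMatD]
  | coe p =>
    refine ⟨1, one_ne_zero, ?_⟩
    obtain ⟨x, y, z⟩ := p
    rw [reeMatD_reeVec h.map_map, extendPerm_coe, reeD_apply, one_smul]

theorem isReeLinear_inversion {θ : F →+* F} (h : IsReeTwist θ)
    (hθ : θ = iterateFrobenius F 3 (n + 1)) {π : Equiv.Perm (OnePoint (F × F × F))}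
    (hπ : ⇑π = reeInversion (3 ^ (n + 1))) : IsReeLinear θ π := by
  have hi : π ∞ = ((0, 0, 0) : F × F × F) := by rw [hπ]; rfl
  refine ⟨reeMatN, 1, one_ne_zero, reeForm_reeMatN, fun p => ?_⟩
  induction p using OnePoint.rec with
  | infty =>
    refine ⟨1, one_ne_zero, ?_⟩
    rw [hi, one_smul, reeVec_infty, reeVec_coe]
    ext i
    fin_cases i <;> simp [reeMatN, reeU, reeV, reeW]
  | coe p =>
    obtain ⟨x, y, z⟩ := p
    by_cases hp : (x, y, z) = ((0, 0, 0) : F × F × F)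
    · refine ⟨1, one_ne_zero, ?_⟩
      have : π ((x, y, z) : F × F × F) = ∞ := by rw [hπ]; exact if_pos hp
      rw [this, hp, one_smul, reeVec_infty, reeVec_coe]
      ext i
      fin_cases i <;> simp [reeMatN, reeU, reeV, reeW]
    · have hp' := reeInversion_coe hp hθ
      rw [← hπ] at hp'
      -- If w were zero, division by zero would return 0 and the point would be sent to the origin,
      -- which is already the image of ∞. Injectivity of π thus replaces a proof that w has no other
      -- zeros.
      have hw : reeW θ x y z ≠ 0 := by
        intro hw
        rw [hw, div_zero, div_zero, div_zero, ← hi] at hp'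
        exact OnePoint.coe_ne_infty _ (π.injective hp')
      exact ⟨_, hw, by rw [reeMatN_reeVec h.map_map hw, hp']⟩

/-- That some element moves ∞ is taken as a hypothesis, so that the inversion formula need not be
shown to be a permutation; in the application it follows from transitivity. -/
theorem reeGroup_isReeModel (hn : 1 ≤ n) (hF : Nat.card F = 3 ^ (2 * n + 1))
    (hne : ∃ r ∈ reeGroup F n, r ∞ ≠ ∞) :
    IsReeModel (iterateFrobenius F 3 (n + 1)) (reeGroup F n) (reeGroup F n) where
  twist := isReeTwist_iterateFrobenius hn hF
  le := le_rfl
  conj_mem g hg r hr := mul_mem (mul_mem hg hr) (inv_mem hg)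
  tr_mem p := Subgroup.subset_closure (Or.inl ⟨p.1, p.2.1, p.2.2, (reeTranslation_eq ..).symm⟩)
  d_mem κ := Subgroup.subset_closure (Or.inr (Or.inl ⟨κ, κ.ne_zero, (reeTorus_eq κ).symm⟩))
  linear r hr := by
    have h := isReeTwist_iterateFrobenius hn hF
    have : Finite F := h.finite
    refine isReeLinear_of_mem_closure ?_ hr
    rintro π (⟨a, b, c, hπ⟩ | ⟨κ, hκ, hπ⟩ | hπ)
    · rw [reeTranslation_eq, DFunLike.coe_fn_eq] at hπ
      rw [hπ]
      exact isReeLinear_tr h _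
    · rw [← Units.val_mk0 hκ, reeTorus_eq, DFunLike.coe_fn_eq] at hπ
      rw [hπ]
      exact isReeLinear_d h _
    · exact isReeLinear_inversion h rfl hπ
  exists_ne := hne

end ReeGroup

/-! ### The Ree family. -/

section ReeCase

variable {Ω : Type*} [Finite Ω] {G : Subgroup (Equiv.Perm Ω)}

theorem IsReeCase.even_degree (hprim : MulAction.IsPreprimitive G Ω) (h : IsReeCase G) (v : Ω) :
    Even (degree (saxlHypergraph G) v) := by
  obtain ⟨n, F, _, T, hn, hF, hT, ω, φ, hφ⟩ := h
  have htr := hT.isPretransitive hprim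
  have : Finite F := Nat.finite_of_card_ne_zero (by rw [hF]; positivity)
  have : CharP F 3 := by
    have := Fintype.ofFinite F
    have := Fact.mk Nat.prime_three
    exact charP_of_card_eq_prime_pow (f := 2 * n + 1) (by rw [← Nat.card_eq_fintype_card, hF])
  have hst : ∀ r : reeGroup F n, φ.symm r • ω = ω ↔ r • (∞ : OnePoint (F × F × F)) = ∞ :=
    fun r => symm_smul_eq_iff φ hφ r
  have hst' : ∀ t : T, t • ω = ω ↔ (φ t : Equiv.Perm (OnePoint (F × F × F))) ∞ = ∞ := fun t => by
    rw [← φ.symm_apply_apply t, hst, φ.symm_apply_apply]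
    rfl
  -- If ∞ were fixed by the whole group, the transitive group T would fix ω, Ω would be a point and
  -- G trivial.
  have hne : ∃ r ∈ reeGroup F n, r ∞ ≠ ∞ := by
    by_contra! hc
    have hfix : ∀ x : Ω, x = ω := fun x => by
      obtain ⟨t, rfl⟩ := MulAction.exists_smul_eq T ω x
      exact (hst' t).2 (hc _ (φ t).2)
    have : Subsingleton Ω := ⟨fun x y => (hfix x).trans (hfix y).symm⟩
    obtain ⟨x, _, y, _, hxy⟩ := hT.nonabelian
    exact hxy (Subtype.ext (Subsingleton.elim _ _))
  have hR := reeGroup_isReeModel hn hF hne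
  have hex : ∀ x : Ω, ∃ t : T, t • ω = x := fun x => MulAction.exists_smul_eq T ω x
  choose τ hτ using hex
  have heq : ∀ s t : T, s • ω = t • ω ↔ (φ s : Equiv.Perm (OnePoint (F × F × F))) ∞ =
      (φ t : Equiv.Perm (OnePoint (F × F × F))) ∞ := fun s t => by
    rw [← inv_smul_eq_iff, smul_smul, hst', map_mul, map_inv, Subgroup.coe_mul, Subgroup.coe_inv,
      Equiv.Perm.mul_apply, Equiv.Perm.inv_eq_iff_eq, eq_comm]
  obtain ⟨f, hf⟩ : ∃ f : Ω → OnePoint (F × F × F), ∀ t : T,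
      f (t • ω) = (φ t : Equiv.Perm (OnePoint (F × F × F))) ∞ :=
    ⟨fun x => (φ (τ x) : Equiv.Perm (OnePoint (F × F × F))) ∞, fun t => (heq _ _).1 (hτ _)⟩
  have hbij : Function.Bijective f := by
    constructor
    · intro x y hxy
      obtain ⟨s, rfl⟩ := MulAction.exists_smul_eq T ω x
      obtain ⟨t, rfl⟩ := MulAction.exists_smul_eq T ω y
      rw [hf, hf] at hxy
      exact (heq s t).2 hxy
    · intro x
      obtain ⟨r, hr, hx⟩ := hR.exists_map_infty x
      refine ⟨φ.symm ⟨r, hr⟩⁻¹ • ω, ?_⟩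
      rw [hf, φ.apply_symm_apply, Subgroup.coe_inv, Equiv.Perm.inv_eq_iff_eq, hx]
  let e := Equiv.ofBijective f hbij
  have hperm : ∀ t : T, e.permCongr (t : G) = φ t := fun t => by
    refine Equiv.ext fun x => ?_
    obtain ⟨y, rfl⟩ := e.surjective x
    obtain ⟨s, rfl⟩ := MulAction.exists_smul_eq T ω y
    rw [Equiv.permCongr_apply, e.symm_apply_apply]
    change f ((t * s) • ω) = (φ t : Equiv.Perm (OnePoint (F × F × F))) (f (s • ω))
    rw [hf, hf, map_mul]
    rfl
  have hmem : ∀ g, g ∈ G ↔ e.permCongr g ∈ G.map e.permCongrHom.toMonoidHom := fun g => by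
    constructor
    · exact fun hg => ⟨g, hg, rfl⟩
    · rintro ⟨g', hg', he⟩
      rwa [← e.permCongr.injective he]
  have hmodel : IsReeModel (iterateFrobenius F 3 (n + 1)) (reeGroup F n)
      (G.map e.permCongrHom.toMonoidHom) :=
    { hR with
      le := fun r hr => by
        have h1 := hperm (φ.symm ⟨r, hr⟩)
        rw [φ.apply_symm_apply] at h1
        exact ⟨_, (φ.symm ⟨r, hr⟩ : G).2, h1⟩
      conj_mem := by
        rintro _ ⟨g, hg, rfl⟩ r hr
        have h1 := hperm (φ.symm ⟨r, hr⟩)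
        rw [φ.apply_symm_apply] at h1
        have h2 := hperm ⟨_, hT.normal.conj_mem _ (φ.symm ⟨r, hr⟩).2 ⟨g, hg⟩⟩
        have h3 : e.permCongrHom.toMonoidHom g * r * (e.permCongrHom.toMonoidHom g)⁻¹ =
            e.permCongrHom.toMonoidHom (g * (φ.symm ⟨r, hr⟩ : G) * g⁻¹) := by
          rw [map_mul, map_mul, map_inv]
          exact congrArg (fun s => e.permCongrHom.toMonoidHom g * s *
            (e.permCongrHom.toMonoidHom g)⁻¹) h1.symm
        rw [h3]
        exact (congrArg (· ∈ reeGroup F n) h2).mpr (φ _).2 }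
  rw [degree_eq_degree htr v (e.symm ∞), degree_equiv hmem, e.apply_symm_apply]
  exact hmodel.even_degree

end ReeCase

end SaxlHypergraph

namespace SaxlHypergraph

/-! ### Assembling the families. -/

section Main

variable {Ω : Type*} [Finite Ω] {G : Subgroup (Equiv.Perm Ω)}

theorem nonempty_of_isAlmostSimple {T : Subgroup G} (hT : IsAlmostSimpleWithSocle T) :
    Nonempty Ω := by
  by_contra h
  rw [not_nonempty_iff] at h
  obtain ⟨x, _, y, _, hxy⟩ := hT.nonabelian
  exact hxy (Subtype.ext (Subsingleton.elim _ _))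

theorem nonempty_of_inTable (h : InTable G) : Nonempty Ω := by
  rcases h with ⟨_, _, _, T, _, _, hT, _⟩ | ⟨_, _, _, T, _, _, _, hT, _⟩ |
    ⟨_, _, _, T, _, _, _, _, hT, _⟩ | ⟨_, _, _, T, _, _, _, hT, _⟩ | ⟨T, _, _, _, hT, _⟩ <;>
  exact nonempty_of_isAlmostSimple hT

theorem finite_of_card {F : Type*} (h : Nat.card F ≠ 0) : Finite F := Nat.finite_of_card_ne_zero h

end Main

end SaxlHypergraph

open SaxlHypergraph in
theorem mainTheorem8 {Ω : Type*} [Finite Ω] (G : Subgroup (Equiv.Perm Ω))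
    (hprim : MulAction.IsPreprimitive G Ω) (hG : InTable G) :
    ∃ d : ℕ, HasValency (saxlHypergraph G) d ∧
      (Odd d ↔
        (∃ (e : ℕ) (F : Type) (_ : Field F) (T : Subgroup G),
          Odd e ∧ Squarefree e ∧ Nat.card F = 2 ^ e ∧ IsSplitCase G F T ∧
          Nonempty (G ≃* PGammaL 2 F)) ∨
        (∃ (F : Type) (_ : Field F) (T : Subgroup G),
          Nat.card F % 4 = 3 ∧ IsParabolicCase G F T ∧
          (Nonempty (G ≃* PSL 2 F) ∨ Nonempty (G ≃* PGL 2 F)))) := by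
  obtain ⟨v⟩ := nonempty_of_inTable hG
  refine ⟨degree (saxlHypergraph G) v, hasValency_degree v, ?_, ?_⟩
  · intro hd
    rcases hG with h | ⟨F, _, _, T, h⟩ | ⟨F, _, _, T, h⟩ | ⟨F, _, _, T, h⟩ | h
    · exact absurd hd (Nat.not_odd_iff_even.2 (h.even_degree hprim v))
    · exact Or.inr ⟨F, _, T, ((h.odd_degree_iff hprim v).1 hd).1, h,
        ((h.odd_degree_iff hprim v).1 hd).2⟩
    · obtain ⟨e, he, hsq, hF, hiso⟩ := (h.odd_degree_iff hprim v).1 hd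
      exact Or.inl ⟨e, F, _, T, he, hsq, hF, h, hiso⟩
    · exact absurd hd (Nat.not_odd_iff_even.2 (h.even_degree hprim v))
    · exact absurd hd (Nat.not_odd_iff_even.2 (h.even_degree hprim v))
  -- Each alternative carries its own field and socle, so the degree is computed from these and not
  -- from the family that was given initially.
  · rintro (⟨e, F, _, T, he, hsq, hF, h, hiso⟩ | ⟨F, _, T, hF, h, hiso⟩)
    · have : Finite F := finite_of_card (by rw [hF]; positivity)
      exact (h.odd_degree_iff hprim v).2 ⟨e, he, hsq, hF, hiso⟩
    · have : Finite F := finite_of_card (by omega)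
      exact (h.odd_degree_iff hprim v).2 ⟨hF, hiso⟩
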